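/- Let $m\in\mathbb N$. Consider two matrix pencils $L$, $\tilde L$ on the half-line: $L$ is given by $m\times m$ complex matrix functions $Q_0,Q_1$ on $[0,\infty)$ and matrices $h_0,h_1\in\mathbb C^{m\times m}$ through $$\ell_\rho(Y)=Y''+(\rho^2I+2i\rho Q_1(x)+Q_0(x))Y,\qquad U_\rho(Y)=Y'(0)+(i\rho h_1+h_0)Y(0),$$ where $Q_1$ is absolutely continuous on $[0,T]$ for each $T>0$, $Q_0,Q_1,Q_1'\in L(0,\infty)$ and $\det(I\pm h_1)\neq0$. The pencil $\tilde L$ has the same form and satisfies the same conditions with coefficients $\tilde Q_0,\tilde Q_1,\tilde h_0,\tilde h_1$; a tilde marks the objects of $\tilde L$. Solutions are understood as functions $Y$ with locally absolutely continuous derivative that satisfy the equation almost everywhere. Let $\varphi(x,\rho)$ be the solution of $\ell_\rho(\varphi)=0$, $\varphi(0,\rho)=I$, $U_\rho(\varphi)=0$, and let $\varphi^*(x,\rho)$ be the solution of $Z''+Z(\rho^2I+2i\rho Q_1+Q_0)=0$, $Z(0)=I$, $Z'(0)+Z(0)(i\rho h_1+h_0)=0$. Let $\Pi_\pm=\{\rho:\pm\operatorname{Im}\rho>0\}$.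 For $\rho\in\Pi_\pm$ the Weyl solution $\Phi(x,\rho)$ is the solution of $\ell_\rho(\Phi)=0$ with $U_\rho(\Phi)=I$ and $\Phi(x,\rho)=O(\exp(\pm i\rho x))$ as $x\to\infty$, and $M(\rho)=\Phi(0,\rho)$ is the Weyl matrix. For real $\rho$, $M_\pm(\rho)$ is the limit of $M$ at $\rho$ from $\Pi_\pm$. Let $\Lambda_\pm\subset\overline{\Pi_\pm}$ be the (bounded) set of the points near which $M$ is not everywhere defined in $\Pi_\pm$ or at which $M$ has no finite limit from $\Pi_\pm$. Let $P_\pm$ and $P^*_\pm$ be the solutions of $$P_\pm'=\pm Q_1P_\pm,\quad P_\pm(0)=I,\qquad {P^*_\pm}'=\pm P^*_\pm Q_1,\quad P^*_\pm(0)=I,$$ and put $\Omega(x)=\tfrac12\bigl(P_-(x)\tilde P^*_+(x)+P_+(x)\tilde P^*_-(x)\bigr)$. Assume that for both signs and for sufficiently large $\rho^*>0$ $$\int_{|\rho|>\rho^*}\|M_\pm(\rho)-\tilde M_\pm(\rho)\|^2\rho^4\,d\rho<\infty .$$ Let $\gamma_0$ be a simple closed piecewise $C^1$ contour, oriented counterclockwise,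 whose interior contains $0$ and the sets $\Lambda_\pm,\tilde\Lambda_\pm$, and which meets the real axis exactly at two points $r_-<0<r_+$. Let $\gamma_+$ and $\gamma_-$ be the two-sided cuts along $[r_+,\infty)$ and $(-\infty,r_-]$, and let $\gamma=\gamma_-\cup\gamma_0\cup\gamma_+$, oriented counterclockwise: the upper sides of the cuts are traversed from right to left, the lower sides from left to right. Integrals over $\gamma$ are principal values, $\int_\gamma=\lim_{R\to\infty}\int_{\gamma\cap\{|\theta|\le R\}}$. Let $C(\gamma;\mathbb C^{m\times m})$ be the space of bounded continuous matrix functions on $\gamma$; the values on the two sides of a cut may differ. Put $$\tilde D(x,\rho,\theta)=\frac{\tilde\varphi^{*\prime}(x,\theta)\tilde\varphi(x,\rho)-\tilde\varphi^*(x,\theta)\tilde\varphi'(x,\rho)}{\rho-\theta},\qquad \tilde r(x,\rho,\theta)=\bigl(M(\theta)-\tilde M(\theta)\bigr)\tilde D(x,\rho,\theta),$$ where on the upper and lower sides of the cuts $M,\tilde M$ are replaced by their boundary values $M_\pm,\tilde M_\pm$ ($+$ on the upper sides, $-$ on the lower sides). Then for each $x\ge0$ with $\det\Omega(x)\ne0$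 the main equation $$\tilde\varphi(x,\rho)=z(x,\rho)+\frac1{2\pi i}\int_\gamma z(x,\theta)\,\tilde r(x,\rho,\theta)\,d\theta,\qquad\rho\in\gamma,$$ has a unique solution $z(x,\cdot)$ in $C(\gamma;\mathbb C^{m\times m})$, and this solution is $z(x,\rho)=\Omega(x)^{-1}\varphi(x,\rho)$. -/

import Mathlib

open Set Filter Topology MeasureTheory

/-- Complex `m × m` matrices. -/
abbrev CMat (m : ℕ) : Type := Matrix (Fin m) (Fin m) ℂ

noncomputable section

/- The matrix norm is the maximal row sum `max_j ∑_k |a_jk|`. -/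
attribute [local instance] Matrix.linftyOpNormedRing Matrix.linftyOpNormedAlgebra

/-- The topology of the norm; it is definitionally the entrywise topology. -/
abbrev CMat.topology (m : ℕ) : TopologicalSpace (CMat m) :=
  PseudoMetricSpace.toUniformSpace.toTopologicalSpace

/-- The uniform structure of the norm. -/
abbrev CMat.uniformity (m : ℕ) : UniformSpace (CMat m) :=
  PseudoMetricSpace.toUniformSpace

attribute [local instance] CMat.topology CMat.uniformity

/-! ### Pencils -/

/-- The coefficients of the pencil
`ℓ_ρ(Y) = Y'' + (ρ² I + 2 i ρ Q₁(x) + Q₀(x)) Y`, `U_ρ(Y) = Y'(0) + (i ρ h₁ + h₀) Y(0)`, `x ≥ 0`.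
Only the values of `Q₀`, `Q₁` on `[0, ∞)` matter. -/
structure Pencil (m : ℕ) where
  Q₀ : ℝ → CMat m
  Q₁ : ℝ → CMat m
  h₀ : CMat m
  h₁ : CMat m

namespace Pencil

variable {m : ℕ}

/-- The class `𝒱`: `Q₁` is absolutely continuous on `[0, T]` for each `T > 0`, and
`Q₀, Q₁, Q₁' ∈ L((0, ∞))`. -/
structure ClassV (L : Pencil m) : Prop where
  absCont : ∀ T : ℝ, 0 < T → AbsolutelyContinuousOnInterval L.Q₁ 0 T
  integrable_Q₀ : IntegrableOn L.Q₀ (Ioi 0)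
  integrable_Q₁ : IntegrableOn L.Q₁ (Ioi 0)
  integrable_deriv_Q₁ : IntegrableOn (deriv L.Q₁) (Ioi 0)

/-- The condition `det (I ± h₁) ≠ 0`. -/
def NonRegge (L : Pencil m) : Prop := (1 + L.h₁).det ≠ 0 ∧ (1 - L.h₁).det ≠ 0

end Pencil

/-- The derivative of a function on `[0, ∞)`, one-sided at `0`. -/
def dHalf {m : ℕ} (Y : ℝ → CMat m) (x : ℝ) : CMat m := derivWithin Y (Ici 0) x

/-- `Y` is differentiable on `[0, ∞)`, `Y'` is locally absolutely continuous there, and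
`Y'' = R` almost everywhere on `(0, ∞)`. -/
def HasSecondDeriv {m : ℕ} (Y R : ℝ → CMat m) : Prop :=
  DifferentiableOn ℝ Y (Ici 0) ∧
  (∀ T : ℝ, 0 < T → AbsolutelyContinuousOnInterval (dHalf Y) 0 T) ∧
  ∀ᵐ x ∂(volume.restrict (Ioi (0 : ℝ))), HasDerivAt (dHalf Y) (R x) x

namespace Pencil

variable {m : ℕ}

/-- `ρ² I + 2 i ρ Q₁(x) + Q₀(x)`. -/
def coeff (L : Pencil m) (ρ : ℂ) (x : ℝ) : CMat m :=
  ρ ^ 2 • (1 : CMat m) + (2 * Complex.I * ρ) • L.Q₁ x + L.Q₀ x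

/-- `ℓ_ρ(Y) = 0` on the half-line. -/
def IsSolution (L : Pencil m) (ρ : ℂ) (Y : ℝ → CMat m) : Prop :=
  HasSecondDeriv Y (fun x => -(L.coeff ρ x * Y x))

/-- `ℓ*_ρ(Z) = Z'' + Z (ρ² I + 2 i ρ Q₁(x) + Q₀(x)) = 0` on the half-line. -/
def IsSolutionStar (L : Pencil m) (ρ : ℂ) (Z : ℝ → CMat m) : Prop :=
  HasSecondDeriv Z (fun x => -(Z x * L.coeff ρ x))

/-- `U_ρ(Y) = Y'(0) + (i ρ h₁ + h₀) Y(0)`. -/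
def U (L : Pencil m) (ρ : ℂ) (Y : ℝ → CMat m) : CMat m :=
  dHalf Y 0 + ((Complex.I * ρ) • L.h₁ + L.h₀) * Y 0

/-- `U*_ρ(Z) = Z'(0) + Z(0) (i ρ h₁ + h₀)`. -/
def UStar (L : Pencil m) (ρ : ℂ) (Z : ℝ → CMat m) : CMat m :=
  dHalf Z 0 + Z 0 * ((Complex.I * ρ) • L.h₁ + L.h₀)

/-- `φ(·, ρ)`: the solution (unique on `[0, ∞)`) of `ℓ_ρ(φ) = 0`, `φ(0) = I`, `U_ρ(φ) = 0`. -/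
def phi (L : Pencil m) (ρ : ℂ) : ℝ → CMat m :=
  Classical.epsilon fun Y => L.IsSolution ρ Y ∧ Y 0 = 1 ∧ L.U ρ Y = 0

/-- `φ*(·, ρ)`: the solution (unique on `[0, ∞)`) of `ℓ*_ρ(φ*) = 0`, `φ*(0) = I`,
`U*_ρ(φ*) = 0`. -/
def phiStar (L : Pencil m) (ρ : ℂ) : ℝ → CMat m :=
  Classical.epsilon fun Z => L.IsSolutionStar ρ Z ∧ Z 0 = 1 ∧ L.UStar ρ Z = 0

/-- `D(x, ρ, θ) = ⟨φ*(x, θ), φ(x, ρ)⟩ / (ρ - θ)`, where `⟨Z, Y⟩ = Z' Y - Z Y'`. The singularity at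
`ρ = θ` is removable; the value chosen there plays no role under an integral along a curve. -/
def D (L : Pencil m) (x : ℝ) (ρ θ : ℂ) : CMat m :=
  (ρ - θ)⁻¹ • (dHalf (L.phiStar θ) x * L.phi ρ x - L.phiStar θ x * dHalf (L.phi ρ) x)

end Pencil

/-! ### Half-planes, the Weyl solution and the Weyl matrix -/

/-- The two signs in `Π_±`, `M_±`, `P_±`; also the two sides of the cuts. -/
inductive Side
  | plus
  | minus

/-- `± 1`. -/
def Side.sign : Side → ℝ
  | Side.plus => 1
  | Side.minus => -1

/-- `Π_± = {ρ : ± Im ρ > 0}`. -/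
def halfPlane (s : Side) : Set ℂ := {ρ | 0 < s.sign * ρ.im}

namespace Pencil

variable {m : ℕ}

/-- `Φ` is a Weyl solution at `ρ ∈ Π_±`: `ℓ_ρ(Φ) = 0`, `U_ρ(Φ) = I` and
`Φ(x) = O(exp(± i ρ x))` as `x → ∞`. -/
def IsWeylSolution (L : Pencil m) (ρ : ℂ) (Φ : ℝ → CMat m) : Prop :=
  L.IsSolution ρ Φ ∧ L.U ρ Φ = 1 ∧
  ∃ s : Side, ρ ∈ halfPlane s ∧
    Φ =O[atTop] fun x : ℝ => Complex.exp (s.sign * Complex.I * ρ * x)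

/-- The Weyl matrix `M(ρ) = Φ(0, ρ)`, `ρ ∈ Π_±` (meaningful where a Weyl solution exists). -/
def weylMatrix (L : Pencil m) (ρ : ℂ) : CMat m :=
  (Classical.epsilon (L.IsWeylSolution ρ)) 0

open Classical in
/-- `M` on the closed half-plane `Π_±` : the matrix `M(ρ)` for `ρ ∈ Π_±`, and the boundary value
`M_±(ρ)`, the limit of `M` from `Π_±`, for real `ρ`. -/
def weylSide (L : Pencil m) (s : Side) (ρ : ℂ) : CMat m :=
  if ρ ∈ halfPlane s then L.weylMatrix ρ else limUnder (𝓝[halfPlane s] ρ) L.weylMatrix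

/-- The set `Λ_±` of the points of the closed half-plane `Π_±` near which `M` fails to be defined
in `Π_±`, or at which `M` has no finite limit from `Π_±`. It contains the poles of `M` in `Π_±`;
`M` extends continuously to the closed half-plane with `Λ_±` removed. -/
def singularSet (L : Pencil m) (s : Side) : Set ℂ :=
  {ρ | ρ ∈ closure (halfPlane s) ∧
    ¬ ((∀ᶠ w in 𝓝[halfPlane s] ρ, ∃ Φ, L.IsWeylSolution w Φ) ∧
        ∃ A : CMat m, Tendsto L.weylMatrix (𝓝[halfPlane s] ρ) (𝓝 A))}

/-! ### The matrices `P_±`, `P*_±` and `Ω` -/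

/-- The solution (unique on `[0, ∞)`) of `P_±' = ± Q₁ P_±`, `P_±(0) = I`. -/
def P (L : Pencil m) (s : Side) : ℝ → CMat m :=
  Classical.epsilon fun P => P 0 = 1 ∧
    ∀ x : ℝ, 0 ≤ x → HasDerivWithinAt P (s.sign • (L.Q₁ x * P x)) (Ici 0) x

/-- The solution (unique on `[0, ∞)`) of `P*_±' = ± P*_± Q₁`, `P*_±(0) = I`. -/
def PStar (L : Pencil m) (s : Side) : ℝ → CMat m :=
  Classical.epsilon fun P => P 0 = 1 ∧
    ∀ x : ℝ, 0 ≤ x → HasDerivWithinAt P (s.sign • (P x * L.Q₁ x)) (Ici 0) x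

end Pencil

/-- `Ω(x) = (P₋(x) P̃*₊(x) + P₊(x) P̃*₋(x)) / 2`. -/
def Omega {m : ℕ} (L Lt : Pencil m) (x : ℝ) : CMat m :=
  (2⁻¹ : ℂ) • (L.P Side.minus x * Lt.PStar Side.plus x + L.P Side.plus x * Lt.PStar Side.minus x)

/-- `∫_{|ρ| > ρ⁎} ‖M_±(ρ) - M̃_±(ρ)‖² ρ⁴ dρ < ∞` (both signs) for sufficiently large `ρ⁎ > 0`. -/
def IsModelPencil {m : ℕ} (L Lt : Pencil m) : Prop :=
  ∃ R : ℝ, 0 < R ∧ ∀ s : Side,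
    ∫⁻ t in {t : ℝ | R < |t|},
      ENNReal.ofReal (‖L.weylSide s (t : ℂ) - Lt.weylSide s (t : ℂ)‖ ^ 2 * t ^ 4) < ⊤

/-! ### The contour -/

/-- The data of `γ = γ₋ ∪ γ₀ ∪ γ₊`. Here `γ₀` is a closed simple piecewise `C¹` curve that meets the
real axis exactly at `left < 0 < right`; it is oriented counterclockwise and parametrized from
`right`, so that it runs through the open upper half-plane from `right` to `left`, and back through
the open lower half-plane. `γ₊`, `γ₋` are the two-sided cuts along `[right, ∞)`, `(-∞, left]`. -/
structure Contour where
  curve : ℝ → ℂ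
  left : ℝ
  right : ℝ
  mid : ℝ
  left_neg : left < 0
  right_pos : 0 < right
  mid_mem : mid ∈ Ioo (0 : ℝ) 1
  curve_zero : curve 0 = right
  curve_mid : curve mid = left
  curve_one : curve 1 = right
  upper : ∀ t ∈ Ioo 0 mid, 0 < (curve t).im
  lower : ∀ t ∈ Ioo mid 1, (curve t).im < 0
  simple : InjOn curve (Ico 0 1)
  piecewise_C1 : ∃ (n : ℕ) (p : ℕ → ℝ), Monotone p ∧ p 0 = 0 ∧ p n = 1 ∧
    ∀ i < n, ContDiffOn ℝ 1 curve (Icc (p i) (p (i + 1)))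

namespace Contour

/-- The curve `γ₀` as a set. -/
def inner (γ : Contour) : Set ℂ := γ.curve '' Icc 0 1

/-- `w ∈ int γ₀`: `γ₀` winds once around `w`. -/
def Encloses (γ : Contour) (w : ℂ) : Prop :=
  w ∉ γ.inner ∧
    (2 * Real.pi * Complex.I)⁻¹ * ∫ t in (0 : ℝ)..1, deriv γ.curve t / (γ.curve t - w) = 1

/-- The part of `γ` in the closed half-plane `Π_±`: an arc of `γ₀` and the upper (for `+`) or lower
(for `-`) sides of the two cuts. -/
def side (γ : Contour) (s : Side) : Set ℂ :=
  {ρ | (ρ ∈ γ.inner ∧ 0 ≤ s.sign * ρ.im) ∨ ∃ t : ℝ, (t ≤ γ.left ∨ γ.right ≤ t) ∧ ρ = t}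

/-- The space `C(γ; ℂ^{m×m})` of bounded continuous functions on `γ`. On a two-sided cut the values
on the two sides may differ, so a function on `γ` is a pair `z plus`, `z minus` of functions on the
two parts of `γ`, with equal values at the points `left`, `right` where the parts are joined. -/
structure IsContinuousFun {m : ℕ} (γ : Contour) (z : Side → ℂ → CMat m) : Prop where
  cont : ∀ s, ContinuousOn (z s) (γ.side s)
  glue_left : z Side.plus γ.left = z Side.minus γ.left
  glue_right : z Side.plus γ.right = z Side.minus γ.right
  bdd : ∃ C : ℝ, ∀ s, ∀ ρ ∈ γ.side s, ‖z s ρ‖ ≤ C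

/-- `∫_{γ_R} F(θ) dθ`, `γ_R = γ ∩ {|θ| ≤ R}`, for `R` so large that `γ₀` lies in the disc. The
counterclockwise orientation of `γ` runs through the lower sides of the cuts from left to right
and through the upper sides from right to left. -/
def truncIntegral {m : ℕ} (γ : Contour) (F : Side → ℂ → CMat m) (R : ℝ) : CMat m :=
  (∫ t in (0 : ℝ)..γ.mid, deriv γ.curve t • F Side.plus (γ.curve t)) +
  (∫ t in γ.mid..1, deriv γ.curve t • F Side.minus (γ.curve t)) +
  (∫ t in γ.right..R, (F Side.minus (t : ℂ) - F Side.plus (t : ℂ))) +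
  (∫ t in (-R)..γ.left, (F Side.minus (t : ℂ) - F Side.plus (t : ℂ)))

/-- `∫_γ F(θ) dθ = J`, in the sense of the principal value `∫_γ = lim_{R → ∞} ∫_{γ_R}`. -/
def HasIntegral {m : ℕ} (γ : Contour) (F : Side → ℂ → CMat m) (J : CMat m) : Prop :=
  Tendsto (γ.truncIntegral F) atTop (𝓝 J)

end Contour

/-! ### The main equation -/

/-- `r̃(x, ρ, θ) = M̂(θ) D̃(x, ρ, θ)`, `M̂ = M - M̃`; the boundary values `M_±`, `M̃_±` are used on the
two sides of the cuts. -/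
def rTilde {m : ℕ} (L Lt : Pencil m) (x : ℝ) (ρ : ℂ) (s : Side) (θ : ℂ) : CMat m :=
  (L.weylSide s θ - Lt.weylSide s θ) * Lt.D x ρ θ

/-- `z` solves `φ̃(x, ρ) = z(ρ) + (1 / 2πi) ∫_γ z(θ) r̃(x, ρ, θ) dθ`, `ρ ∈ γ`. -/
def SolvesMainEquation {m : ℕ} (L Lt : Pencil m) (γ : Contour) (x : ℝ) (z : Side → ℂ → CMat m) :
    Prop :=
  ∀ s, ∀ ρ ∈ γ.side s, ∃ J : CMat m,
    γ.HasIntegral (fun s' θ => z s' θ * rTilde L Lt x ρ s' θ) J ∧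
    Lt.phi ρ x = z s ρ + (2 * Real.pi * Complex.I : ℂ)⁻¹ • J

end

/-!
The main equation is Cauchy's theorem for the spectral matrix of the two pencils, the product of
`[φ Φ; φ' Φ']` and the inverse of `[φ̃ Φ̃; φ̃' Φ̃']`. The inverse is expressed by star solutions,
and `Φ = S + φ M` with entire `S` and `φ` shows that the spectral matrix is an entire matrix
(`regular₁₁`, …) plus a term with the factor `M - M̃` (`spectral₁₁`, …). In either half-plane it is
holomorphic off the singular sets, it extends continuously to the real line
(`ClassV.differentiableAt_weylMatrix`, `ClassV.continuousOn_weylSide`), and its entries, scaled by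
powers of `iρ`, tend to `Ω` and to a companion `Ξ` at infinity (`tendsto_spectral`).

These limits rest on asymptotics that are uniform in closed half-planes, for arbitrary solutions
(`exists_solution_asymptotics`) and for decaying ones (`exists_decaying_asymptotics`). Both are a
priori estimates: the equation is brought into a canonical form for two amplitudes, whose
perturbation is integrable and of order `1 / |ρ|`. Decaying solutions need no construction, since
their existence off the singular set is part of the definition of that set. The lower half-plane is
reduced to the upper one by `ρ ↦ -ρ`, and star solutions to solutions by transposition.

The integral over `γ` of a pair of functions holomorphic in the two half-planes equals an integral
over a large circle (`Contour.truncIntegral_eq_circle`). It follows from a homological form of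
Cauchy's theorem (`PathCycle.integral_eq_zero`, by Dixon's argument), which is extended to functions
continuous up to the real line. Hence the behaviour at infinity determines the integral
(`Contour.hasIntegral_of_tendsto`). Applied to the spectral matrix times the column `φ̃, φ̃'` this
shows that `Ω⁻¹ φ` solves the main equation (`hasIntegral_phi`), and applied to a row and a column
it gives a relation between the kernels of the two pencils (`hasIntegral_kernel`). The condition
`h₁ = h̃₁`, without which the limits would differ, is forced by the integrability of
`‖M - M̃‖² ρ⁴` (`h₁_eq_of_isModelPencil`).

For uniqueness let `y` solve the homogeneous equation. Inserting the equation into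
`∫ y (M - M̃) D`, exchanging the integrals, and using the kernel relation with the pencils
interchanged gives `y = B φ` with a constant matrix `B` (`exists_eq_mul_phi`). By the first integral
the homogeneous equation then says `B Ω φ̃ = 0`, and the rows of `φ̃` are linearly independent as
functions of `ρ` (`eq_zero_of_mul_phi`), so that `B Ω = 0` and `B = 0`.
-/

noncomputable section

set_option linter.unusedSectionVars false

/-! ### Primitives on the half-line -/

section Primitive

variable {F G H : Type*} [NormedAddCommGroup F] [NormedSpace ℝ F] [CompleteSpace F]
  [NormedAddCommGroup G] [NormedSpace ℝ G] [CompleteSpace G]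
  [NormedAddCommGroup H] [NormedSpace ℝ H] [CompleteSpace H]

/-- `f` is a primitive of the locally integrable function `f'` on `[0, ∞)`. Equivalently, `f` is
locally absolutely continuous there and `f'` is its derivative almost everywhere. -/
structure IsPrim (f f' : ℝ → F) : Prop where
  intervalIntegrable_zero : ∀ T : ℝ, 0 ≤ T → IntervalIntegrable f' volume 0 T
  eq_add : ∀ x : ℝ, 0 ≤ x → f x = f 0 + ∫ t in (0 : ℝ)..x, f' t

theorem AbsolutelyContinuousOnInterval.of_dist_le {X Y : Type*} [PseudoMetricSpace X]
    [PseudoMetricSpace Y] {f : ℝ → X} {g : ℝ → Y} {a b K : ℝ}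
    (hg : AbsolutelyContinuousOnInterval g a b)
    (h : ∀ x ∈ uIcc a b, ∀ y ∈ uIcc a b, dist (f x) (f y) ≤ K * dist (g x) (g y)) :
    AbsolutelyContinuousOnInterval f a b := by
  rw [absolutelyContinuousOnInterval_iff] at hg ⊢
  intro ε hε
  obtain ⟨δ, hδ, hδ'⟩ := hg (ε / (|K| + 1)) (by positivity)
  refine ⟨δ, hδ, fun I hI hlt => ?_⟩
  have h1 := hδ' I hI hlt
  calc _ ≤ ∑ i ∈ Finset.range I.1, (|K| + 1) * dist (g (I.2 i).1) (g (I.2 i).2) := by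
        refine Finset.sum_le_sum fun i hi => ?_
        refine (h _ (hI.1 i hi).1 _ (hI.1 i hi).2).trans ?_
        gcongr
        linarith [le_abs_self K]
    _ = (|K| + 1) * ∑ i ∈ Finset.range I.1, dist (g (I.2 i).1) (g (I.2 i).2) := by
        rw [Finset.mul_sum]
    _ < (|K| + 1) * (ε / (|K| + 1)) := by gcongr
    _ = ε := by field_simp

namespace IsPrim

variable {f f' : ℝ → F} {g g' : ℝ → G}

theorem intervalIntegrable (h : IsPrim f f') {x y : ℝ} (hx : 0 ≤ x) (hy : 0 ≤ y) :
    IntervalIntegrable f' volume x y :=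
  (h.intervalIntegrable_zero x hx).symm.trans (h.intervalIntegrable_zero y hy)

theorem sub_eq (h : IsPrim f f') {x y : ℝ} (hx : 0 ≤ x) (hy : 0 ≤ y) :
    f y - f x = ∫ t in x..y, f' t := by
  rw [h.eq_add x hx, h.eq_add y hy, ← intervalIntegral.integral_add_adjacent_intervals
    (h.intervalIntegrable_zero x hx) (h.intervalIntegrable hx hy)]
  abel

theorem norm_sub_le (h : IsPrim f f') {x y : ℝ} (hx : 0 ≤ x) (hxy : x ≤ y) :
    ‖f y - f x‖ ≤ ∫ t in x..y, ‖f' t‖ := by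
  rw [h.sub_eq hx (hx.trans hxy)]
  exact intervalIntegral.norm_integral_le_integral_norm hxy

theorem absCont (h : IsPrim f f') {T : ℝ} (hT : 0 ≤ T) :
    AbsolutelyContinuousOnInterval f 0 T := by
  have h1 := (h.intervalIntegrable_zero T hT).norm.absolutelyContinuousOnInterval_intervalIntegral
    (c := 0) (by simp)
  refine h1.of_dist_le (K := 1) ?_
  have key : ∀ x y : ℝ, 0 ≤ x → x ≤ y → dist (f x) (f y) ≤
      1 * dist (∫ t in (0 : ℝ)..x, ‖f' t‖) (∫ t in (0 : ℝ)..y, ‖f' t‖) := by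
    intro x y hx hxy
    rw [one_mul, dist_comm, dist_eq_norm, dist_comm, dist_eq_norm,
      intervalIntegral.integral_interval_sub_left
        (h.intervalIntegrable_zero y (hx.trans hxy)).norm (h.intervalIntegrable_zero x hx).norm]
    exact (h.norm_sub_le hx hxy).trans (Real.le_norm_self _)
  intro x hx y hy
  rw [uIcc_of_le hT] at hx hy
  rcases le_total x y with hxy | hxy
  · exact key x y hx.1 hxy
  · rw [dist_comm, dist_comm (∫ t in (0 : ℝ)..x, ‖f' t‖)]
    exact key y x hy.1 hxy

theorem continuousOn (h : IsPrim f f') : ContinuousOn f (Ici 0) := by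
  intro x hx
  have h1 := (h.absCont (T := x + 1) (by linarith [mem_Ici.1 hx])).continuousOn
  rw [uIcc_of_le (by linarith [mem_Ici.1 hx])] at h1
  refine (h1 x ⟨hx, by linarith⟩).mono_of_mem_nhdsWithin ?_
  rw [mem_nhdsWithin]
  exact ⟨Iio (x + 1), isOpen_Iio, by simp, fun y hy => ⟨hy.2, hy.1.le⟩⟩

theorem ae_hasDerivAt (h : IsPrim f f') :
    ∀ᵐ x ∂(volume.restrict (Ioi (0 : ℝ))), HasDerivAt f (f' x) x := by
  rw [ae_restrict_iff' measurableSet_Ioi]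
  have h1 : ∀ n : ℕ, ∀ᵐ x : ℝ, x ∈ uIcc (0 : ℝ) n → ∀ c ∈ uIcc (0 : ℝ) n,
      HasDerivAt (fun x => ∫ t in c..x, f' t) (f' x) x := fun n =>
    (h.intervalIntegrable_zero n (by positivity)).ae_hasDerivAt_integral
  filter_upwards [ae_all_iff.2 h1] with x hx hx0
  obtain ⟨n, hn⟩ := exists_nat_ge x
  have h2 := hx n (by rw [uIcc_of_le (by positivity)]; exact ⟨hx0.le, hn⟩) 0 (by simp)
  refine (h2.const_add (f 0)).congr_of_eventuallyEq ?_
  filter_upwards [Ioi_mem_nhds hx0] with y hy using h.eq_add y (le_of_lt hy)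

/-- A locally absolutely continuous function is a primitive of its derivative. -/
theorem of_absCont (hac : ∀ T : ℝ, 0 < T → AbsolutelyContinuousOnInterval f 0 T)
    (hint : ∀ T : ℝ, 0 ≤ T → IntervalIntegrable f' volume 0 T)
    (hd : ∀ᵐ x ∂(volume.restrict (Ioi (0 : ℝ))), HasDerivAt f (f' x) x) : IsPrim f f' := by
  refine ⟨hint, fun x hx => ?_⟩
  rcases hx.eq_or_lt with rfl | hx0
  · simp
  set g : ℝ → F := fun y => ∫ t in (0 : ℝ)..y, f' t
  have hg : IsPrim g f' := ⟨hint, fun y _ => by simp [g]⟩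
  have h1 := (hac x hx0).sub (hg.absCont hx)
  obtain ⟨C, hC⟩ := h1.const_of_ae_hasDerivAt_zero (by
    have e1 := hd
    have e2 := hg.ae_hasDerivAt
    rw [ae_restrict_iff' measurableSet_Ioi] at e1 e2
    have e3 : ∀ᵐ y : ℝ, y ≠ 0 := by simp [ae_iff, measure_singleton]
    filter_upwards [e1, e2, e3] with y h1 h2 h3 hy
    rw [uIcc_of_le hx] at hy
    have hy0 : y ∈ Ioi (0 : ℝ) := lt_of_le_of_ne hy.1 (Ne.symm h3)
    simpa using! (h1 hy0).sub (h2 hy0))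
  have h2 := hC 0 (by simp)
  have h3 := hC x (by simp)
  simp only [Pi.sub_apply, g, intervalIntegral.integral_same, sub_zero] at h2 h3
  rw [h2, ← h3]
  abel

theorem hasDerivWithinAt (h : IsPrim f f') (hc : ContinuousOn f' (Ici 0)) {x : ℝ} (hx : 0 ≤ x) :
    HasDerivWithinAt f (f' x) (Ici 0) x := by
  set e : ℝ → F := fun t => f' (max t 0)
  have he : Continuous e :=
    hc.comp_continuous (by fun_prop) fun t => le_max_right t 0
  have h1 : HasDerivAt (fun y => f 0 + ∫ t in (0 : ℝ)..y, e t) (e x) x :=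
    (intervalIntegral.integral_hasDerivAt_right (he.intervalIntegrable _ _)
      he.stronglyMeasurable.stronglyMeasurableAtFilter he.continuousAt).const_add _
  have h2 : e x = f' x := by simp [e, max_eq_left hx]
  have key : ∀ y ∈ Ici (0 : ℝ), f y = f 0 + ∫ t in (0 : ℝ)..y, e t := by
    intro y hy
    rw [h.eq_add y hy]
    congr 1
    refine intervalIntegral.integral_congr fun t ht => ?_
    rw [uIcc_of_le hy] at ht
    simp [e, max_eq_left ht.1]
  rw [← h2]
  exact h1.hasDerivWithinAt.congr key (key x hx)

theorem of_hasDerivWithinAt (hc : ContinuousOn f' (Ici 0))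
    (hd : ∀ x : ℝ, 0 ≤ x → HasDerivWithinAt f (f' x) (Ici 0) x) : IsPrim f f' := by
  have hint : ∀ T : ℝ, 0 ≤ T → IntervalIntegrable f' volume 0 T := fun T hT =>
    (hc.mono (by rw [uIcc_of_le hT]; exact fun t ht => ht.1)).intervalIntegrable
  refine ⟨hint, fun x hx => ?_⟩
  rw [intervalIntegral.integral_eq_sub_of_hasDerivAt_of_le hx
    (fun t ht => ((hd t ht.1).continuousWithinAt).mono fun y hy => hy.1)
    (fun t ht => (hd t ht.1.le).hasDerivAt (Ici_mem_nhds ht.1)) (hint x hx)]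
  abel

theorem congr (h : IsPrim f f') {e e' : ℝ → F} (he : ∀ x, 0 ≤ x → e x = f x)
    (he' : ∀ x, 0 ≤ x → e' x = f' x) : IsPrim e e' := by
  refine ⟨fun T hT => ?_, fun x hx => ?_⟩
  · refine (h.intervalIntegrable_zero T hT).congr fun t ht => ?_
    rw [uIoc_of_le hT] at ht
    exact (he' t ht.1.le).symm
  · rw [he x hx, he 0 le_rfl, h.eq_add x hx]
    congr 1
    refine intervalIntegral.integral_congr fun t ht => ?_
    rw [uIcc_of_le hx] at ht
    exact (he' t ht.1).symm

theorem const (c : F) : IsPrim (fun _ => c) (fun _ => 0) :=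
  ⟨fun _ _ => by simp, fun x _ => by simp⟩

theorem add {g g' : ℝ → F} (h : IsPrim f f') (k : IsPrim g g') :
    IsPrim (fun x => f x + g x) (fun x => f' x + g' x) := by
  refine ⟨fun T hT => (h.intervalIntegrable_zero T hT).add (k.intervalIntegrable_zero T hT),
    fun x hx => ?_⟩
  rw [intervalIntegral.integral_add (h.intervalIntegrable_zero x hx)
    (k.intervalIntegrable_zero x hx), h.eq_add x hx, k.eq_add x hx]
  abel

/-- The product rule. -/
theorem bilin (B : F →L[ℝ] G →L[ℝ] H) (hf : IsPrim f f') (hg : IsPrim g g') :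
    IsPrim (fun x => B (f x) (g x)) (fun x => B (f' x) (g x) + B (f x) (g' x)) := by
  have hsub : ∀ T : ℝ, 0 ≤ T → uIcc 0 T ⊆ Ici 0 := fun T hT => by
    rw [uIcc_of_le hT]; exact fun t ht => ht.1
  have hbd : ∀ T : ℝ, 0 ≤ T → ∃ C, 0 ≤ C ∧ ∀ x ∈ uIcc 0 T, ‖f x‖ ≤ C ∧ ‖g x‖ ≤ C := by
    intro T hT
    obtain ⟨C, hC⟩ := isCompact_uIcc.exists_bound_of_continuousOn (hf.continuousOn.mono (hsub T hT))
    obtain ⟨D, hD⟩ := isCompact_uIcc.exists_bound_of_continuousOn (hg.continuousOn.mono (hsub T hT))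
    refine ⟨max C D, ?_, fun x hx => ⟨(hC x hx).trans (le_max_left _ _),
      (hD x hx).trans (le_max_right _ _)⟩⟩
    exact ((norm_nonneg _).trans (hC 0 (by simp))).trans (le_max_left _ _)
  have hint : ∀ T : ℝ, 0 ≤ T →
      IntervalIntegrable (fun x => B (f' x) (g x) + B (f x) (g' x)) volume 0 T := by
    intro T hT
    obtain ⟨C, hC0, hC⟩ := hbd T hT
    have cf := hf.continuousOn.mono (hsub T hT)
    have cg := hg.continuousOn.mono (hsub T hT)
    have hf1 := (hf.intervalIntegrable_zero T hT)
    have hg1 := (hg.intervalIntegrable_zero T hT)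
    rw [intervalIntegrable_iff] at hf1 hg1 ⊢
    have mf : AEStronglyMeasurable f (volume.restrict (uIoc 0 T)) :=
      (cf.mono uIoc_subset_uIcc).aestronglyMeasurable measurableSet_uIoc
    have mg : AEStronglyMeasurable g (volume.restrict (uIoc 0 T)) :=
      (cg.mono uIoc_subset_uIcc).aestronglyMeasurable measurableSet_uIoc
    refine Integrable.add ?_ ?_
    · refine (hf1.norm.const_mul (‖B‖ * C)).mono' (B.aestronglyMeasurable_comp₂ hf1.1 mg) ?_
      rw [ae_restrict_iff' measurableSet_uIoc]
      refine .of_forall fun t ht => (B.le_opNorm₂ _ _).trans ?_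
      have := (hC t (uIoc_subset_uIcc ht)).2
      nlinarith [mul_le_mul_of_nonneg_left this (mul_nonneg (norm_nonneg B) (norm_nonneg (f' t)))]
    · refine (hg1.norm.const_mul (‖B‖ * C)).mono' (B.aestronglyMeasurable_comp₂ mf hg1.1) ?_
      rw [ae_restrict_iff' measurableSet_uIoc]
      refine .of_forall fun t ht => (B.le_opNorm₂ _ _).trans ?_
      have := (hC t (uIoc_subset_uIcc ht)).1
      gcongr
  refine of_absCont ?_ hint ?_
  · intro T hT
    obtain ⟨C, hC0, hC⟩ := hbd T hT.le
    have hi : ∀ S, 0 ≤ S → IntervalIntegrable (fun t => ‖f' t‖ + ‖g' t‖) volume 0 S := fun S hS =>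
      (hf.intervalIntegrable_zero S hS).norm.add (hg.intervalIntegrable_zero S hS).norm
    -- The product is as absolutely continuous as the primitive of `‖f'‖ + ‖g'‖`.
    have h1 := (hi T hT.le).absolutelyContinuousOnInterval_intervalIntegral (c := 0) (by simp)
    refine h1.of_dist_le (K := ‖B‖ * C) ?_
    have key : ∀ x ∈ uIcc 0 T, ∀ y ∈ uIcc 0 T, x ≤ y → dist (B (f x) (g x)) (B (f y) (g y)) ≤
        ‖B‖ * C * dist (∫ t in (0 : ℝ)..x, (‖f' t‖ + ‖g' t‖))
          (∫ t in (0 : ℝ)..y, (‖f' t‖ + ‖g' t‖)) := by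
      intro x hx y hy hxy
      have hx' := hx
      have hy' := hy
      rw [uIcc_of_le hT.le] at hx' hy'
      have e1 := hf.norm_sub_le hx'.1 hxy
      have e2 := hg.norm_sub_le hx'.1 hxy
      have e3 : ∫ t in x..y, (‖f' t‖ + ‖g' t‖) = (∫ t in x..y, ‖f' t‖) + ∫ t in x..y, ‖g' t‖ :=
        intervalIntegral.integral_add (hf.intervalIntegrable hx'.1 hy'.1).norm
          (hg.intervalIntegrable hx'.1 hy'.1).norm
      rw [dist_comm, dist_eq_norm, dist_comm, dist_eq_norm,
        intervalIntegral.integral_interval_sub_left (hi y hy'.1) (hi x hx'.1), e3]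
      have e4 : B (f y) (g y) - B (f x) (g x) = B (f y - f x) (g y) + B (f x) (g y - g x) := by
        simp
      rw [e4]
      have e5 : ‖B (f y - f x) (g y)‖ ≤ ‖B‖ * C * ‖f y - f x‖ := by
        refine (B.le_opNorm₂ _ _).trans ?_
        have := (hC y hy).2
        nlinarith [mul_le_mul_of_nonneg_left this
          (mul_nonneg (norm_nonneg B) (norm_nonneg (f y - f x)))]
      have e6 : ‖B (f x) (g y - g x)‖ ≤ ‖B‖ * C * ‖g y - g x‖ := by
        refine (B.le_opNorm₂ _ _).trans ?_
        have := (hC x hx).1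
        gcongr
      calc _ ≤ ‖B‖ * C * ‖f y - f x‖ + ‖B‖ * C * ‖g y - g x‖ := (norm_add_le _ _).trans (by gcongr)
        _ ≤ ‖B‖ * C * (∫ t in x..y, ‖f' t‖) + ‖B‖ * C * ∫ t in x..y, ‖g' t‖ := by gcongr
        _ = ‖B‖ * C * ((∫ t in x..y, ‖f' t‖) + ∫ t in x..y, ‖g' t‖) := by ring
        _ ≤ _ := by gcongr; exact Real.le_norm_self _
    intro x hx y hy
    rcases le_total x y with hxy | hxy
    · exact key x hx y hy hxy
    · rw [dist_comm, dist_comm (∫ t in (0 : ℝ)..x, _)]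
      exact key y hy x hx hxy
  · filter_upwards [hf.ae_hasDerivAt, hg.ae_hasDerivAt] with x h1 h2
    have h3 := B.hasFDerivAt_of_bilinear h1.hasFDerivAt h2.hasFDerivAt
    have h4 := h3.hasDerivAt
    simp at h4
    rw [add_comm]
    exact h4

theorem map (T : F →L[ℝ] G) (h : IsPrim f f') :
    IsPrim (fun x => T (f x)) (fun x => T (f' x)) := by
  refine ⟨fun S hS => ?_, fun x hx => ?_⟩
  · exact ⟨T.integrable_comp (h.intervalIntegrable_zero S hS).1,
      T.integrable_comp (h.intervalIntegrable_zero S hS).2⟩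
  · rw [h.eq_add x hx, map_add, T.intervalIntegral_comp_comm (h.intervalIntegrable_zero x hx)]

theorem neg (h : IsPrim f f') : IsPrim (fun x => -f x) (fun x => -f' x) :=
  h.map (-ContinuousLinearMap.id ℝ F)

theorem sub {g g' : ℝ → F} (h : IsPrim f f') (k : IsPrim g g') :
    IsPrim (fun x => f x - g x) (fun x => f' x - g' x) := by
  simpa only [sub_eq_add_neg] using h.add k.neg

theorem fun_mul {𝒜 : Type*} [NormedRing 𝒜] [NormedAlgebra ℝ 𝒜] [CompleteSpace 𝒜]
    {f f' g g' : ℝ → 𝒜} (hf : IsPrim f f') (hg : IsPrim g g') :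
    IsPrim (fun x => f x * g x) (fun x => f' x * g x + f x * g' x) :=
  hf.bilin (ContinuousLinearMap.mul ℝ 𝒜) hg

theorem fun_smul [NormedSpace ℂ F] {c c' : ℝ → ℂ} (hc : IsPrim c c')
    (hf : IsPrim f f') : IsPrim (fun x => c x • f x) (fun x => c' x • f x + c x • f' x) := by
  exact hc.bilin (ContinuousLinearMap.lsmul ℝ ℂ (E := F)) hf

/-- A primitive of `0` is constant. -/
theorem eq_zero_apply (h : IsPrim f fun _ => 0) {x : ℝ} (hx : 0 ≤ x) : f x = f 0 := by
  simpa using h.eq_add x hx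

end IsPrim

theorem isPrim_cexp (c : ℂ) :
    IsPrim (fun x : ℝ => Complex.exp (c * x)) (fun x => c * Complex.exp (c * x)) := by
  refine IsPrim.of_hasDerivWithinAt (by fun_prop) fun x _ => HasDerivAt.hasDerivWithinAt ?_
  have h1 : HasDerivAt (fun x : ℝ => c * (x : ℂ)) c x := by
    simpa using! (Complex.ofRealCLM.hasDerivAt (x := x)).const_mul c
  simpa [mul_comm] using! h1.cexp

end Primitive

/-! ### Grönwall's inequality and linear equations with integrable coefficients -/

section Volterra

namespace IsPrim

variable {K k : ℝ → ℝ}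

theorem pow_succ (h : IsPrim K k) (n : ℕ) :
    IsPrim (fun x => K x ^ (n + 1)) (fun x => (n + 1) * (k x * K x ^ n)) := by
  induction n with
  | zero => simpa using h
  | succ n ih =>
    refine (ih.fun_mul h).congr (fun x _ => _root_.pow_succ _ _) fun x _ => ?_
    push_cast
    ring

theorem exp_neg (h : IsPrim K k) :
    IsPrim (fun x => Real.exp (-K x)) (fun x => -k x * Real.exp (-K x)) := by
  have hc : ContinuousOn (fun x => Real.exp (-K x)) (Ici 0) := h.continuousOn.neg.rexp
  have hsub : ∀ T : ℝ, 0 ≤ T → uIcc 0 T ⊆ Ici 0 := fun T hT => by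
    rw [uIcc_of_le hT]; exact fun t ht => ht.1
  refine of_absCont (fun T hT => ?_) (fun T hT => ?_) ?_
  · obtain ⟨C, hC⟩ := isCompact_uIcc.exists_bound_of_continuousOn
      (h.continuousOn.mono (hsub T hT.le))
    obtain ⟨M, hM⟩ : ∃ M : NNReal, LipschitzOnWith M Real.exp (Icc (-C) C) :=
      (Real.contDiff_exp (n := 1)).contDiffOn.exists_lipschitzOnWith (by decide)
        (convex_Icc _ _) isCompact_Icc
    refine (h.absCont hT.le).of_dist_le (K := M) fun x hx y hy => ?_
    have h1 := hM.dist_le_mul (-K x) (by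
      have := hC x hx
      rw [Real.norm_eq_abs, abs_le] at this
      constructor <;> linarith)
      (-K y) (by have := hC y hy; rw [Real.norm_eq_abs, abs_le] at this; constructor <;> linarith)
    rwa [dist_neg_neg] at h1
  · exact ((h.intervalIntegrable_zero T hT).neg).mul_continuousOn (hc.mono (hsub T hT))
  · filter_upwards [h.ae_hasDerivAt] with x hx
    simpa [mul_comm] using hx.neg.exp

end IsPrim

/-- Grönwall's inequality with an integrable weight. -/
theorem gronwall_of_integrable {u k : ℝ → ℝ} {c T : ℝ} (hT : 0 ≤ T)
    (hu : ContinuousOn u (Icc 0 T)) (hk : IntervalIntegrable k volume 0 T)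
    (hk0 : ∀ t, 0 ≤ k t)
    (h : ∀ x ∈ Icc 0 T, u x ≤ c + ∫ t in (0 : ℝ)..x, k t * u t) :
    u T ≤ c * Real.exp (∫ t in (0 : ℝ)..T, k t) := by
  -- The coefficients are cut off at `T`, so as to have primitives on the whole half-line.
  set κ : ℝ → ℝ := (Ioc 0 T).indicator k
  set U : ℝ → ℝ := fun x => c + ∫ t in (0 : ℝ)..x, κ t * u t
  have ku : IntervalIntegrable (fun t => k t * u t) volume 0 T :=
    hk.mul_continuousOn (by rwa [uIcc_of_le hT])
  have hκ : Integrable κ := by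
    rw [integrable_indicator_iff measurableSet_Ioc]
    exact hk.1
  have hκu : Integrable (fun t => κ t * u t) := by
    have : (fun t => κ t * u t) = (Ioc 0 T).indicator fun t => k t * u t := by
      funext t; by_cases ht : t ∈ Ioc 0 T <;> simp [κ, ht]
    rw [this, integrable_indicator_iff measurableSet_Ioc]
    exact ku.1
  have hκ0 : ∀ t, 0 ≤ κ t := fun t => indicator_nonneg (fun t _ => hk0 t) t
  have eqI : ∀ x ∈ Icc 0 T, ∀ v : ℝ → ℝ,
      ∫ t in (0 : ℝ)..x, κ t * v t = ∫ t in (0 : ℝ)..x, k t * v t := by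
    intro x hx v
    refine intervalIntegral.integral_congr_ae (.of_forall fun t ht => ?_)
    rw [uIoc_of_le hx.1] at ht
    have : t ∈ Ioc 0 T := ⟨ht.1, ht.2.trans hx.2⟩
    simp [κ, this]
  have hU : IsPrim U (fun t => κ t * u t) :=
    ⟨fun S _ => hκu.intervalIntegrable, fun x _ => by simp [U]⟩
  have hK : IsPrim (fun x => ∫ t in (0 : ℝ)..x, κ t) κ :=
    ⟨fun S _ => hκ.intervalIntegrable, fun x _ => by simp⟩
  have hp := hU.fun_mul hK.exp_neg
  have h1 := hp.eq_add T hT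
  have h2 : ∫ t in (0 : ℝ)..T, (κ t * u t * Real.exp (-∫ s in (0 : ℝ)..t, κ s) +
      U t * (-κ t * Real.exp (-∫ s in (0 : ℝ)..t, κ s))) ≤ 0 := by
    rw [intervalIntegral.integral_of_le hT]
    refine setIntegral_nonpos measurableSet_Ioc fun t ht => ?_
    have h3 : u t ≤ U t := by
      have := h t ⟨ht.1.le, ht.2⟩
      rwa [← eqI t ⟨ht.1.le, ht.2⟩] at this
    have h4 := mul_nonneg (hκ0 t) (Real.exp_pos (-∫ s in (0 : ℝ)..t, κ s)).le
    nlinarith [mul_nonneg h4 (sub_nonneg.2 h3)]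
  have h5 : U 0 = c := by simp [U]
  have h6 : ∫ t in (0 : ℝ)..T, κ t = ∫ t in (0 : ℝ)..T, k t := by
    simpa using eqI T ⟨hT, le_rfl⟩ fun _ => 1
  rw [h5, h6] at h1
  simp only [intervalIntegral.integral_same, neg_zero, Real.exp_zero, mul_one] at h1
  have h7 : U T * Real.exp (-∫ t in (0 : ℝ)..T, k t) ≤ c := by linarith
  have h8 : u T ≤ U T := by
    have := h T ⟨hT, le_rfl⟩
    rwa [← eqI T ⟨hT, le_rfl⟩] at this
  rw [Real.exp_neg, ← div_eq_mul_inv, div_le_iff₀ (Real.exp_pos _)] at h7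
  exact h8.trans h7

section Holomorphic

variable {E : Type*} [NormedAddCommGroup E] [NormedSpace ℂ E] [CompleteSpace E]

/-- Holomorphy of a parametric integral; no bound on the derivative is needed, because Cauchy's
estimate provides one. -/
theorem differentiableOn_integral_of_dominated {α : Type*} [MeasurableSpace α] {μ : Measure α}
    {F : ℂ → α → E} {U : Set ℂ} (hU : IsOpen U) {bound : α → ℝ}
    (hmeas : ∀ z ∈ U, AEStronglyMeasurable (F z) μ)
    (hd : ∀ᵐ a ∂μ, DifferentiableOn ℂ (fun z => F z a) U)
    (hb : ∀ᵐ a ∂μ, ∀ z ∈ U, ‖F z a‖ ≤ bound a) (hbi : Integrable bound μ) :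
    DifferentiableOn ℂ (fun z => ∫ a, F z a ∂μ) U := by
  intro z hz
  obtain ⟨ε, hε, hεU⟩ := Metric.isOpen_iff.1 hU z hz
  have hU' : U ∈ 𝓝 z := hU.mem_nhds hz
  -- The derivative in the parameter is a limit of difference quotients, hence measurable.
  have hderiv : ∀ᵐ a ∂μ, Tendsto (fun n : ℕ => ((n : ℂ) + 1) •
      (F (z + (((ε / 2 : ℝ) : ℂ)) * (1 / ((n : ℂ) + 1))) a - F z a)) atTop
      (𝓝 (((ε / 2 : ℝ) : ℂ) • deriv (fun z => F z a) z)) := by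
    filter_upwards [hd] with a ha
    have h1 : HasDerivAt (fun z => F z a) (deriv (fun z => F z a) z) z :=
      (ha.differentiableAt hU').hasDerivAt
    have h0 : (((ε / 2 : ℝ) : ℂ)) ≠ 0 := by exact_mod_cast (half_pos hε).ne'
    have ht : Tendsto (fun n : ℕ => z + (((ε / 2 : ℝ) : ℂ)) * (1 / ((n : ℂ) + 1))) atTop
        (𝓝[≠] z) := by
      refine tendsto_nhdsWithin_iff.2 ⟨?_, .of_forall fun n => ?_⟩
      · have := (tendsto_one_div_add_atTop_nhds_zero_nat (𝕜 := ℂ)).const_mul ((ε / 2 : ℝ) : ℂ)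
        simpa using this.const_add z
      · have : (n : ℂ) + 1 ≠ 0 := Nat.cast_add_one_ne_zero n
        simp [hε.ne', this]
    have h2 := (hasDerivAt_iff_tendsto_slope.1 h1).comp ht
    refine (h2.const_smul (((ε / 2 : ℝ) : ℂ))).congr fun n => ?_
    have : (n : ℂ) + 1 ≠ 0 := Nat.cast_add_one_ne_zero n
    simp only [slope, Function.comp_apply, vsub_eq_sub, add_sub_cancel_left]
    rw [smul_smul]
    congr 1
    field_simp
  have hmem : ∀ n : ℕ, z + (((ε / 2 : ℝ) : ℂ)) * (1 / ((n : ℂ) + 1)) ∈ U := by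
    intro n
    apply hεU
    rw [Metric.mem_ball, dist_eq_norm, add_sub_cancel_left, norm_mul, norm_div, norm_one]
    have h1 : ‖(n : ℂ) + 1‖ = (n : ℝ) + 1 := by
      have : ((n : ℂ) + 1) = (((n : ℝ) + 1 : ℝ) : ℂ) := by push_cast; rfl
      rw [this, Complex.norm_real, Real.norm_of_nonneg (by positivity)]
    rw [h1, Complex.norm_real, Real.norm_of_nonneg (half_pos hε).le]
    have : 1 / ((n : ℝ) + 1) ≤ 1 := by
      rw [div_le_one (by positivity)]; linarith [(Nat.cast_nonneg n : (0 : ℝ) ≤ n)]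
    nlinarith
  have hm' : AEStronglyMeasurable (fun a => deriv (fun z => F z a) z) μ := by
    have h1 := aestronglyMeasurable_of_tendsto_ae (u := atTop) (f := fun (n : ℕ) a =>
      ((n : ℂ) + 1) • (F (z + (((ε / 2 : ℝ) : ℂ)) * (1 / ((n : ℂ) + 1))) a - F z a))
      (fun n => ((hmeas _ (hmem n)).sub (hmeas z hz)).const_smul _) hderiv
    have h0 : (((ε / 2 : ℝ) : ℂ)) ≠ 0 := by exact_mod_cast (half_pos hε).ne'
    have h2 := h1.const_smul ((((ε / 2 : ℝ) : ℂ))⁻¹)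
    refine h2.congr (.of_forall fun a => ?_)
    simp only [Pi.smul_apply]
    rw [smul_smul, inv_mul_cancel₀ h0, one_smul]
  have hF : Integrable (F z) μ := by
    refine hbi.mono' (hmeas z hz) ?_
    filter_upwards [hb] with a ha using ha z hz
  have key := hasDerivAt_integral_of_dominated_loc_of_deriv_le (𝕜 := ℂ) (μ := μ) (F := F)
    (F' := fun z a => deriv (fun z => F z a) z) (x₀ := z) (s := Metric.ball z (ε / 2))
    (bound := fun a => bound a / (ε / 4)) (Metric.ball_mem_nhds z (half_pos hε))
    (by filter_upwards [hU'] with w hw using hmeas w hw) hF hm' ?_ (hbi.div_const _) ?_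
  · exact key.2.differentiableAt.differentiableWithinAt
  -- Cauchy's estimate on circles of radius `ε / 4`.
  · filter_upwards [hd, hb] with a ha hb w hw
    have hsub : Metric.closedBall w (ε / 4) ⊆ U := fun v hv => hεU (by
      rw [Metric.mem_closedBall] at hv
      rw [Metric.mem_ball] at hw ⊢
      linarith [dist_triangle v w z])
    refine Complex.norm_deriv_le_of_forall_mem_sphere_norm_le (by positivity) ?_
      fun v hv => hb v (hsub (Metric.sphere_subset_closedBall hv))
    exact (ha.mono ((Metric.closure_ball_subset_closedBall).trans hsub)).diffContOnCl
  · filter_upwards [hd] with a ha w hw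
    have : w ∈ U := hεU (Metric.ball_subset_ball (by linarith) hw)
    exact (ha.differentiableAt (hU.mem_nhds this)).hasDerivAt

/-- A family of locally integrable coefficients, holomorphic in the parameter. -/
structure HolomorphicFamily (A : ℂ → ℝ → E →L[ℂ] E) : Prop where
  intervalIntegrable : ∀ z, ∀ T : ℝ, 0 ≤ T → IntervalIntegrable (A z) volume 0 T
  differentiable : ∀ t, Differentiable ℂ fun z => A z t
  bound : ∀ r : ℝ, ∃ k : ℝ → ℝ, (∀ T : ℝ, 0 ≤ T → IntervalIntegrable k volume 0 T) ∧
    ∀ z, ‖z‖ ≤ r → ∀ t, ‖A z t‖ ≤ k t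

theorem IsPrim.norm_le_of_linear {W : ℝ → E} {A : ℝ → E →L[ℂ] E} {k : ℝ → ℝ}
    (h : IsPrim W fun t => A t (W t)) (hk : ∀ T : ℝ, 0 ≤ T → IntervalIntegrable k volume 0 T)
    (hA : ∀ t, ‖A t‖ ≤ k t) {x : ℝ} (hx : 0 ≤ x) :
    ‖W x‖ ≤ ‖W 0‖ * Real.exp (∫ t in (0 : ℝ)..x, k t) := by
  refine gronwall_of_integrable (u := fun t => ‖W t‖) hx
    (h.continuousOn.norm.mono fun t ht => ht.1) (hk x hx)
    (fun t => (norm_nonneg _).trans (hA t)) fun y hy => ?_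
  have h1 := h.norm_sub_le le_rfl hy.1
  have hsub : uIcc 0 y ⊆ Ici 0 := by rw [uIcc_of_le hy.1]; exact fun t ht => ht.1
  have h2 : ∫ t in (0 : ℝ)..y, ‖A t (W t)‖ ≤ ∫ t in (0 : ℝ)..y, k t * ‖W t‖ :=
    intervalIntegral.integral_mono_on hy.1 (h.intervalIntegrable_zero y hy.1).norm
      ((hk y hy.1).mul_continuousOn (h.continuousOn.norm.mono hsub)) fun t _ =>
      ((A t).le_opNorm _).trans (by gcongr; exact hA t)
  calc ‖W y‖ = ‖W 0 + (W y - W 0)‖ := by congr 1; abel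
    _ ≤ ‖W 0‖ + ‖W y - W 0‖ := norm_add_le _ _
    _ ≤ _ := by linarith

theorem IsPrim.eq_of_linear {W V : ℝ → E} {A : ℝ → E →L[ℂ] E} {k : ℝ → ℝ}
    (h : IsPrim W fun t => A t (W t)) (h' : IsPrim V fun t => A t (V t))
    (hk : ∀ T : ℝ, 0 ≤ T → IntervalIntegrable k volume 0 T)
    (hA : ∀ t, ‖A t‖ ≤ k t) (h0 : W 0 = V 0) {x : ℝ} (hx : 0 ≤ x) : W x = V x := by
  have h1 : IsPrim (fun t => W t - V t) fun t => A t (W t - V t) := by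
    simpa only [map_sub] using h.sub h'
  have h2 := h1.norm_le_of_linear hk hA hx
  simp only [h0, sub_self, norm_zero, zero_mul, norm_le_zero_iff] at h2
  exact sub_eq_zero.1 h2

/-- The terms of the Picard series of `W' = A W`, `W(0) = w`. -/
def picardTerm (A : ℂ → ℝ → E →L[ℂ] E) (w : ℂ → E) : ℕ → ℂ → ℝ → E
  | 0 => fun z _ => w z
  | n + 1 => fun z x => ∫ t in (0 : ℝ)..x, A z t (picardTerm A w n z t)

namespace HolomorphicFamily

variable {A : ℂ → ℝ → E →L[ℂ] E} (hA : HolomorphicFamily A) {w : ℂ → E}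
include hA

theorem intervalIntegrable_apply {W : ℝ → E} (hW : ContinuousOn W (Ici 0)) (z : ℂ) {T : ℝ}
    (hT : 0 ≤ T) : IntervalIntegrable (fun t => A z t (W t)) volume 0 T := by
  have hsub : uIcc 0 T ⊆ Ici 0 := by rw [uIcc_of_le hT]; exact fun t ht => ht.1
  obtain ⟨C, hC⟩ := isCompact_uIcc.exists_bound_of_continuousOn (hW.mono hsub)
  have h1 := hA.intervalIntegrable z T hT
  rw [intervalIntegrable_iff] at h1 ⊢
  refine (h1.norm.mul_const C).mono'
    ((ContinuousLinearMap.id ℂ (E →L[ℂ] E)).aestronglyMeasurable_comp₂ h1.1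
    ((hW.mono (uIoc_subset_uIcc.trans hsub)).aestronglyMeasurable measurableSet_uIoc)) ?_
  rw [ae_restrict_iff' measurableSet_uIoc]
  exact .of_forall fun t ht => ((A z t).le_opNorm _).trans
    (by gcongr; exact hC t (uIoc_subset_uIcc ht))

theorem picardTerm_isPrim (n : ℕ) (z : ℂ) : ContinuousOn (picardTerm A w n z) (Ici 0) ∧
    IsPrim (picardTerm A w (n + 1) z) fun t => A z t (picardTerm A w n z t) := by
  have step : ∀ n, ContinuousOn (picardTerm A w n z) (Ici 0) →
      IsPrim (picardTerm A w (n + 1) z) fun t => A z t (picardTerm A w n z t) := fun n hn =>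
    ⟨fun T hT => hA.intervalIntegrable_apply hn z hT, fun x _ => by simp [picardTerm]⟩
  have : ContinuousOn (picardTerm A w n z) (Ici 0) := by
    induction n with
    | zero => exact continuousOn_const
    | succ n ih => exact (step n ih).continuousOn
  exact ⟨this, step n this⟩

theorem norm_picardTerm_le {k : ℝ → ℝ} (hk : ∀ T : ℝ, 0 ≤ T → IntervalIntegrable k volume 0 T)
    {z : ℂ} (hz : ∀ t, ‖A z t‖ ≤ k t) (n : ℕ) {x : ℝ} (hx : 0 ≤ x) :
    ‖picardTerm A w n z x‖ ≤ ‖w z‖ * ((∫ t in (0 : ℝ)..x, k t) ^ n / n.factorial) := by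
  induction n generalizing x with
  | zero => simp [picardTerm]
  | succ n ih =>
    have hK : IsPrim (fun x => ∫ t in (0 : ℝ)..x, k t) k := ⟨hk, fun x _ => by simp⟩
    have h1 := (hK.pow_succ n).eq_add x hx
    simp only [intervalIntegral.integral_same, ne_eq, Nat.add_eq_zero_iff, one_ne_zero, and_false,
      not_false_eq_true, zero_pow, zero_add, intervalIntegral.integral_const_mul] at h1
    have hsub : uIcc 0 x ⊆ Ici 0 := by rw [uIcc_of_le hx]; exact fun t ht => ht.1
    have h2 := ((hA.picardTerm_isPrim (w := w) n z).2).norm_sub_le le_rfl hx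
    have h3 : picardTerm A w (n + 1) z 0 = 0 := by simp [picardTerm]
    rw [h3, sub_zero] at h2
    refine h2.trans ?_
    calc ∫ t in (0 : ℝ)..x, ‖A z t (picardTerm A w n z t)‖
        ≤ ∫ t in (0 : ℝ)..x, ‖w z‖ / n.factorial * (k t * (∫ s in (0 : ℝ)..t, k s) ^ n) := by
          refine intervalIntegral.integral_mono_on hx
            ((hA.picardTerm_isPrim (w := w) n z).2.intervalIntegrable_zero x hx).norm
            (((hk x hx).mul_continuousOn ((hK.continuousOn.mono hsub).pow n)).const_mul _)
            fun t ht => ?_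
          refine ((A z t).le_opNorm _).trans ((mul_le_mul (hz t) (ih ht.1) (norm_nonneg _)
            ((norm_nonneg _).trans (hz t))).trans (le_of_eq ?_))
          ring
      _ = _ := by
          rw [intervalIntegral.integral_const_mul, h1, Nat.factorial_succ]
          push_cast
          field_simp

theorem picardTerm_differentiable (hw : Differentiable ℂ w) (n : ℕ) {x : ℝ} (hx : 0 ≤ x) :
    Differentiable ℂ fun z => picardTerm A w n z x := by
  induction n generalizing x with
  | zero => exact hw
  | succ n ih =>
    intro z₀
    obtain ⟨k, hk, hkA⟩ := hA.bound (‖z₀‖ + 1)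
    obtain ⟨C, hC⟩ := (isCompact_closedBall z₀ 1).exists_bound_of_continuousOn
      hw.continuous.continuousOn
    have hC0 : 0 ≤ C := (norm_nonneg _).trans (hC z₀ (by simp))
    have hz : ∀ z ∈ Metric.ball z₀ 1, ‖z‖ ≤ ‖z₀‖ + 1 := fun z hz => by
      rw [Metric.mem_ball, dist_eq_norm] at hz
      linarith [norm_sub_norm_le z z₀]
    set B := C * ((∫ t in (0 : ℝ)..x, k t) ^ n / n.factorial)
    have hk0 : ∀ t, 0 ≤ k t := fun t => (norm_nonneg _).trans (hkA 0 (by simp; positivity) t)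
    have key := differentiableOn_integral_of_dominated (μ := volume.restrict (Ioc 0 x))
      (F := fun z t => A z t (picardTerm A w n z t)) (U := Metric.ball z₀ 1) Metric.isOpen_ball
      (bound := fun t => k t * B)
      (fun z _ => ((hA.picardTerm_isPrim (w := w) n z).2.intervalIntegrable_zero x hx).1.1)
      (by
        rw [ae_restrict_iff' measurableSet_Ioc]
        exact .of_forall fun t ht =>
          ((hA.differentiable t).clm_apply (ih ht.1.le)).differentiableOn)
      (by
        rw [ae_restrict_iff' measurableSet_Ioc]
        refine .of_forall fun t ht z hzb => ((A z t).le_opNorm _).trans ?_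
        refine mul_le_mul (hkA z (hz z hzb) t) ?_ (norm_nonneg _) (hk0 t)
        refine (hA.norm_picardTerm_le hk (hkA z (hz z hzb)) n ht.1.le).trans ?_
        have h1 : 0 ≤ ∫ s in (0 : ℝ)..t, k s :=
          intervalIntegral.integral_nonneg ht.1.le fun s _ => hk0 s
        have h2 : ∫ s in (0 : ℝ)..t, k s ≤ ∫ s in (0 : ℝ)..x, k s :=
          intervalIntegral.integral_mono_interval le_rfl ht.1.le ht.2 (.of_forall hk0) (hk x hx)
        have h3 := hC z (Metric.ball_subset_closedBall hzb)
        simp only [B]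
        gcongr)
      ((hk x hx).1.mul_const B)
    have h1 := key.differentiableAt (Metric.ball_mem_nhds z₀ one_pos)
    simpa only [picardTerm, intervalIntegral.integral_of_le hx] using h1

/-- The Picard series solves the linear equation; the solution is entire in the parameter. -/
theorem exists_solution (hw : Differentiable ℂ w) :
    ∃ W : ℂ → ℝ → E, (∀ z, W z 0 = w z) ∧ (∀ z, IsPrim (W z) fun t => A z t (W z t)) ∧
      ∀ x : ℝ, 0 ≤ x → Differentiable ℂ fun z => W z x := by
  set W : ℂ → ℝ → E := fun z x => ∑' n, picardTerm A w n z x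
  -- Uniform summability for bounded parameters and times.
  have hsum : ∀ (r x : ℝ), 0 ≤ x → ∃ u : ℕ → ℝ, Summable u ∧ ∀ z, ‖z‖ ≤ r → ∀ t ∈ Icc 0 x, ∀ n,
      ‖picardTerm A w n z t‖ ≤ u n := by
    intro r x hx
    obtain ⟨k, hk, hkA⟩ := hA.bound (max r 0)
    obtain ⟨C, hC⟩ := (isCompact_closedBall (0 : ℂ) (max r 0)).exists_bound_of_continuousOn
      hw.continuous.continuousOn
    have hk0 : ∀ t, 0 ≤ k t := fun t => (norm_nonneg _).trans (hkA 0 (by simp) t)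
    have hC0 : 0 ≤ C := (norm_nonneg _).trans (hC 0 (by simp))
    refine ⟨fun n => C * ((∫ t in (0 : ℝ)..x, k t) ^ n / n.factorial),
      (Real.summable_pow_div_factorial _).mul_left C, fun z hz t ht n => ?_⟩
    have hz' : ‖z‖ ≤ max r 0 := hz.trans (le_max_left _ _)
    refine (hA.norm_picardTerm_le hk (hkA z hz') n ht.1).trans ?_
    have h1 : 0 ≤ ∫ s in (0 : ℝ)..t, k s :=
      intervalIntegral.integral_nonneg ht.1 fun s _ => hk0 s
    have h2 : ∫ s in (0 : ℝ)..t, k s ≤ ∫ s in (0 : ℝ)..x, k s :=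
      intervalIntegral.integral_mono_interval le_rfl ht.1 ht.2 (.of_forall hk0) (hk x hx)
    have h3 := hC z (by simpa using hz')
    beta_reduce
    gcongr
  have hsm : ∀ z x, 0 ≤ x → Summable fun n => picardTerm A w n z x := by
    intro z x hx
    obtain ⟨u, hu, hb⟩ := hsum ‖z‖ x hx
    exact Summable.of_norm_bounded hu fun n => hb z le_rfl x ⟨hx, le_rfl⟩ n
  have hW : ∀ z x, 0 ≤ x → HasSum (fun n => picardTerm A w n z x) (W z x) :=
    fun z x hx => (hsm z x hx).hasSum
  have hcont : ∀ z, ContinuousOn (W z) (Ici 0) := by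
    intro z x hx
    obtain ⟨u, hu, hb⟩ := hsum ‖z‖ (x + 1) (by linarith [mem_Ici.1 hx])
    have h1 : ContinuousOn (W z) (Icc 0 (x + 1)) :=
      continuousOn_tsum (fun n => ((hA.picardTerm_isPrim (w := w) n z).1).mono fun t ht => ht.1) hu
        fun n t ht => hb z le_rfl t ht n
    refine (h1 x ⟨hx, by linarith⟩).mono_of_mem_nhdsWithin ?_
    rw [mem_nhdsWithin]
    exact ⟨Iio (x + 1), isOpen_Iio, by simp, fun y hy => ⟨hy.2, hy.1.le⟩⟩
  have h0 : ∀ z, W z 0 = w z := by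
    intro z
    rw [show W z 0 = ∑' n, picardTerm A w n z 0 from rfl, tsum_eq_single 0]
    · rfl
    · intro n hn
      obtain ⟨m, rfl⟩ := Nat.exists_eq_succ_of_ne_zero hn
      simp [picardTerm]
  refine ⟨W, h0, fun z => ⟨fun T hT => hA.intervalIntegrable_apply (hcont z) z hT,
    fun x hx => ?_⟩, fun x hx z₀ => ?_⟩
  · rw [h0 z]
    obtain ⟨u, hu, hb⟩ := hsum ‖z‖ x hx
    have hAi := (hA.intervalIntegrable z x hx).norm
    have h1 : HasSum (fun n => ∫ t in (0 : ℝ)..x, A z t (picardTerm A w n z t))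
        (∫ t in (0 : ℝ)..x, A z t (W z t)) := by
      refine intervalIntegral.hasSum_integral_of_dominated_convergence
        (fun n t => ‖A z t‖ * u n) (fun n => ?_) (fun n => .of_forall fun t ht => ?_)
        (.of_forall fun t _ => hu.mul_left _) ?_ (.of_forall fun t ht => ?_)
      · rw [uIoc_of_le hx]
        exact ((hA.picardTerm_isPrim (w := w) n z).2.intervalIntegrable_zero x hx).1.1
      · rw [uIoc_of_le hx] at ht
        exact ((A z t).le_opNorm _).trans (by gcongr; exact hb z le_rfl t ⟨ht.1.le, ht.2⟩ n)
      · simp_rw [tsum_mul_left]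
        exact hAi.mul_const _
      · rw [uIoc_of_le hx] at ht
        exact (A z t).hasSum (hW z t ht.1.le)
    have h2 : HasSum (fun n => picardTerm A w (n + 1) z x) (W z x - w z) := by
      have := (hasSum_nat_add_iff' 1).2 (hW z x hx)
      simpa [picardTerm] using this
    rw [← h2.unique h1]
    abel
  · obtain ⟨u, hu, hb⟩ := hsum (‖z₀‖ + 1) x hx
    have h1 : DifferentiableOn ℂ (fun z => W z x) (Metric.ball z₀ 1) := by
      refine Complex.differentiableOn_tsum_of_summable_norm hu
        (fun n => (hA.picardTerm_differentiable hw n hx).differentiableOn) Metric.isOpen_ball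
        fun n z hz => hb z ?_ x ⟨hx, le_rfl⟩ n
      rw [Metric.mem_ball, dist_eq_norm] at hz
      linarith [norm_sub_norm_le z z₀]
    exact h1.differentiableAt (Metric.ball_mem_nhds z₀ one_pos)

end HolomorphicFamily

end Holomorphic

end Volterra

/-! ### Solutions of the pencil equation in a Banach algebra: large parameters -/

section Canonical

theorem IsPrim.norm_sub_le_of_le {F : Type*} [NormedAddCommGroup F] [NormedSpace ℝ F]
    [CompleteSpace F] {g g' : ℝ → F} (h : IsPrim g g') {κ : ℝ → ℝ}
    (hκ : IntegrableOn κ (Ioi 0)) (hκ0 : ∀ t, 0 ≤ κ t) {B x y : ℝ} (hB : 0 ≤ B) (hx : 0 ≤ x)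
    (hxy : x ≤ y) (hb : ∀ t ∈ Icc x y, ‖g' t‖ ≤ B * κ t) :
    ‖g y - g x‖ ≤ B * ∫ t in Ioi 0, κ t := by
  have hsub : Ioc x y ⊆ Ioi 0 := fun t ht => hx.trans_lt ht.1
  have hκi : IntervalIntegrable κ volume x y := by
    rw [intervalIntegrable_iff_integrableOn_Ioc_of_le hxy]
    exact hκ.mono_set hsub
  calc ‖g y - g x‖ ≤ ∫ t in x..y, ‖g' t‖ := h.norm_sub_le hx hxy
    _ ≤ ∫ t in x..y, B * κ t := intervalIntegral.integral_mono_on hxy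
        (h.intervalIntegrable hx (hx.trans hxy)).norm (hκi.const_mul B) hb
    _ = B * ∫ t in Ioc x y, κ t := by
        rw [intervalIntegral.integral_const_mul, intervalIntegral.integral_of_le hxy]
    _ ≤ _ := by
        gcongr
        exact .of_forall hκ0

variable {𝒜 : Type*} [NormedRing 𝒜] [NormedAlgebra ℂ 𝒜] [CompleteSpace 𝒜]

/-- The equation `Y'' = σ² Y - 2 σ A Y - Q Y` on the half-line as a first order system for
`Y` and `Y₁ = Y'`. With `σ = i ρ` this is `Y'' + (ρ² + 2 i ρ A + Q) Y = 0`. -/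
structure IsSol (A Q : ℝ → 𝒜) (σ : ℂ) (Y Y₁ : ℝ → 𝒜) : Prop where
  fst : IsPrim Y Y₁
  snd : IsPrim Y₁ fun t => σ ^ 2 • Y t - (2 * σ) • (A t * Y t) - Q t * Y t

/-- Integrable coefficients on the half-line, the first one absolutely continuous. -/
structure IntegrableCoeff (A A' Q : ℝ → 𝒜) : Prop where
  prim : IsPrim A A'
  int : IntegrableOn A (Ioi 0)
  int_deriv : IntegrableOn A' (Ioi 0)
  int_pot : IntegrableOn Q (Ioi 0)

/-- Bounded solutions of `Rp' = Rp A`, `Rm' = - Rm A` with unit initial values, together with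
left inverses `Pm` of `Rp` and `Pp` of `Rm`. -/
structure Transport (A Pp Pm Rp Rm : ℝ → 𝒜) (C : ℝ) : Prop where
  prim_Rp : IsPrim Rp fun t => Rp t * A t
  prim_Rm : IsPrim Rm fun t => -(Rm t * A t)
  Rp_zero : Rp 0 = 1
  Rm_zero : Rm 0 = 1
  Pm_mul_Rp : ∀ t, 0 ≤ t → Pm t * Rp t = 1
  Pp_mul_Rm : ∀ t, 0 ≤ t → Pp t * Rm t = 1
  norm_le : ∀ t, 0 ≤ t → ‖Pp t‖ ≤ C ∧ ‖Pm t‖ ≤ C ∧ ‖Rp t‖ ≤ C ∧ ‖Rm t‖ ≤ C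

theorem IntegrableCoeff.exists_bound {A A' Q : ℝ → 𝒜} (h : IntegrableCoeff A A' Q) :
    ∃ B, 0 ≤ B ∧ ∀ t, 0 ≤ t → ‖A t‖ ≤ B := by
  have h0 : 0 ≤ ∫ t in Ioi 0, ‖A' t‖ := integral_nonneg fun _ => norm_nonneg _
  refine ⟨‖A 0‖ + ∫ t in Ioi 0, ‖A' t‖, by positivity, fun t ht => ?_⟩
  have := h.prim.norm_sub_le_of_le (B := 1) h.int_deriv.norm (fun _ => norm_nonneg _) zero_le_one
    le_rfl ht fun s _ => by simp
  calc ‖A t‖ = ‖A 0 + (A t - A 0)‖ := by congr 1; abel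
    _ ≤ ‖A 0‖ + ‖A t - A 0‖ := norm_add_le _ _
    _ ≤ _ := by linarith

/-- The weight that controls the perturbation in the canonical system. -/
def canonicalWeight (A A' Q : ℝ → 𝒜) (t : ℝ) : ℝ := ‖A' t‖ + 2 * ‖A t‖ ^ 2 + 2 * ‖Q t‖

theorem canonicalWeight_nonneg (A A' Q : ℝ → 𝒜) (t : ℝ) : 0 ≤ canonicalWeight A A' Q t := by
  unfold canonicalWeight; positivity

theorem IntegrableCoeff.integrable_weight {A A' Q : ℝ → 𝒜} (h : IntegrableCoeff A A' Q) :
    IntegrableOn (canonicalWeight A A' Q) (Ioi 0) := by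
  obtain ⟨B, hB0, hB⟩ := h.exists_bound
  refine (h.int_deriv.norm.add (Integrable.const_mul ?_ 2)).add (h.int_pot.norm.const_mul 2)
  refine (h.int.norm.const_mul B).mono' (h.int.1.norm.pow 2) ?_
  rw [ae_restrict_iff' measurableSet_Ioi]
  refine .of_forall fun t ht => ?_
  rw [Real.norm_of_nonneg (by positivity), pow_two]
  gcongr
  exact hB t (le_of_lt ht)

/-- The amplitude of the solution in the direction `exp (σ x)`: here `ε = -1 / (2 σ)`, and the
correction by `ε A` removes the part of the coupling that does not decay as `σ → ∞`. -/
def ampPlus (A Rp : ℝ → 𝒜) (σ : ℂ) (Y Y₁ : ℝ → 𝒜) (t : ℝ) : 𝒜 :=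
  Rp t * ((1 / 2 : ℂ) • ((Y t + (-σ⁻¹ / 2) • (A t * Y t)) +
    (σ⁻¹ • Y₁ t - (-σ⁻¹ / 2) • (A t * σ⁻¹ • Y₁ t))))

/-- The amplitude of the solution in the direction `exp (-σ x)`. -/
def ampMinus (A Rm : ℝ → 𝒜) (σ : ℂ) (Y Y₁ : ℝ → 𝒜) (t : ℝ) : 𝒜 :=
  Rm t * ((1 / 2 : ℂ) • ((Y t + (-σ⁻¹ / 2) • (A t * Y t)) -
    (σ⁻¹ • Y₁ t - (-σ⁻¹ / 2) • (A t * σ⁻¹ • Y₁ t))))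

/-- The perturbation in the equation of `ampPlus`. -/
def pertPlus (A A' Q : ℝ → 𝒜) (σ : ℂ) (Y Y₁ : ℝ → 𝒜) (t : ℝ) : 𝒜 :=
  (1 / 2 : ℂ) • (A' t * (Y t - σ⁻¹ • Y₁ t)) + A t * (A t * Y t) +
    (Q t * Y t - (-σ⁻¹ / 2) • (A t * (Q t * Y t))) +
    (1 / 2 : ℂ) • (A t * (A t * (Y t - σ⁻¹ • Y₁ t)))

/-- The perturbation in the equation of `ampMinus`. -/
def pertMinus (A A' Q : ℝ → 𝒜) (σ : ℂ) (Y Y₁ : ℝ → 𝒜) (t : ℝ) : 𝒜 :=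
  (1 / 2 : ℂ) • (A' t * (Y t + σ⁻¹ • Y₁ t)) - A t * (A t * Y t) -
    (Q t * Y t - (-σ⁻¹ / 2) • (A t * (Q t * Y t))) -
    (1 / 2 : ℂ) • (A t * (A t * (Y t + σ⁻¹ • Y₁ t)))

variable {A A' Q Pp Pm Rp Rm Y Y₁ : ℝ → 𝒜} {C : ℝ} {σ : ℂ}

theorem IsPrim.fun_const_smul {F : Type*} [NormedAddCommGroup F] [NormedSpace ℂ F]
    [CompleteSpace F] {f f' : ℝ → F} (h : IsPrim f f') (c : ℂ) :
    IsPrim (fun x => c • f x) (fun x => c • f' x) :=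
  h.map ((c • ContinuousLinearMap.id ℂ F).restrictScalars ℝ)

theorem isPrim_ampPlus (hA : IntegrableCoeff A A' Q) (hT : Transport A Pp Pm Rp Rm C)
    (hσ : σ ≠ 0) (hY : IsSol A Q σ Y Y₁) :
    IsPrim (ampPlus A Rp σ Y Y₁) fun t => σ • ampPlus A Rp σ Y Y₁ t +
      (-σ⁻¹ / 2) • (Rp t * pertPlus A A' Q σ Y Y₁ t) := by
  have hV := hY.snd.fun_const_smul σ⁻¹
  have hV' := hY.fst.add ((hA.prim.fun_mul hY.fst).fun_const_smul (-σ⁻¹ / 2))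
  have hW := hV.sub ((hA.prim.fun_mul hV).fun_const_smul (-σ⁻¹ / 2))
  refine (hT.prim_Rp.fun_mul ((hV'.add hW).fun_const_smul (1 / 2))).congr (fun x _ => rfl)
    fun x _ => ?_
  simp only [ampPlus, pertPlus, mul_add, mul_sub, mul_smul_comm, smul_add, smul_sub, mul_assoc,
    smul_smul]
  match_scalars <;> field_simp <;> ring

theorem isPrim_ampMinus (hA : IntegrableCoeff A A' Q) (hT : Transport A Pp Pm Rp Rm C)
    (hσ : σ ≠ 0) (hY : IsSol A Q σ Y Y₁) :
    IsPrim (ampMinus A Rm σ Y Y₁) fun t => -σ • ampMinus A Rm σ Y Y₁ t +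
      (-σ⁻¹ / 2) • (Rm t * pertMinus A A' Q σ Y Y₁ t) := by
  have hV := hY.snd.fun_const_smul σ⁻¹
  have hV' := hY.fst.add ((hA.prim.fun_mul hY.fst).fun_const_smul (-σ⁻¹ / 2))
  have hW := hV.sub ((hA.prim.fun_mul hV).fun_const_smul (-σ⁻¹ / 2))
  refine (hT.prim_Rm.fun_mul ((hV'.sub hW).fun_const_smul (1 / 2))).congr (fun x _ => rfl)
    fun x _ => ?_
  simp only [ampMinus, pertMinus, mul_add, mul_sub, mul_smul_comm, smul_add, smul_sub, mul_assoc,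
    smul_smul, neg_mul]
  match_scalars <;> field_simp <;> ring

/-- The size of a solution with parameter `σ`. -/
def solSize (σ : ℂ) (Y Y₁ : ℝ → 𝒜) (t : ℝ) : ℝ := ‖Y t‖ + ‖σ⁻¹ • Y₁ t‖

theorem solSize_nonneg (σ : ℂ) (Y Y₁ : ℝ → 𝒜) (t : ℝ) : 0 ≤ solSize σ Y Y₁ t := by
  unfold solSize; positivity

theorem norm_pertPlus_le {t : ℝ} (h : ‖σ⁻¹‖ * ‖A t‖ ≤ 1) :
    ‖pertPlus A A' Q σ Y Y₁ t‖ ≤ canonicalWeight A A' Q t * solSize σ Y Y₁ t := by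
  unfold pertPlus canonicalWeight solSize
  set V := σ⁻¹ • Y₁ t
  have h1 : ‖(1 / 2 : ℂ) • (A' t * (Y t - V))‖ ≤ 1 / 2 * (‖A' t‖ * (‖Y t‖ + ‖V‖)) := by
    rw [norm_smul]; norm_num
    exact (norm_mul_le _ _).trans (by gcongr; exact norm_sub_le _ _)
  have h2 : ‖A t * (A t * Y t)‖ ≤ ‖A t‖ * (‖A t‖ * ‖Y t‖) :=
    (norm_mul_le _ _).trans (by gcongr; exact norm_mul_le _ _)
  have h3 : ‖(-σ⁻¹ / 2) • (A t * (Q t * Y t))‖ ≤ ‖Q t‖ * ‖Y t‖ := by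
    rw [norm_smul, norm_div, norm_neg]
    have e1 : ‖A t * (Q t * Y t)‖ ≤ ‖A t‖ * (‖Q t‖ * ‖Y t‖) :=
      (norm_mul_le _ _).trans (by gcongr; exact norm_mul_le _ _)
    have e2 : 0 ≤ ‖Q t‖ * ‖Y t‖ := by positivity
    calc _ ≤ ‖σ⁻¹‖ / ‖(2 : ℂ)‖ * (‖A t‖ * (‖Q t‖ * ‖Y t‖)) := by gcongr
      _ = (‖σ⁻¹‖ * ‖A t‖) / 2 * (‖Q t‖ * ‖Y t‖) := by norm_num; ring
      _ ≤ 1 * (‖Q t‖ * ‖Y t‖) := by gcongr; linarith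
      _ = _ := one_mul _
  have h4 : ‖(1 / 2 : ℂ) • (A t * (A t * (Y t - V)))‖ ≤
      1 / 2 * (‖A t‖ * (‖A t‖ * (‖Y t‖ + ‖V‖))) := by
    rw [norm_smul]; norm_num
    refine (norm_mul_le _ _).trans ?_
    gcongr
    exact (norm_mul_le _ _).trans (by gcongr; exact norm_sub_le _ _)
  have h5 := norm_mul_le (Q t) (Y t)
  have n1 : 0 ≤ ‖A' t‖ * (‖Y t‖ + ‖V‖) := by positivity
  have n2 : 0 ≤ ‖A t‖ * (‖A t‖ * ‖V‖) := by positivity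
  have n2' : 0 ≤ ‖A t‖ * (‖A t‖ * ‖Y t‖) := by positivity
  have n3 : 0 ≤ ‖Q t‖ * ‖V‖ := by positivity
  calc _ ≤ 1 / 2 * (‖A' t‖ * (‖Y t‖ + ‖V‖)) + ‖A t‖ * (‖A t‖ * ‖Y t‖) +
        (‖Q t‖ * ‖Y t‖ + ‖Q t‖ * ‖Y t‖) + 1 / 2 * (‖A t‖ * (‖A t‖ * (‖Y t‖ + ‖V‖))) := by
        refine (norm_add_le _ _).trans (add_le_add ((norm_add_le _ _).trans (add_le_add
          ((norm_add_le _ _).trans (add_le_add h1 h2)) ?_)) h4)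
        exact (norm_sub_le _ _).trans (add_le_add h5 h3)
    _ ≤ _ := by nlinarith

theorem norm_pertMinus_le {t : ℝ} (h : ‖σ⁻¹‖ * ‖A t‖ ≤ 1) :
    ‖pertMinus A A' Q σ Y Y₁ t‖ ≤ canonicalWeight A A' Q t * solSize σ Y Y₁ t := by
  -- Up to the signs of `A'` and `Y₁` this is the negative of `pertPlus`.
  have h1 : pertMinus A A' Q σ Y Y₁ t =
      -pertPlus A (fun t => -A' t) Q σ Y (fun t => -Y₁ t) t := by
    simp only [pertMinus, pertPlus, smul_neg, sub_neg_eq_add, neg_mul, smul_add, mul_add,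
      smul_neg]
    abel
  have h2 := norm_pertPlus_le (A := A) (A' := fun t => -A' t) (Q := Q) (σ := σ) (Y := Y)
    (Y₁ := fun t => -Y₁ t) h
  rw [h1, norm_neg]
  simpa only [canonicalWeight, solSize, norm_neg, smul_neg] using h2

theorem norm_smul_mul_le {t B : ℝ} (hA : ‖A t‖ ≤ B) (W : 𝒜) :
    ‖(-σ⁻¹ / 2) • (A t * W)‖ ≤ ‖σ⁻¹‖ * B * ‖W‖ / 2 := by
  rw [norm_smul, norm_div, norm_neg]
  have h1 := norm_mul_le (A t) W
  have h2 : ‖(2 : ℂ)‖ = 2 := by norm_num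
  rw [h2]
  calc _ ≤ ‖σ⁻¹‖ / 2 * (B * ‖W‖) := by
        gcongr
        exact h1.trans (by gcongr)
    _ = _ := by ring

/-- The solution is recovered from its amplitudes up to `O(1/σ)`. -/
theorem norm_sub_amp_le (hT : Transport A Pp Pm Rp Rm C) {B t : ℝ} (ht : 0 ≤ t)
    (hA : ‖A t‖ ≤ B) :
    ‖Y t - (Pm t * ampPlus A Rp σ Y Y₁ t + Pp t * ampMinus A Rm σ Y Y₁ t)‖ ≤
      ‖σ⁻¹‖ * B * ‖Y t‖ / 2 ∧
    ‖σ⁻¹ • Y₁ t - (Pm t * ampPlus A Rp σ Y Y₁ t - Pp t * ampMinus A Rm σ Y Y₁ t)‖ ≤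
      ‖σ⁻¹‖ * B * ‖σ⁻¹ • Y₁ t‖ / 2 := by
  have h1 := norm_smul_mul_le (σ := σ) hA (Y t)
  have h2 := norm_smul_mul_le (σ := σ) hA (σ⁻¹ • Y₁ t)
  constructor
  · convert h1 using 1
    rw [ampPlus, ampMinus, ← mul_assoc, ← mul_assoc, hT.Pm_mul_Rp t ht, hT.Pp_mul_Rm t ht, one_mul,
      one_mul, ← norm_neg]
    congr 1
    module
  · convert h2 using 1
    rw [ampPlus, ampMinus, ← mul_assoc, ← mul_assoc, hT.Pm_mul_Rp t ht, hT.Pp_mul_Rm t ht, one_mul,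
      one_mul]
    congr 1
    module

theorem norm_amp_le (hT : Transport A Pp Pm Rp Rm C) {B t : ℝ} (ht : 0 ≤ t)
    (hB : ‖σ⁻¹‖ * B ≤ 1) (hA : ‖A t‖ ≤ B) :
    ‖ampPlus A Rp σ Y Y₁ t‖ ≤ C * solSize σ Y Y₁ t ∧
      ‖ampMinus A Rm σ Y Y₁ t‖ ≤ C * solSize σ Y Y₁ t := by
  have h1 := norm_smul_mul_le (σ := σ) hA (Y t)
  have h2 := norm_smul_mul_le (σ := σ) hA (σ⁻¹ • Y₁ t)
  have h0 : 0 ≤ C := (norm_nonneg _).trans (hT.norm_le t ht).1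
  have e1 : ‖σ⁻¹‖ * B * ‖Y t‖ / 2 ≤ ‖Y t‖ := by nlinarith [norm_nonneg (Y t)]
  have e2 : ‖σ⁻¹‖ * B * ‖σ⁻¹ • Y₁ t‖ / 2 ≤ ‖σ⁻¹ • Y₁ t‖ := by nlinarith [norm_nonneg (σ⁻¹ • Y₁ t)]
  have h3 : ‖Y t + (-σ⁻¹ / 2) • (A t * Y t)‖ ≤ 2 * ‖Y t‖ := by
    linarith [norm_add_le (Y t) ((-σ⁻¹ / 2) • (A t * Y t))]
  have h4 : ‖σ⁻¹ • Y₁ t - (-σ⁻¹ / 2) • (A t * σ⁻¹ • Y₁ t)‖ ≤ 2 * ‖σ⁻¹ • Y₁ t‖ := by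
    linarith [norm_sub_le (σ⁻¹ • Y₁ t) ((-σ⁻¹ / 2) • (A t * σ⁻¹ • Y₁ t))]
  have half : ∀ W : 𝒜, ‖(1 / 2 : ℂ) • W‖ = ‖W‖ / 2 := fun W => by
    rw [norm_smul]; norm_num; ring
  unfold ampPlus ampMinus solSize
  constructor
  · refine (norm_mul_le _ _).trans ?_
    gcongr
    · exact (hT.norm_le t ht).2.2.1
    · rw [half]
      linarith [norm_add_le (Y t + (-σ⁻¹ / 2) • (A t * Y t))
        (σ⁻¹ • Y₁ t - (-σ⁻¹ / 2) • (A t * σ⁻¹ • Y₁ t))]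
  · refine (norm_mul_le _ _).trans ?_
    gcongr
    · exact (hT.norm_le t ht).2.2.2
    · rw [half]
      linarith [norm_sub_le (Y t + (-σ⁻¹ / 2) • (A t * Y t))
        (σ⁻¹ • Y₁ t - (-σ⁻¹ / 2) • (A t * σ⁻¹ • Y₁ t))]

theorem solSize_le_amp (hT : Transport A Pp Pm Rp Rm C) {B t : ℝ} (ht : 0 ≤ t)
    (hB : ‖σ⁻¹‖ * B ≤ 1) (hA : ‖A t‖ ≤ B) :
    solSize σ Y Y₁ t ≤ 4 * C * (‖ampPlus A Rp σ Y Y₁ t‖ + ‖ampMinus A Rm σ Y Y₁ t‖) := by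
  obtain ⟨h1, h2⟩ := norm_sub_amp_le (σ := σ) (Y := Y) (Y₁ := Y₁) hT ht hA
  have h0 : 0 ≤ C := (norm_nonneg _).trans (hT.norm_le t ht).1
  set a := ampPlus A Rp σ Y Y₁ t
  set b := ampMinus A Rm σ Y Y₁ t
  have e1 : ‖σ⁻¹‖ * B * ‖Y t‖ / 2 ≤ ‖Y t‖ / 2 := by nlinarith [norm_nonneg (Y t)]
  have e2 : ‖σ⁻¹‖ * B * ‖σ⁻¹ • Y₁ t‖ / 2 ≤ ‖σ⁻¹ • Y₁ t‖ / 2 := by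
    nlinarith [norm_nonneg (σ⁻¹ • Y₁ t)]
  have h3 : ‖Pm t * a‖ ≤ C * ‖a‖ := (norm_mul_le _ _).trans (by
    gcongr; exact (hT.norm_le t ht).2.1)
  have h4 : ‖Pp t * b‖ ≤ C * ‖b‖ := (norm_mul_le _ _).trans (by
    gcongr; exact (hT.norm_le t ht).1)
  have h5 := norm_sub_norm_le (Y t) (Pm t * a + Pp t * b)
  have h6 := norm_sub_norm_le (σ⁻¹ • Y₁ t) (Pm t * a - Pp t * b)
  have h7 := norm_add_le (Pm t * a) (Pp t * b)
  have h8 := norm_sub_le (Pm t * a) (Pp t * b)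
  unfold solSize
  linarith

theorem norm_cexp_mul_ofReal (c : ℂ) (t : ℝ) :
    ‖Complex.exp (c * t)‖ = Real.exp (c.re * t) := by
  rw [Complex.norm_exp]; simp

/-- Removing the exponential factor (Duhamel's formula). -/
theorem IsPrim.cexp_smul {F : Type*} [NormedAddCommGroup F] [NormedSpace ℂ F] [CompleteSpace F]
    {a f : ℝ → F} {c : ℂ} (h : IsPrim a fun t => c • a t + f t) :
    IsPrim (fun t => Complex.exp (-c * t) • a t) fun t => Complex.exp (-c * t) • f t := by
  refine ((isPrim_cexp (-c)).fun_smul h).congr (fun _ _ => rfl) fun t _ => ?_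
  module

theorem IsSol.continuousOn_solSize (hY : IsSol A Q σ Y Y₁) :
    ContinuousOn (solSize σ Y Y₁) (Ici 0) :=
  hY.fst.continuousOn.norm.add (hY.snd.continuousOn.const_smul σ⁻¹).norm

/-- The amplitudes of an arbitrary solution for large `σ` in the left half-plane. -/
theorem exists_amp_bound (hA : IntegrableCoeff A A' Q) (hT : Transport A Pp Pm Rp Rm C) :
    ∃ s₀ D : ℝ, 0 < s₀ ∧ 0 ≤ D ∧ ∀ σ : ℂ, σ.re ≤ 0 → s₀ ≤ ‖σ‖ → ∀ Y Y₁ : ℝ → 𝒜,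
      IsSol A Q σ Y Y₁ → ∀ x : ℝ, 0 ≤ x →
      solSize σ Y Y₁ x ≤ D * Real.exp (-σ.re * x) * solSize σ Y Y₁ 0 ∧
      ‖Complex.exp (σ * x) • ampPlus A Rp σ Y Y₁ x -
        Complex.exp (2 * σ * x) • ampPlus A Rp σ Y Y₁ 0‖ ≤ D * ‖σ⁻¹‖ * solSize σ Y Y₁ 0 ∧
      ‖Complex.exp (σ * x) • ampMinus A Rm σ Y Y₁ x - ampMinus A Rm σ Y Y₁ 0‖ ≤
        D * ‖σ⁻¹‖ * solSize σ Y Y₁ 0 := by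
  obtain ⟨B, hB0, hB⟩ := hA.exists_bound
  have hC0 : 0 ≤ C := (norm_nonneg _).trans (hT.norm_le 0 le_rfl).1
  set κ := canonicalWeight A A' Q
  have hκ : IntegrableOn κ (Ioi 0) := hA.integrable_weight
  have hκ0 : ∀ t, 0 ≤ κ t := canonicalWeight_nonneg A A' Q
  set k1 := ∫ t in Ioi 0, κ t
  have hk1 : 0 ≤ k1 := integral_nonneg hκ0
  set D := max (16 * C ^ 2) (16 * C ^ 2 * (C * k1))
  have hD : 0 ≤ D := le_max_of_le_left (by positivity)
  refine ⟨B + 16 * C ^ 2 * k1 + 1, D, by positivity, hD, fun σ hre hσ Y Y₁ hY x hx => ?_⟩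
  have hσ0 : 0 < ‖σ‖ := lt_of_lt_of_le (by positivity) hσ
  have hne : σ ≠ 0 := norm_pos_iff.1 hσ0
  have hs : ‖σ⁻¹‖ * ‖σ‖ = 1 := by rw [norm_inv]; field_simp
  have hi0 : 0 ≤ ‖σ⁻¹‖ := norm_nonneg _
  have hBs : ‖σ⁻¹‖ * B ≤ 1 := by
    have : 0 ≤ 16 * C ^ 2 * k1 := by positivity
    rw [← hs]; gcongr; linarith
  have hKs : ‖σ⁻¹‖ * (16 * C ^ 2 * k1) ≤ 1 := by
    rw [← hs]; gcongr; linarith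
  set τ := -σ.re
  have hτ : 0 ≤ τ := by simp [τ]; exact hre
  set a := ampPlus A Rp σ Y Y₁
  set b := ampMinus A Rm σ Y Y₁
  -- `N` is the largest size of the solution on `[0, x]`, relative to its expected growth.
  set g : ℝ → ℝ := fun t => Real.exp (-τ * t) * solSize σ Y Y₁ t
  obtain ⟨t₀, ht₀, hmax⟩ := isCompact_Icc.exists_isMaxOn (nonempty_Icc.2 hx)
    (f := g) (((Continuous.continuousOn (by fun_prop)).mul (hY.continuousOn_solSize.mono
      fun t ht => ht.1)))
  set N := g t₀
  have hN : ∀ t ∈ Icc 0 x, solSize σ Y Y₁ t ≤ N * Real.exp (τ * t) := fun t ht => by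
    have : g t ≤ N := hmax ht
    calc solSize σ Y Y₁ t = g t * Real.exp (τ * t) := by
          simp only [g]; rw [mul_right_comm, ← Real.exp_add]; simp
      _ ≤ _ := by gcongr
  have hN0 : 0 ≤ N := mul_nonneg (Real.exp_pos _).le (solSize_nonneg _ _ _ _)
  have hε : ‖-σ⁻¹ / 2‖ = ‖σ⁻¹‖ / 2 := by rw [norm_div, norm_neg]; norm_num
  have hf1 : ∀ t ∈ Icc 0 x, ‖(-σ⁻¹ / 2) • (Rp t * pertPlus A A' Q σ Y Y₁ t)‖ ≤
      ‖σ⁻¹‖ * C * N * κ t * Real.exp (τ * t) := by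
    intro t ht
    have h1 := norm_pertPlus_le (A' := A') (Q := Q) (Y := Y) (Y₁ := Y₁) (σ := σ) (t := t)
      ((mul_le_mul_of_nonneg_left (hB t ht.1) hi0).trans hBs)
    rw [norm_smul, hε]
    calc ‖σ⁻¹‖ / 2 * ‖Rp t * pertPlus A A' Q σ Y Y₁ t‖
        ≤ ‖σ⁻¹‖ * (C * (κ t * (N * Real.exp (τ * t)))) := by
          gcongr
          · linarith
          · refine (norm_mul_le _ _).trans ?_
            gcongr
            · exact (hT.norm_le t ht.1).2.2.1
            · exact h1.trans (by gcongr; exacts [hκ0 t, hN t ht])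
      _ = _ := by ring
  have hf2 : ∀ t ∈ Icc 0 x, ‖(-σ⁻¹ / 2) • (Rm t * pertMinus A A' Q σ Y Y₁ t)‖ ≤
      ‖σ⁻¹‖ * C * N * κ t * Real.exp (τ * t) := by
    intro t ht
    have h1 := norm_pertMinus_le (A' := A') (Q := Q) (Y := Y) (Y₁ := Y₁) (σ := σ) (t := t)
      ((mul_le_mul_of_nonneg_left (hB t ht.1) hi0).trans hBs)
    rw [norm_smul, hε]
    calc ‖σ⁻¹‖ / 2 * ‖Rm t * pertMinus A A' Q σ Y Y₁ t‖
        ≤ ‖σ⁻¹‖ * (C * (κ t * (N * Real.exp (τ * t)))) := by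
          gcongr
          · linarith
          · refine (norm_mul_le _ _).trans ?_
            gcongr
            · exact (hT.norm_le t ht.1).2.2.2
            · exact h1.trans (by gcongr; exacts [hκ0 t, hN t ht])
      _ = _ := by ring
  have ha := (isPrim_ampPlus hA hT hne hY).cexp_smul
  have hb := (isPrim_ampMinus hA hT hne hY).cexp_smul
  have hNN : 0 ≤ ‖σ⁻¹‖ * C * N := by positivity
  -- The deviations of the amplitudes.
  have dev1 : ∀ t ∈ Icc 0 x, ‖Complex.exp (σ * t) • a t - Complex.exp (2 * σ * t) • a 0‖ ≤
      ‖σ⁻¹‖ * C * N * k1 := by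
    intro t ht
    have h1 := ha.norm_sub_le_of_le hκ hκ0 (B := ‖σ⁻¹‖ * C * N * Real.exp (2 * τ * t))
      (by positivity) le_rfl ht.1 fun s hs => by
        rw [norm_smul, norm_cexp_mul_ofReal]
        calc _ ≤ Real.exp ((-σ).re * s) * (‖σ⁻¹‖ * C * N * κ s * Real.exp (τ * s)) := by
              gcongr; exact hf1 s ⟨hs.1, hs.2.trans ht.2⟩
          _ = ‖σ⁻¹‖ * C * N * κ s * Real.exp (2 * τ * s) := by
              rw [mul_left_comm, ← Real.exp_add]; simp only [Complex.neg_re, τ]; ring_nf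
          _ ≤ ‖σ⁻¹‖ * C * N * κ s * Real.exp (2 * τ * t) := by
              have := hκ0 s
              gcongr
              exact hs.2
          _ = _ := by ring
    have h2 : Complex.exp (σ * t) • a t - Complex.exp (2 * σ * t) • a 0 = Complex.exp (2 * σ * t) •
        (Complex.exp (-σ * t) • a t - Complex.exp (-σ * (0 : ℝ)) • a 0) := by
      rw [smul_sub, smul_smul, smul_smul, ← Complex.exp_add, ← Complex.exp_add]
      congr 3 <;> push_cast <;> ring_nf
    rw [h2, norm_smul, norm_cexp_mul_ofReal]
    calc _ ≤ Real.exp ((2 * σ).re * t) * (‖σ⁻¹‖ * C * N * Real.exp (2 * τ * t) * k1) := by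
          gcongr
      _ = ‖σ⁻¹‖ * C * N * k1 * (Real.exp ((2 * σ).re * t) * Real.exp (2 * τ * t)) := by ring
      _ = _ := by rw [← Real.exp_add]; simp [τ]
  have dev2 : ∀ t ∈ Icc 0 x, ‖Complex.exp (σ * t) • b t - b 0‖ ≤ ‖σ⁻¹‖ * C * N * k1 := by
    intro t ht
    have h1 := hb.norm_sub_le_of_le hκ hκ0 (B := ‖σ⁻¹‖ * C * N) hNN le_rfl ht.1 fun s hs => by
      rw [norm_smul, norm_cexp_mul_ofReal]
      calc _ ≤ Real.exp ((- -σ).re * s) * (‖σ⁻¹‖ * C * N * κ s * Real.exp (τ * s)) := by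
            gcongr; exact hf2 s ⟨hs.1, hs.2.trans ht.2⟩
        _ = ‖σ⁻¹‖ * C * N * κ s := by
            rw [mul_left_comm, ← Real.exp_add]; simp [τ]
    simpa using h1
  have hn0 : ‖a 0‖ ≤ C * solSize σ Y Y₁ 0 ∧ ‖b 0‖ ≤ C * solSize σ Y Y₁ 0 :=
    norm_amp_le hT le_rfl hBs (hB 0 le_rfl)
  have hNle : N ≤ 16 * C ^ 2 * solSize σ Y Y₁ 0 := by
    have h1 := dev1 t₀ ht₀
    have h2 := dev2 t₀ ht₀
    have h3 := solSize_le_amp (Y := Y) (Y₁ := Y₁) hT ht₀.1 hBs (hB t₀ ht₀.1)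
    have h4 : ‖Complex.exp (2 * σ * t₀) • a 0‖ ≤ ‖a 0‖ := by
      rw [norm_smul, norm_cexp_mul_ofReal]
      have : Real.exp ((2 * σ).re * t₀) ≤ 1 := by
        rw [Real.exp_le_one_iff]; simp; nlinarith [ht₀.1]
      nlinarith [norm_nonneg (a 0)]
    have h5 : Real.exp (-τ * t₀) * ‖a t₀‖ ≤ ‖a 0‖ + ‖σ⁻¹‖ * C * N * k1 := by
      have : ‖Complex.exp (σ * t₀) • a t₀‖ = Real.exp (-τ * t₀) * ‖a t₀‖ := by
        rw [norm_smul, norm_cexp_mul_ofReal]; simp [τ]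
      rw [← this]
      linarith [norm_sub_norm_le (Complex.exp (σ * t₀) • a t₀) (Complex.exp (2 * σ * t₀) • a 0)]
    have h6 : Real.exp (-τ * t₀) * ‖b t₀‖ ≤ ‖b 0‖ + ‖σ⁻¹‖ * C * N * k1 := by
      have : ‖Complex.exp (σ * t₀) • b t₀‖ = Real.exp (-τ * t₀) * ‖b t₀‖ := by
        rw [norm_smul, norm_cexp_mul_ofReal]; simp [τ]
      rw [← this]
      linarith [norm_sub_norm_le (Complex.exp (σ * t₀) • b t₀) (b 0)]
    have h7 : N ≤ 4 * C * (Real.exp (-τ * t₀) * ‖a t₀‖ + Real.exp (-τ * t₀) * ‖b t₀‖) := by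
      calc N = Real.exp (-τ * t₀) * solSize σ Y Y₁ t₀ := rfl
        _ ≤ Real.exp (-τ * t₀) * (4 * C * (‖a t₀‖ + ‖b t₀‖)) := by gcongr
        _ = _ := by ring
    have h8 : N ≤ 4 * C * (2 * (C * solSize σ Y Y₁ 0) + 2 * (‖σ⁻¹‖ * C * N * k1)) :=
      h7.trans (mul_le_mul_of_nonneg_left (by linarith [hn0.1, hn0.2]) (by positivity))
    have h9 : ‖σ⁻¹‖ * (16 * C ^ 2 * k1) * N ≤ N := mul_le_of_le_one_left hN0 hKs
    linarith
  have hfin : ‖σ⁻¹‖ * C * N * k1 ≤ D * ‖σ⁻¹‖ * solSize σ Y Y₁ 0 := by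
    calc ‖σ⁻¹‖ * C * N * k1 ≤ ‖σ⁻¹‖ * C * (16 * C ^ 2 * solSize σ Y Y₁ 0) * k1 := by gcongr
      _ = 16 * C ^ 2 * (C * k1) * (‖σ⁻¹‖ * solSize σ Y Y₁ 0) := by ring
      _ ≤ D * (‖σ⁻¹‖ * solSize σ Y Y₁ 0) := by
          have := solSize_nonneg σ Y Y₁ 0
          gcongr
          exact le_max_right _ _
      _ = _ := by ring
  refine ⟨?_, (dev1 x ⟨hx, le_rfl⟩).trans hfin, (dev2 x ⟨hx, le_rfl⟩).trans hfin⟩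
  calc solSize σ Y Y₁ x ≤ N * Real.exp (τ * x) := hN x ⟨hx, le_rfl⟩
    _ ≤ D * solSize σ Y Y₁ 0 * Real.exp (τ * x) := by
        have := solSize_nonneg σ Y Y₁ 0
        gcongr
        exact hNle.trans (by gcongr; exact le_max_left _ _)
    _ = _ := by ring

/-- The initial amplitudes are `(Y(0) ± σ⁻¹ Y'(0)) / 2` up to an error of order `1 / |σ|` relative
to the size of the initial values. -/
theorem norm_ampPlus_zero_sub_le (hT : Transport A Pp Pm Rp Rm C) {B : ℝ} (hA : ‖A 0‖ ≤ B) :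
    ‖ampPlus A Rp σ Y Y₁ 0 - (1 / 2 : ℂ) • (Y 0 + σ⁻¹ • Y₁ 0)‖ ≤
        ‖σ⁻¹‖ * B * solSize σ Y Y₁ 0 ∧
      ‖ampMinus A Rm σ Y Y₁ 0 - (1 / 2 : ℂ) • (Y 0 - σ⁻¹ • Y₁ 0)‖ ≤
        ‖σ⁻¹‖ * B * solSize σ Y Y₁ 0 := by
  have h1 := norm_smul_mul_le (σ := σ) hA (Y 0)
  have h2 := norm_smul_mul_le (σ := σ) hA (σ⁻¹ • Y₁ 0)
  have half : ∀ W : 𝒜, ‖(1 / 2 : ℂ) • W‖ = ‖W‖ / 2 := fun W => by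
    rw [norm_smul]; norm_num; ring
  have hB : 0 ≤ B := (norm_nonneg _).trans hA
  have n1 : 0 ≤ ‖σ⁻¹‖ * B * ‖Y 0‖ := by positivity
  have n2 : 0 ≤ ‖σ⁻¹‖ * B * ‖σ⁻¹ • Y₁ 0‖ := by positivity
  set X := (-σ⁻¹ / 2) • (A 0 * Y 0)
  set Z := (-σ⁻¹ / 2) • (A 0 * σ⁻¹ • Y₁ 0)
  constructor
  · have : ampPlus A Rp σ Y Y₁ 0 - (1 / 2 : ℂ) • (Y 0 + σ⁻¹ • Y₁ 0) = (1 / 2 : ℂ) • (X - Z) := by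
      rw [ampPlus, hT.Rp_zero, one_mul]
      module
    rw [this, half, solSize]
    linarith [norm_sub_le X Z]
  · have : ampMinus A Rm σ Y Y₁ 0 - (1 / 2 : ℂ) • (Y 0 - σ⁻¹ • Y₁ 0) = (1 / 2 : ℂ) • (X + Z) := by
      rw [ampMinus, hT.Rm_zero, one_mul]
      module
    rw [this, half, solSize]
    linarith [norm_add_le X Z]

/-- Asymptotics of solutions with given initial values, uniformly for large `σ` in the closed left
half-plane. -/
theorem exists_solution_asymptotics (hA : IntegrableCoeff A A' Q)
    (hT : Transport A Pp Pm Rp Rm C) :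
    ∃ s₀ D : ℝ, 0 < s₀ ∧ 0 ≤ D ∧ ∀ σ : ℂ, σ.re ≤ 0 → s₀ ≤ ‖σ‖ → ∀ Y Y₁ : ℝ → 𝒜,
      IsSol A Q σ Y Y₁ → ∀ x : ℝ, 0 ≤ x →
      solSize σ Y Y₁ x ≤ D * Real.exp (-σ.re * x) * solSize σ Y Y₁ 0 ∧
      ‖Complex.exp (σ * x) • Y x - (1 / 2 : ℂ) • (Complex.exp (2 * σ * x) •
        (Pm x * (Y 0 + σ⁻¹ • Y₁ 0)) + Pp x * (Y 0 - σ⁻¹ • Y₁ 0))‖ ≤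
          D * ‖σ⁻¹‖ * solSize σ Y Y₁ 0 ∧
      ‖Complex.exp (σ * x) • σ⁻¹ • Y₁ x - (1 / 2 : ℂ) • (Complex.exp (2 * σ * x) •
        (Pm x * (Y 0 + σ⁻¹ • Y₁ 0)) - Pp x * (Y 0 - σ⁻¹ • Y₁ 0))‖ ≤
          D * ‖σ⁻¹‖ * solSize σ Y Y₁ 0 := by
  obtain ⟨B, hB0, hB⟩ := hA.exists_bound
  have hC0 : 0 ≤ C := (norm_nonneg _).trans (hT.norm_le 0 le_rfl).1
  obtain ⟨s₀, D, hs₀, hD, h⟩ := exists_amp_bound hA hT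
  have hDm : D ≤ D + (B * D + 2 * C * D + 2 * C * B) := by
    have : 0 ≤ B * D + 2 * C * D + 2 * C * B := by positivity
    linarith
  refine ⟨s₀ + B, D + (B * D + 2 * C * D + 2 * C * B), by positivity, by positivity,
    fun σ hre hσ Y Y₁ hY x hx => ?_⟩
  obtain ⟨h1, h2, h3⟩ := h σ hre (by linarith) Y Y₁ hY x hx
  set n := solSize σ Y Y₁ 0
  have hn : 0 ≤ n := solSize_nonneg _ _ _ _
  have hσ0 : 0 < ‖σ‖ := lt_of_lt_of_le (by positivity) hσ
  have hs : ‖σ⁻¹‖ * ‖σ‖ = 1 := by rw [norm_inv]; field_simp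
  have hi0 : 0 ≤ ‖σ⁻¹‖ := norm_nonneg _
  have hBs : ‖σ⁻¹‖ * B ≤ 1 := by
    rw [← hs]; gcongr; linarith
  obtain ⟨h4, h5⟩ := norm_sub_amp_le (σ := σ) (Y := Y) (Y₁ := Y₁) hT hx (hB x hx)
  obtain ⟨h6, h7⟩ := norm_ampPlus_zero_sub_le (σ := σ) (Y := Y) (Y₁ := Y₁) hT (hB 0 le_rfl)
  set a := ampPlus A Rp σ Y Y₁
  set b := ampMinus A Rm σ Y Y₁
  have hPp := (hT.norm_le x hx).1
  have hPm := (hT.norm_le x hx).2.1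
  -- The solution is expressed by its amplitudes at `x`, these are replaced by the initial
  -- amplitudes, and the latter by the initial values.
  have e1 : ‖Pm x * (Complex.exp (σ * x) • a x - Complex.exp (2 * σ * x) • a 0)‖ ≤
      C * (D * ‖σ⁻¹‖ * n) := (norm_mul_le _ _).trans (by gcongr)
  have e2 : ‖Pp x * (Complex.exp (σ * x) • b x - b 0)‖ ≤ C * (D * ‖σ⁻¹‖ * n) :=
    (norm_mul_le _ _).trans (by gcongr)
  have hexp : ‖Complex.exp (2 * σ * x)‖ ≤ 1 := by
    rw [norm_cexp_mul_ofReal, Real.exp_le_one_iff]; simp; nlinarith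
  have e3 : ‖Complex.exp (2 * σ * x) • (Pm x * (a 0 - (1 / 2 : ℂ) • (Y 0 + σ⁻¹ • Y₁ 0)))‖ ≤
      C * (‖σ⁻¹‖ * B * n) := by
    rw [norm_smul]
    calc _ ≤ 1 * (C * (‖σ⁻¹‖ * B * n)) := by
          gcongr
          exact (norm_mul_le _ _).trans (by gcongr)
      _ = _ := one_mul _
  have e4 : ‖Pp x * (b 0 - (1 / 2 : ℂ) • (Y 0 - σ⁻¹ • Y₁ 0))‖ ≤ C * (‖σ⁻¹‖ * B * n) :=
    (norm_mul_le _ _).trans (by gcongr)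
  have size : ∀ W : 𝒜, ‖W‖ ≤ solSize σ Y Y₁ x → Real.exp (σ.re * x) * (‖σ⁻¹‖ * B * ‖W‖ / 2) ≤
      ‖σ⁻¹‖ * B * D * n := by
    intro W hW
    calc Real.exp (σ.re * x) * (‖σ⁻¹‖ * B * ‖W‖ / 2)
        ≤ Real.exp (σ.re * x) * (‖σ⁻¹‖ * B * (D * Real.exp (-σ.re * x) * n)) := by
          gcongr
          have := hW.trans h1
          have h0 : 0 ≤ ‖σ⁻¹‖ * B := by positivity
          nlinarith [mul_le_mul_of_nonneg_left this h0, mul_nonneg h0 (norm_nonneg W)]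
      _ = ‖σ⁻¹‖ * B * D * n * (Real.exp (σ.re * x) * Real.exp (-σ.re * x)) := by ring
      _ = _ := by rw [← Real.exp_add]; simp
  refine ⟨h1.trans (by gcongr), ?_, ?_⟩
  · have e5 : ‖Complex.exp (σ * x) • (Y x - (Pm x * a x + Pp x * b x))‖ ≤ ‖σ⁻¹‖ * B * D * n := by
      rw [norm_smul, norm_cexp_mul_ofReal]
      exact (mul_le_mul_of_nonneg_left h4 (Real.exp_pos _).le).trans
        (size _ (le_add_of_nonneg_right (norm_nonneg _)))
    have e6 : Complex.exp (σ * x) • Y x - (1 / 2 : ℂ) • (Complex.exp (2 * σ * x) •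
        (Pm x * (Y 0 + σ⁻¹ • Y₁ 0)) + Pp x * (Y 0 - σ⁻¹ • Y₁ 0)) =
        Complex.exp (σ * x) • (Y x - (Pm x * a x + Pp x * b x)) +
        Pm x * (Complex.exp (σ * x) • a x - Complex.exp (2 * σ * x) • a 0) +
        Pp x * (Complex.exp (σ * x) • b x - b 0) +
        Complex.exp (2 * σ * x) • (Pm x * (a 0 - (1 / 2 : ℂ) • (Y 0 + σ⁻¹ • Y₁ 0))) +
        Pp x * (b 0 - (1 / 2 : ℂ) • (Y 0 - σ⁻¹ • Y₁ 0)) := by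
      simp only [mul_sub, mul_add, mul_smul_comm]
      module
    rw [e6]
    refine (norm_add_le _ _).trans ((add_le_add ((norm_add_le _ _).trans (add_le_add
      ((norm_add_le _ _).trans (add_le_add ((norm_add_le _ _).trans (add_le_add e5 e1)) e2)) e3))
      e4).trans ?_)
    have : 0 ≤ D * ‖σ⁻¹‖ * n := by positivity
    linarith
  · have e5 : ‖Complex.exp (σ * x) • (σ⁻¹ • Y₁ x - (Pm x * a x - Pp x * b x))‖ ≤
        ‖σ⁻¹‖ * B * D * n := by
      rw [norm_smul, norm_cexp_mul_ofReal]
      exact (mul_le_mul_of_nonneg_left h5 (Real.exp_pos _).le).trans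
        (size _ (le_add_of_nonneg_left (norm_nonneg _)))
    have e6 : Complex.exp (σ * x) • σ⁻¹ • Y₁ x - (1 / 2 : ℂ) • (Complex.exp (2 * σ * x) •
        (Pm x * (Y 0 + σ⁻¹ • Y₁ 0)) - Pp x * (Y 0 - σ⁻¹ • Y₁ 0)) =
        Complex.exp (σ * x) • (σ⁻¹ • Y₁ x - (Pm x * a x - Pp x * b x)) +
        Pm x * (Complex.exp (σ * x) • a x - Complex.exp (2 * σ * x) • a 0) -
        Pp x * (Complex.exp (σ * x) • b x - b 0) +
        Complex.exp (2 * σ * x) • (Pm x * (a 0 - (1 / 2 : ℂ) • (Y 0 + σ⁻¹ • Y₁ 0))) -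
        Pp x * (b 0 - (1 / 2 : ℂ) • (Y 0 - σ⁻¹ • Y₁ 0)) := by
      simp only [mul_sub, mul_add, mul_smul_comm]
      module
    rw [e6]
    refine (norm_sub_le _ _).trans ((add_le_add ((norm_add_le _ _).trans (add_le_add
      ((norm_sub_le _ _).trans (add_le_add ((norm_add_le _ _).trans (add_le_add e5 e1)) e2)) e3))
      e4).trans ?_)
    have : 0 ≤ D * ‖σ⁻¹‖ * n := by positivity
    linarith

/-- Asymptotics of the decaying solutions, uniformly for large `σ` in the open left half-plane. No
construction of decaying solutions is involved: these are a priori estimates. -/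
theorem exists_decaying_asymptotics (hA : IntegrableCoeff A A' Q)
    (hT : Transport A Pp Pm Rp Rm C) :
    ∃ s₀ D : ℝ, 0 < s₀ ∧ 0 ≤ D ∧ ∀ σ : ℂ, σ.re < 0 → s₀ ≤ ‖σ‖ → ∀ Y Y₁ : ℝ → 𝒜,
      IsSol A Q σ Y Y₁ → (∃ M, ∀ x : ℝ, 0 ≤ x → Real.exp (-σ.re * x) * solSize σ Y Y₁ x ≤ M) →
      ∀ x : ℝ, 0 ≤ x →
      ‖Complex.exp (-σ * x) • Y x - (1 / 2 : ℂ) • (Pm x * (Y 0 + σ⁻¹ • Y₁ 0))‖ ≤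
          D * ‖σ⁻¹‖ * solSize σ Y Y₁ 0 ∧
      ‖Complex.exp (-σ * x) • σ⁻¹ • Y₁ x - (1 / 2 : ℂ) • (Pm x * (Y 0 + σ⁻¹ • Y₁ 0))‖ ≤
          D * ‖σ⁻¹‖ * solSize σ Y Y₁ 0 := by
  obtain ⟨B, hB0, hB⟩ := hA.exists_bound
  have hC0 : 0 ≤ C := (norm_nonneg _).trans (hT.norm_le 0 le_rfl).1
  set κ := canonicalWeight A A' Q
  have hκ : IntegrableOn κ (Ioi 0) := hA.integrable_weight
  have hκ0 : ∀ t, 0 ≤ κ t := canonicalWeight_nonneg A A' Q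
  set k1 := ∫ t in Ioi 0, κ t
  have hk1 : 0 ≤ k1 := integral_nonneg hκ0
  set D := 8 * C ^ 2 * (B + 2 * C ^ 2 * k1) + C * B
  refine ⟨B + 16 * C ^ 2 * k1 + 1, D, by positivity, by positivity,
    fun σ hre hσ Y Y₁ hY hbdd x hx => ?_⟩
  have hσ0 : 0 < ‖σ‖ := lt_of_lt_of_le (by positivity) hσ
  have hne : σ ≠ 0 := norm_pos_iff.1 hσ0
  have hs : ‖σ⁻¹‖ * ‖σ‖ = 1 := by rw [norm_inv]; field_simp
  have hi0 : 0 ≤ ‖σ⁻¹‖ := norm_nonneg _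
  have hBs : ‖σ⁻¹‖ * B ≤ 1 := by
    have : 0 ≤ 16 * C ^ 2 * k1 := by positivity
    rw [← hs]; gcongr; linarith
  have hKs : ‖σ⁻¹‖ * (16 * C ^ 2 * k1) ≤ 1 := by
    rw [← hs]; gcongr; linarith
  set τ := -σ.re
  have hτ : 0 < τ := by simp [τ]; exact hre
  set a := ampPlus A Rp σ Y Y₁
  set b := ampMinus A Rm σ Y Y₁
  -- `N` is the least upper bound of the relative size of the solution on the half-line.
  set g : ℝ → ℝ := fun t => Real.exp (τ * t) * solSize σ Y Y₁ t
  set N := sSup (g '' Ici 0)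
  have hBA : BddAbove (g '' Ici 0) := by
    obtain ⟨M, hM⟩ := hbdd
    exact ⟨M, by rintro _ ⟨t, ht, rfl⟩; exact hM t ht⟩
  have hN : ∀ t, 0 ≤ t → solSize σ Y Y₁ t ≤ N * Real.exp (-τ * t) := fun t ht => by
    have : g t ≤ N := le_csSup hBA ⟨t, ht, rfl⟩
    calc solSize σ Y Y₁ t = g t * Real.exp (-τ * t) := by
          simp only [g]; rw [mul_right_comm, ← Real.exp_add]; simp
      _ ≤ _ := by gcongr
  have hN0 : 0 ≤ N := (mul_nonneg (Real.exp_pos _).le (solSize_nonneg _ _ _ _)).trans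
    (le_csSup hBA ⟨0, mem_Ici.2 le_rfl, rfl⟩)
  have hε : ‖-σ⁻¹ / 2‖ = ‖σ⁻¹‖ / 2 := by rw [norm_div, norm_neg]; norm_num
  have hf1 : ∀ t, 0 ≤ t → ‖(-σ⁻¹ / 2) • (Rp t * pertPlus A A' Q σ Y Y₁ t)‖ ≤
      ‖σ⁻¹‖ * C * N * κ t * Real.exp (-τ * t) := by
    intro t ht
    have h1 := norm_pertPlus_le (A' := A') (Q := Q) (Y := Y) (Y₁ := Y₁) (σ := σ) (t := t)
      ((mul_le_mul_of_nonneg_left (hB t ht) hi0).trans hBs)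
    rw [norm_smul, hε]
    calc ‖σ⁻¹‖ / 2 * ‖Rp t * pertPlus A A' Q σ Y Y₁ t‖
        ≤ ‖σ⁻¹‖ * (C * (κ t * (N * Real.exp (-τ * t)))) := by
          gcongr
          · linarith
          · refine (norm_mul_le _ _).trans ?_
            gcongr
            · exact (hT.norm_le t ht).2.2.1
            · exact h1.trans (by gcongr; exacts [hκ0 t, hN t ht])
      _ = _ := by ring
  have hf2 : ∀ t, 0 ≤ t → ‖(-σ⁻¹ / 2) • (Rm t * pertMinus A A' Q σ Y Y₁ t)‖ ≤
      ‖σ⁻¹‖ * C * N * κ t * Real.exp (-τ * t) := by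
    intro t ht
    have h1 := norm_pertMinus_le (A' := A') (Q := Q) (Y := Y) (Y₁ := Y₁) (σ := σ) (t := t)
      ((mul_le_mul_of_nonneg_left (hB t ht) hi0).trans hBs)
    rw [norm_smul, hε]
    calc ‖σ⁻¹‖ / 2 * ‖Rm t * pertMinus A A' Q σ Y Y₁ t‖
        ≤ ‖σ⁻¹‖ * (C * (κ t * (N * Real.exp (-τ * t)))) := by
          gcongr
          · linarith
          · refine (norm_mul_le _ _).trans ?_
            gcongr
            · exact (hT.norm_le t ht).2.2.2
            · exact h1.trans (by gcongr; exacts [hκ0 t, hN t ht])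
      _ = _ := by ring
  have ha := (isPrim_ampPlus hA hT hne hY).cexp_smul
  have hb := (isPrim_ampMinus hA hT hne hY).cexp_smul
  have hNN : 0 ≤ ‖σ⁻¹‖ * C * N := by positivity
  have dev1 : ∀ t : ℝ, 0 ≤ t → ‖Complex.exp (-σ * t) • a t - a 0‖ ≤ ‖σ⁻¹‖ * C * N * k1 := by
    intro t ht
    have h1 := ha.norm_sub_le_of_le hκ hκ0 (B := ‖σ⁻¹‖ * C * N) hNN le_rfl ht fun s hs => by
      rw [norm_smul, norm_cexp_mul_ofReal]
      calc _ ≤ Real.exp ((-σ).re * s) * (‖σ⁻¹‖ * C * N * κ s * Real.exp (-τ * s)) := by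
            gcongr; exact hf1 s hs.1
        _ = ‖σ⁻¹‖ * C * N * κ s := by
            rw [mul_left_comm, ← Real.exp_add]; simp [τ]
    simpa using h1
  -- The growing amplitude is integrated from infinity, where it vanishes.
  have dev2 : ∀ t : ℝ, 0 ≤ t → ‖Complex.exp (-σ * t) • b t‖ ≤ ‖σ⁻¹‖ * C * N * k1 := by
    intro t ht
    have h1 : ∀ T : ℝ, t ≤ T → ‖Complex.exp (σ * t) • b t‖ ≤ C * N * Real.exp (-(2 * τ) * T) +
        ‖σ⁻¹‖ * C * N * Real.exp (-(2 * τ) * t) * k1 := by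
      intro T hT'
      have hT0 := ht.trans hT'
      have h1 := hb.norm_sub_le_of_le hκ hκ0 (B := ‖σ⁻¹‖ * C * N * Real.exp (-(2 * τ) * t))
        (by positivity) ht hT' fun s hs => by
          rw [norm_smul, norm_cexp_mul_ofReal]
          calc _ ≤ Real.exp ((- -σ).re * s) * (‖σ⁻¹‖ * C * N * κ s * Real.exp (-τ * s)) := by
                gcongr; exact hf2 s (ht.trans hs.1)
            _ = ‖σ⁻¹‖ * C * N * κ s * Real.exp (-(2 * τ) * s) := by
                rw [mul_left_comm, ← Real.exp_add]; simp only [neg_neg, τ]; ring_nf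
            _ ≤ ‖σ⁻¹‖ * C * N * κ s * Real.exp (-(2 * τ) * t) := by
                have := hκ0 s
                gcongr ?_ * ?_
                rw [Real.exp_le_exp]
                nlinarith [hs.1]
            _ = _ := by ring
      simp only [neg_neg] at h1
      have h2 : ‖Complex.exp (σ * T) • b T‖ ≤ C * N * Real.exp (-(2 * τ) * T) := by
        rw [norm_smul, norm_cexp_mul_ofReal]
        have h3 := (norm_amp_le (Y := Y) (Y₁ := Y₁) hT hT0 hBs (hB T hT0)).2
        calc _ ≤ Real.exp (σ.re * T) * (C * (N * Real.exp (-τ * T))) := by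
              gcongr; exact h3.trans (by gcongr; exact hN T hT0)
          _ = C * N * (Real.exp (σ.re * T) * Real.exp (-τ * T)) := by ring
          _ = _ := by rw [← Real.exp_add]; simp only [τ]; ring_nf
      have h4 := norm_sub_norm_le (Complex.exp (σ * t) • b t) (Complex.exp (σ * T) • b T)
      rw [norm_sub_rev] at h4
      linarith
    have h2 : ‖Complex.exp (σ * t) • b t‖ ≤ ‖σ⁻¹‖ * C * N * Real.exp (-(2 * τ) * t) * k1 := by
      have ht1 : Tendsto (fun T : ℝ => C * N * Real.exp (-(2 * τ) * T) +
          ‖σ⁻¹‖ * C * N * Real.exp (-(2 * τ) * t) * k1) atTop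
          (𝓝 (C * N * 0 + ‖σ⁻¹‖ * C * N * Real.exp (-(2 * τ) * t) * k1)) := by
        refine Tendsto.add_const _ (Tendsto.const_mul _ (Real.tendsto_exp_atBot.comp ?_))
        exact tendsto_id.const_mul_atTop_of_neg (by linarith)
      have := ge_of_tendsto ht1 (eventually_atTop.2 ⟨t, h1⟩)
      simpa using this
    have h3 : Complex.exp (-σ * t) • b t =
        Complex.exp (-(2 * σ) * t) • Complex.exp (σ * t) • b t := by
      rw [smul_smul, ← Complex.exp_add]; congr 2; ring
    rw [h3, norm_smul, norm_cexp_mul_ofReal]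
    calc _ ≤ Real.exp ((-(2 * σ)).re * t) *
          (‖σ⁻¹‖ * C * N * Real.exp (-(2 * τ) * t) * k1) := by gcongr
      _ = ‖σ⁻¹‖ * C * N * k1 * (Real.exp ((-(2 * σ)).re * t) * Real.exp (-(2 * τ) * t)) := by ring
      _ = _ := by rw [← Real.exp_add]; simp [τ]
  have hn0 : ‖a 0‖ ≤ C * solSize σ Y Y₁ 0 := (norm_amp_le hT le_rfl hBs (hB 0 le_rfl)).1
  set n := solSize σ Y Y₁ 0
  have hn : 0 ≤ n := solSize_nonneg _ _ _ _
  have hNle : N ≤ 8 * C ^ 2 * n := by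
    have h1 : N ≤ 4 * C * (C * n + 2 * (‖σ⁻¹‖ * C * N * k1)) := by
      refine csSup_le ⟨g 0, 0, mem_Ici.2 le_rfl, rfl⟩ ?_
      rintro _ ⟨t, ht, rfl⟩
      have h3 := solSize_le_amp (Y := Y) (Y₁ := Y₁) hT ht hBs (hB t ht)
      have h5 : Real.exp (τ * t) * ‖a t‖ ≤ ‖a 0‖ + ‖σ⁻¹‖ * C * N * k1 := by
        have : ‖Complex.exp (-σ * t) • a t‖ = Real.exp (τ * t) * ‖a t‖ := by
          rw [norm_smul, norm_cexp_mul_ofReal]; simp [τ]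
        rw [← this]
        linarith [norm_sub_norm_le (Complex.exp (-σ * t) • a t) (a 0), dev1 t ht]
      have h6 : Real.exp (τ * t) * ‖b t‖ ≤ ‖σ⁻¹‖ * C * N * k1 := by
        have : ‖Complex.exp (-σ * t) • b t‖ = Real.exp (τ * t) * ‖b t‖ := by
          rw [norm_smul, norm_cexp_mul_ofReal]; simp [τ]
        rw [← this]
        exact dev2 t ht
      calc g t ≤ Real.exp (τ * t) * (4 * C * (‖a t‖ + ‖b t‖)) := by
            simp only [g]; gcongr
        _ = 4 * C * (Real.exp (τ * t) * ‖a t‖ + Real.exp (τ * t) * ‖b t‖) := by ring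
        _ ≤ _ := mul_le_mul_of_nonneg_left (by linarith) (by positivity)
    have h9 : ‖σ⁻¹‖ * (16 * C ^ 2 * k1) * N ≤ N := mul_le_of_le_one_left hN0 hKs
    linarith
  obtain ⟨h4, h5⟩ := norm_sub_amp_le (σ := σ) (Y := Y) (Y₁ := Y₁) hT hx (hB x hx)
  obtain ⟨h6, -⟩ := norm_ampPlus_zero_sub_le (σ := σ) (Y := Y) (Y₁ := Y₁) hT (hB 0 le_rfl)
  have hPp := (hT.norm_le x hx).1
  have hPm := (hT.norm_le x hx).2.1
  have e1 : ‖Pm x * (Complex.exp (-σ * x) • a x - a 0)‖ ≤ C * (‖σ⁻¹‖ * C * N * k1) :=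
    (norm_mul_le _ _).trans (by gcongr; exact dev1 x hx)
  have e2 : ‖Pp x * (Complex.exp (-σ * x) • b x)‖ ≤ C * (‖σ⁻¹‖ * C * N * k1) :=
    (norm_mul_le _ _).trans (by gcongr; exact dev2 x hx)
  have e3 : ‖Pm x * (a 0 - (1 / 2 : ℂ) • (Y 0 + σ⁻¹ • Y₁ 0))‖ ≤ C * (‖σ⁻¹‖ * B * n) :=
    (norm_mul_le _ _).trans (by gcongr)
  have size : ∀ W : 𝒜, ‖W‖ ≤ solSize σ Y Y₁ x →
      Real.exp (τ * x) * (‖σ⁻¹‖ * B * ‖W‖ / 2) ≤ ‖σ⁻¹‖ * B * N := by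
    intro W hW
    calc Real.exp (τ * x) * (‖σ⁻¹‖ * B * ‖W‖ / 2)
        ≤ Real.exp (τ * x) * (‖σ⁻¹‖ * B * (N * Real.exp (-τ * x))) := by
          gcongr
          have := hW.trans (hN x hx)
          have h0 : 0 ≤ ‖σ⁻¹‖ * B := by positivity
          nlinarith [mul_le_mul_of_nonneg_left this h0, mul_nonneg h0 (norm_nonneg W)]
      _ = ‖σ⁻¹‖ * B * N * (Real.exp (τ * x) * Real.exp (-τ * x)) := by ring
      _ = _ := by rw [← Real.exp_add]; simp
  have total : ‖σ⁻¹‖ * B * N + C * (‖σ⁻¹‖ * C * N * k1) + C * (‖σ⁻¹‖ * C * N * k1) +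
      C * (‖σ⁻¹‖ * B * n) ≤ D * ‖σ⁻¹‖ * n := by
    calc _ = ‖σ⁻¹‖ * (B + 2 * C ^ 2 * k1) * N + C * (‖σ⁻¹‖ * B * n) := by ring
      _ ≤ ‖σ⁻¹‖ * (B + 2 * C ^ 2 * k1) * (8 * C ^ 2 * n) + C * (‖σ⁻¹‖ * B * n) := by gcongr
      _ = _ := by simp only [D]; ring
  constructor
  · have e5 : ‖Complex.exp (-σ * x) • (Y x - (Pm x * a x + Pp x * b x))‖ ≤ ‖σ⁻¹‖ * B * N := by
      rw [norm_smul, norm_cexp_mul_ofReal]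
      exact (mul_le_mul_of_nonneg_left h4 (Real.exp_pos _).le).trans
        (size _ (le_add_of_nonneg_right (norm_nonneg _)))
    have e6 : Complex.exp (-σ * x) • Y x - (1 / 2 : ℂ) • (Pm x * (Y 0 + σ⁻¹ • Y₁ 0)) =
        Complex.exp (-σ * x) • (Y x - (Pm x * a x + Pp x * b x)) +
        Pm x * (Complex.exp (-σ * x) • a x - a 0) +
        Pp x * (Complex.exp (-σ * x) • b x) +
        Pm x * (a 0 - (1 / 2 : ℂ) • (Y 0 + σ⁻¹ • Y₁ 0)) := by
      simp only [mul_sub, mul_add, mul_smul_comm]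
      module
    rw [e6]
    exact (norm_add_le _ _).trans ((add_le_add ((norm_add_le _ _).trans (add_le_add
      ((norm_add_le _ _).trans (add_le_add e5 e1)) e2)) e3).trans total)
  · have e5 : ‖Complex.exp (-σ * x) • (σ⁻¹ • Y₁ x - (Pm x * a x - Pp x * b x))‖ ≤
        ‖σ⁻¹‖ * B * N := by
      rw [norm_smul, norm_cexp_mul_ofReal]
      exact (mul_le_mul_of_nonneg_left h5 (Real.exp_pos _).le).trans
        (size _ (le_add_of_nonneg_left (norm_nonneg _)))
    have e6 : Complex.exp (-σ * x) • σ⁻¹ • Y₁ x - (1 / 2 : ℂ) • (Pm x * (Y 0 + σ⁻¹ • Y₁ 0)) =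
        Complex.exp (-σ * x) • (σ⁻¹ • Y₁ x - (Pm x * a x - Pp x * b x)) +
        Pm x * (Complex.exp (-σ * x) • a x - a 0) -
        Pp x * (Complex.exp (-σ * x) • b x) +
        Pm x * (a 0 - (1 / 2 : ℂ) • (Y 0 + σ⁻¹ • Y₁ 0)) := by
      simp only [mul_sub, mul_add, mul_smul_comm]
      module
    rw [e6]
    exact (norm_add_le _ _).trans ((add_le_add ((norm_sub_le _ _).trans (add_le_add
      ((norm_add_le _ _).trans (add_le_add e5 e1)) e2)) e3).trans total)

end Canonical

/-! ### Decaying solutions at bounded values of the parameter -/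

section Decaying

theorem IsPrim.norm_sub_le_tail {F : Type*} [NormedAddCommGroup F] [NormedSpace ℝ F]
    [CompleteSpace F] {g g' : ℝ → F} (h : IsPrim g g') {κ : ℝ → ℝ}
    (hκ : IntegrableOn κ (Ioi 0)) (hκ0 : ∀ t, 0 ≤ κ t) {B x y : ℝ} (hB : 0 ≤ B) (hx : 0 ≤ x)
    (hxy : x ≤ y) (hb : ∀ t ∈ Icc x y, ‖g' t‖ ≤ B * κ t) :
    ‖g y - g x‖ ≤ B * ∫ t in Ioi x, κ t := by
  have hsub : Ioc x y ⊆ Ioi x := fun t ht => ht.1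
  have hκx : IntegrableOn κ (Ioi x) := hκ.mono_set (Ioi_subset_Ioi hx)
  have hκi : IntervalIntegrable κ volume x y := by
    rw [intervalIntegrable_iff_integrableOn_Ioc_of_le hxy]
    exact hκx.mono_set hsub
  calc ‖g y - g x‖ ≤ ∫ t in x..y, ‖g' t‖ := h.norm_sub_le hx hxy
    _ ≤ ∫ t in x..y, B * κ t := intervalIntegral.integral_mono_on hxy
        (h.intervalIntegrable hx (hx.trans hxy)).norm (hκi.const_mul B) hb
    _ = B * ∫ t in Ioc x y, κ t := by
        rw [intervalIntegral.integral_const_mul, intervalIntegral.integral_of_le hxy]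
    _ ≤ _ := by
        gcongr
        exact .of_forall hκ0

/-- The tail of an integrable weight becomes arbitrarily small; this supplies the point beyond which
the equation is a small perturbation of the free one. -/
theorem exists_tail_le {κ : ℝ → ℝ} (hκ : IntegrableOn κ (Ioi 0)) {δ : ℝ} (hδ : 0 < δ) :
    ∃ X, 0 ≤ X ∧ ∫ t in Ioi X, κ t ≤ δ := by
  have h1 := intervalIntegral_tendsto_integral_Ioi 0 hκ tendsto_id
  have h2 : ∀ᶠ X in atTop, (∫ t in Ioi 0, κ t) - δ < ∫ t in (0 : ℝ)..id X, κ t :=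
    h1.eventually_const_lt (by linarith)
  obtain ⟨X, hX, hX0⟩ := (h2.and (eventually_ge_atTop 0)).exists
  refine ⟨X, hX0, ?_⟩
  have h3 : (∫ t in Ioi 0, κ t) = (∫ t in Ioc 0 X, κ t) + ∫ t in Ioi X, κ t := by
    rw [← Ioc_union_Ioi_eq_Ioi hX0, setIntegral_union (Ioc_disjoint_Ioi le_rfl) measurableSet_Ioi
      (hκ.mono_set fun t ht => ht.1) (hκ.mono_set (Ioi_subset_Ioi hX0))]
  rw [id, intervalIntegral.integral_of_le hX0] at hX
  linarith

variable {𝒜 : Type*} [NormedRing 𝒜] [NormedAlgebra ℂ 𝒜] [CompleteSpace 𝒜]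
variable {A A' Q Y Y₁ : ℝ → 𝒜} {σ : ℂ}

/-- `exp (-σ x) Y`. -/
def reduced (σ : ℂ) (Y : ℝ → 𝒜) (x : ℝ) : 𝒜 := Complex.exp (-σ * x) • Y x

/-- The derivative of `reduced σ Y` if `Y₁ = Y'`. -/
def reducedDeriv (σ : ℂ) (Y Y₁ : ℝ → 𝒜) (x : ℝ) : 𝒜 :=
  Complex.exp (-σ * x) • (Y₁ x - σ • Y x)

/-- The norm of the lower order coefficient `2 σ A + Q`, or rather a bound for it. -/
def potWeight (A Q : ℝ → 𝒜) (s : ℝ) (t : ℝ) : ℝ := 2 * s * ‖A t‖ + ‖Q t‖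

theorem potWeight_nonneg (A Q : ℝ → 𝒜) {s : ℝ} (hs : 0 ≤ s) (t : ℝ) : 0 ≤ potWeight A Q s t := by
  unfold potWeight; positivity

theorem IntegrableCoeff.integrable_potWeight (h : IntegrableCoeff A A' Q) (s : ℝ) :
    IntegrableOn (potWeight A Q s) (Ioi 0) :=
  (h.int.norm.const_mul _).add h.int_pot.norm

theorem IsSol.mul_const (h : IsSol A Q σ Y Y₁) (c : 𝒜) :
    IsSol A Q σ (fun t => Y t * c) (fun t => Y₁ t * c) := by
  have m : ∀ {f f' : ℝ → 𝒜}, IsPrim f f' → IsPrim (fun t => f t * c) (fun t => f' t * c) :=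
    fun h => (h.fun_mul (IsPrim.const c)).congr (fun _ _ => rfl) fun _ _ => by simp
  refine ⟨m h.fst, (m h.snd).congr (fun _ _ => rfl) fun t _ => ?_⟩
  simp only [sub_mul, smul_mul_assoc, mul_assoc]

theorem IsPrim.reduced {Y Y₁ : ℝ → 𝒜} (h : IsPrim Y Y₁) :
    IsPrim (reduced σ Y) (reducedDeriv σ Y Y₁) := by
  refine ((isPrim_cexp (-σ)).fun_smul h).congr (fun _ _ => rfl) fun t _ => ?_
  unfold reducedDeriv
  module

theorem IsSol.reducedDeriv (h : IsSol A Q σ Y Y₁) :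
    IsPrim (reducedDeriv σ Y Y₁) fun t => -(2 * σ) • reducedDeriv σ Y Y₁ t -
      ((2 * σ) • (A t * reduced σ Y t) + Q t * reduced σ Y t) := by
  refine ((isPrim_cexp (-σ)).fun_smul (h.snd.sub (h.fst.fun_const_smul σ))).congr
    (fun _ _ => rfl) fun t _ => ?_
  simp only [_root_.reducedDeriv, _root_.reduced, mul_smul_comm]
  module

theorem norm_pot_mul_le (A Q : ℝ → 𝒜) {s : ℝ} (hs : ‖σ‖ ≤ s) (t : ℝ) (y : 𝒜) :
    ‖(2 * σ) • (A t * y) + Q t * y‖ ≤ ‖y‖ * potWeight A Q s t := by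
  have h1 := norm_mul_le (A t) y
  have h2 := norm_mul_le (Q t) y
  have hs0 : 0 ≤ s := (norm_nonneg σ).trans hs
  have h3 : ‖(2 * σ) • (A t * y)‖ ≤ 2 * s * (‖A t‖ * ‖y‖) := by
    rw [norm_smul, norm_mul, Complex.norm_ofNat]
    gcongr
  unfold potWeight
  linarith [norm_add_le ((2 * σ) • (A t * y)) (Q t * y)]

/-- `y' + 2 σ y` has the derivative `- (2 σ A + Q) y`. -/
theorem IsSol.reducedDeriv_add (h : IsSol A Q σ Y Y₁) :
    IsPrim (fun t => _root_.reducedDeriv σ Y Y₁ t + (2 * σ) • reduced σ Y t) fun t =>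
      -((2 * σ) • (A t * reduced σ Y t) + Q t * reduced σ Y t) := by
  refine (h.reducedDeriv.add (h.fst.reduced.fun_const_smul (2 * σ))).congr (fun _ _ => rfl)
    fun t _ => ?_
  module

theorem IsSol.exists_bound_reducedDeriv (hA : IntegrableCoeff A A' Q) (h : IsSol A Q σ Y Y₁) {M : ℝ}
    (hM : ∀ x, 0 ≤ x → ‖reduced σ Y x‖ ≤ M) :
    ∃ M', ∀ x, 0 ≤ x → ‖_root_.reducedDeriv σ Y Y₁ x‖ ≤ M' := by
  have hM0 : 0 ≤ M := (norm_nonneg _).trans (hM 0 le_rfl)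
  set W := fun t => _root_.reducedDeriv σ Y Y₁ t + (2 * σ) • reduced σ Y t
  refine ⟨‖W 0‖ + M * (∫ t in Ioi 0, potWeight A Q ‖σ‖ t) + ‖2 * σ‖ * M, fun x hx => ?_⟩
  have h1 := h.reducedDeriv_add.norm_sub_le_of_le (hA.integrable_potWeight ‖σ‖)
    (potWeight_nonneg A Q (norm_nonneg σ)) hM0 le_rfl hx fun t ht => by
      rw [norm_neg]
      refine (norm_pot_mul_le A Q le_rfl t _).trans ?_
      gcongr
      · exact potWeight_nonneg A Q (norm_nonneg σ) t
      · exact hM t ht.1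
  have h2 : _root_.reducedDeriv σ Y Y₁ x = W 0 + (W x - W 0) - (2 * σ) • reduced σ Y x := by
    simp only [W]; abel
  rw [h2]
  have h3 : ‖(2 * σ) • reduced σ Y x‖ ≤ ‖2 * σ‖ * M := by
    rw [norm_smul]; gcongr; exact hM x hx
  linarith [norm_sub_le (W 0 + (W x - W 0)) ((2 * σ) • reduced σ Y x),
    norm_add_le (W 0) (W x - W 0)]

/-- For a decaying solution the derivative of the reduced solution is integrated from infinity. -/
theorem IsSol.norm_reducedDeriv_le (hA : IntegrableCoeff A A' Q) (hσ : σ.re < 0)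
    (h : IsSol A Q σ Y Y₁) {M N s x : ℝ} (hM : ∀ x, 0 ≤ x → ‖reduced σ Y x‖ ≤ M) (hs : ‖σ‖ ≤ s)
    (hx : 0 ≤ x) (hN : ∀ t, x ≤ t → ‖reduced σ Y t‖ ≤ N) :
    ‖_root_.reducedDeriv σ Y Y₁ x‖ ≤ N * ∫ t in Ioi x, potWeight A Q s t := by
  obtain ⟨M', hM'⟩ := h.exists_bound_reducedDeriv hA hM
  have hN0 : 0 ≤ N := (norm_nonneg _).trans (hN x le_rfl)
  have hs0 : 0 ≤ s := (norm_nonneg σ).trans hs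
  have hp : IsPrim (fun t : ℝ => Complex.exp (2 * σ * t) • _root_.reducedDeriv σ Y Y₁ t) fun t =>
      Complex.exp (2 * σ * t) • -((2 * σ) • (A t * reduced σ Y t) + Q t * reduced σ Y t) := by
    have := IsPrim.cexp_smul (c := -(2 * σ)) (h.reducedDeriv.congr (fun _ _ => rfl)
      (e' := fun t => -(2 * σ) • _root_.reducedDeriv σ Y Y₁ t +
        -((2 * σ) • (A t * reduced σ Y t) + Q t * reduced σ Y t)) fun t _ => by abel)
    simpa only [neg_neg] using this
  set I := ∫ t in Ioi x, potWeight A Q s t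
  have h1 : ∀ T, x ≤ T → Real.exp (2 * σ.re * x) * ‖_root_.reducedDeriv σ Y Y₁ x‖ ≤
      M' * Real.exp (2 * σ.re * T) + N * Real.exp (2 * σ.re * x) * I := by
    intro T hT
    have h2 := hp.norm_sub_le_tail (hA.integrable_potWeight s) (potWeight_nonneg A Q hs0)
      (B := N * Real.exp (2 * σ.re * x)) (by positivity) hx hT fun t ht => by
        rw [norm_smul, norm_neg, norm_cexp_mul_ofReal]
        have h3 := (norm_pot_mul_le A Q hs t (reduced σ Y t)).trans
          (mul_le_mul_of_nonneg_right (hN t ht.1) (potWeight_nonneg A Q hs0 t))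
        calc _ ≤ Real.exp ((2 * σ).re * t) * (N * potWeight A Q s t) := by gcongr
          _ ≤ Real.exp (2 * σ.re * x) * (N * potWeight A Q s t) := by
              have := mul_nonneg hN0 (potWeight_nonneg A Q hs0 t)
              gcongr ?_ * _
              rw [Real.exp_le_exp]
              simp
              nlinarith [ht.1]
          _ = _ := by ring
    have n1 : ∀ t : ℝ, ‖Complex.exp (2 * σ * t) • _root_.reducedDeriv σ Y Y₁ t‖ =
        Real.exp (2 * σ.re * t) * ‖_root_.reducedDeriv σ Y Y₁ t‖ := fun t => by
      rw [norm_smul, norm_cexp_mul_ofReal]; simp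
    have h4 := norm_sub_norm_le (Complex.exp (2 * σ * x) • _root_.reducedDeriv σ Y Y₁ x)
      (Complex.exp (2 * σ * T) • _root_.reducedDeriv σ Y Y₁ T)
    rw [norm_sub_rev, n1, n1] at h4
    have h5 := mul_le_mul_of_nonneg_left (hM' T (hx.trans hT)) (Real.exp_pos (2 * σ.re * T)).le
    linarith
  have ht1 : Tendsto (fun T : ℝ => M' * Real.exp (2 * σ.re * T) +
      N * Real.exp (2 * σ.re * x) * I) atTop (𝓝 (M' * 0 + N * Real.exp (2 * σ.re * x) * I)) := by
    refine Tendsto.add_const _ (Tendsto.const_mul _ (Real.tendsto_exp_atBot.comp ?_))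
    exact tendsto_id.const_mul_atTop_of_neg (by linarith)
  have h2 := ge_of_tendsto ht1 (eventually_atTop.2 ⟨x, h1⟩)
  have h3 := Real.exp_pos (2 * σ.re * x)
  nlinarith

/-- Beyond the point `X` where the tail of the coefficients becomes small, a decaying solution
is nearly a multiple of `exp (σ x)`. -/
theorem IsSol.norm_reduced_sub_le (hA : IntegrableCoeff A A' Q) (hσ : σ.re < 0)
    (h : IsSol A Q σ Y Y₁) {M s X δ : ℝ} (hM : ∀ x, 0 ≤ x → ‖reduced σ Y x‖ ≤ M) (hs : ‖σ‖ ≤ s)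
    (hX : 0 ≤ X) (hδ : 3 * ∫ t in Ioi X, potWeight A Q s t ≤ 2 * ‖σ‖ * δ) (hδ' : δ ≤ 1 / 2)
    {x : ℝ} (hx : X ≤ x) :
    ‖reduced σ Y x‖ ≤ 2 * ‖reduced σ Y X‖ ∧
      ‖reduced σ Y x - reduced σ Y X‖ ≤ 2 * δ * ‖reduced σ Y X‖ := by
  have hs0 : 0 ≤ s := (norm_nonneg σ).trans hs
  have hσ0 : 0 < ‖σ‖ := norm_pos_iff.2 fun h0 => by simp [h0] at hσ
  set I := ∫ t in Ioi X, potWeight A Q s t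
  have hI0 : 0 ≤ I := integral_nonneg (potWeight_nonneg A Q hs0)
  have hBA : BddAbove ((fun t => ‖reduced σ Y t‖) '' Ici X) :=
    ⟨M, by rintro _ ⟨t, ht, rfl⟩; exact hM t (hX.trans ht)⟩
  set N := sSup ((fun t => ‖reduced σ Y t‖) '' Ici X)
  have hN : ∀ t, X ≤ t → ‖reduced σ Y t‖ ≤ N := fun t ht => le_csSup hBA ⟨t, ht, rfl⟩
  have hN0 : 0 ≤ N := (norm_nonneg _).trans (hN X le_rfl)
  have key : ∀ x, X ≤ x → ‖reduced σ Y x - reduced σ Y X‖ ≤ δ * N := by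
    intro x hx
    have h1 := h.reducedDeriv_add.norm_sub_le_tail (hA.integrable_potWeight s)
      (potWeight_nonneg A Q hs0) hN0 hX hx fun t ht => by
        rw [norm_neg]
        exact (norm_pot_mul_le A Q hs t _).trans
          (mul_le_mul_of_nonneg_right (hN t ht.1) (potWeight_nonneg A Q hs0 t))
    have h2 := h.norm_reducedDeriv_le hA hσ hM hs hX hN
    have h3 := h.norm_reducedDeriv_le hA hσ hM hs (hX.trans hx) fun t ht => hN t (hx.trans ht)
    have h4 : ∫ t in Ioi x, potWeight A Q s t ≤ I :=
      setIntegral_mono_set ((hA.integrable_potWeight s).mono_set (Ioi_subset_Ioi hX))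
        (.of_forall (potWeight_nonneg A Q hs0)) (Ioi_subset_Ioi hx).eventuallyLE
    have h5 : (2 * σ) • (reduced σ Y x - reduced σ Y X) =
        (_root_.reducedDeriv σ Y Y₁ x + (2 * σ) • reduced σ Y x -
          (_root_.reducedDeriv σ Y Y₁ X + (2 * σ) • reduced σ Y X)) -
        _root_.reducedDeriv σ Y Y₁ x + _root_.reducedDeriv σ Y Y₁ X := by
      rw [smul_sub]; abel
    have h6 : ‖(2 * σ) • (reduced σ Y x - reduced σ Y X)‖ ≤ 3 * (N * I) := by
      rw [h5]
      refine (norm_add_le _ _).trans ?_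
      have := norm_sub_le (_root_.reducedDeriv σ Y Y₁ x + (2 * σ) • reduced σ Y x -
          (_root_.reducedDeriv σ Y Y₁ X + (2 * σ) • reduced σ Y X)) (_root_.reducedDeriv σ Y Y₁ x)
      have := mul_le_mul_of_nonneg_left h4 hN0
      linarith
    have h7 : ‖(2 * σ)‖ = 2 * ‖σ‖ := by rw [norm_mul]; norm_num
    rw [norm_smul, h7] at h6
    have h8 : 2 * ‖σ‖ * ‖reduced σ Y x - reduced σ Y X‖ ≤ 2 * ‖σ‖ * (δ * N) := by
      nlinarith [mul_le_mul_of_nonneg_right hδ hN0]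
    exact le_of_mul_le_mul_left h8 (by positivity)
  have hN2 : N ≤ 2 * ‖reduced σ Y X‖ := by
    have h1 : N ≤ ‖reduced σ Y X‖ + δ * N := by
      refine csSup_le ⟨_, X, mem_Ici.2 le_rfl, rfl⟩ ?_
      rintro _ ⟨t, ht, rfl⟩
      have := norm_sub_norm_le (reduced σ Y t) (reduced σ Y X)
      linarith [key t ht]
    nlinarith
  have hδ0 : 0 ≤ δ := by
    by_contra hneg
    push Not at hneg
    nlinarith
  refine ⟨(hN x hx).trans hN2, (key x hx).trans ?_⟩
  nlinarith

/-- The bound of `IsSol.norm_reduced_sub_le` holds with the same `X` for all `σ` in an annulus. -/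
theorem exists_uniform_reduced_bound (hA : IntegrableCoeff A A' Q) {s₁ s₂ : ℝ} (hs₁ : 0 < s₁) :
    ∃ X, 0 ≤ X ∧ ∀ σ : ℂ, σ.re < 0 → s₁ ≤ ‖σ‖ → ‖σ‖ ≤ s₂ → ∀ Y Y₁ : ℝ → 𝒜,
      IsSol A Q σ Y Y₁ → (∃ M, ∀ x, 0 ≤ x → ‖reduced σ Y x‖ ≤ M) →
      ∀ x, X ≤ x → ‖reduced σ Y x‖ ≤ 2 * ‖reduced σ Y X‖ := by
  obtain ⟨X, hX, hI⟩ := exists_tail_le (hA.integrable_potWeight s₂) (δ := s₁ / 3) (by positivity)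
  refine ⟨X, hX, fun σ hσ h1 h2 Y Y₁ hY ⟨M, hM⟩ x hx => ?_⟩
  refine (hY.norm_reduced_sub_le hA hσ hM h2 hX (δ := 1 / 2) ?_ le_rfl hx).1
  linarith

/-- Star solutions: `Z'' = σ² Z - 2 σ Z A - Z Q`. -/
structure IsSolStar (A Q : ℝ → 𝒜) (σ : ℂ) (Z Z₁ : ℝ → 𝒜) : Prop where
  fst : IsPrim Z Z₁
  snd : IsPrim Z₁ fun t => σ ^ 2 • Z t - (2 * σ) • (Z t * A t) - Z t * Q t

/-- If a decaying solution `Y` is conjugate to `Z`, that is `Z' Y - Z Y' = 0`, and is normalized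
against a star solution `Ψ`, then `Z` decays as well. -/
theorem IsSolStar.exists_bound_reduced [FiniteDimensional ℂ 𝒜] (hA : IntegrableCoeff A A' Q)
    (hσ : σ.re < 0) (h : IsSol A Q σ Y Y₁) {M : ℝ} (hM : ∀ x, 0 ≤ x → ‖reduced σ Y x‖ ≤ M)
    {Z Z₁ Ψ Ψ₁ : ℝ → 𝒜} (hZ : IsSolStar A Q σ Z Z₁)
    (hZY : ∀ x, 0 ≤ x → Z₁ x * Y x - Z x * Y₁ x = 0)
    (hΨY : ∀ x, 0 ≤ x → Ψ x * Y₁ x - Ψ₁ x * Y x = 1) :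
    ∃ M', ∀ x, 0 ≤ x → ‖reduced σ Z x‖ ≤ M' := by
  have hσ0 : 0 < ‖σ‖ := norm_pos_iff.2 fun h0 => by simp [h0] at hσ
  set o := ‖(1 : 𝒜)‖
  have ho : 0 ≤ o := norm_nonneg _
  set δ := 1 / (4 * (1 + o))
  have hδ0 : 0 < δ := by positivity
  have hδ4 : δ ≤ 1 / 4 := by
    simp only [δ]; gcongr; linarith
  have hδo : δ * o ≤ 1 / 4 := by
    simp only [δ]; rw [div_mul_eq_mul_div, one_mul, div_le_div_iff₀ (by positivity) (by norm_num)]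
    linarith
  set κ := potWeight A Q ‖σ‖
  have hκ : IntegrableOn κ (Ioi 0) := hA.integrable_potWeight ‖σ‖
  have hκ0 : ∀ t, 0 ≤ κ t := potWeight_nonneg A Q hσ0.le
  -- The tail beyond `X` is so small that both `Y` and the ratio of `Y'` to `Y` are controlled.
  set B := 2 * o * (2 * (1 + o))
  have hB : 0 ≤ B := by positivity
  obtain ⟨X, hX, hI⟩ := exists_tail_le hκ (δ := min (2 * ‖σ‖ * δ / 3) (‖σ‖ / (B + 1)))
    (by positivity)
  set I := ∫ t in Ioi X, κ t
  have hI0 : 0 ≤ I := integral_nonneg hκ0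
  have hI1 : 3 * I ≤ 2 * ‖σ‖ * δ := by
    have := hI.trans (min_le_left _ _); linarith
  have hI2 : (B + 1) * I ≤ ‖σ‖ := by
    have := hI.trans (min_le_right _ _)
    rwa [le_div_iff₀ (by positivity), mul_comm] at this
  -- `Y X` is invertible: an annihilated direction would vanish identically.
  have hinj : ∀ c, Y X * c = 0 → c = 0 := by
    intro c hc
    have hYc := h.mul_const c
    have hred : ∀ t, reduced σ (fun t => Y t * c) t = reduced σ Y t * c := fun t => by
      simp [reduced]
    have hMc : ∀ x, 0 ≤ x → ‖reduced σ (fun t => Y t * c) x‖ ≤ M * ‖c‖ := fun x hx => by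
      rw [hred]; exact (norm_mul_le _ _).trans (by gcongr; exact hM x hx)
    have h0 : ∀ t, X ≤ t → ‖reduced σ (fun t => Y t * c) t‖ ≤ 0 := fun t ht => by
      have := (hYc.norm_reduced_sub_le hA hσ hMc le_rfl hX hI1 (by linarith) ht).1
      simpa [reduced, hc] using this
    have h1 := hYc.norm_reducedDeriv_le hA hσ hMc le_rfl hX h0
    have h2 : Y₁ X * c = 0 := by
      have : _root_.reducedDeriv σ (fun t => Y t * c) (fun t => Y₁ t * c) X = 0 := by
        rw [← norm_le_zero_iff]; simpa using h1
      simpa [_root_.reducedDeriv, hc] using this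
    calc c = (Ψ X * Y₁ X - Ψ₁ X * Y X) * c := by rw [hΨY X hX, one_mul]
      _ = Ψ X * (Y₁ X * c) - Ψ₁ X * (Y X * c) := by simp only [sub_mul, mul_assoc]
      _ = 0 := by rw [h2, hc]; simp
  obtain ⟨c, hc⟩ : ∃ c, Y X * c = 1 := by
    have h1 : Function.Injective (LinearMap.mulLeft ℂ (Y X)) :=
      (injective_iff_map_eq_zero _).2 fun c hc => hinj c (by simpa using hc)
    exact (LinearMap.injective_iff_surjective.1 h1) 1
  -- Normalize the solution at `X`.
  set e := Complex.exp (-σ * X)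
  have he : e ≠ 0 := Complex.exp_ne_zero _
  set c' : 𝒜 := e⁻¹ • c
  have hV := h.mul_const c'
  set V := fun t => Y t * c'
  set V₁ := fun t => Y₁ t * c'
  have hVX : reduced σ V X = 1 := by
    show e • (Y X * (e⁻¹ • c)) = 1
    rw [mul_smul_comm, hc, smul_smul, mul_inv_cancel₀ he, one_smul]
  have hMV : ∀ x, 0 ≤ x → ‖reduced σ V x‖ ≤ M * ‖c'‖ := fun x hx => by
    have : reduced σ V x = reduced σ Y x * c' := by simp [reduced, V]
    rw [this]; exact (norm_mul_le _ _).trans (by gcongr; exact hM x hx)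
  have hVb : ∀ x, X ≤ x → ‖reduced σ V x‖ ≤ 2 * o ∧ ‖1 - reduced σ V x‖ ≤ 1 / 2 := by
    intro x hx
    have h1 := hV.norm_reduced_sub_le hA hσ hMV le_rfl hX hI1 (by linarith) hx
    rw [hVX] at h1
    refine ⟨h1.1, ?_⟩
    rw [norm_sub_rev]
    exact h1.2.trans (by simp only [o] at hδo; linarith)
  have hVd : ∀ x, X ≤ x → ‖_root_.reducedDeriv σ V V₁ x‖ ≤ 2 * o * I := by
    intro x hx
    refine (hV.norm_reducedDeriv_le hA hσ hMV le_rfl (hX.trans hx) fun t ht =>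
      (hVb t (hx.trans ht)).1).trans ?_
    gcongr
    exact setIntegral_mono_set (hκ.mono_set (Ioi_subset_Ioi hX)) (.of_forall hκ0)
      (Ioi_subset_Ioi hx).eventuallyLE
  -- The logarithmic derivative of `Z` is controlled by that of `Y`.
  have hη : ∀ x, X ≤ x → ‖_root_.reducedDeriv σ Z Z₁ x‖ ≤ B * I * ‖reduced σ Z x‖ := by
    intro x hx
    obtain ⟨u, hu⟩ : IsUnit (reduced σ V x) := by
      have := isUnit_one_sub_of_norm_lt_one (x := 1 - reduced σ V x)
        (lt_of_le_of_lt (hVb x hx).2 (by norm_num))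
      simpa using this
    have hui : ‖(↑u⁻¹ : 𝒜)‖ ≤ 2 * (1 + o) := by
      have h1 : (↑u⁻¹ : 𝒜) = 1 + ↑u⁻¹ * (1 - reduced σ V x) := by
        rw [← hu, mul_sub, Units.inv_mul]; simp
      have h2 : ‖(↑u⁻¹ : 𝒜)‖ ≤ o + ‖(↑u⁻¹ : 𝒜)‖ * (1 / 2) := by
        calc ‖(↑u⁻¹ : 𝒜)‖ = ‖1 + ↑u⁻¹ * (1 - reduced σ V x)‖ := by rw [← h1]
          _ ≤ o + ‖(↑u⁻¹ : 𝒜) * (1 - reduced σ V x)‖ := norm_add_le _ _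
          _ ≤ o + ‖(↑u⁻¹ : 𝒜)‖ * ‖1 - reduced σ V x‖ := by gcongr; exact norm_mul_le _ _
          _ ≤ _ := by gcongr; exact (hVb x hx).2
      linarith
    have h1 : _root_.reducedDeriv σ Z Z₁ x * reduced σ V x =
        reduced σ Z x * _root_.reducedDeriv σ V V₁ x := by
      have h2 : Z₁ x * V x = Z x * V₁ x := by
        have := congrArg (· * c') (sub_eq_zero.1 (hZY x (hX.trans hx)))
        simpa only [V, V₁, mul_assoc] using this
      simp only [_root_.reducedDeriv, reduced, sub_mul, mul_sub, h2, smul_mul_assoc,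
        mul_smul_comm]
      module
    have h3 : _root_.reducedDeriv σ Z Z₁ x =
        reduced σ Z x * _root_.reducedDeriv σ V V₁ x * ↑u⁻¹ := by
      rw [← h1, ← hu, mul_assoc, Units.mul_inv, mul_one]
    rw [h3]
    calc _ ≤ ‖reduced σ Z x‖ * ‖_root_.reducedDeriv σ V V₁ x‖ * ‖(↑u⁻¹ : 𝒜)‖ :=
          (norm_mul_le _ _).trans (by gcongr; exact norm_mul_le _ _)
      _ ≤ ‖reduced σ Z x‖ * (2 * o * I) * (2 * (1 + o)) := by
          gcongr; exact hVd x hx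
      _ = _ := by simp only [B]; ring
  have hp : IsPrim (fun t => _root_.reducedDeriv σ Z Z₁ t + (2 * σ) • reduced σ Z t) fun t =>
      -((2 * σ) • (reduced σ Z t * A t) + reduced σ Z t * Q t) := by
    have h1 := (isPrim_cexp (-σ)).fun_smul (hZ.snd.sub (hZ.fst.fun_const_smul σ))
    refine (h1.add (hZ.fst.reduced.fun_const_smul (2 * σ))).congr (fun _ _ => rfl) fun t _ => ?_
    simp only [_root_.reducedDeriv, _root_.reduced, smul_mul_assoc]
    module
  -- On `[X, T]` the reduced derivative plus `2σ` times `Z` is nearly constant; since the reduced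
  -- derivative is small relative to `Z`, the maximum of `Z` is bounded independently of `T`.
  set K := ‖_root_.reducedDeriv σ Z Z₁ X + (2 * σ) • reduced σ Z X‖
  have hcont : ContinuousOn (reduced σ Z) (Ici 0) := hZ.fst.reduced.continuousOn
  have hlarge : ∀ x, X ≤ x → ‖reduced σ Z x‖ ≤ K / ‖σ‖ := by
    intro T hT
    obtain ⟨t₀, ht₀, hmax⟩ := isCompact_Icc.exists_isMaxOn (nonempty_Icc.2 hT)
      (f := fun t => ‖reduced σ Z t‖) (hcont.norm.mono fun t ht => hX.trans ht.1)
    set N := ‖reduced σ Z t₀‖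
    have hN : ∀ t ∈ Icc X T, ‖reduced σ Z t‖ ≤ N := fun t ht => hmax ht
    have h1 := hp.norm_sub_le_tail hκ hκ0 (norm_nonneg (reduced σ Z t₀)) hX ht₀.1 fun t ht => by
      rw [norm_neg]
      have e1 := norm_mul_le (reduced σ Z t) (A t)
      have e2 := norm_mul_le (reduced σ Z t) (Q t)
      have e3 : ‖(2 * σ) • (reduced σ Z t * A t)‖ ≤ 2 * ‖σ‖ * (‖reduced σ Z t‖ * ‖A t‖) := by
        rw [norm_smul, norm_mul, Complex.norm_ofNat]; gcongr
      have e4 := mul_le_mul_of_nonneg_right (hN t ⟨ht.1, ht.2.trans ht₀.2⟩) (hκ0 t)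
      refine le_trans ?_ e4
      simp only [κ, potWeight]
      linarith [norm_add_le ((2 * σ) • (reduced σ Z t * A t)) (reduced σ Z t * Q t)]
    have h2 := hη t₀ ht₀.1
    have h3 : ‖(2 * σ) • reduced σ Z t₀‖ = 2 * ‖σ‖ * N := by
      rw [norm_smul, norm_mul, Complex.norm_ofNat]
    have h4 : ‖(2 * σ) • reduced σ Z t₀‖ ≤ N * I + K + B * I * N := by
      have e1 : (2 * σ) • reduced σ Z t₀ =
          (_root_.reducedDeriv σ Z Z₁ t₀ + (2 * σ) • reduced σ Z t₀ -
          (_root_.reducedDeriv σ Z Z₁ X + (2 * σ) • reduced σ Z X)) +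
          (_root_.reducedDeriv σ Z Z₁ X + (2 * σ) • reduced σ Z X) -
          _root_.reducedDeriv σ Z Z₁ t₀ := by abel
      rw [e1]
      exact (norm_sub_le _ _).trans
        (add_le_add ((norm_add_le _ _).trans (add_le_add h1 le_rfl)) h2)
    have h5 : ‖σ‖ * N ≤ K := by
      have : (B + 1) * I * N ≤ ‖σ‖ * N := by gcongr
      linarith
    calc ‖reduced σ Z T‖ ≤ N := hN T ⟨hT, le_rfl⟩
      _ ≤ K / ‖σ‖ := by rw [le_div_iff₀ hσ0]; linarith
  obtain ⟨M₁, hM₁⟩ := isCompact_Icc.exists_bound_of_continuousOn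
    (hcont.mono (fun t (ht : t ∈ Icc 0 X) => ht.1))
  refine ⟨max M₁ (K / ‖σ‖), fun x hx => ?_⟩
  rcases le_total x X with hxX | hxX
  · exact (hM₁ x ⟨hx, hxX⟩).trans (le_max_left _ _)
  · exact (hlarge x hxX).trans (le_max_right _ _)

end Decaying

/-! ### Solutions depending on the spectral parameter -/

section System

variable {F : Type*} [NormedAddCommGroup F] [NormedSpace ℂ F]

/-- A linear map, acting from the first to the second component of `F × F`. -/
def toSndL : (F →L[ℂ] F) →L[ℂ] (F × F →L[ℂ] F × F) :=
  ((ContinuousLinearMap.compL ℂ (F × F) F (F × F)) (ContinuousLinearMap.inr ℂ F F)).comp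
    ((ContinuousLinearMap.compL ℂ (F × F) F F).flip (ContinuousLinearMap.fst ℂ F F))

/-- The first order system for `(Y, Y')` that belongs to `Y'' = σ² Y - 2 σ A Y - Q Y`. -/
def systemMap (A Q : ℝ → F →L[ℂ] F) (σ : ℂ) (t : ℝ) : F × F →L[ℂ] F × F :=
  (ContinuousLinearMap.inl ℂ F F).comp (ContinuousLinearMap.snd ℂ F F) +
    σ ^ 2 • toSndL (ContinuousLinearMap.id ℂ F) - (2 * σ) • toSndL (A t) - toSndL (Q t)

theorem systemMap_apply (A Q : ℝ → F →L[ℂ] F) (σ : ℂ) (t : ℝ) (W : F × F) :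
    systemMap A Q σ t W = (W.2, σ ^ 2 • W.1 - (2 * σ) • A t W.1 - Q t W.1) := by
  simp [systemMap, toSndL]

theorem intervalIntegrable_toSndL {A : ℝ → F →L[ℂ] F} {T : ℝ}
    (hA : IntervalIntegrable A volume 0 T) :
    IntervalIntegrable (fun t => toSndL (A t)) volume 0 T :=
  ⟨ContinuousLinearMap.integrable_comp (toSndL (F := F)) hA.1,
    ContinuousLinearMap.integrable_comp (toSndL (F := F)) hA.2⟩

theorem norm_toSndL_le (T : F →L[ℂ] F) : ‖toSndL T‖ ≤ ‖T‖ := by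
  refine ContinuousLinearMap.opNorm_le_bound _ (norm_nonneg T) fun W => ?_
  have h1 : toSndL T W = (0, T W.1) := rfl
  rw [h1, Prod.norm_def, norm_zero, max_eq_right (norm_nonneg _)]
  exact (T.le_opNorm _).trans (by gcongr; exact norm_fst_le W)

theorem holomorphicFamily_systemMap {A Q : ℝ → F →L[ℂ] F}
    (hA : ∀ T : ℝ, 0 ≤ T → IntervalIntegrable A volume 0 T)
    (hQ : ∀ T : ℝ, 0 ≤ T → IntervalIntegrable Q volume 0 T) :
    HolomorphicFamily (systemMap A Q) where
  intervalIntegrable σ T hT :=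
    (intervalIntegrable_const.sub ((intervalIntegrable_toSndL (hA T hT)).smul (2 * σ))).sub
      (intervalIntegrable_toSndL (hQ T hT))
  differentiable t := by
    unfold systemMap
    fun_prop
  bound r := by
    refine ⟨fun t => ‖(ContinuousLinearMap.inl ℂ F F).comp (ContinuousLinearMap.snd ℂ F F)‖ +
      r ^ 2 * ‖toSndL (ContinuousLinearMap.id ℂ F)‖ + 2 * r * ‖A t‖ +
      ‖Q t‖, fun T hT => ?_, fun σ hσ t => ?_⟩
    · exact (intervalIntegrable_const.add ((hA T hT).norm.const_mul _)).add
        (hQ T hT).norm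
    · have hr : 0 ≤ r := (norm_nonneg σ).trans hσ
      unfold systemMap
      refine (norm_sub_le _ _).trans (add_le_add ((norm_sub_le _ _).trans (add_le_add
        ((norm_add_le _ _).trans (add_le_add le_rfl ?_)) ?_)) (norm_toSndL_le _))
      · rw [norm_smul, norm_pow]
        gcongr
      · rw [norm_smul, norm_mul, Complex.norm_ofNat]
        gcongr
        exact norm_toSndL_le _

end System

section Family

variable {𝒜 : Type*} [NormedRing 𝒜] [NormedAlgebra ℂ 𝒜] [CompleteSpace 𝒜]
variable {A A' Q Y Y₁ Z Z₁ : ℝ → 𝒜} {σ : ℂ}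

theorem IntegrableCoeff.intervalIntegrable (h : IntegrableCoeff A A' Q) {x y : ℝ} (hx : 0 ≤ x)
    (hy : 0 ≤ y) :
    IntervalIntegrable A volume x y ∧ IntervalIntegrable Q volume x y := by
  have hsub : uIoc x y ⊆ Ioi 0 := fun t ht => (le_min hx hy).trans_lt ht.1
  constructor <;> rw [intervalIntegrable_iff]
  · exact h.int.mono_set hsub
  · exact h.int_pot.mono_set hsub

/-- The system of the pencil with the coefficients `A`, `Q`. -/
def pencilMap (A Q : ℝ → 𝒜) (σ : ℂ) (t : ℝ) : 𝒜 × 𝒜 →L[ℂ] 𝒜 × 𝒜 :=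
  systemMap (fun t => ContinuousLinearMap.mul ℂ 𝒜 (A t))
    (fun t => ContinuousLinearMap.mul ℂ 𝒜 (Q t)) σ t

theorem pencilMap_apply (A Q : ℝ → 𝒜) (σ : ℂ) (t : ℝ) (W : 𝒜 × 𝒜) :
    pencilMap A Q σ t W = (W.2, σ ^ 2 • W.1 - (2 * σ) • (A t * W.1) - Q t * W.1) := by
  simp [pencilMap, systemMap_apply]

theorem holomorphicFamily_pencilMap (h : IntegrableCoeff A A' Q) :
    HolomorphicFamily (pencilMap A Q) := by
  refine holomorphicFamily_systemMap (fun T hT => ?_) fun T hT => ?_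
  · obtain ⟨h1, -⟩ := h.intervalIntegrable le_rfl hT
    exact ⟨(ContinuousLinearMap.mul ℂ 𝒜).integrable_comp h1.1,
      (ContinuousLinearMap.mul ℂ 𝒜).integrable_comp h1.2⟩
  · obtain ⟨-, h1⟩ := h.intervalIntegrable le_rfl hT
    exact ⟨(ContinuousLinearMap.mul ℂ 𝒜).integrable_comp h1.1,
      (ContinuousLinearMap.mul ℂ 𝒜).integrable_comp h1.2⟩

theorem isSol_iff_system : IsSol A Q σ Y Y₁ ↔
    IsPrim (fun t => (Y t, Y₁ t)) (fun t => pencilMap A Q σ t (Y t, Y₁ t)) := by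
  constructor
  · intro h
    have h1 := h.fst.map (ContinuousLinearMap.inl ℝ 𝒜 𝒜)
    have h2 := h.snd.map (ContinuousLinearMap.inr ℝ 𝒜 𝒜)
    refine (h1.add h2).congr (fun x _ => by simp) fun x _ => by
      simp [pencilMap_apply]
  · intro h
    refine ⟨(h.map (ContinuousLinearMap.fst ℝ 𝒜 𝒜)).congr (fun _ _ => rfl) fun x _ => ?_,
      (h.map (ContinuousLinearMap.snd ℝ 𝒜 𝒜)).congr (fun _ _ => rfl) fun x _ => ?_⟩
    · simp [pencilMap_apply]
    · simp [pencilMap_apply]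

theorem exists_isSol_entire (h : IntegrableCoeff A A' Q) {a b : ℂ → 𝒜} (ha : Differentiable ℂ a)
    (hb : Differentiable ℂ b) :
    ∃ Y Y₁ : ℂ → ℝ → 𝒜, (∀ σ, IsSol A Q σ (Y σ) (Y₁ σ) ∧ Y σ 0 = a σ ∧ Y₁ σ 0 = b σ) ∧
      ∀ x : ℝ, 0 ≤ x → (Differentiable ℂ fun σ => Y σ x) ∧ Differentiable ℂ fun σ => Y₁ σ x := by
  obtain ⟨W, h0, h1, h2⟩ := (holomorphicFamily_pencilMap h).exists_solution (ha.prodMk hb)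
  refine ⟨fun σ t => (W σ t).1, fun σ t => (W σ t).2, fun σ => ⟨?_, ?_, ?_⟩, fun x hx => ⟨?_, ?_⟩⟩
  · exact isSol_iff_system.2 (h1 σ)
  · simp [h0]
  · simp [h0]
  · exact (h2 x hx).fst
  · exact (h2 x hx).snd

theorem IsSol.eq_of_initial (h : IntegrableCoeff A A' Q) (hY : IsSol A Q σ Y Y₁)
    (hZ : IsSol A Q σ Z Z₁) (h0 : Y 0 = Z 0) (h1 : Y₁ 0 = Z₁ 0) {x : ℝ} (hx : 0 ≤ x) :
    Y x = Z x ∧ Y₁ x = Z₁ x := by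
  obtain ⟨k, hk, hk'⟩ := (holomorphicFamily_pencilMap h).bound ‖σ‖
  have := (isSol_iff_system.1 hY).eq_of_linear (isSol_iff_system.1 hZ) hk (hk' σ le_rfl)
    (by simp [h0, h1]) hx
  simpa using this

/-- Solutions are bounded locally uniformly in `σ` and `x`. -/
theorem IntegrableCoeff.exists_local_bound (h : IntegrableCoeff A A' Q) (r : ℝ) {T : ℝ}
    (hT : 0 ≤ T) :
    ∃ C, 0 ≤ C ∧ ∀ σ : ℂ, ‖σ‖ ≤ r → ∀ Y Y₁ : ℝ → 𝒜, IsSol A Q σ Y Y₁ → ∀ x ∈ Icc 0 T,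
      ‖Y x‖ ≤ C * (‖Y 0‖ + ‖Y₁ 0‖) ∧ ‖Y₁ x‖ ≤ C * (‖Y 0‖ + ‖Y₁ 0‖) := by
  obtain ⟨k, hk, hk'⟩ := (holomorphicFamily_pencilMap h).bound (max r 0)
  have hk0 : ∀ t, 0 ≤ k t := fun t => (norm_nonneg _).trans (hk' 0 (by simp) t)
  refine ⟨Real.exp (∫ t in (0 : ℝ)..T, k t), (Real.exp_pos _).le, fun σ hσ Y Y₁ hY x hx => ?_⟩
  have h1 := (isSol_iff_system.1 hY).norm_le_of_linear hk (hk' σ (hσ.trans (le_max_left _ _))) hx.1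
  have h2 : ∫ t in (0 : ℝ)..x, k t ≤ ∫ t in (0 : ℝ)..T, k t :=
    intervalIntegral.integral_mono_interval le_rfl hx.1 hx.2 (.of_forall hk0) (hk T hT)
  have h3 : ‖((Y 0, Y₁ 0) : 𝒜 × 𝒜)‖ ≤ ‖Y 0‖ + ‖Y₁ 0‖ := by
    rw [Prod.norm_def]
    exact max_le (by simp) (by simp)
  have h4 : ‖((Y x, Y₁ x) : 𝒜 × 𝒜)‖ ≤
      Real.exp (∫ t in (0 : ℝ)..T, k t) * (‖Y 0‖ + ‖Y₁ 0‖) := by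
    refine h1.trans ?_
    rw [mul_comm]
    gcongr
  exact ⟨(norm_fst_le (Y x, Y₁ x)).trans h4, (norm_snd_le (Y x, Y₁ x)).trans h4⟩

/-- The linear equation `P' = T(t) P` on the half-line with integrable continuous coefficients. -/
theorem exists_linear_solution {T : ℝ → 𝒜 →L[ℂ] 𝒜} (hc : ContinuousOn T (Ici 0))
    (hi : IntegrableOn T (Ioi 0)) :
    ∃ P : ℝ → 𝒜, P 0 = 1 ∧ (∀ x, 0 ≤ x → HasDerivWithinAt P (T x (P x)) (Ici 0) x) := by
  have hint : ∀ x : ℝ, 0 ≤ x → IntervalIntegrable T volume 0 x := fun x hx => by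
    rw [intervalIntegrable_iff_integrableOn_Ioc_of_le hx]
    exact hi.mono_set fun t ht => ht.1
  have hH : HolomorphicFamily fun (_ : ℂ) t => T t :=
    ⟨fun _ => hint, fun t => by fun_prop, fun r => ⟨fun t => ‖T t‖, fun x hx => (hint x hx).norm,
      fun _ _ t => le_rfl⟩⟩
  obtain ⟨W, h0, h1, -⟩ := hH.exists_solution (w := fun _ => 1) (by fun_prop)
  exact ⟨W 0, h0 0, fun x hx => (h1 0).hasDerivWithinAt (hc.clm_apply (h1 0).continuousOn) hx⟩

theorem norm_le_of_linear_of_integrable {T : ℝ → 𝒜 →L[ℂ] 𝒜} (hi : IntegrableOn T (Ioi 0))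
    {P : ℝ → 𝒜} (hP : IsPrim P fun t => T t (P t)) {x : ℝ} (hx : 0 ≤ x) :
    ‖P x‖ ≤ ‖P 0‖ * Real.exp (∫ t in Ioi 0, ‖T t‖) := by
  have h1 := hP.norm_le_of_linear (k := fun t => ‖T t‖) (fun x hx => by
    rw [intervalIntegrable_iff_integrableOn_Ioc_of_le hx]
    exact (hi.mono_set fun t ht => ht.1).norm) (fun t => le_rfl) hx
  refine h1.trans ?_
  gcongr
  rw [intervalIntegral.integral_of_le hx]
  exact setIntegral_mono_set hi.norm (.of_forall fun t => norm_nonneg _)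
    (Ioc_subset_Ioi_self.eventuallyLE)

end Family

/-! ### The solutions of the pencil -/

section Wronskian

variable {𝒜 : Type*} [NormedRing 𝒜] [NormedAlgebra ℂ 𝒜] [CompleteSpace 𝒜]
variable {A Q Y Y₁ Z Z₁ : ℝ → 𝒜} {ρ θ : ℂ}

/-- The derivative of the Wronskian `Z' Y - Z Y'` of solutions for different parameters. -/
theorem IsSolStar.isPrim_wronskian (hZ : IsSolStar A Q (Complex.I * θ) Z Z₁)
    (hY : IsSol A Q (Complex.I * ρ) Y Y₁) :
    IsPrim (fun t => Z₁ t * Y t - Z t * Y₁ t) fun t =>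
      (ρ - θ) • ((ρ + θ) • (Z t * Y t) + (2 * Complex.I) • (Z t * A t * Y t)) := by
  refine ((hZ.snd.fun_mul hY.fst).sub (hZ.fst.fun_mul hY.snd)).congr (fun _ _ => rfl) fun t _ => ?_
  simp only [sub_mul, mul_sub, smul_mul_assoc, mul_smul_comm, mul_pow, Complex.I_sq, mul_assoc]
  match_scalars <;> ring

theorem IsSolStar.wronskian_eq (hZ : IsSolStar A Q (Complex.I * ρ) Z Z₁)
    (hY : IsSol A Q (Complex.I * ρ) Y Y₁) {x : ℝ} (hx : 0 ≤ x) :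
    Z₁ x * Y x - Z x * Y₁ x = Z₁ 0 * Y 0 - Z 0 * Y₁ 0 :=
  ((hZ.isPrim_wronskian hY).congr (e' := fun _ => 0) (fun _ _ => rfl)
    fun t _ => by simp).eq_zero_apply hx

theorem IsSol.fun_add {σ : ℂ} (hY : IsSol A Q σ Y Y₁) (hZ : IsSol A Q σ Z Z₁) :
    IsSol A Q σ (fun t => Y t + Z t) (fun t => Y₁ t + Z₁ t) := by
  refine ⟨hY.fst.add hZ.fst, (hY.snd.add hZ.snd).congr (fun _ _ => rfl) fun t _ => ?_⟩
  simp only [mul_add, smul_add]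
  abel

/-- The right-hand sides of the equations are locally integrable. -/
theorem intervalIntegrable_rhs {f g h : ℝ → 𝒜} {T : ℝ} (c d : ℂ)
    (hf : IntervalIntegrable f volume 0 T) (hg : IntervalIntegrable g volume 0 T)
    (hh : IntervalIntegrable h volume 0 T) :
    IntervalIntegrable (fun t => c • f t - d • g t - h t) volume 0 T :=
  ((hf.smul c).sub (hg.smul d)).sub hh

end Wronskian

attribute [local instance] Matrix.linftyOpNormedRing Matrix.linftyOpNormedAlgebra

attribute [local instance] CMat.topology CMat.uniformity

variable {m : ℕ}

/-- Transposition as a continuous linear map. -/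
def transposeCLM (m : ℕ) : CMat m →L[ℂ] CMat m :=
  (Matrix.transposeLinearEquiv (Fin m) (Fin m) ℂ ℂ).toLinearMap.toContinuousLinearMap

theorem IsPrim.transpose {Y Y₁ : ℝ → CMat m} (h : IsPrim Y Y₁) :
    IsPrim (fun t => (Y t).transpose) fun t => (Y₁ t).transpose :=
  h.map ((transposeCLM m).restrictScalars ℝ)

theorem isSolStar_iff_transpose {A Q Z Z₁ : ℝ → CMat m} {σ : ℂ} :
    IsSolStar A Q σ Z Z₁ ↔ IsSol (fun t => (A t).transpose) (fun t => (Q t).transpose) σ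
      (fun t => (Z t).transpose) fun t => (Z₁ t).transpose := by
  constructor
  · intro h
    refine ⟨h.fst.transpose, h.snd.transpose.congr (fun _ _ => rfl) fun t _ => ?_⟩
    simp [Matrix.transpose_mul]
  · intro h
    refine ⟨h.fst.transpose.congr (fun _ _ => by simp) fun _ _ => by simp,
      h.snd.transpose.congr (fun _ _ => by simp) fun t _ => ?_⟩
    simp [Matrix.transpose_mul]

theorem continuousOn_Ici_of_absCont {F : Type*} [SeminormedAddCommGroup F]
    {f : ℝ → F}
    (h : ∀ T : ℝ, 0 < T → AbsolutelyContinuousOnInterval f 0 T) : ContinuousOn f (Ici 0) := by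
  intro x hx
  have hx0 : 0 ≤ x := hx
  have h1 := (h (x + 1) (by linarith)).continuousOn
  rw [uIcc_of_le (by linarith)] at h1
  refine (h1 x ⟨hx, by linarith⟩).mono_of_mem_nhdsWithin ?_
  rw [mem_nhdsWithin]
  exact ⟨Iio (x + 1), isOpen_Iio, by simp, fun y hy => ⟨hy.2, hy.1.le⟩⟩

theorem AbsolutelyContinuousOnInterval.ae_hasDerivAt {F : Type*} [NormedAddCommGroup F]
    [NormedSpace ℝ F] [FiniteDimensional ℝ F] {f : ℝ → F}
    (h : ∀ T : ℝ, 0 < T → AbsolutelyContinuousOnInterval f 0 T) :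
    ∀ᵐ x ∂(volume.restrict (Ioi (0 : ℝ))), HasDerivAt f (deriv f x) x := by
  rw [ae_restrict_iff' measurableSet_Ioi]
  have h1 : ∀ n : ℕ, ∀ᵐ x : ℝ, x ∈ uIcc (0 : ℝ) (n + 1) → DifferentiableAt ℝ f x := fun n =>
    (h (n + 1) (by positivity)).boundedVariationOn.ae_differentiableAt_of_mem_uIcc
  filter_upwards [ae_all_iff.2 h1] with x hx hx0
  obtain ⟨n, hn⟩ := exists_nat_ge x
  refine (hx n ?_).hasDerivAt
  rw [uIcc_of_le (by positivity)]
  exact ⟨(mem_Ioi.1 hx0).le, by linarith⟩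

/-- A primitive `Y` of `Y₁`, itself a primitive of `R`, solves `Y'' = R`. -/
theorem IsPrim.hasSecondDeriv {Y Y₁ R : ℝ → CMat m} (h : IsPrim Y Y₁) (h₁ : IsPrim Y₁ R) :
    HasSecondDeriv Y R ∧ ∀ x, 0 ≤ x → dHalf Y x = Y₁ x := by
  have hd : ∀ x, 0 ≤ x → HasDerivWithinAt Y (Y₁ x) (Ici 0) x := fun x hx =>
    h.hasDerivWithinAt h₁.continuousOn hx
  have he : ∀ x, 0 ≤ x → dHalf Y x = Y₁ x := fun x hx =>
    (hd x hx).derivWithin (uniqueDiffOn_Ici 0 x hx)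
  refine ⟨⟨fun x hx => (hd x hx).differentiableWithinAt, fun T hT => ?_, ?_⟩, he⟩
  · refine (h₁.absCont hT.le).of_dist_le (K := 1) fun x hx y hy => ?_
    rw [uIcc_of_le hT.le] at hx hy
    rw [he x hx.1, he y hy.1, one_mul]
  · rw [ae_restrict_iff' measurableSet_Ioi]
    have h2 := h₁.ae_hasDerivAt
    rw [ae_restrict_iff' measurableSet_Ioi] at h2
    filter_upwards [h2] with x hx hx0
    refine (hx hx0).congr_of_eventuallyEq ?_
    filter_upwards [Ioi_mem_nhds hx0] with y hy using he y (le_of_lt hy)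

theorem HasSecondDeriv.isPrim {Y R : ℝ → CMat m} (h : HasSecondDeriv Y R)
    (hR : ∀ T : ℝ, 0 ≤ T → IntervalIntegrable R volume 0 T) :
    IsPrim Y (dHalf Y) ∧ IsPrim (dHalf Y) R :=
  ⟨IsPrim.of_hasDerivWithinAt (continuousOn_Ici_of_absCont h.2.1)
    fun x hx => (h.1 x hx).hasDerivWithinAt, IsPrim.of_absCont h.2.1 hR h.2.2⟩

namespace Pencil

variable {L : Pencil m} {ρ : ℂ}

theorem ClassV.integrableCoeff (h : L.ClassV) : IntegrableCoeff L.Q₁ (deriv L.Q₁) L.Q₀ where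
  prim := IsPrim.of_absCont h.absCont (fun T hT => by
      rw [intervalIntegrable_iff_integrableOn_Ioc_of_le hT]
      exact h.integrable_deriv_Q₁.mono_set fun t ht => ht.1)
    (AbsolutelyContinuousOnInterval.ae_hasDerivAt h.absCont)
  int := h.integrable_Q₁
  int_deriv := h.integrable_deriv_Q₁
  int_pot := h.integrable_Q₀

/-- The transposed pencil. -/
def transpose (L : Pencil m) : Pencil m where
  Q₀ t := (L.Q₀ t).transpose
  Q₁ t := (L.Q₁ t).transpose
  h₀ := L.h₀.transpose
  h₁ := L.h₁.transpose

theorem deriv_transpose (f : ℝ → CMat m) (x : ℝ) :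
    deriv (fun t => (f t).transpose) x = (deriv f x).transpose := by
  by_cases hf : DifferentiableAt ℝ f x
  · exact (((transposeCLM m).restrictScalars ℝ).hasFDerivAt.comp_hasDerivAt x hf.hasDerivAt).deriv
  · rw [deriv_zero_of_not_differentiableAt hf, deriv_zero_of_not_differentiableAt]
    · simp
    · intro h
      exact hf (((transposeCLM m).restrictScalars ℝ).differentiableAt.comp x h)

theorem ClassV.transpose (h : L.ClassV) : L.transpose.ClassV where
  absCont T hT := by
    have h1 := (h.integrableCoeff.prim.transpose).absCont hT.le
    exact h1
  integrable_Q₀ := (transposeCLM m).integrable_comp h.integrable_Q₀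
  integrable_Q₁ := (transposeCLM m).integrable_comp h.integrable_Q₁
  integrable_deriv_Q₁ := by
    have h1 := (transposeCLM m).integrable_comp h.integrable_deriv_Q₁
    refine h1.congr (.of_forall fun t => ?_)
    exact (deriv_transpose L.Q₁ t).symm

theorem ClassV.isSol (h : L.ClassV) {Y : ℝ → CMat m} (hY : L.IsSolution ρ Y) :
    IsSol L.Q₁ L.Q₀ (Complex.I * ρ) Y (dHalf Y) := by
  have hc := h.integrableCoeff
  have hYc : ContinuousOn Y (Ici 0) := hY.1.continuousOn
  have e : ∀ t, -(L.coeff ρ t * Y t) = (Complex.I * ρ) ^ 2 • Y t -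
      (2 * (Complex.I * ρ)) • (L.Q₁ t * Y t) - L.Q₀ t * Y t := fun t => by
    simp only [coeff, add_mul, smul_mul_assoc, one_mul, mul_pow, Complex.I_sq]
    module
  have h1 := HasSecondDeriv.isPrim hY fun T hT => by
    simp only [e]
    have hYT : ContinuousOn Y (uIcc 0 T) := hYc.mono (by rw [uIcc_of_le hT]; exact fun t ht => ht.1)
    obtain ⟨i1, i2⟩ := hc.intervalIntegrable le_rfl hT
    exact intervalIntegrable_rhs _ _ hYT.intervalIntegrable (i1.mul_continuousOn hYT)
      (i2.mul_continuousOn hYT)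
  exact ⟨h1.1, h1.2.congr (fun _ _ => rfl) fun t _ => (e t).symm⟩

theorem isSolution_of_isSol {Y Y₁ : ℝ → CMat m} (h : IsSol L.Q₁ L.Q₀ (Complex.I * ρ) Y Y₁) :
    L.IsSolution ρ Y ∧ ∀ x, 0 ≤ x → dHalf Y x = Y₁ x := by
  refine h.fst.hasSecondDeriv (h.snd.congr (fun _ _ => rfl) fun t _ => ?_)
  simp only [coeff, add_mul, smul_mul_assoc, one_mul, mul_pow, Complex.I_sq]
  module

theorem ClassV.isSolStar (h : L.ClassV) {Z : ℝ → CMat m} (hZ : L.IsSolutionStar ρ Z) :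
    IsSolStar L.Q₁ L.Q₀ (Complex.I * ρ) Z (dHalf Z) := by
  have hc := h.integrableCoeff
  have hZc : ContinuousOn Z (Ici 0) := hZ.1.continuousOn
  have e : ∀ t, -(Z t * L.coeff ρ t) = (Complex.I * ρ) ^ 2 • Z t -
      (2 * (Complex.I * ρ)) • (Z t * L.Q₁ t) - Z t * L.Q₀ t := fun t => by
    simp only [coeff, mul_add, mul_smul_comm, mul_one, mul_pow, Complex.I_sq]
    module
  have h1 := HasSecondDeriv.isPrim hZ fun T hT => by
    simp only [e]
    have hZT : ContinuousOn Z (uIcc 0 T) := hZc.mono (by rw [uIcc_of_le hT]; exact fun t ht => ht.1)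
    obtain ⟨i1, i2⟩ := hc.intervalIntegrable le_rfl hT
    exact intervalIntegrable_rhs _ _ hZT.intervalIntegrable (i1.continuousOn_mul hZT)
      (i2.continuousOn_mul hZT)
  exact ⟨h1.1, h1.2.congr (fun _ _ => rfl) fun t _ => (e t).symm⟩

theorem isSolutionStar_of_isSolStar {Z Z₁ : ℝ → CMat m}
    (h : IsSolStar L.Q₁ L.Q₀ (Complex.I * ρ) Z Z₁) :
    L.IsSolutionStar ρ Z ∧ ∀ x, 0 ≤ x → dHalf Z x = Z₁ x := by
  refine h.fst.hasSecondDeriv (h.snd.congr (fun _ _ => rfl) fun t _ => ?_)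
  simp only [coeff, mul_add, mul_smul_comm, mul_one, mul_pow, Complex.I_sq]
  module

/-- The coefficient `i ρ h₁ + h₀` of the boundary form. -/
def bc (L : Pencil m) (ρ : ℂ) : CMat m := (Complex.I * ρ) • L.h₁ + L.h₀

theorem differentiable_bc (L : Pencil m) : Differentiable ℂ L.bc := by
  unfold bc; fun_prop

/-- The solution with the initial values `0`, `I`. -/
def sine (L : Pencil m) (ρ : ℂ) : ℝ → CMat m :=
  Classical.epsilon fun Y => L.IsSolution ρ Y ∧ Y 0 = 0 ∧ dHalf Y 0 = 1

theorem ClassV.exists_isSolution (h : L.ClassV) (ρ : ℂ) (a b : CMat m) :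
    ∃ Y, L.IsSolution ρ Y ∧ Y 0 = a ∧ dHalf Y 0 = b := by
  obtain ⟨Y, Y₁, h1, -⟩ := exists_isSol_entire h.integrableCoeff
    (a := fun _ => a) (b := fun _ => b) (by fun_prop) (by fun_prop)
  obtain ⟨h2, h3, h4⟩ := h1 (Complex.I * ρ)
  obtain ⟨h5, h6⟩ := isSolution_of_isSol h2
  exact ⟨_, h5, h3, by rw [h6 0 le_rfl, h4]⟩

theorem ClassV.phi_spec (h : L.ClassV) (ρ : ℂ) :
    IsSol L.Q₁ L.Q₀ (Complex.I * ρ) (L.phi ρ) (dHalf (L.phi ρ)) ∧ L.phi ρ 0 = 1 ∧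
      dHalf (L.phi ρ) 0 = -L.bc ρ := by
  obtain ⟨Y, h1, h2, h3⟩ := h.exists_isSolution ρ 1 (-L.bc ρ)
  obtain ⟨e1, e2, e3⟩ := Classical.epsilon_spec
    (p := fun Y => L.IsSolution ρ Y ∧ Y 0 = 1 ∧ L.U ρ Y = 0)
    ⟨Y, h1, h2, by simp [U, h2, h3, bc]⟩
  refine ⟨h.isSol e1, e2, ?_⟩
  change L.phi ρ 0 = 1 at e2
  change dHalf (L.phi ρ) 0 + _ * L.phi ρ 0 = 0 at e3
  rw [e2, mul_one] at e3
  exact eq_neg_of_add_eq_zero_left e3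

theorem ClassV.sine_spec (h : L.ClassV) (ρ : ℂ) :
    IsSol L.Q₁ L.Q₀ (Complex.I * ρ) (L.sine ρ) (dHalf (L.sine ρ)) ∧ L.sine ρ 0 = 0 ∧
      dHalf (L.sine ρ) 0 = 1 := by
  obtain ⟨e1, e2, e3⟩ := Classical.epsilon_spec
    (p := fun Y => L.IsSolution ρ Y ∧ Y 0 = 0 ∧ dHalf Y 0 = 1) (h.exists_isSolution ρ 0 1)
  exact ⟨h.isSol e1, e2, e3⟩

/-- Solutions whose initial values are entire in `ρ` are entire in `ρ`. -/
theorem ClassV.differentiable_of_initial (h : L.ClassV) {a b : ℂ → CMat m}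
    (ha : Differentiable ℂ a) (hb : Differentiable ℂ b) {Y Y₁ : ℂ → ℝ → CMat m}
    (hY : ∀ ρ, IsSol L.Q₁ L.Q₀ (Complex.I * ρ) (Y ρ) (Y₁ ρ) ∧ Y ρ 0 = a ρ ∧ Y₁ ρ 0 = b ρ)
    {x : ℝ} (hx : 0 ≤ x) :
    (Differentiable ℂ fun ρ => Y ρ x) ∧ Differentiable ℂ fun ρ => Y₁ ρ x := by
  obtain ⟨W, W₁, h1, h2⟩ := exists_isSol_entire h.integrableCoeff
    (a := fun σ => a (-Complex.I * σ)) (b := fun σ => b (-Complex.I * σ))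
    (ha.comp (by fun_prop)) (hb.comp (by fun_prop))
  have e0 : ∀ ρ : ℂ, -Complex.I * (Complex.I * ρ) = ρ := fun ρ => by
    rw [← mul_assoc]; simp
  have e : ∀ ρ, Y ρ x = W (Complex.I * ρ) x ∧ Y₁ ρ x = W₁ (Complex.I * ρ) x := fun ρ => by
    obtain ⟨g1, g2, g3⟩ := hY ρ
    obtain ⟨k1, k2, k3⟩ := h1 (Complex.I * ρ)
    exact g1.eq_of_initial h.integrableCoeff k1 (by rw [g2, k2, e0]) (by rw [g3, k3, e0]) hx
  obtain ⟨d1, d2⟩ := h2 x hx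
  constructor
  · rw [funext fun ρ => (e ρ).1]
    exact d1.comp (by fun_prop)
  · rw [funext fun ρ => (e ρ).2]
    exact d2.comp (by fun_prop)

theorem ClassV.differentiable_phi (h : L.ClassV) {x : ℝ} (hx : 0 ≤ x) :
    (Differentiable ℂ fun ρ => L.phi ρ x) ∧ Differentiable ℂ fun ρ => dHalf (L.phi ρ) x :=
  h.differentiable_of_initial (a := fun _ => 1) (by fun_prop) L.differentiable_bc.neg h.phi_spec hx

theorem ClassV.differentiable_sine (h : L.ClassV) {x : ℝ} (hx : 0 ≤ x) :
    (Differentiable ℂ fun ρ => L.sine ρ x) ∧ Differentiable ℂ fun ρ => dHalf (L.sine ρ) x :=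
  h.differentiable_of_initial (a := fun _ => 0) (b := fun _ => 1) (by fun_prop) (by fun_prop)
    h.sine_spec hx

theorem transpose_bc (L : Pencil m) (ρ : ℂ) : (L.transpose.bc ρ).transpose = L.bc ρ := by
  simp [bc, Pencil.transpose]

/-- `φ*` is the transpose of the solution `φ` of the transposed pencil. -/
theorem ClassV.phiStar_eq (h : L.ClassV) (ρ : ℂ) {x : ℝ} (hx : 0 ≤ x) :
    L.phiStar ρ x = (L.transpose.phi ρ x).transpose ∧
      dHalf (L.phiStar ρ) x = (dHalf (L.transpose.phi ρ) x).transpose := by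
  obtain ⟨p1, p2, p3⟩ := h.transpose.phi_spec ρ
  have hs : IsSolStar L.Q₁ L.Q₀ (Complex.I * ρ) (fun t => (L.transpose.phi ρ t).transpose)
      fun t => (dHalf (L.transpose.phi ρ) t).transpose := by
    rw [isSolStar_iff_transpose]
    simpa [Pencil.transpose] using! p1
  obtain ⟨s1, s2⟩ := isSolutionStar_of_isSolStar hs
  obtain ⟨e1, e2, e3⟩ := Classical.epsilon_spec
    (p := fun Z => L.IsSolutionStar ρ Z ∧ Z 0 = 1 ∧ L.UStar ρ Z = 0)
    ⟨_, s1, by simp [p2], by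
      rw [UStar, s2 0 le_rfl, p2, p3]
      simp [bc, Pencil.transpose]⟩
  change L.IsSolutionStar ρ (L.phiStar ρ) at e1
  change L.phiStar ρ 0 = 1 at e2
  change dHalf (L.phiStar ρ) 0 + L.phiStar ρ 0 * _ = 0 at e3
  rw [e2, one_mul] at e3
  have e4 := isSolStar_iff_transpose.1 (h.isSolStar e1)
  have := e4.eq_of_initial h.transpose.integrableCoeff p1 (by simp [e2, p2])
    (by rw [eq_neg_of_add_eq_zero_left e3, p3]; simp [bc, Pencil.transpose]) hx
  exact ⟨by rw [← this.1, Matrix.transpose_transpose],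
    by rw [← this.2, Matrix.transpose_transpose]⟩

/-- The star solution with the initial values `0`, `I`. -/
def sineStar (L : Pencil m) (ρ : ℂ) (x : ℝ) : CMat m := (L.transpose.sine ρ x).transpose

theorem ClassV.dHalf_sineStar (h : L.ClassV) (ρ : ℂ) {x : ℝ} (hx : 0 ≤ x) :
    dHalf (L.sineStar ρ) x = (dHalf (L.transpose.sine ρ) x).transpose := by
  have := (h.transpose.sine_spec ρ).1
  exact (this.fst.transpose.hasSecondDeriv this.snd.transpose).2 x hx

theorem ClassV.sineStar_spec (h : L.ClassV) (ρ : ℂ) :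
    IsSolStar L.Q₁ L.Q₀ (Complex.I * ρ) (L.sineStar ρ) (dHalf (L.sineStar ρ)) ∧
      L.sineStar ρ 0 = 0 ∧ dHalf (L.sineStar ρ) 0 = 1 := by
  obtain ⟨p1, p2, p3⟩ := h.transpose.sine_spec ρ
  have hs : IsSolStar L.Q₁ L.Q₀ (Complex.I * ρ) (L.sineStar ρ)
      fun t => (dHalf (L.transpose.sine ρ) t).transpose := by
    rw [isSolStar_iff_transpose]
    simpa [sineStar, Pencil.transpose] using! p1
  exact ⟨h.isSolStar (isSolutionStar_of_isSolStar hs).1, by simp [sineStar, p2],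
    by simp [h.dHalf_sineStar ρ le_rfl, p3]⟩

theorem ClassV.phiStar_spec (h : L.ClassV) (ρ : ℂ) :
    IsSolStar L.Q₁ L.Q₀ (Complex.I * ρ) (L.phiStar ρ) (dHalf (L.phiStar ρ)) ∧
      L.phiStar ρ 0 = 1 ∧ dHalf (L.phiStar ρ) 0 = -L.bc ρ := by
  obtain ⟨p1, p2, p3⟩ := h.transpose.phi_spec ρ
  refine ⟨?_, by rw [(h.phiStar_eq ρ le_rfl).1, p2]; simp,
    by rw [(h.phiStar_eq ρ le_rfl).2, p3]; simp [transpose_bc]⟩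
  rw [isSolStar_iff_transpose]
  refine ⟨p1.fst.congr (fun x hx => ?_) fun x hx => ?_,
    p1.snd.congr (fun x hx => ?_) fun x hx => ?_⟩
  all_goals simp [h.phiStar_eq ρ hx, Pencil.transpose]

theorem differentiable_transpose {f : ℂ → CMat m} (h : Differentiable ℂ f) :
    Differentiable ℂ fun z => (f z).transpose :=
  (transposeCLM m).differentiable.comp h

theorem ClassV.differentiable_phiStar (h : L.ClassV) {x : ℝ} (hx : 0 ≤ x) :
    (Differentiable ℂ fun ρ => L.phiStar ρ x) ∧
      Differentiable ℂ fun ρ => dHalf (L.phiStar ρ) x := by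
  obtain ⟨h1, h2⟩ := h.transpose.differentiable_phi hx
  constructor
  · rw [funext fun ρ => (h.phiStar_eq ρ hx).1]
    exact differentiable_transpose h1
  · rw [funext fun ρ => (h.phiStar_eq ρ hx).2]
    exact differentiable_transpose h2

theorem ClassV.differentiable_sineStar (h : L.ClassV) {x : ℝ} (hx : 0 ≤ x) :
    (Differentiable ℂ fun ρ => L.sineStar ρ x) ∧
      Differentiable ℂ fun ρ => dHalf (L.sineStar ρ) x := by
  obtain ⟨h1, h2⟩ := h.transpose.differentiable_sine hx
  refine ⟨differentiable_transpose h1, ?_⟩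
  rw [funext fun ρ => h.dHalf_sineStar ρ hx]
  exact differentiable_transpose h2

/-- The matrix of a fundamental system is inverse to that of the fundamental system of star
solutions. -/
theorem ClassV.fundamental_inverse (h : L.ClassV) (ρ : ℂ) {x : ℝ} (hx : 0 ≤ x) :
    (dHalf (L.sineStar ρ) x * L.phi ρ x - L.sineStar ρ x * dHalf (L.phi ρ) x = 1 ∧
      dHalf (L.phiStar ρ) x * L.phi ρ x - L.phiStar ρ x * dHalf (L.phi ρ) x = 0) ∧
    (L.phi ρ x * dHalf (L.sineStar ρ) x - L.sine ρ x * dHalf (L.phiStar ρ) x = 1 ∧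
      L.sine ρ x * L.phiStar ρ x - L.phi ρ x * L.sineStar ρ x = 0 ∧
      dHalf (L.phi ρ) x * dHalf (L.sineStar ρ) x - dHalf (L.sine ρ) x * dHalf (L.phiStar ρ) x = 0 ∧
      dHalf (L.sine ρ) x * L.phiStar ρ x - dHalf (L.phi ρ) x * L.sineStar ρ x = 1) := by
  obtain ⟨f1, f2, f3⟩ := h.phi_spec ρ
  obtain ⟨s1, s2, s3⟩ := h.sine_spec ρ
  obtain ⟨g1, g2, g3⟩ := h.phiStar_spec ρ
  obtain ⟨t1, t2, t3⟩ := h.sineStar_spec ρ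
  have w1 := t1.wronskian_eq f1 hx
  have w2 := t1.wronskian_eq s1 hx
  have w3 := g1.wronskian_eq f1 hx
  have w4 := g1.wronskian_eq s1 hx
  rw [t3, t2, f2, f3] at w1
  rw [t3, t2, s2, s3] at w2
  rw [g3, g2, f2, f3] at w3
  rw [g3, g2, s2, s3] at w4
  simp only [one_mul, mul_one, zero_mul, mul_zero, sub_zero, sub_self,
    zero_sub] at w1 w2 w3 w4
  refine ⟨⟨w1, w3⟩, ?_⟩
  have hmul : Matrix.fromBlocks (dHalf (L.sineStar ρ) x) (-L.sineStar ρ x)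
      (-dHalf (L.phiStar ρ) x) (L.phiStar ρ x) *
      Matrix.fromBlocks (L.phi ρ x) (L.sine ρ x) (dHalf (L.phi ρ) x) (dHalf (L.sine ρ) x) = 1 := by
    rw [Matrix.fromBlocks_multiply, ← Matrix.fromBlocks_one]
    congr 1
    · rw [neg_mul, ← sub_eq_add_neg, w1]
    · rw [neg_mul, ← sub_eq_add_neg, w2]
    · rw [neg_mul, neg_add_eq_sub, ← neg_sub, w3, neg_zero]
    · rw [neg_mul, neg_add_eq_sub, ← neg_sub, w4, neg_neg]
  rw [mul_eq_one_comm, Matrix.fromBlocks_multiply, ← Matrix.fromBlocks_one,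
    Matrix.fromBlocks_inj] at hmul
  obtain ⟨k1, k2, k3, k4⟩ := hmul
  simp only [mul_neg] at k1 k2 k3 k4
  refine ⟨?_, ?_, ?_, ?_⟩
  · rw [sub_eq_add_neg, k1]
  · rw [sub_eq_neg_add, k2]
  · rw [sub_eq_add_neg, k3]
  · rw [sub_eq_neg_add, k4]

end Pencil

/-! ### The matrices `P` and `P*` -/

section TransportExistence

variable {𝒜 : Type*} [NormedRing 𝒜] [NormedAlgebra ℂ 𝒜] [CompleteSpace 𝒜]
variable {A A' Q : ℝ → 𝒜}

/-- The equation `P' = c B(A(t)) P`, where `B` is left or right multiplication. -/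
theorem IntegrableCoeff.exists_linear (h : IntegrableCoeff A A' Q) (B : 𝒜 →L[ℂ] 𝒜 →L[ℂ] 𝒜)
    (c : ℝ) :
    (∃ P : ℝ → 𝒜, P 0 = 1 ∧ ∀ x, 0 ≤ x → HasDerivWithinAt P (c • B (A x) (P x)) (Ici 0) x) ∧
    ∃ C, 0 ≤ C ∧ ∀ P : ℝ → 𝒜, P 0 = 1 →
      (∀ x, 0 ≤ x → HasDerivWithinAt P (c • B (A x) (P x)) (Ici 0) x) →
      IsPrim P (fun t => c • B (A t) (P t)) ∧ ∀ x, 0 ≤ x → ‖P x‖ ≤ C := by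
  have hB : ContinuousOn (fun x => B (A x)) (Ici 0) :=
    B.continuous.comp_continuousOn h.prim.continuousOn
  have hc : ContinuousOn (fun x => (c : ℂ) • B (A x)) (Ici 0) := hB.const_smul (c : ℂ)
  have hi : IntegrableOn (fun x => (c : ℂ) • B (A x)) (Ioi 0) :=
    (B.integrable_comp h.int).smul (c : ℂ)
  have e : ∀ (x : ℝ) (P : 𝒜), ((c : ℂ) • B (A x)) P = c • B (A x) P := fun x P => by simp
  obtain ⟨P, h0, h1⟩ := exists_linear_solution hc hi
  simp only [e] at h1
  refine ⟨⟨P, h0, h1⟩, ‖(1 : 𝒜)‖ * Real.exp (∫ t in Ioi 0, ‖(c : ℂ) • B (A t)‖), by positivity,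
    fun P h0 h1 => ?_⟩
  have hPc : ContinuousOn P (Ici 0) := fun x hx => (h1 x hx).continuousWithinAt
  have hp : IsPrim P fun t => c • B (A t) (P t) := by
    refine IsPrim.of_hasDerivWithinAt ?_ h1
    have := hc.clm_apply hPc
    simpa only [e] using this
  refine ⟨hp, fun x hx => ?_⟩
  rw [← h0]
  refine norm_le_of_linear_of_integrable hi ?_ hx
  simpa only [e] using hp

end TransportExistence

namespace Pencil

variable {L : Pencil m} {ρ : ℂ}

theorem ClassV.P_spec (h : L.ClassV) (s : Side) : L.P s 0 = 1 ∧
    ∀ x : ℝ, 0 ≤ x → HasDerivWithinAt (L.P s) (s.sign • (L.Q₁ x * L.P s x)) (Ici 0) x :=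
  Classical.epsilon_spec (p := fun P : ℝ → CMat m => P 0 = 1 ∧
    ∀ x : ℝ, 0 ≤ x → HasDerivWithinAt P (s.sign • (L.Q₁ x * P x)) (Ici 0) x)
    (h.integrableCoeff.exists_linear (ContinuousLinearMap.mul ℂ (CMat m)) s.sign).1

theorem ClassV.PStar_spec (h : L.ClassV) (s : Side) : L.PStar s 0 = 1 ∧
    ∀ x : ℝ, 0 ≤ x → HasDerivWithinAt (L.PStar s) (s.sign • (L.PStar s x * L.Q₁ x)) (Ici 0) x :=
  Classical.epsilon_spec (p := fun P : ℝ → CMat m => P 0 = 1 ∧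
    ∀ x : ℝ, 0 ≤ x → HasDerivWithinAt P (s.sign • (P x * L.Q₁ x)) (Ici 0) x)
    (h.integrableCoeff.exists_linear (ContinuousLinearMap.mul ℂ (CMat m)).flip s.sign).1

theorem ClassV.isPrim_P (h : L.ClassV) (s : Side) :
    IsPrim (L.P s) (fun t => s.sign • (L.Q₁ t * L.P s t)) := by
  obtain ⟨-, C, -, hC⟩ :=
    h.integrableCoeff.exists_linear (ContinuousLinearMap.mul ℂ (CMat m)) s.sign
  exact (hC _ (h.P_spec s).1 (h.P_spec s).2).1

theorem ClassV.isPrim_PStar (h : L.ClassV) (s : Side) :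
    IsPrim (L.PStar s) (fun t => s.sign • (L.PStar s t * L.Q₁ t)) := by
  obtain ⟨-, C, -, hC⟩ :=
    h.integrableCoeff.exists_linear (ContinuousLinearMap.mul ℂ (CMat m)).flip s.sign
  exact (hC _ (h.PStar_spec s).1 (h.PStar_spec s).2).1

theorem ClassV.exists_bound_P (h : L.ClassV) :
    ∃ C, ∀ s, ∀ x, 0 ≤ x → ‖L.P s x‖ ≤ C ∧ ‖L.PStar s x‖ ≤ C := by
  have h1 : ∀ s, ∃ C, 0 ≤ C ∧ ∀ x, 0 ≤ x → ‖L.P s x‖ ≤ C ∧ ‖L.PStar s x‖ ≤ C := fun s => by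
    obtain ⟨-, C, hC0, hC⟩ :=
      h.integrableCoeff.exists_linear (ContinuousLinearMap.mul ℂ (CMat m)) s.sign
    obtain ⟨-, D, hD0, hD⟩ :=
      h.integrableCoeff.exists_linear (ContinuousLinearMap.mul ℂ (CMat m)).flip s.sign
    refine ⟨C + D, by positivity, fun x hx => ⟨?_, ?_⟩⟩
    · linarith [(hC _ (h.P_spec s).1 (h.P_spec s).2).2 x hx]
    · linarith [(hD _ (h.PStar_spec s).1 (h.PStar_spec s).2).2 x hx]
  obtain ⟨C, hC0, hC⟩ := h1 Side.plus
  obtain ⟨D, hD0, hD⟩ := h1 Side.minus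
  refine ⟨C + D, fun s x hx => ?_⟩
  cases s
  · exact ⟨by linarith [(hC x hx).1], by linarith [(hC x hx).2]⟩
  · exact ⟨by linarith [(hD x hx).1], by linarith [(hD x hx).2]⟩

/-- The opposite sign. -/
def _root_.Side.opp : Side → Side
  | Side.plus => Side.minus
  | Side.minus => Side.plus

@[simp]
theorem _root_.Side.sign_opp (s : Side) : s.opp.sign = -s.sign := by
  cases s <;> simp [Side.opp, Side.sign]

@[simp]
theorem _root_.Side.opp_opp (s : Side) : s.opp.opp = s := by cases s <;> rfl

theorem ClassV.PStar_mul_P (h : L.ClassV) (s : Side) {x : ℝ} (hx : 0 ≤ x) :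
    L.PStar s.opp x * L.P s x = 1 := by
  have h1 := ((h.isPrim_PStar s.opp).fun_mul (h.isPrim_P s)).congr (e' := fun _ => 0)
    (fun _ _ => rfl) fun t _ => by simp [mul_assoc]
  rw [h1.eq_zero_apply hx, (h.P_spec s).1, (h.PStar_spec s.opp).1, one_mul]

theorem ClassV.P_mul_PStar (h : L.ClassV) (s : Side) {x : ℝ} (hx : 0 ≤ x) :
    L.P s x * L.PStar s.opp x = 1 := by
  rw [mul_eq_one_comm, h.PStar_mul_P s hx]

theorem ClassV.exists_transport (h : L.ClassV) : ∃ C, Transport L.Q₁ (L.P Side.plus)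
    (L.P Side.minus) (L.PStar Side.plus) (L.PStar Side.minus) C := by
  obtain ⟨C, hC⟩ := h.exists_bound_P
  refine ⟨C, ⟨?_, ?_, (h.PStar_spec _).1, (h.PStar_spec _).1, fun t ht => ?_, fun t ht => ?_,
    fun t ht => ⟨(hC _ t ht).1, (hC _ t ht).1, (hC _ t ht).2, (hC _ t ht).2⟩⟩⟩
  · exact (h.isPrim_PStar Side.plus).congr (fun _ _ => rfl) fun t _ => by simp [Side.sign]
  · exact (h.isPrim_PStar Side.minus).congr (fun _ _ => rfl) fun t _ => by simp [Side.sign]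
  · exact h.P_mul_PStar Side.minus ht
  · exact h.P_mul_PStar Side.plus ht

/-- `P_±` of the transposed pencil is the transpose of `P*_±`: both are inverse to the transpose
of `P_∓`. -/
theorem ClassV.transpose_P (h : L.ClassV) (s : Side) {x : ℝ} (hx : 0 ≤ x) :
    (L.transpose.P s x).transpose = L.PStar s x := by
  have h1 := ((h.transpose.isPrim_P s).transpose.fun_mul (h.isPrim_P s.opp)).congr
    (e' := fun _ => 0) (fun _ _ => rfl) fun t _ => by
      simp [mul_assoc, Pencil.transpose, Matrix.transpose_mul]
  have h2 : (L.transpose.P s x).transpose * L.P s.opp x = 1 := by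
    rw [h1.eq_zero_apply hx, (h.P_spec _).1, (h.transpose.P_spec s).1]
    simp
  have h3 := h.P_mul_PStar s.opp hx
  rw [Side.opp_opp] at h3
  rw [← mul_one (L.transpose.P s x).transpose, ← h3, ← mul_assoc, h2, one_mul]

/-! ### The reflection `ρ ↦ -ρ` -/

/-- The pencil `L` with the parameter `-ρ`. It exchanges the two half-planes. -/
def reflect (L : Pencil m) : Pencil m where
  Q₀ := L.Q₀
  Q₁ t := -L.Q₁ t
  h₀ := L.h₀
  h₁ := -L.h₁

theorem reflect_coeff (L : Pencil m) (ρ : ℂ) : L.reflect.coeff (-ρ) = L.coeff ρ := by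
  funext x
  simp [coeff, reflect]

theorem reflect_isSolution (L : Pencil m) (ρ : ℂ) : L.reflect.IsSolution (-ρ) = L.IsSolution ρ := by
  funext Y
  simp only [IsSolution, reflect_coeff]

theorem reflect_isSolutionStar (L : Pencil m) (ρ : ℂ) :
    L.reflect.IsSolutionStar (-ρ) = L.IsSolutionStar ρ := by
  funext Y
  simp only [IsSolutionStar, reflect_coeff]

theorem reflect_U (L : Pencil m) (ρ : ℂ) : L.reflect.U (-ρ) = L.U ρ := by
  funext Y
  simp [U, reflect]

theorem reflect_UStar (L : Pencil m) (ρ : ℂ) : L.reflect.UStar (-ρ) = L.UStar ρ := by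
  funext Y
  simp [UStar, reflect]

theorem reflect_phi (L : Pencil m) (ρ : ℂ) : L.reflect.phi (-ρ) = L.phi ρ := by
  simp only [phi, reflect_isSolution, reflect_U]

theorem reflect_phiStar (L : Pencil m) (ρ : ℂ) : L.reflect.phiStar (-ρ) = L.phiStar ρ := by
  simp only [phiStar, reflect_isSolutionStar, reflect_UStar]

theorem _root_.neg_mem_halfPlane {s : Side} {ρ : ℂ} :
    -ρ ∈ halfPlane s ↔ ρ ∈ halfPlane s.opp := by
  simp [halfPlane]

theorem reflect_isWeylSolution (L : Pencil m) (ρ : ℂ) :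
    L.reflect.IsWeylSolution (-ρ) = L.IsWeylSolution ρ := by
  funext Φ
  simp only [IsWeylSolution, reflect_isSolution, reflect_U, eq_iff_iff]
  refine and_congr_right fun _ => and_congr_right fun _ => ?_
  have key : ∀ s : Side, (-ρ ∈ halfPlane s ∧ Φ =O[atTop] fun x : ℝ =>
      Complex.exp (s.sign * Complex.I * (-ρ) * x)) ↔ (ρ ∈ halfPlane s.opp ∧
      Φ =O[atTop] fun x : ℝ => Complex.exp (s.opp.sign * Complex.I * ρ * x)) := fun s => by
    rw [neg_mem_halfPlane]
    simp
  constructor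
  · rintro ⟨s, hs⟩
    exact ⟨s.opp, (key s).1 hs⟩
  · rintro ⟨s, hs⟩
    refine ⟨s.opp, (key s.opp).2 ?_⟩
    rwa [Side.opp_opp]

theorem reflect_weylMatrix (L : Pencil m) (ρ : ℂ) :
    L.reflect.weylMatrix (-ρ) = L.weylMatrix ρ := by
  simp only [weylMatrix, reflect_isWeylSolution]

theorem _root_.map_neg_nhdsWithin_halfPlane (s : Side) (ρ : ℂ) :
    map Neg.neg (𝓝[halfPlane s] ρ) = 𝓝[halfPlane s.opp] (-ρ) := by
  have h1 := (Homeomorph.neg ℂ).isEmbedding.map_nhdsWithin_eq (halfPlane s) ρ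
  have h2 : Homeomorph.neg ℂ '' halfPlane s = halfPlane s.opp := by
    ext w
    simp only [Homeomorph.coe_neg, image_neg_eq_neg, Set.mem_neg, neg_mem_halfPlane]
  rw [h2] at h1
  simpa using! h1

theorem reflect_singularSet (L : Pencil m) (s : Side) (ρ : ℂ) :
    -ρ ∈ L.reflect.singularSet s ↔ ρ ∈ L.singularSet s.opp := by
  have hm : 𝓝[halfPlane s] (-ρ) = map Neg.neg (𝓝[halfPlane s.opp] ρ) := by
    rw [map_neg_nhdsWithin_halfPlane, Side.opp_opp]
  have hcl : -ρ ∈ closure (halfPlane s) ↔ ρ ∈ closure (halfPlane s.opp) := by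
    rw [mem_closure_iff_nhdsWithin_neBot, mem_closure_iff_nhdsWithin_neBot, hm,
      Filter.map_neBot_iff]
  simp only [singularSet, Set.mem_ofPred_eq, hcl, hm, Filter.eventually_map, reflect_isWeylSolution]
  simp only [Tendsto, Filter.map_map, show L.reflect.weylMatrix ∘ Neg.neg = L.weylMatrix from
    funext fun ρ => L.reflect_weylMatrix ρ]

theorem ClassV.reflect (h : L.ClassV) : L.reflect.ClassV where
  absCont T hT := (h.absCont T hT).neg
  integrable_Q₀ := h.integrable_Q₀
  integrable_Q₁ := h.integrable_Q₁.neg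
  integrable_deriv_Q₁ := by
    refine h.integrable_deriv_Q₁.neg.congr (.of_forall fun t => ?_)
    exact (deriv.fun_neg (f := L.Q₁) (x := t)).symm

theorem NonRegge.reflect (h : L.NonRegge) : L.reflect.NonRegge := by
  obtain ⟨h1, h2⟩ := h
  refine ⟨?_, ?_⟩
  · simpa [Pencil.reflect, ← sub_eq_add_neg] using h2
  · simpa [Pencil.reflect] using h1

theorem reflect_P (L : Pencil m) (s : Side) : L.reflect.P s = L.P s.opp := by
  simp [P, Pencil.reflect]

theorem reflect_PStar (L : Pencil m) (s : Side) : L.reflect.PStar s = L.PStar s.opp := by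
  simp [PStar, Pencil.reflect]

theorem reflect_Omega (L Lt : Pencil m) (x : ℝ) : Omega L.reflect Lt.reflect x = Omega L Lt x := by
  simp [Omega, reflect_P, reflect_PStar, Side.opp, add_comm]

/-! ### Weyl solutions in the upper half-plane -/

/-- The Weyl solution `S + φ M`, defined by its initial values. -/
def weylSol (L : Pencil m) (ρ : ℂ) (x : ℝ) : CMat m := L.sine ρ x + L.phi ρ x * L.weylMatrix ρ

/-- The derivative of `weylSol`. -/
def weylSolDeriv (L : Pencil m) (ρ : ℂ) (x : ℝ) : CMat m :=
  dHalf (L.sine ρ) x + dHalf (L.phi ρ) x * L.weylMatrix ρ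

/-- The Weyl solution `S* + M φ*` of the star equation. -/
def weylStar (L : Pencil m) (ρ : ℂ) (x : ℝ) : CMat m :=
  L.sineStar ρ x + L.weylMatrix ρ * L.phiStar ρ x

/-- The derivative of `weylStar`. -/
def weylStarDeriv (L : Pencil m) (ρ : ℂ) (x : ℝ) : CMat m :=
  dHalf (L.sineStar ρ) x + L.weylMatrix ρ * dHalf (L.phiStar ρ) x

theorem ClassV.isSol_weylSol (h : L.ClassV) (ρ : ℂ) :
    IsSol L.Q₁ L.Q₀ (Complex.I * ρ) (L.weylSol ρ) (L.weylSolDeriv ρ) ∧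
      L.weylSol ρ 0 = L.weylMatrix ρ ∧ L.weylSolDeriv ρ 0 = 1 - L.bc ρ * L.weylMatrix ρ := by
  obtain ⟨s1, s2, s3⟩ := h.sine_spec ρ
  obtain ⟨f1, f2, f3⟩ := h.phi_spec ρ
  refine ⟨s1.fun_add (f1.mul_const _), by simp [weylSol, s2, f2], ?_⟩
  simp [weylSolDeriv, s3, f3, sub_eq_add_neg]

theorem ClassV.isSolStar_weylStar (h : L.ClassV) (ρ : ℂ) :
    IsSolStar L.Q₁ L.Q₀ (Complex.I * ρ) (L.weylStar ρ) (L.weylStarDeriv ρ) ∧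
      L.weylStar ρ 0 = L.weylMatrix ρ ∧ L.weylStarDeriv ρ 0 = 1 - L.weylMatrix ρ * L.bc ρ := by
  obtain ⟨s1, s2, s3⟩ := h.sineStar_spec ρ
  obtain ⟨f1, f2, f3⟩ := h.phiStar_spec ρ
  refine ⟨?_, by simp [weylStar, s2, f2], by simp [weylStarDeriv, s3, f3, sub_eq_add_neg]⟩
  have h1 := (isSolStar_iff_transpose.1 s1).fun_add
    ((isSolStar_iff_transpose.1 f1).mul_const (L.weylMatrix ρ).transpose)
  rw [isSolStar_iff_transpose]
  simpa [weylStar, weylStarDeriv, Matrix.transpose_mul] using! h1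

theorem re_I_mul_neg {ρ : ℂ} (h : ρ ∈ halfPlane Side.plus) : (Complex.I * ρ).re < 0 := by
  have : 0 < ρ.im := by simpa [halfPlane, Side.sign] using h
  simpa using this

/-- Where a Weyl solution exists, both `S + φ M` and `S* + M φ*` decay. -/
theorem ClassV.exists_bound_weyl (h : L.ClassV) {ρ : ℂ} (hρ : ρ ∈ halfPlane Side.plus)
    (hW : ∃ Φ, L.IsWeylSolution ρ Φ) :
    ∃ M, ∀ x, 0 ≤ x → ‖reduced (Complex.I * ρ) (L.weylSol ρ) x‖ ≤ M ∧
      ‖reduced (Complex.I * ρ) (L.weylStar ρ) x‖ ≤ M := by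
  have hW' := Classical.epsilon_spec hW
  set Φ := Classical.epsilon (L.IsWeylSolution ρ) with hΦ
  obtain ⟨w1, w2, s, hs, w3⟩ := hW'
  have hM : Φ 0 = L.weylMatrix ρ := rfl
  obtain ⟨e1, e2, e3⟩ := h.isSol_weylSol ρ
  have hsol := h.isSol w1
  -- The Weyl solution and `S + φ M` have the same initial values.
  have heq : ∀ x, 0 ≤ x → L.weylSol ρ x = Φ x := fun x hx => by
    refine (e1.eq_of_initial h.integrableCoeff hsol (by rw [e2, hM]) ?_ hx).1
    rw [e3, ← w2, U, hM]
    simp [bc]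
  have hs' : s = Side.plus := by
    cases s with
    | plus => rfl
    | minus =>
      simp only [halfPlane, Side.sign, Set.mem_ofPred_eq] at hs hρ
      linarith
  have hb : ∃ M, ∀ x, 0 ≤ x → ‖reduced (Complex.I * ρ) (L.weylSol ρ) x‖ ≤ M := by
    obtain ⟨C, hC⟩ := w3.bound
    obtain ⟨X, hX⟩ := eventually_atTop.1 hC
    have hcont : ContinuousOn (reduced (Complex.I * ρ) (L.weylSol ρ)) (Ici 0) :=
      e1.fst.reduced.continuousOn
    obtain ⟨M, hM⟩ := isCompact_Icc.exists_bound_of_continuousOn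
      (hcont.mono (fun t (ht : t ∈ Icc 0 X) => ht.1))
    refine ⟨max M C, fun x hx => ?_⟩
    rcases le_total x X with hxX | hxX
    · exact (hM x ⟨hx, hxX⟩).trans (le_max_left _ _)
    · refine le_trans ?_ (le_max_right _ _)
      have h1 := hX x hxX
      rw [← heq x hx, hs', Side.sign] at h1
      have h2 : Complex.exp (-(Complex.I * ρ) * x) *
          Complex.exp ((1 : ℝ) * Complex.I * ρ * x) = 1 := by
        rw [← Complex.exp_add]
        simp
      rw [reduced, norm_smul]
      calc _ ≤ ‖Complex.exp (-(Complex.I * ρ) * x)‖ *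
            (C * ‖Complex.exp ((1 : ℝ) * Complex.I * ρ * x)‖) := by gcongr
        _ = C * ‖Complex.exp (-(Complex.I * ρ) * x) *
              Complex.exp ((1 : ℝ) * Complex.I * ρ * x)‖ := by
            rw [norm_mul]; ring
        _ = C := by rw [h2]; simp
  obtain ⟨M, hM⟩ := hb
  obtain ⟨z1, z2, z3⟩ := h.isSolStar_weylStar ρ
  obtain ⟨f1, f2, f3⟩ := h.phiStar_spec ρ
  -- The star solution is conjugate to the Weyl solution, since their Wronskian vanishes at `0`.
  obtain ⟨M', hM'⟩ := z1.exists_bound_reduced h.integrableCoeff (re_I_mul_neg hρ) e1 hM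
    (Ψ := L.phiStar ρ) (Ψ₁ := dHalf (L.phiStar ρ))
    (fun x hx => by
      rw [z1.wronskian_eq e1 hx, z2, z3, e2, e3]
      noncomm_ring)
    (fun x hx => by
      have := f1.wronskian_eq e1 hx
      rw [← neg_sub, this, f2, f3, e2, e3]
      noncomm_ring)
  exact ⟨max M M', fun x hx => ⟨(hM x hx).trans (le_max_left _ _),
    (hM' x hx).trans (le_max_right _ _)⟩⟩

end Pencil

/-! ### Regularity of the Weyl matrix -/

section DecayBounds

variable {𝒜 : Type*} [NormedRing 𝒜] [NormedAlgebra ℂ 𝒜] [CompleteSpace 𝒜]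
variable {A A' Q Y Y₁ : ℝ → 𝒜} {σ : ℂ}

theorem norm_reduced (σ : ℂ) (Y : ℝ → 𝒜) (x : ℝ) :
    ‖reduced σ Y x‖ = Real.exp (-σ.re * x) * ‖Y x‖ := by
  rw [reduced, norm_smul, norm_cexp_mul_ofReal, Complex.neg_re]

theorem norm_eq_exp_mul_norm_reduced (σ : ℂ) (Y : ℝ → 𝒜) (x : ℝ) :
    ‖Y x‖ = Real.exp (σ.re * x) * ‖reduced σ Y x‖ := by
  rw [norm_reduced, ← mul_assoc, ← Real.exp_add]
  simp

theorem norm_le_of_reduced_le {M x : ℝ} (h : ‖reduced σ Y x‖ ≤ M) :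
    ‖Y x‖ ≤ M * Real.exp (σ.re * x) := by
  rw [norm_eq_exp_mul_norm_reduced σ, mul_comm]
  gcongr

/-- A decaying solution and its derivative decay at the same rate. -/
theorem IsSol.exists_decay_bound (hA : IntegrableCoeff A A' Q) (h : IsSol A Q σ Y Y₁) {M : ℝ}
    (hM : ∀ x, 0 ≤ x → ‖reduced σ Y x‖ ≤ M) :
    ∃ C, 0 ≤ C ∧ ∀ x, 0 ≤ x → ‖Y x‖ ≤ C * Real.exp (σ.re * x) ∧
      ‖Y₁ x‖ ≤ C * Real.exp (σ.re * x) := by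
  have hM0 : 0 ≤ M := (norm_nonneg _).trans (hM 0 le_rfl)
  obtain ⟨M', hM'⟩ := h.exists_bound_reducedDeriv hA hM
  have hM'0 : 0 ≤ M' := (norm_nonneg _).trans (hM' 0 le_rfl)
  refine ⟨M + (M' + ‖σ‖ * M), by positivity, fun x hx => ⟨?_, ?_⟩⟩
  · refine (norm_le_of_reduced_le (hM x hx)).trans ?_
    gcongr
    linarith [mul_nonneg (norm_nonneg σ) hM0]
  · have h1 : reduced σ Y₁ x = _root_.reducedDeriv σ Y Y₁ x + σ • reduced σ Y x := by
      simp only [reduced, _root_.reducedDeriv]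
      module
    have h2 : ‖reduced σ Y₁ x‖ ≤ M' + ‖σ‖ * M := by
      rw [h1]
      refine (norm_add_le _ _).trans (add_le_add (hM' x hx) ?_)
      rw [norm_smul]
      gcongr
      exact hM x hx
    exact (norm_le_of_reduced_le h2).trans
      (mul_le_mul_of_nonneg_right (by linarith) (Real.exp_pos _).le)

theorem integrableOn_exp_mul_Ioi_zero {a : ℝ} (ha : a < 0) :
    IntegrableOn (fun x : ℝ => Real.exp (a * x)) (Ioi 0) := by
  simpa using integrableOn_exp_mul_Ioi ha 0

end DecayBounds

theorem norm_transpose_le (A : CMat m) : ‖A.transpose‖ ≤ ‖transposeCLM m‖ * ‖A‖ :=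
  (transposeCLM m).le_opNorm A

theorem reduced_transpose (σ : ℂ) (Y : ℝ → CMat m) (x : ℝ) :
    reduced σ (fun t => (Y t).transpose) x = (reduced σ Y x).transpose := by
  simp [reduced]

namespace Pencil

variable {L : Pencil m} {ρ θ : ℂ}

/-- The decay of the Weyl solutions and of their derivatives. -/
theorem ClassV.exists_decay_weyl (h : L.ClassV) (hρ : ρ ∈ halfPlane Side.plus)
    (hW : ∃ Φ, L.IsWeylSolution ρ Φ) :
    ∃ C, 0 ≤ C ∧ ∀ x, 0 ≤ x → ‖L.weylSol ρ x‖ ≤ C * Real.exp (-ρ.im * x) ∧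
      ‖L.weylSolDeriv ρ x‖ ≤ C * Real.exp (-ρ.im * x) ∧
      ‖L.weylStar ρ x‖ ≤ C * Real.exp (-ρ.im * x) ∧
      ‖L.weylStarDeriv ρ x‖ ≤ C * Real.exp (-ρ.im * x) := by
  obtain ⟨M, hM⟩ := h.exists_bound_weyl hρ hW
  have hM0 : 0 ≤ M := (norm_nonneg _).trans (hM 0 le_rfl).1
  obtain ⟨C, hC0, hC⟩ := (h.isSol_weylSol ρ).1.exists_decay_bound h.integrableCoeff
    fun x hx => (hM x hx).1
  obtain ⟨D, hD0, hD⟩ := (isSolStar_iff_transpose.1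
    (h.isSolStar_weylStar ρ).1).exists_decay_bound h.transpose.integrableCoeff
    (M := ‖transposeCLM m‖ * M) fun x hx => by
      rw [reduced_transpose]
      exact (norm_transpose_le _).trans (by gcongr; exact (hM x hx).2)
  have hre : (Complex.I * ρ).re = -ρ.im := by simp
  rw [hre] at hC hD
  have ht : ∀ B : CMat m, ‖B‖ ≤ ‖transposeCLM m‖ * ‖B.transpose‖ := fun B => by
    simpa using norm_transpose_le B.transpose
  refine ⟨C + ‖transposeCLM m‖ * D, by positivity, fun x hx => ⟨?_, ?_, ?_, ?_⟩⟩
  · refine (hC x hx).1.trans ?_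
    gcongr
    linarith [mul_nonneg (norm_nonneg (transposeCLM m)) hD0]
  · refine (hC x hx).2.trans ?_
    gcongr
    linarith [mul_nonneg (norm_nonneg (transposeCLM m)) hD0]
  · refine (ht _).trans ?_
    have := mul_le_mul_of_nonneg_left (hD x hx).1 (norm_nonneg (transposeCLM m))
    nlinarith [mul_nonneg hC0 (Real.exp_pos (-ρ.im * x)).le]
  · refine (ht _).trans ?_
    have := mul_le_mul_of_nonneg_left (hD x hx).2 (norm_nonneg (transposeCLM m))
    nlinarith [mul_nonneg hC0 (Real.exp_pos (-ρ.im * x)).le]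

/-- The Weyl solutions are bounded uniformly for `ρ` in a half-annulus where `M` is bounded. -/
theorem ClassV.exists_uniform_weyl_bound (h : L.ClassV) {s₁ : ℝ} (s₂ B : ℝ) (hs₁ : 0 < s₁) :
    ∃ C, 0 ≤ C ∧ ∀ ρ ∈ halfPlane Side.plus, s₁ ≤ ‖ρ‖ → ‖ρ‖ ≤ s₂ →
      (∃ Φ, L.IsWeylSolution ρ Φ) → ‖L.weylMatrix ρ‖ ≤ B → ∀ x, 0 ≤ x → ‖L.weylSol ρ x‖ ≤ C := by
  obtain ⟨X, hX, hXb⟩ := exists_uniform_reduced_bound (s₂ := s₂) h.integrableCoeff hs₁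
  obtain ⟨C, hC0, hC⟩ := h.integrableCoeff.exists_local_bound s₂ hX
  set D := C * (B + (‖(1 : CMat m)‖ + (s₂ * ‖L.h₁‖ + ‖L.h₀‖) * B)) with hD
  by_cases hne : 0 ≤ s₂ ∧ 0 ≤ B
  swap
  · refine ⟨0, le_rfl, fun ρ hρ h1 h2 hW hMB x hx => (hne ⟨?_, ?_⟩).elim⟩
    · exact (norm_nonneg _).trans h2
    · exact (norm_nonneg _).trans hMB
  obtain ⟨hs₂, hB⟩ := hne
  have hD0 : 0 ≤ D := by positivity
  refine ⟨D + 2 * (Real.exp (s₂ * X) * D), by positivity, fun ρ hρ h1 h2 hW hMB x hx => ?_⟩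
  obtain ⟨e1, e2, e3⟩ := h.isSol_weylSol ρ
  have hn : ‖Complex.I * ρ‖ = ‖ρ‖ := by simp
  have hbc : ‖L.bc ρ‖ ≤ s₂ * ‖L.h₁‖ + ‖L.h₀‖ := by
    unfold bc
    refine (norm_add_le _ _).trans (add_le_add ?_ le_rfl)
    rw [norm_smul, hn]
    gcongr
  have hinit : ‖L.weylSol ρ 0‖ + ‖L.weylSolDeriv ρ 0‖ ≤
      B + (‖(1 : CMat m)‖ + (s₂ * ‖L.h₁‖ + ‖L.h₀‖) * B) := by
    rw [e2, e3]
    refine add_le_add hMB ((norm_sub_le _ _).trans (add_le_add le_rfl ((norm_mul_le _ _).trans ?_)))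
    gcongr
  have hloc : ∀ t ∈ Icc 0 X, ‖L.weylSol ρ t‖ ≤ D := fun t ht =>
    (hC _ (by rw [hn]; exact h2) _ _ e1 t ht).1.trans (by rw [hD]; gcongr)
  rcases le_total x X with hxX | hxX
  · have := hloc x ⟨hx, hxX⟩
    have : 0 ≤ 2 * (Real.exp (s₂ * X) * D) := by positivity
    linarith
  · have hσ : (Complex.I * ρ).re < 0 := re_I_mul_neg hρ
    obtain ⟨M, hM⟩ := h.exists_bound_weyl hρ hW
    have k1 := hXb _ hσ (by rw [hn]; exact h1) (by rw [hn]; exact h2) _ _ e1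
      ⟨M, fun x hx => (hM x hx).1⟩ x hxX
    have k2 : ‖L.weylSol ρ x‖ ≤ ‖reduced (Complex.I * ρ) (L.weylSol ρ) x‖ := by
      rw [norm_reduced]
      have : 1 ≤ Real.exp (-(Complex.I * ρ).re * x) := Real.one_le_exp (by nlinarith)
      nlinarith [norm_nonneg (L.weylSol ρ x)]
    have k3 : ‖reduced (Complex.I * ρ) (L.weylSol ρ) X‖ ≤ Real.exp (s₂ * X) * D := by
      rw [norm_reduced]
      gcongr
      · have := Complex.abs_re_le_norm (Complex.I * ρ)
        rw [hn] at this
        linarith [neg_le_abs (Complex.I * ρ).re]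
      · exact hloc X ⟨hX, le_rfl⟩
    linarith

/-- The kernel of the difference formula for the Weyl matrix. -/
def weylKernel (L : Pencil m) (ρ θ : ℂ) (t : ℝ) : CMat m :=
  (ρ + θ) • (L.weylStar θ t * L.weylSol ρ t) +
    (2 * Complex.I) • (L.weylStar θ t * L.Q₁ t * L.weylSol ρ t)

theorem ClassV.continuousOn_weylKernel (h : L.ClassV) (ρ θ : ℂ) :
    ContinuousOn (L.weylKernel ρ θ) (Ici 0) := by
  have c1 := (h.isSol_weylSol ρ).1.fst.continuousOn
  have c2 := (h.isSolStar_weylStar θ).1.fst.continuousOn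
  have c3 := h.integrableCoeff.prim.continuousOn
  unfold weylKernel
  fun_prop

theorem norm_weylKernel_le {t C D B : ℝ} (hC : ‖L.weylStar θ t‖ ≤ C) (hD : ‖L.weylSol ρ t‖ ≤ D)
    (hB : ‖L.Q₁ t‖ ≤ B) : ‖L.weylKernel ρ θ t‖ ≤ (‖ρ‖ + ‖θ‖ + 2 * B) * D * C := by
  have hC0 : 0 ≤ C := (norm_nonneg _).trans hC
  have hD0 : 0 ≤ D := (norm_nonneg _).trans hD
  have hB0 : 0 ≤ B := (norm_nonneg _).trans hB
  have h1 : ‖(ρ + θ) • (L.weylStar θ t * L.weylSol ρ t)‖ ≤ (‖ρ‖ + ‖θ‖) * (C * D) := by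
    rw [norm_smul]
    gcongr
    · exact norm_add_le _ _
    · exact (norm_mul_le _ _).trans (by gcongr)
  have h2 : ‖(2 * Complex.I) • (L.weylStar θ t * L.Q₁ t * L.weylSol ρ t)‖ ≤ 2 * (C * B * D) := by
    rw [norm_smul]
    gcongr
    · simp
    · refine (norm_mul_le _ _).trans ?_
      gcongr
      exact (norm_mul_le _ _).trans (by gcongr)
  unfold weylKernel
  linarith [norm_add_le ((ρ + θ) • (L.weylStar θ t * L.weylSol ρ t))
    ((2 * Complex.I) • (L.weylStar θ t * L.Q₁ t * L.weylSol ρ t))]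

/-- The difference of two values of the Weyl matrix, from the Wronskian of Weyl solutions. -/
theorem ClassV.weylMatrix_sub (h : L.ClassV) (hρ : ρ ∈ halfPlane Side.plus)
    (hρW : ∃ Φ, L.IsWeylSolution ρ Φ) (hθ : θ ∈ halfPlane Side.plus)
    (hθW : ∃ Φ, L.IsWeylSolution θ Φ) :
    L.weylMatrix ρ - L.weylMatrix θ = -((ρ - θ) • (Complex.I • (L.weylMatrix θ * L.h₁ *
      L.weylMatrix ρ) + ∫ t in Ioi 0, L.weylKernel ρ θ t)) := by
  obtain ⟨e1, e2, e3⟩ := h.isSol_weylSol ρ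
  obtain ⟨z1, z2, z3⟩ := h.isSolStar_weylStar θ
  obtain ⟨C, hC0, hC⟩ := h.exists_decay_weyl hρ hρW
  obtain ⟨D, hD0, hD⟩ := h.exists_decay_weyl hθ hθW
  obtain ⟨B, hB0, hB⟩ := h.integrableCoeff.exists_bound
  have hρ' : 0 < ρ.im := by simpa [halfPlane, Side.sign] using hρ
  have hθ' : 0 < θ.im := by simpa [halfPlane, Side.sign] using hθ
  have hW := z1.isPrim_wronskian e1
  have hint : IntegrableOn (L.weylKernel ρ θ) (Ioi 0) := by
    refine Integrable.mono' ((integrableOn_exp_mul_Ioi_zero (a := -θ.im) (by linarith)).const_mul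
      ((‖ρ‖ + ‖θ‖ + 2 * B) * C * D)) (((h.continuousOn_weylKernel ρ θ).mono
        Ioi_subset_Ici_self).aestronglyMeasurable measurableSet_Ioi) ?_
    rw [ae_restrict_iff' measurableSet_Ioi]
    refine .of_forall fun t ht => ?_
    have ht0 : 0 ≤ t := le_of_lt ht
    have h1 : ‖L.weylSol ρ t‖ ≤ C := (hC t ht0).1.trans
      (mul_le_of_le_one_right hC0 (Real.exp_le_one_iff.2 (by nlinarith)))
    exact (norm_weylKernel_le (hD t ht0).2.2.1 h1 (hB t ht0)).trans_eq (by ring)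
  have hlim1 := (intervalIntegral_tendsto_integral_Ioi 0 hint tendsto_id).const_smul (ρ - θ)
  -- The Wronskian of the two decaying solutions vanishes at infinity.
  have hlim2 : Tendsto (fun x => L.weylStarDeriv θ x * L.weylSol ρ x -
      L.weylStar θ x * L.weylSolDeriv ρ x) atTop (𝓝 0) := by
    have hb : Tendsto (fun x => 2 * (D * C) * Real.exp (-θ.im * x)) atTop
        (𝓝 (2 * (D * C) * 0)) := by
      refine Tendsto.const_mul _ (Real.tendsto_exp_atBot.comp ?_)
      exact tendsto_id.const_mul_atTop_of_neg (by linarith)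
    rw [mul_zero] at hb
    refine squeeze_zero_norm' ?_ hb
    filter_upwards [eventually_ge_atTop 0] with x hx
    obtain ⟨c1, c2, -, -⟩ := hC x hx
    obtain ⟨-, -, d3, d4⟩ := hD x hx
    have hexp : C * Real.exp (-ρ.im * x) ≤ C :=
      mul_le_of_le_one_right hC0 (Real.exp_le_one_iff.2 (by nlinarith))
    have n1 : ‖L.weylStarDeriv θ x * L.weylSol ρ x‖ ≤ D * Real.exp (-θ.im * x) * C :=
      (norm_mul_le _ _).trans (by gcongr; exact c1.trans hexp)
    have n2 : ‖L.weylStar θ x * L.weylSolDeriv ρ x‖ ≤ D * Real.exp (-θ.im * x) * C :=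
      (norm_mul_le _ _).trans (by gcongr; exact c2.trans hexp)
    linarith [norm_sub_le (L.weylStarDeriv θ x * L.weylSol ρ x)
      (L.weylStar θ x * L.weylSolDeriv ρ x)]
  have heq : ∀ x, 0 ≤ x → (ρ - θ) • ∫ t in (0 : ℝ)..x, L.weylKernel ρ θ t =
      (L.weylStarDeriv θ x * L.weylSol ρ x - L.weylStar θ x * L.weylSolDeriv ρ x) -
      (L.weylStarDeriv θ 0 * L.weylSol ρ 0 - L.weylStar θ 0 * L.weylSolDeriv ρ 0) := fun x hx => by
    rw [hW.sub_eq le_rfl hx, ← intervalIntegral.integral_smul]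
    rfl
  have hlim3 := (hlim2.sub_const (L.weylStarDeriv θ 0 * L.weylSol ρ 0 -
    L.weylStar θ 0 * L.weylSolDeriv ρ 0)).congr' (by
      filter_upwards [eventually_ge_atTop 0] with x hx using (heq x hx).symm)
  have hfin := tendsto_nhds_unique hlim1 hlim3
  rw [z2, z3, e2, e3] at hfin
  rw [smul_add, hfin]
  have hb : L.bc ρ = L.bc θ + ((ρ - θ) * Complex.I) • L.h₁ := by
    unfold bc
    module
  rw [hb]
  simp only [sub_mul, mul_sub, add_mul, mul_add, one_mul, mul_one, smul_mul_assoc, mul_smul_comm,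
    smul_smul, mul_assoc]
  module

/-- Where Weyl solutions exist and are normalized by a bounded Weyl matrix, the Weyl matrix is
holomorphic. -/
theorem ClassV.differentiableAt_weylMatrix (h : L.ClassV) (hθ : θ ∈ halfPlane Side.plus) {B : ℝ}
    (hW : ∀ᶠ ρ in 𝓝 θ, (∃ Φ, L.IsWeylSolution ρ Φ) ∧ ‖L.weylMatrix ρ‖ ≤ B) :
    DifferentiableAt ℂ L.weylMatrix θ := by
  have hθ' : 0 < θ.im := by simpa [halfPlane, Side.sign] using hθ
  have hθn : 0 < ‖θ‖ := hθ'.trans_le ((le_abs_self _).trans (Complex.abs_im_le_norm θ))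
  obtain ⟨C, hC0, hC⟩ := h.exists_uniform_weyl_bound (2 * ‖θ‖) B (half_pos hθn)
  obtain ⟨D, hD0, hD⟩ := h.exists_decay_weyl hθ hW.self_of_nhds.1
  obtain ⟨q, hq0, hq⟩ := h.integrableCoeff.exists_bound
  have hopen : IsOpen (halfPlane Side.plus) := by
    simp only [halfPlane]
    exact isOpen_lt continuous_const (by fun_prop)
  have hn1 : ∀ᶠ ρ in 𝓝 θ, ‖θ‖ / 2 < ‖ρ‖ :=
    continuous_norm.continuousAt.eventually_const_lt (by linarith)
  have hn2 : ∀ᶠ ρ in 𝓝 θ, ‖ρ‖ < 2 * ‖θ‖ :=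
    continuous_norm.continuousAt.eventually_lt_const (by linarith)
  have hev : ∀ᶠ ρ in 𝓝 θ, ρ ∈ halfPlane Side.plus ∧ ((∃ Φ, L.IsWeylSolution ρ Φ) ∧
      ‖L.weylMatrix ρ‖ ≤ B) ∧ ‖ρ‖ ≤ 2 * ‖θ‖ ∧ ∀ x, 0 ≤ x → ‖L.weylSol ρ x‖ ≤ C := by
    filter_upwards [hn1, hn2, hopen.mem_nhds hθ, hW] with ρ h1 h2 h3 h4
    exact ⟨h3, h4, h2.le, hC ρ h3 h1.le h2.le h4.1 h4.2⟩
  -- The domination by an integrable function that does not depend on `ρ`.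
  set k : ℝ → ℝ := fun t => (3 * ‖θ‖ + 2 * q) * C * (D * Real.exp (-θ.im * t))
  have hk : IntegrableOn k (Ioi 0) :=
    ((integrableOn_exp_mul_Ioi_zero (a := -θ.im) (by linarith)).const_mul _).const_mul _
  have hdom : ∀ᶠ ρ in 𝓝 θ, ∀ t, 0 ≤ t → ‖L.weylKernel ρ θ t‖ ≤ k t := by
    filter_upwards [hev] with ρ h1 t ht
    refine (norm_weylKernel_le (hD t ht).2.2.1 (h1.2.2.2 t ht) (hq t ht)).trans ?_
    have := h1.2.2.1
    simp only [k]
    gcongr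
    linarith
  set g : ℂ → CMat m := fun ρ => -(Complex.I • (L.weylMatrix θ * L.h₁ * L.weylMatrix ρ) +
    ∫ t in Ioi 0, L.weylKernel ρ θ t) with hg
  have hform : ∀ᶠ ρ in 𝓝 θ, L.weylMatrix ρ - L.weylMatrix θ = (ρ - θ) • g ρ := by
    filter_upwards [hev] with ρ h1
    rw [h.weylMatrix_sub h1.1 h1.2.1.1 hθ hW.self_of_nhds.1, hg, smul_neg]
  have hgb : ∀ᶠ ρ in 𝓝 θ, ‖g ρ‖ ≤ ‖L.weylMatrix θ * L.h₁‖ * B + ∫ t in Ioi 0, k t := by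
    filter_upwards [hev, hdom] with ρ h1 h2
    simp only [hg, norm_neg]
    refine (norm_add_le _ _).trans (add_le_add ?_ ?_)
    · rw [norm_smul, Complex.norm_I, one_mul]
      exact (norm_mul_le _ _).trans (by gcongr; exact h1.2.1.2)
    · refine norm_integral_le_of_norm_le hk ?_
      rw [ae_restrict_iff' measurableSet_Ioi]
      exact .of_forall fun t ht => h2 t (le_of_lt ht)
  have hcont : Tendsto L.weylMatrix (𝓝 θ) (𝓝 (L.weylMatrix θ)) := by
    rw [tendsto_iff_norm_sub_tendsto_zero]
    have h0 : Tendsto (fun ρ => ‖ρ - θ‖ * (‖L.weylMatrix θ * L.h₁‖ * B + ∫ t in Ioi 0, k t)) (𝓝 θ)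
        (𝓝 (‖θ - θ‖ * (‖L.weylMatrix θ * L.h₁‖ * B + ∫ t in Ioi 0, k t))) :=
      Tendsto.mul_const _ ((by fun_prop : Continuous fun ρ : ℂ => ‖ρ - θ‖).tendsto θ)
    simp only [sub_self, norm_zero, zero_mul] at h0
    refine squeeze_zero' (.of_forall fun _ => norm_nonneg _) ?_ h0
    filter_upwards [hform, hgb] with ρ h1 h2
    rw [h1, norm_smul]
    gcongr
  have hg_lim : Tendsto g (𝓝 θ) (𝓝 (g θ)) := by
    refine Tendsto.neg (Tendsto.add ((tendsto_const_nhds.mul hcont).const_smul _) ?_)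
    refine tendsto_integral_filter_of_dominated_convergence k ?_ ?_ hk ?_
    · exact .of_forall fun ρ => ((h.continuousOn_weylKernel ρ θ).mono
        Ioi_subset_Ici_self).aestronglyMeasurable measurableSet_Ioi
    · filter_upwards [hdom] with ρ h1
      rw [ae_restrict_iff' measurableSet_Ioi]
      exact .of_forall fun t ht => h1 t (le_of_lt ht)
    · rw [ae_restrict_iff' measurableSet_Ioi]
      refine .of_forall fun t ht => ?_
      have ht0 : 0 ≤ t := le_of_lt ht
      have c1 : Tendsto (fun ρ => L.sine ρ t) (𝓝 θ) (𝓝 (L.sine θ t)) :=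
        (h.differentiable_sine ht0).1.continuous.tendsto θ
      have c2 : Tendsto (fun ρ => L.phi ρ t) (𝓝 θ) (𝓝 (L.phi θ t)) :=
        (h.differentiable_phi ht0).1.continuous.tendsto θ
      have c3 : Tendsto (fun ρ => L.weylSol ρ t) (𝓝 θ) (𝓝 (L.weylSol θ t)) :=
        c1.add (c2.mul hcont)
      have c4 : Tendsto (fun ρ : ℂ => ρ + θ) (𝓝 θ) (𝓝 (θ + θ)) :=
        (continuous_id.add continuous_const).tendsto θ
      exact (c4.smul (tendsto_const_nhds.mul c3)).add
        ((tendsto_const_nhds.mul c3).const_smul (2 * Complex.I))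
  refine HasDerivAt.differentiableAt (f' := g θ) ?_
  rw [hasDerivAt_iff_tendsto_slope]
  refine (hg_lim.mono_left nhdsWithin_le_nhds).congr' ?_
  filter_upwards [hform.filter_mono nhdsWithin_le_nhds, self_mem_nhdsWithin] with ρ h1 h2
  rw [slope_def_module, h1, smul_smul, inv_mul_cancel₀ (sub_ne_zero.2 h2), one_smul]

end Pencil

/-! ### Asymptotics for large values of the parameter -/

section Asymptotics

variable {𝒜 : Type*} [NormedRing 𝒜] [NormedAlgebra ℂ 𝒜] [CompleteSpace 𝒜]
variable {A A' Q Pp Pm Rp Rm : ℝ → 𝒜} {C : ℝ}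

/-- The decaying solution with `Y'(0) + (σ h₁ + h₀) Y(0) = 1`: the initial value is
`σ⁻¹ (1 + h₁)⁻¹` up to lower order terms, and the solution follows `P₋`. -/
theorem exists_weyl_asymptotics (hA : IntegrableCoeff A A' Q) (hT : Transport A Pp Pm Rp Rm C)
    {h₀ h₁ K : 𝒜} (hK : K * (1 + h₁) = 1) (hK' : (1 + h₁) * K = 1) :
    ∃ s₀ D : ℝ, 0 < s₀ ∧ 0 ≤ D ∧ ∀ σ : ℂ, σ.re < 0 → s₀ ≤ ‖σ‖ → ∀ Y Y₁ : ℝ → 𝒜,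
      IsSol A Q σ Y Y₁ → Y₁ 0 = 1 - (σ • h₁ + h₀) * Y 0 →
      (∃ M, ∀ x, 0 ≤ x → Real.exp (-σ.re * x) * solSize σ Y Y₁ x ≤ M) →
      ‖σ • Y 0 - K‖ ≤ D * ‖σ⁻¹‖ ∧ ∀ x : ℝ, 0 ≤ x →
        ‖Complex.exp (-σ * x) • σ • Y x - Pm x * K‖ ≤ D * ‖σ⁻¹‖ ∧
        ‖Complex.exp (-σ * x) • Y₁ x - Pm x * K‖ ≤ D * ‖σ⁻¹‖ := by
  obtain ⟨s₀, D, hs₀, hD, hdec⟩ := exists_decaying_asymptotics hA hT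
  have hC : 0 ≤ C := (norm_nonneg _).trans (hT.norm_le 0 le_rfl).1
  have hPm0 : Pm 0 = 1 := by
    have := hT.Pm_mul_Rp 0 le_rfl
    rwa [hT.Rp_zero, mul_one] at this
  set o := ‖(1 : 𝒜)‖
  have ho : 0 ≤ o := norm_nonneg _
  set c₁ := 1 + ‖h₁‖ + ‖h₀‖
  set c₂ := 2 * (‖K‖ * (o * (1 + 2 * D)))
  set c₃ := o + c₁ * c₂
  set c₄ := ‖K‖ * (‖h₀‖ * c₂ + 2 * D * c₃)
  set c₅ := C * ((o + ‖h₁‖) * c₄ + ‖h₀‖ * c₂) + D * c₃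
  have hc₁ : 0 ≤ c₁ := by positivity
  have hc₂ : 0 ≤ c₂ := by positivity
  have hc₃ : 0 ≤ c₃ := by positivity
  have hc₄ : 0 ≤ c₄ := by positivity
  have hc₅ : 0 ≤ c₅ := by positivity
  set e := 2 * (‖K‖ * (‖h₀‖ + 2 * D * c₁))
  have he : 0 ≤ e := by positivity
  -- For `|σ| ≥ 1 + e` the terms with `‖Y(0)‖` on the right of the estimate for `Y(0)` are absorbed.
  refine ⟨max s₀ (1 + e), c₄ + c₅, by positivity, by positivity,
    fun σ hσ hσs Y Y₁ hY hY1 hdecay => ?_⟩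
  have hσ0 : σ ≠ 0 := by rintro rfl; simp at hσ
  have hσn : 0 < ‖σ‖ := norm_pos_iff.2 hσ0
  have hdec' := hdec σ hσ ((le_max_left _ _).trans hσs) Y Y₁ hY hdecay
  set r := ‖σ⁻¹‖
  have hr0 : 0 ≤ r := norm_nonneg _
  have hr : ‖σ‖ * r = 1 := by rw [← norm_mul, mul_inv_cancel₀ hσ0, norm_one]
  have h1e : (1 + e) * r ≤ 1 := by
    have := (le_max_right _ _).trans hσs
    nlinarith
  have hr1 : r ≤ 1 := by nlinarith
  have her : e * r ≤ 1 := by nlinarith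
  set M := Y 0 with hM
  set v := σ⁻¹ • Y₁ 0 with hv
  have hv' : v = σ⁻¹ • (1 : 𝒜) - h₁ * M - σ⁻¹ • (h₀ * M) := by
    rw [hv, hY1]
    simp only [smul_sub, add_mul, smul_add, smul_mul_assoc, smul_smul, inv_mul_cancel₀ hσ0,
      one_smul]
    abel
  have hsize : solSize σ Y Y₁ 0 = ‖M‖ + ‖v‖ := rfl
  set S := solSize σ Y Y₁ 0
  have hS0 : 0 ≤ S := solSize_nonneg _ _ _ _
  have hvn : ‖v‖ ≤ r * o + (‖h₁‖ + ‖h₀‖) * ‖M‖ := by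
    rw [hv']
    have n1 : ‖σ⁻¹ • (1 : 𝒜)‖ = r * o := norm_smul _ _
    have n2 := norm_mul_le h₁ M
    have n3 : ‖σ⁻¹ • (h₀ * M)‖ ≤ ‖h₀‖ * ‖M‖ := by
      rw [norm_smul]
      exact (mul_le_of_le_one_left (norm_nonneg _) hr1).trans (norm_mul_le _ _)
    linarith [norm_sub_le (σ⁻¹ • (1 : 𝒜) - h₁ * M) (σ⁻¹ • (h₀ * M)),
      norm_sub_le (σ⁻¹ • (1 : 𝒜)) (h₁ * M)]
  have hS1 : S ≤ r * o + c₁ * ‖M‖ := by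
    rw [hsize]
    simp only [c₁]
    linarith
  -- A decaying solution has almost no growing amplitude, so that `E = (Y(0) - σ⁻¹ Y'(0)) / 2` is
  -- small. The boundary condition then determines `Y(0)`.
  set E := M - (1 / 2 : ℂ) • (M + v) with hE
  have hEn : ‖E‖ ≤ D * r * S := by
    have := (hdec' 0 le_rfl).1
    simpa [hPm0, hE] using this
  have h2E : (2 : ℂ) • E = (1 + h₁) * M - σ⁻¹ • (1 : 𝒜) + σ⁻¹ • (h₀ * M) := by
    rw [hE, hv']
    simp only [add_mul, one_mul]
    module
  have hMeq : M = K * (σ⁻¹ • (1 : 𝒜) - σ⁻¹ • (h₀ * M) + (2 : ℂ) • E) := by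
    rw [h2E, show σ⁻¹ • (1 : 𝒜) - σ⁻¹ • (h₀ * M) + ((1 + h₁) * M - σ⁻¹ • (1 : 𝒜) +
      σ⁻¹ • (h₀ * M)) = (1 + h₁) * M by abel, ← mul_assoc, hK, one_mul]
  have h2n : ‖(2 : ℂ) • E‖ ≤ 2 * (D * r * S) := by
    rw [norm_smul, Complex.norm_ofNat]; gcongr
  have hMn : ‖M‖ ≤ c₂ * r := by
    have n1 : ‖M‖ ≤ ‖K‖ * (r * o + r * (‖h₀‖ * ‖M‖) + 2 * (D * r * S)) := by
      conv_lhs => rw [hMeq]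
      refine (norm_mul_le _ _).trans ?_
      gcongr
      refine (norm_add_le _ _).trans (add_le_add ((norm_sub_le _ _).trans (add_le_add ?_ ?_)) h2n)
      · exact (norm_smul _ _).le
      · rw [norm_smul]
        gcongr
        exact norm_mul_le _ _
    have n2 : 2 * (D * r * S) ≤ 2 * (D * r * (r * o + c₁ * ‖M‖)) := by gcongr
    have n3 : 2 * (D * r * (r * o + c₁ * ‖M‖)) ≤ 2 * D * (r * o) + 2 * D * c₁ * (r * ‖M‖) := by
      have : D * o * r * r ≤ D * o * r * 1 := by gcongr
      nlinarith
    have n4 : ‖M‖ ≤ ‖K‖ * (r * o + r * (‖h₀‖ * ‖M‖) +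
        (2 * D * (r * o) + 2 * D * c₁ * (r * ‖M‖))) :=
      n1.trans (by gcongr; exact n2.trans n3)
    have n5 : ‖K‖ * (r * o + r * (‖h₀‖ * ‖M‖) + (2 * D * (r * o) + 2 * D * c₁ * (r * ‖M‖))) =
        c₂ * r / 2 + e * r * ‖M‖ / 2 := by
      simp only [c₂, e]; ring
    have n6 : e * r * ‖M‖ ≤ ‖M‖ := mul_le_of_le_one_left (norm_nonneg _) her
    linarith
  have hS : S ≤ c₃ * r := by
    have := mul_le_mul_of_nonneg_left hMn hc₁
    simp only [c₃]
    linarith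
  have hσE : ∀ F : 𝒜, ‖F‖ ≤ D * r * S → ‖σ • F‖ ≤ D * c₃ * r := fun F hF => by
    rw [norm_smul]
    calc ‖σ‖ * ‖F‖ ≤ ‖σ‖ * (D * r * (c₃ * r)) := by
          gcongr; exact hF.trans (by gcongr)
      _ = D * c₃ * r * (‖σ‖ * r) := by ring
      _ = D * c₃ * r := by rw [hr, mul_one]
  have hK1 : σ • M - K = K * (-(h₀ * M) + (2 : ℂ) • (σ • E)) := by
    have : σ • M = K * (1 - h₀ * M + (2 : ℂ) • (σ • E)) := by
      conv_lhs => rw [hMeq]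
      rw [← mul_smul_comm]
      congr 1
      simp only [smul_add, smul_sub, smul_smul, mul_inv_cancel₀ hσ0, one_smul]
      module
    rw [this]
    noncomm_ring
  have hh0M : ‖h₀ * M‖ ≤ ‖h₀‖ * c₂ * r := by
    rw [mul_assoc]
    exact (norm_mul_le _ _).trans (by gcongr)
  have hKn : ‖σ • M - K‖ ≤ c₄ * r := by
    rw [hK1]
    calc _ ≤ ‖K‖ * (‖h₀‖ * c₂ * r + 2 * (D * c₃ * r)) := by
          refine (norm_mul_le _ _).trans ?_
          gcongr
          refine (norm_add_le _ _).trans (add_le_add ?_ ?_)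
          · rwa [norm_neg]
          · rw [norm_smul, Complex.norm_ofNat]
            gcongr
            exact hσE E hEn
      _ = c₄ * r := by simp only [c₄]; ring
  have hsum : σ • (M + v) = (2 : ℂ) • K + ((1 - h₁) * (σ • M - K) - h₀ * M) := by
    have e1 : σ • (M + v) = σ • M + 1 - h₁ * σ • M - h₀ * M := by
      rw [hv']
      simp only [smul_add, smul_sub, smul_smul, mul_inv_cancel₀ hσ0, one_smul, mul_smul_comm]
      abel
    have e2 : (2 : ℂ) • K = K + (1 - h₁ * K) := by
      have : h₁ * K = 1 - K := by rw [← hK']; noncomm_ring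
      rw [this, two_smul]; abel
    rw [e1, e2]
    generalize σ • M = w
    noncomm_ring
  have hmain : ∀ x, 0 ≤ x → ∀ F : 𝒜, ‖F - (1 / 2 : ℂ) • (Pm x * (M + v))‖ ≤ D * r * S →
      ‖σ • F - Pm x * K‖ ≤ c₅ * r := by
    intro x hx F hF
    have e1 : σ • F - Pm x * K = σ • (F - (1 / 2 : ℂ) • (Pm x * (M + v))) +
        (1 / 2 : ℂ) • (Pm x * ((1 - h₁) * (σ • M - K) - h₀ * M)) := by
      have e2 : (1 - h₁) * (σ • M - K) - h₀ * M = σ • (M + v) - (2 : ℂ) • K := by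
        rw [hsum]; abel
      rw [e2]
      simp only [mul_sub, mul_smul_comm]
      module
    have e3 : ‖(1 - h₁) * (σ • M - K) - h₀ * M‖ ≤ (o + ‖h₁‖) * (c₄ * r) + ‖h₀‖ * c₂ * r := by
      refine (norm_sub_le _ _).trans (add_le_add ((norm_mul_le _ _).trans ?_) hh0M)
      gcongr
      exact norm_sub_le _ _
    rw [e1]
    refine (norm_add_le _ _).trans ?_
    have e4 := hσE _ hF
    have e5 : ‖(1 / 2 : ℂ) • (Pm x * ((1 - h₁) * (σ • M - K) - h₀ * M))‖ ≤
        C * ((o + ‖h₁‖) * (c₄ * r) + ‖h₀‖ * c₂ * r) := by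
      rw [norm_smul]
      calc _ ≤ 1 * (C * ((o + ‖h₁‖) * (c₄ * r) + ‖h₀‖ * c₂ * r)) := by
            gcongr
            · norm_num
            · exact (norm_mul_le _ _).trans (by gcongr; exact (hT.norm_le x hx).2.1)
        _ = _ := one_mul _
    simp only [c₅]
    linarith
  refine ⟨hKn.trans (by gcongr; linarith), fun x hx => ?_⟩
  obtain ⟨d1, d2⟩ := hdec' x hx
  have g1 := hmain x hx _ d1
  have g2 := hmain x hx _ d2
  have hle : c₅ * r ≤ (c₄ + c₅) * r := by gcongr; linarith
  refine ⟨?_, ?_⟩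
  · rw [smul_comm]; exact g1.trans hle
  · rw [smul_comm σ, smul_smul σ, mul_inv_cancel₀ hσ0, one_smul] at g2
    exact g2.trans hle

/-- The solution with the initial values `1`, `-(σ h₁ + h₀)`. -/
theorem exists_regular_asymptotics (hA : IntegrableCoeff A A' Q) (hT : Transport A Pp Pm Rp Rm C)
    (h₀ h₁ : 𝒜) :
    ∃ s₀ D : ℝ, 0 < s₀ ∧ 0 ≤ D ∧ ∀ σ : ℂ, σ.re ≤ 0 → s₀ ≤ ‖σ‖ → ∀ Y Y₁ : ℝ → 𝒜,
      IsSol A Q σ Y Y₁ → Y 0 = 1 → Y₁ 0 = -(σ • h₁ + h₀) → ∀ x : ℝ, 0 ≤ x →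
        ‖Complex.exp (σ * x) • Y x - (1 / 2 : ℂ) • (Complex.exp (2 * σ * x) • (Pm x * (1 - h₁)) +
          Pp x * (1 + h₁))‖ ≤ D * ‖σ⁻¹‖ ∧
        ‖Complex.exp (σ * x) • σ⁻¹ • Y₁ x - (1 / 2 : ℂ) •
          (Complex.exp (2 * σ * x) • (Pm x * (1 - h₁)) - Pp x * (1 + h₁))‖ ≤ D * ‖σ⁻¹‖ := by
  obtain ⟨s₀, D, hs₀, hD, hsol⟩ := exists_solution_asymptotics hA hT
  have hC : 0 ≤ C := (norm_nonneg _).trans (hT.norm_le 0 le_rfl).1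
  refine ⟨max s₀ 1, D * (‖(1 : 𝒜)‖ + ‖h₁‖ + ‖h₀‖) + C * ‖h₀‖, by positivity, by positivity,
    fun σ hσ hσs Y Y₁ hY h0 h1 x hx => ?_⟩
  have hσ1 : 1 ≤ ‖σ‖ := (le_max_right _ _).trans hσs
  have hσ0 : σ ≠ 0 := by rintro rfl; simp at hσ1; linarith
  have hr1 : ‖σ⁻¹‖ ≤ 1 := by rw [norm_inv]; exact inv_le_one_of_one_le₀ hσ1
  obtain ⟨-, g1, g2⟩ := hsol σ hσ ((le_max_left _ _).trans hσs) Y Y₁ hY x hx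
  have hv : σ⁻¹ • Y₁ 0 = -h₁ - σ⁻¹ • h₀ := by
    rw [h1, smul_neg, smul_add, smul_smul, inv_mul_cancel₀ hσ0, one_smul]
    abel
  have hsize : solSize σ Y Y₁ 0 ≤ ‖(1 : 𝒜)‖ + ‖h₁‖ + ‖h₀‖ := by
    rw [solSize, h0, hv]
    have n1 := norm_sub_le (-h₁) (σ⁻¹ • h₀)
    have n2 : ‖σ⁻¹ • h₀‖ ≤ ‖h₀‖ := by
      rw [norm_smul]; exact mul_le_of_le_one_left (norm_nonneg _) hr1
    rw [norm_neg] at n1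
    linarith
  have hbound : D * ‖σ⁻¹‖ * solSize σ Y Y₁ 0 ≤ D * (‖(1 : 𝒜)‖ + ‖h₁‖ + ‖h₀‖) * ‖σ⁻¹‖ := by
    have := mul_le_mul_of_nonneg_left hsize (mul_nonneg hD (norm_nonneg σ⁻¹))
    linarith
  rw [h0, hv] at g1 g2
  have hexp : ‖Complex.exp (2 * σ * x)‖ ≤ 1 := by
    rw [norm_cexp_mul_ofReal]
    refine Real.exp_le_one_iff.2 ?_
    simp
    nlinarith
  have hP : ∀ P : 𝒜, ‖P‖ ≤ C → ‖P * σ⁻¹ • h₀‖ ≤ C * ‖h₀‖ * ‖σ⁻¹‖ := fun P hP => by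
    refine (norm_mul_le _ _).trans ?_
    rw [norm_smul]
    calc ‖P‖ * (‖σ⁻¹‖ * ‖h₀‖) ≤ C * (‖σ⁻¹‖ * ‖h₀‖) := by gcongr
      _ = _ := by ring
  obtain ⟨hPp, hPm, -, -⟩ := hT.norm_le x hx
  have n1 := hP _ hPp
  have n2 : ‖Complex.exp (2 * σ * x) • (Pm x * σ⁻¹ • h₀)‖ ≤ C * ‖h₀‖ * ‖σ⁻¹‖ := by
    rw [norm_smul]
    exact (mul_le_of_le_one_left (norm_nonneg _) hexp).trans (hP _ hPm)
  have half : ∀ u v : 𝒜, ‖u‖ ≤ C * ‖h₀‖ * ‖σ⁻¹‖ → ‖v‖ ≤ C * ‖h₀‖ * ‖σ⁻¹‖ →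
      ‖(1 / 2 : ℂ) • (u + v)‖ ≤ C * ‖h₀‖ * ‖σ⁻¹‖ := fun u v hu hv => by
    have h2 : ‖(1 / 2 : ℂ)‖ = 1 / 2 := by norm_num
    rw [norm_smul, h2]
    linarith [norm_add_le u v]
  constructor
  · have e1 : Complex.exp (σ * x) • Y x - (1 / 2 : ℂ) • (Complex.exp (2 * σ * x) •
        (Pm x * (1 - h₁)) + Pp x * (1 + h₁)) = (Complex.exp (σ * x) • Y x - (1 / 2 : ℂ) •
        (Complex.exp (2 * σ * x) • (Pm x * (1 + (-h₁ - σ⁻¹ • h₀))) +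
        Pp x * (1 - (-h₁ - σ⁻¹ • h₀)))) +
        (1 / 2 : ℂ) • (-(Complex.exp (2 * σ * x) • (Pm x * σ⁻¹ • h₀)) + Pp x * σ⁻¹ • h₀) := by
      simp only [mul_sub, mul_add, mul_neg, mul_one]
      module
    rw [e1]
    have := half _ _ (by rwa [norm_neg]) n1
    refine (norm_add_le _ _).trans ((add_le_add (g1.trans hbound) this).trans_eq (by ring))
  · have e1 : Complex.exp (σ * x) • σ⁻¹ • Y₁ x - (1 / 2 : ℂ) • (Complex.exp (2 * σ * x) •
        (Pm x * (1 - h₁)) - Pp x * (1 + h₁)) = (Complex.exp (σ * x) • σ⁻¹ • Y₁ x - (1 / 2 : ℂ) •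
        (Complex.exp (2 * σ * x) • (Pm x * (1 + (-h₁ - σ⁻¹ • h₀))) -
        Pp x * (1 - (-h₁ - σ⁻¹ • h₀)))) +
        (1 / 2 : ℂ) • (-(Complex.exp (2 * σ * x) • (Pm x * σ⁻¹ • h₀)) + -(Pp x * σ⁻¹ • h₀)) := by
      simp only [mul_sub, mul_add, mul_neg, mul_one]
      module
    rw [e1]
    have := half _ _ (by rwa [norm_neg]) (by rwa [norm_neg] : ‖-(Pp x * σ⁻¹ • h₀)‖ ≤ _)
    refine (norm_add_le _ _).trans ((add_le_add (g2.trans hbound) this).trans_eq (by ring))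

end Asymptotics

theorem isOpen_halfPlane (s : Side) : IsOpen (halfPlane s) := by
  simp only [halfPlane]
  exact isOpen_lt continuous_const (by fun_prop)

/-! ### The Weyl matrix off the singular set -/

namespace Pencil

variable {L : Pencil m} {ρ θ : ℂ}

theorem isWeylSolution_eventually (hρ : ρ ∈ halfPlane Side.plus)
    (hs : ρ ∉ L.singularSet Side.plus) :
    ∃ B, ∀ᶠ w in 𝓝 ρ, (∃ Φ, L.IsWeylSolution w Φ) ∧ ‖L.weylMatrix w‖ ≤ B := by
  have hn : 𝓝[halfPlane Side.plus] ρ = 𝓝 ρ := (isOpen_halfPlane _).nhdsWithin_eq hρ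
  obtain ⟨h1, A, h2⟩ := by_contra fun hcon => hs ⟨subset_closure hρ, hcon⟩
  rw [hn] at h1 h2
  have h3 : ∀ᶠ w in 𝓝 ρ, ‖L.weylMatrix w‖ < ‖A‖ + 1 :=
    h2.norm.eventually_lt_const (by linarith)
  exact ⟨‖A‖ + 1, h1.and (h3.mono fun w hw => hw.le)⟩

theorem ClassV.regular_plus (h : L.ClassV) (hρ : ρ ∈ halfPlane Side.plus)
    (hs : ρ ∉ L.singularSet Side.plus) :
    (∃ Φ, L.IsWeylSolution ρ Φ) ∧ ∀ᶠ w in 𝓝 ρ, DifferentiableAt ℂ L.weylMatrix w ∧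
      w ∉ L.singularSet Side.plus := by
  obtain ⟨B, hB⟩ := isWeylSolution_eventually hρ hs
  refine ⟨hB.self_of_nhds.1, ?_⟩
  filter_upwards [hB.eventually_nhds, (isOpen_halfPlane _).mem_nhds hρ] with w hw hw'
  have hd := h.differentiableAt_weylMatrix hw' hw
  refine ⟨hd, fun hmem => hmem.2 ?_⟩
  rw [(isOpen_halfPlane _).nhdsWithin_eq hw']
  exact ⟨hw.mono fun _ h => h.1, _, hd.continuousAt⟩

theorem ClassV.regular (h : L.ClassV) {s : Side} (hρ : ρ ∈ halfPlane s)
    (hs : ρ ∉ L.singularSet s) :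
    (∃ Φ, L.IsWeylSolution ρ Φ) ∧ ∀ᶠ w in 𝓝 ρ, DifferentiableAt ℂ L.weylMatrix w ∧
      w ∉ L.singularSet s := by
  cases s with
  | plus => exact h.regular_plus hρ hs
  | minus =>
    have h1 : -ρ ∈ halfPlane Side.plus := neg_mem_halfPlane.2 hρ
    have h2 : -ρ ∉ L.reflect.singularSet Side.plus := fun hm =>
      hs ((reflect_singularSet L Side.plus ρ).1 hm)
    obtain ⟨h3, h4⟩ := h.reflect.regular_plus h1 h2
    rw [reflect_isWeylSolution] at h3
    refine ⟨h3, ?_⟩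
    have h5 : Tendsto Neg.neg (𝓝 ρ) (𝓝 (-ρ)) := continuous_neg.tendsto ρ
    filter_upwards [h5.eventually h4] with w hw
    refine ⟨?_, fun hm => hw.2 ((reflect_singularSet L Side.plus w).2 hm)⟩
    have h6 : L.weylMatrix = fun w => L.reflect.weylMatrix (-w) :=
      funext fun w => (L.reflect_weylMatrix w).symm
    rw [h6]
    exact hw.1.comp w differentiableAt_id.neg

theorem ClassV.tendsto_weylMatrix (h : L.ClassV) {s : Side} (hρ : ρ ∈ closure (halfPlane s))
    (hs : ρ ∉ L.singularSet s) :
    Tendsto L.weylMatrix (𝓝[halfPlane s] ρ) (𝓝 (L.weylSide s ρ)) := by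
  by_cases hρ' : ρ ∈ halfPlane s
  · rw [weylSide, if_pos hρ', (isOpen_halfPlane s).nhdsWithin_eq hρ']
    exact (h.regular hρ' hs).2.self_of_nhds.1.continuousAt
  · rw [weylSide, if_neg hρ']
    exact tendsto_nhds_limUnder (by_contra fun hcon => hs ⟨hρ, hcon⟩ :).2

/-- The Weyl matrix with its boundary values is continuous off the singular set. -/
theorem ClassV.continuousOn_weylSide (h : L.ClassV) (s : Side) :
    ContinuousOn (L.weylSide s) (closure (halfPlane s) \ L.singularSet s) := by
  have h1 : ContinuousOn (extendFrom (halfPlane s) L.weylMatrix)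
      (closure (halfPlane s) \ L.singularSet s) :=
    continuousOn_extendFrom sdiff_subset fun ρ hρ => ⟨_, h.tendsto_weylMatrix hρ.1 hρ.2⟩
  refine h1.congr fun ρ hρ => ?_
  exact (extendFrom_eq hρ.1 (h.tendsto_weylMatrix hρ.1 hρ.2)).symm

/-! ### The asymptotics of the spectral matrices -/

/-- `(I + h₁)⁻¹`, the leading coefficient of the Weyl matrix. -/
def lead (L : Pencil m) : CMat m := (1 + L.h₁)⁻¹

theorem NonRegge.lead_mul (h : L.NonRegge) : L.lead * (1 + L.h₁) = 1 :=
  Matrix.nonsing_inv_mul _ (isUnit_iff_ne_zero.2 h.1)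

theorem NonRegge.mul_lead (h : L.NonRegge) : (1 + L.h₁) * L.lead = 1 :=
  Matrix.mul_nonsing_inv _ (isUnit_iff_ne_zero.2 h.1)

theorem bc_eq (L : Pencil m) (ρ : ℂ) : L.bc ρ = (Complex.I * ρ) • L.h₁ + L.h₀ := rfl

theorem norm_I_mul_inv (ρ : ℂ) : ‖(Complex.I * ρ)⁻¹‖ = ‖ρ‖⁻¹ := by simp

theorem ClassV.exists_weyl_asymptotics (h : L.ClassV) (hN : L.NonRegge) :
    ∃ s₀ D : ℝ, 0 < s₀ ∧ 0 ≤ D ∧ ∀ ρ ∈ halfPlane Side.plus, s₀ ≤ ‖ρ‖ →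
      (∃ Φ, L.IsWeylSolution ρ Φ) →
      ‖(Complex.I * ρ) • L.weylMatrix ρ - L.lead‖ ≤ D * ‖ρ‖⁻¹ ∧ ∀ x : ℝ, 0 ≤ x →
        ‖Complex.exp (-(Complex.I * ρ) * x) • (Complex.I * ρ) • L.weylSol ρ x -
          L.P Side.minus x * L.lead‖ ≤ D * ‖ρ‖⁻¹ ∧
        ‖Complex.exp (-(Complex.I * ρ) * x) • L.weylSolDeriv ρ x -
          L.P Side.minus x * L.lead‖ ≤ D * ‖ρ‖⁻¹ := by
  obtain ⟨C, hT⟩ := h.exists_transport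
  obtain ⟨s₀, D, hs₀, hD, H⟩ :=
    _root_.exists_weyl_asymptotics h.integrableCoeff hT (h₀ := L.h₀) hN.lead_mul hN.mul_lead
  refine ⟨s₀, D, hs₀, hD, fun ρ hρ hn hW => ?_⟩
  obtain ⟨e1, e2, e3⟩ := h.isSol_weylSol ρ
  obtain ⟨B, hB0, hB⟩ := h.exists_decay_weyl hρ hW
  have hre : -(Complex.I * ρ).re = ρ.im := by simp
  have := H (Complex.I * ρ) (re_I_mul_neg hρ) (by simpa using hn) _ _ e1
    (by rw [e3, e2, bc_eq]) ⟨B + ‖ρ‖⁻¹ * B, fun x hx => by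
      have hb := hB x hx
      rw [solSize, norm_smul, norm_I_mul_inv, hre]
      have hE : Real.exp (ρ.im * x) * Real.exp (-ρ.im * x) = 1 := by
        rw [← Real.exp_add]; simp
      calc _ ≤ Real.exp (ρ.im * x) * (B * Real.exp (-ρ.im * x) +
            ‖ρ‖⁻¹ * (B * Real.exp (-ρ.im * x))) := by
            gcongr
            · exact hb.1
            · exact hb.2.1
        _ = (Real.exp (ρ.im * x) * Real.exp (-ρ.im * x)) * (B + ‖ρ‖⁻¹ * B) := by ring
        _ = _ := by rw [hE, one_mul]⟩
  rw [norm_I_mul_inv, e2] at this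
  exact this

/-- Follows from the asymptotics of decaying solutions for the transposed pencil. -/
theorem ClassV.exists_weylStar_asymptotics (h : L.ClassV) (hN : L.NonRegge) :
    ∃ s₀ D : ℝ, 0 < s₀ ∧ 0 ≤ D ∧ ∀ ρ ∈ halfPlane Side.plus, s₀ ≤ ‖ρ‖ →
      (∃ Φ, L.IsWeylSolution ρ Φ) → ∀ x : ℝ, 0 ≤ x →
        ‖Complex.exp (-(Complex.I * ρ) * x) • (Complex.I * ρ) • L.weylStar ρ x -
          L.lead * L.PStar Side.minus x‖ ≤ D * ‖ρ‖⁻¹ ∧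
        ‖Complex.exp (-(Complex.I * ρ) * x) • L.weylStarDeriv ρ x -
          L.lead * L.PStar Side.minus x‖ ≤ D * ‖ρ‖⁻¹ := by
  obtain ⟨C, hT⟩ := h.transpose.exists_transport
  obtain ⟨s₀, D, hs₀, hD, H⟩ :=
    _root_.exists_weyl_asymptotics h.transpose.integrableCoeff hT (h₀ := L.h₀.transpose)
      (h₁ := L.h₁.transpose) (K := L.lead.transpose)
      (by simpa [Matrix.transpose_mul] using congrArg Matrix.transpose hN.mul_lead)
      (by simpa [Matrix.transpose_mul] using congrArg Matrix.transpose hN.lead_mul)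
  set τ := ‖transposeCLM m‖
  refine ⟨s₀, τ * D, hs₀, by positivity, fun ρ hρ hn hW x hx => ?_⟩
  obtain ⟨e1, e2, e3⟩ := h.isSolStar_weylStar ρ
  obtain ⟨B, hB0, hB⟩ := h.exists_decay_weyl hρ hW
  have hre : -(Complex.I * ρ).re = ρ.im := by simp
  have := H (Complex.I * ρ) (re_I_mul_neg hρ) (by simpa using hn) _ _
    (isSolStar_iff_transpose.1 e1)
    (by simp only [e3, e2, bc_eq]; simp [Matrix.transpose_mul])
    ⟨τ * B + ‖ρ‖⁻¹ * (τ * B), fun x hx => by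
      have hb := hB x hx
      rw [solSize, norm_smul, norm_I_mul_inv, hre]
      have hE : Real.exp (ρ.im * x) * Real.exp (-ρ.im * x) = 1 := by
        rw [← Real.exp_add]; simp
      calc _ ≤ Real.exp (ρ.im * x) * (τ * (B * Real.exp (-ρ.im * x)) +
            ‖ρ‖⁻¹ * (τ * (B * Real.exp (-ρ.im * x)))) := by
            gcongr
            · exact (norm_transpose_le _).trans (by gcongr; exact hb.2.2.1)
            · exact (norm_transpose_le _).trans (by gcongr; exact hb.2.2.2)
        _ = (Real.exp (ρ.im * x) * Real.exp (-ρ.im * x)) * (τ * B + ‖ρ‖⁻¹ * (τ * B)) := by ring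
        _ = _ := by rw [hE, one_mul]⟩
  rw [norm_I_mul_inv] at this
  obtain ⟨g1, g2⟩ := this.2 x hx
  rw [← h.transpose_P Side.minus hx]
  constructor
  · refine le_trans ?_ ((norm_transpose_le _).trans ((mul_le_mul_of_nonneg_left g1
      (norm_nonneg _)).trans_eq (mul_assoc _ _ _).symm))
    simp [Matrix.transpose_mul]
  · refine le_trans ?_ ((norm_transpose_le _).trans ((mul_le_mul_of_nonneg_left g2
      (norm_nonneg _)).trans_eq (mul_assoc _ _ _).symm))
    simp [Matrix.transpose_mul]

theorem ClassV.exists_phi_asymptotics (h : L.ClassV) :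
    ∃ s₀ D : ℝ, 0 < s₀ ∧ 0 ≤ D ∧ ∀ ρ : ℂ, 0 ≤ ρ.im → s₀ ≤ ‖ρ‖ → ∀ x : ℝ, 0 ≤ x →
        ‖Complex.exp (Complex.I * ρ * x) • L.phi ρ x - (1 / 2 : ℂ) •
          (Complex.exp (2 * (Complex.I * ρ) * x) • (L.P Side.minus x * (1 - L.h₁)) +
          L.P Side.plus x * (1 + L.h₁))‖ ≤ D * ‖ρ‖⁻¹ ∧
        ‖Complex.exp (Complex.I * ρ * x) • (Complex.I * ρ)⁻¹ • dHalf (L.phi ρ) x - (1 / 2 : ℂ) •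
          (Complex.exp (2 * (Complex.I * ρ) * x) • (L.P Side.minus x * (1 - L.h₁)) -
          L.P Side.plus x * (1 + L.h₁))‖ ≤ D * ‖ρ‖⁻¹ := by
  obtain ⟨C, hT⟩ := h.exists_transport
  obtain ⟨s₀, D, hs₀, hD, H⟩ := exists_regular_asymptotics h.integrableCoeff hT L.h₀ L.h₁
  refine ⟨s₀, D, hs₀, hD, fun ρ hρ hn x hx => ?_⟩
  obtain ⟨e1, e2, e3⟩ := h.phi_spec ρ
  have := H (Complex.I * ρ) (by simpa using hρ) (by simpa using hn) _ _ e1 e2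
    (by rw [e3, bc_eq]) x hx
  rwa [norm_I_mul_inv] at this

theorem ClassV.exists_phiStar_asymptotics (h : L.ClassV) :
    ∃ s₀ D : ℝ, 0 < s₀ ∧ 0 ≤ D ∧ ∀ ρ : ℂ, 0 ≤ ρ.im → s₀ ≤ ‖ρ‖ → ∀ x : ℝ, 0 ≤ x →
        ‖Complex.exp (Complex.I * ρ * x) • L.phiStar ρ x - (1 / 2 : ℂ) •
          (Complex.exp (2 * (Complex.I * ρ) * x) • ((1 - L.h₁) * L.PStar Side.minus x) +
          (1 + L.h₁) * L.PStar Side.plus x)‖ ≤ D * ‖ρ‖⁻¹ ∧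
        ‖Complex.exp (Complex.I * ρ * x) • (Complex.I * ρ)⁻¹ • dHalf (L.phiStar ρ) x -
          (1 / 2 : ℂ) •
          (Complex.exp (2 * (Complex.I * ρ) * x) • ((1 - L.h₁) * L.PStar Side.minus x) -
          (1 + L.h₁) * L.PStar Side.plus x)‖ ≤ D * ‖ρ‖⁻¹ := by
  obtain ⟨s₀, D, hs₀, hD, H⟩ := h.transpose.exists_phi_asymptotics
  refine ⟨s₀, ‖transposeCLM m‖ * D, hs₀, by positivity, fun ρ hρ hn x hx => ?_⟩
  obtain ⟨g1, g2⟩ := H ρ hρ hn x hx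
  rw [← h.transpose_P Side.minus hx, ← h.transpose_P Side.plus hx, (h.phiStar_eq ρ hx).1,
    (h.phiStar_eq ρ hx).2]
  constructor
  · refine le_trans ?_ ((norm_transpose_le _).trans ((mul_le_mul_of_nonneg_left g1
      (norm_nonneg _)).trans_eq (mul_assoc _ _ _).symm))
    simp [Matrix.transpose_mul, Pencil.transpose]
  · refine le_trans ?_ ((norm_transpose_le _).trans ((mul_le_mul_of_nonneg_left g2
      (norm_nonneg _)).trans_eq (mul_assoc _ _ _).symm))
    simp [Matrix.transpose_mul, Pencil.transpose]

/-- The part of `ClassV.exists_bound_strip` in the upper half-plane; the other part is its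
reflection. -/
theorem ClassV.exists_bound_strip_plus (h : L.ClassV) {x : ℝ} (hx : 0 ≤ x) (T : ℝ) :
    ∃ C, 0 ≤ C ∧ ∀ ρ : ℂ, 0 ≤ ρ.im → ρ.im ≤ T →
      ‖L.phi ρ x‖ ≤ C ∧ ‖dHalf (L.phi ρ) x‖ ≤ C * (1 + ‖ρ‖) := by
  obtain ⟨s₀, D, hs₀, hD, H⟩ := h.exists_phi_asymptotics
  obtain ⟨p, hp⟩ := h.exists_bound_P
  have hp0 : 0 ≤ p := (norm_nonneg _).trans (hp Side.plus x hx).1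
  have hc := h.differentiable_phi hx
  obtain ⟨C₁, hC₁⟩ := (isCompact_closedBall (0 : ℂ) s₀).exists_bound_of_continuousOn
    hc.1.continuous.continuousOn
  obtain ⟨C₂, hC₂⟩ := (isCompact_closedBall (0 : ℂ) s₀).exists_bound_of_continuousOn
    hc.2.continuous.continuousOn
  have h0 : (0 : ℂ) ∈ Metric.closedBall (0 : ℂ) s₀ := by simp [hs₀.le]
  have hC₁0 : 0 ≤ C₁ := (norm_nonneg _).trans (hC₁ 0 h0)
  have hC₂0 : 0 ≤ C₂ := (norm_nonneg _).trans (hC₂ 0 h0)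
  set q := p * ‖1 - L.h₁‖ + p * ‖1 + L.h₁‖
  have hq0 : 0 ≤ q := by positivity
  set r := Real.exp (T * x) * (D * s₀⁻¹ + q)
  have hr : 0 ≤ r := by positivity
  refine ⟨C₁ + C₂ + r, by positivity, fun ρ hρ hρT => ?_⟩
  -- Compactness for `|ρ| ≤ s₀`, the asymptotics beyond.
  rcases le_or_gt ‖ρ‖ s₀ with hle | hgt
  · have hmem : ρ ∈ Metric.closedBall (0 : ℂ) s₀ := by simpa using hle
    refine ⟨(hC₁ ρ hmem).trans (by linarith), (hC₂ ρ hmem).trans ?_⟩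
    calc C₂ ≤ (C₁ + C₂ + r) * 1 := by linarith
      _ ≤ _ := by gcongr; linarith [norm_nonneg ρ]
  · obtain ⟨g1, g2⟩ := H ρ hρ hgt.le x hx
    have hinv : D * ‖ρ‖⁻¹ ≤ D * s₀⁻¹ := by gcongr
    have he1 : ‖Complex.exp (Complex.I * ρ * x)‖ = Real.exp (-(ρ.im * x)) := by
      rw [norm_cexp_mul_ofReal]; simp
    have he2 : ‖Complex.exp (2 * (Complex.I * ρ) * x)‖ ≤ 1 := by
      rw [norm_cexp_mul_ofReal]
      refine Real.exp_le_one_iff.2 ?_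
      simp
      positivity
    have hhalf : ‖(1 / 2 : ℂ)‖ = 1 / 2 := by norm_num
    have n1 : ‖Complex.exp (2 * (Complex.I * ρ) * x) • (L.P Side.minus x * (1 - L.h₁))‖ ≤
        p * ‖1 - L.h₁‖ := by
      rw [norm_smul]
      refine (mul_le_of_le_one_left (norm_nonneg _) he2).trans ?_
      exact (norm_mul_le _ _).trans (by gcongr; exact (hp _ x hx).1)
    have n2 : ‖L.P Side.plus x * (1 + L.h₁)‖ ≤ p * ‖1 + L.h₁‖ :=
      (norm_mul_le _ _).trans (by gcongr; exact (hp _ x hx).1)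
    have key : ∀ a b : CMat m, ‖Complex.exp (Complex.I * ρ * x) • a - b‖ ≤ D * ‖ρ‖⁻¹ → ‖b‖ ≤ q →
        ‖a‖ ≤ r := fun a b h1 h2 => by
      have h3 := norm_sub_norm_le (Complex.exp (Complex.I * ρ * x) • a) b
      rw [norm_smul, he1] at h3
      have h4 : ‖a‖ = Real.exp (ρ.im * x) * (Real.exp (-(ρ.im * x)) * ‖a‖) := by
        rw [← mul_assoc, ← Real.exp_add, add_neg_cancel, Real.exp_zero, one_mul]
      rw [h4]
      refine mul_le_mul (Real.exp_le_exp.2 (by gcongr)) (by linarith) (by positivity)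
        (by positivity)
    have k1 := key _ _ g1 (by
      rw [norm_smul, hhalf]
      linarith [norm_add_le (Complex.exp (2 * (Complex.I * ρ) * x) •
        (L.P Side.minus x * (1 - L.h₁))) (L.P Side.plus x * (1 + L.h₁))])
    have k2 := key _ _ g2 (by
      rw [norm_smul, hhalf]
      linarith [norm_sub_le (Complex.exp (2 * (Complex.I * ρ) * x) •
        (L.P Side.minus x * (1 - L.h₁))) (L.P Side.plus x * (1 + L.h₁))])
    rw [norm_smul, norm_I_mul_inv, inv_mul_le_iff₀ (hs₀.trans hgt), mul_comm] at k2
    refine ⟨by linarith, k2.trans (mul_le_mul (by linarith) (by linarith) (norm_nonneg _)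
      (by positivity))⟩

/-- `φ` is bounded in horizontal strips, and `φ'` has linear growth there. -/
theorem ClassV.exists_bound_strip (h : L.ClassV) {x : ℝ} (hx : 0 ≤ x) (T : ℝ) :
    ∃ C, 0 ≤ C ∧ ∀ ρ : ℂ, |ρ.im| ≤ T →
      ‖L.phi ρ x‖ ≤ C ∧ ‖dHalf (L.phi ρ) x‖ ≤ C * (1 + ‖ρ‖) := by
  obtain ⟨C₁, h₁, H₁⟩ := h.exists_bound_strip_plus hx T
  obtain ⟨C₂, h₂, H₂⟩ := h.reflect.exists_bound_strip_plus hx T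
  refine ⟨max C₁ C₂, le_max_of_le_left h₁, fun ρ hρ => ?_⟩
  obtain ⟨h3, h4⟩ := abs_le.1 hρ
  rcases le_total 0 ρ.im with him | him
  · obtain ⟨g1, g2⟩ := H₁ ρ him h4
    exact ⟨g1.trans (le_max_left _ _), g2.trans (by gcongr; exact le_max_left _ _)⟩
  · obtain ⟨g1, g2⟩ := H₂ (-ρ) (by simpa using him) (by simp; linarith)
    rw [reflect_phi] at g1 g2
    rw [norm_neg] at g2
    exact ⟨g1.trans (le_max_right _ _), g2.trans (by gcongr; exact le_max_right _ _)⟩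

theorem ClassV.exists_bound_strip_star (h : L.ClassV) {x : ℝ} (hx : 0 ≤ x) (T : ℝ) :
    ∃ C, 0 ≤ C ∧ ∀ ρ : ℂ, |ρ.im| ≤ T →
      ‖L.phiStar ρ x‖ ≤ C ∧ ‖dHalf (L.phiStar ρ) x‖ ≤ C * (1 + ‖ρ‖) := by
  obtain ⟨C, hC0, hC⟩ := h.transpose.exists_bound_strip hx T
  refine ⟨‖transposeCLM m‖ * C, by positivity, fun ρ hρ => ?_⟩
  rw [(h.phiStar_eq ρ hx).1, (h.phiStar_eq ρ hx).2]
  refine ⟨(norm_transpose_le _).trans (by gcongr; exact (hC ρ hρ).1), ?_⟩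
  refine (norm_transpose_le _).trans ?_
  rw [mul_assoc]
  gcongr
  exact (hC ρ hρ).2

end Pencil

/-! ### The spectral matrix of a pair of pencils -/

theorem Filter.Tendsto.mul_sub_mul {α : Type*} {l : Filter α} {u u₀ v v₀ : α → CMat m} {B : ℝ}
    (hu : Tendsto (fun a => u a - u₀ a) l (𝓝 0)) (hv : Tendsto (fun a => v a - v₀ a) l (𝓝 0))
    (hu₀ : ∀ᶠ a in l, ‖u₀ a‖ ≤ B) (hv₀ : ∀ᶠ a in l, ‖v₀ a‖ ≤ B) :
    Tendsto (fun a => u a * v a - u₀ a * v₀ a) l (𝓝 0) := by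
  have h1 : Tendsto (fun a => u₀ a * (v a - v₀ a)) l (𝓝 0) := by
    refine squeeze_zero_norm' (a := fun a => B * ‖v a - v₀ a‖) ?_
      (by simpa using hv.norm.const_mul B)
    filter_upwards [hu₀] with a ha
    exact (norm_mul_le _ _).trans (by gcongr)
  have h2 : Tendsto (fun a => (u a - u₀ a) * v₀ a) l (𝓝 0) := by
    refine squeeze_zero_norm' (a := fun a => ‖u a - u₀ a‖ * B) ?_
      (by simpa using hu.norm.mul_const B)
    filter_upwards [hv₀] with a ha
    exact (norm_mul_le _ _).trans (by gcongr)
  have h3 := ((hu.mul hv).add h1).add h2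
  simp only [mul_zero, add_zero] at h3
  refine h3.congr fun a => ?_
  noncomm_ring

theorem tendsto_zero_of_norm_le_inv {S : Set ℂ} {f : ℂ → CMat m} {s₀ D : ℝ}
    (h : ∀ ρ ∈ S, s₀ ≤ ‖ρ‖ → ‖f ρ‖ ≤ D * ‖ρ‖⁻¹) :
    Tendsto f (Bornology.cobounded ℂ ⊓ 𝓟 S) (𝓝 0) := by
  have h1 : Tendsto (fun ρ : ℂ => D * ‖ρ‖⁻¹) (Bornology.cobounded ℂ ⊓ 𝓟 S) (𝓝 0) := by
    have := (tendsto_norm_cobounded_atTop (E := ℂ)).inv_tendsto_atTop.const_mul D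
    simp only [mul_zero] at this
    exact this.mono_left inf_le_left
  refine squeeze_zero_norm' ?_ h1
  have h2 : ∀ᶠ ρ in Bornology.cobounded ℂ, s₀ ≤ ‖ρ‖ :=
    tendsto_norm_cobounded_atTop.eventually_ge_atTop s₀
  filter_upwards [h2.filter_mono inf_le_left, mem_inf_of_right (mem_principal_self S)] with ρ h3 h4
  exact h ρ h4 h3

namespace Pencil

variable {L Lt : Pencil m} {ρ θ : ℂ} {x : ℝ}

/-- The points of a half-plane at which both pencils have Weyl solutions. -/
def weylSet (L Lt : Pencil m) (s : Side) : Set ℂ :=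
  {ρ | ρ ∈ halfPlane s ∧ (∃ Φ, L.IsWeylSolution ρ Φ) ∧ ∃ Φ, Lt.IsWeylSolution ρ Φ}

/-- The filter `|ρ| → ∞` in a half-plane. -/
def far (L Lt : Pencil m) (s : Side) : Filter ℂ := Bornology.cobounded ℂ ⊓ 𝓟 (weylSet L Lt s)

/-- `M - M̃`. -/
def weylDiff (L Lt : Pencil m) (ρ : ℂ) : CMat m := L.weylMatrix ρ - Lt.weylMatrix ρ

/-- The product of the matrix `[φ S; φ' S']` and the inverse of the matrix `[φ̃ S̃; φ̃' S̃']`, the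
latter expressed by star solutions, is entire. This is its upper left entry. -/
def regular₁₁ (L Lt : Pencil m) (x : ℝ) (ρ : ℂ) : CMat m :=
  L.phi ρ x * dHalf (Lt.sineStar ρ) x - L.sine ρ x * dHalf (Lt.phiStar ρ) x

/-- The upper right entry of the entire matrix whose upper left entry is `regular₁₁`. -/
def regular₁₂ (L Lt : Pencil m) (x : ℝ) (ρ : ℂ) : CMat m :=
  L.sine ρ x * Lt.phiStar ρ x - L.phi ρ x * Lt.sineStar ρ x

/-- The lower left entry of the entire matrix whose upper left entry is `regular₁₁`. -/
def regular₂₁ (L Lt : Pencil m) (x : ℝ) (ρ : ℂ) : CMat m :=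
  dHalf (L.phi ρ) x * dHalf (Lt.sineStar ρ) x - dHalf (L.sine ρ) x * dHalf (Lt.phiStar ρ) x

/-- The lower right entry of the entire matrix whose upper left entry is `regular₁₁`. -/
def regular₂₂ (L Lt : Pencil m) (x : ℝ) (ρ : ℂ) : CMat m :=
  dHalf (L.sine ρ) x * Lt.phiStar ρ x - dHalf (L.phi ρ) x * Lt.sineStar ρ x

/-- The product of the matrix `[φ Φ; φ' Φ']` and the inverse of the matrix `[φ̃ Φ̃; φ̃' Φ̃']`. It
differs from the entire matrix of `regular₁₁` by a term with the factor `M - M̃`. This is its upper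
left entry. -/
def spectral₁₁ (L Lt : Pencil m) (x : ℝ) (ρ : ℂ) : CMat m :=
  regular₁₁ L Lt x ρ - L.phi ρ x * weylDiff L Lt ρ * dHalf (Lt.phiStar ρ) x

/-- The upper right entry of the spectral matrix whose upper left entry is `spectral₁₁`. -/
def spectral₁₂ (L Lt : Pencil m) (x : ℝ) (ρ : ℂ) : CMat m :=
  regular₁₂ L Lt x ρ + L.phi ρ x * weylDiff L Lt ρ * Lt.phiStar ρ x

/-- The lower left entry of the spectral matrix whose upper left entry is `spectral₁₁`. -/
def spectral₂₁ (L Lt : Pencil m) (x : ℝ) (ρ : ℂ) : CMat m :=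
  regular₂₁ L Lt x ρ - dHalf (L.phi ρ) x * weylDiff L Lt ρ * dHalf (Lt.phiStar ρ) x

/-- The lower right entry of the spectral matrix whose upper left entry is `spectral₁₁`. -/
def spectral₂₂ (L Lt : Pencil m) (x : ℝ) (ρ : ℂ) : CMat m :=
  regular₂₂ L Lt x ρ + dHalf (L.phi ρ) x * weylDiff L Lt ρ * Lt.phiStar ρ x

/-- The companion `(P₋ P̃*₊ - P₊ P̃*₋) / 2` of `Ω`. -/
def Xi (L Lt : Pencil m) (x : ℝ) : CMat m :=
  (2⁻¹ : ℂ) • (L.P Side.minus x * Lt.PStar Side.plus x - L.P Side.plus x * Lt.PStar Side.minus x)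

theorem spectral_eq (L Lt : Pencil m) (x : ℝ) (ρ : ℂ) :
    spectral₁₁ L Lt x ρ = L.phi ρ x * Lt.weylStarDeriv ρ x -
      L.weylSol ρ x * dHalf (Lt.phiStar ρ) x ∧
    spectral₁₂ L Lt x ρ = L.weylSol ρ x * Lt.phiStar ρ x - L.phi ρ x * Lt.weylStar ρ x ∧
    spectral₂₁ L Lt x ρ = dHalf (L.phi ρ) x * Lt.weylStarDeriv ρ x -
      L.weylSolDeriv ρ x * dHalf (Lt.phiStar ρ) x ∧
    spectral₂₂ L Lt x ρ = L.weylSolDeriv ρ x * Lt.phiStar ρ x -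
      dHalf (L.phi ρ) x * Lt.weylStar ρ x := by
  simp only [spectral₁₁, spectral₁₂, spectral₂₁, spectral₂₂, regular₁₁, regular₁₂, regular₂₁,
    regular₂₂, weylDiff, weylStarDeriv, weylSol, weylStar, weylSolDeriv]
  refine ⟨?_, ?_, ?_, ?_⟩ <;> noncomm_ring

/-- The terms with the oscillating factor `e` cancel in the limits of the spectral matrix. -/
theorem limit_identities {a b c d h K : CMat m} (e : ℂ) (hK : (1 + h) * K = 1)
    (hK' : K * (1 + h) = 1) :
    ((1 / 2 : ℂ) • (e • (a * (1 - h)) + b * (1 + h)) * (K * c) -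
      a * K * ((1 / 2 : ℂ) • (e • ((1 - h) * c) - (1 + h) * d)) = (2⁻¹ : ℂ) • (a * d + b * c)) ∧
    (a * K * ((1 / 2 : ℂ) • (e • ((1 - h) * c) + (1 + h) * d)) -
      (1 / 2 : ℂ) • (e • (a * (1 - h)) + b * (1 + h)) * (K * c) = (2⁻¹ : ℂ) • (a * d - b * c)) ∧
    ((1 / 2 : ℂ) • (e • (a * (1 - h)) - b * (1 + h)) * (K * c) -
      a * K * ((1 / 2 : ℂ) • (e • ((1 - h) * c) - (1 + h) * d)) = (2⁻¹ : ℂ) • (a * d - b * c)) ∧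
    (a * K * ((1 / 2 : ℂ) • (e • ((1 - h) * c) + (1 + h) * d)) -
      (1 / 2 : ℂ) • (e • (a * (1 - h)) - b * (1 + h)) * (K * c) = (2⁻¹ : ℂ) • (a * d + b * c)) := by
  have k1 : a * (1 - h) * (K * c) = a * K * ((1 - h) * c) := by
    have : (1 - h) * K = K * (1 - h) := by
      have e1 : h * K = 1 - K := by rw [← hK]; noncomm_ring
      have e2 : K * h = 1 - K := by rw [← hK']; noncomm_ring
      rw [sub_mul, mul_sub, one_mul, mul_one, e1, e2]
    calc a * (1 - h) * (K * c) = a * ((1 - h) * K) * c := by noncomm_ring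
      _ = _ := by rw [this]; noncomm_ring
  have k2 : b * (1 + h) * (K * c) = b * c := by
    calc b * (1 + h) * (K * c) = b * ((1 + h) * K) * c := by noncomm_ring
      _ = _ := by rw [hK, mul_one]
  have k3 : a * K * ((1 + h) * d) = a * d := by
    calc a * K * ((1 + h) * d) = a * (K * (1 + h)) * d := by noncomm_ring
      _ = _ := by rw [hK', mul_one]
  have e1 : ∀ w : CMat m, (1 / 2 : ℂ) • (e • (a * (1 - h)) + w) * (K * c) =
      (1 / 2 : ℂ) • (e • (a * K * ((1 - h) * c)) + w * (K * c)) := fun w => by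
    rw [smul_mul_assoc, add_mul, smul_mul_assoc, k1]
  have e2 : ∀ w : CMat m, a * K * ((1 / 2 : ℂ) • (e • ((1 - h) * c) + w)) =
      (1 / 2 : ℂ) • (e • (a * K * ((1 - h) * c)) + a * K * w) := fun w => by
    rw [mul_smul_comm, mul_add, mul_smul_comm]
  refine ⟨?_, ?_, ?_, ?_⟩
  all_goals
    simp only [sub_eq_add_neg (e • (a * (1 - h))), sub_eq_add_neg (e • ((1 - h) * c)), e1, e2,
      neg_mul, mul_neg, k2, k3]
    module

/-- The leading terms of `φ`, `Φ` and of the star solutions of the second pencil carry inverse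
exponentials, so that their products converge; the oscillating parts cancel by
`limit_identities`. -/
theorem tendsto_spectral_plus (hL : L.ClassV) (hLt : Lt.ClassV) (hN : L.NonRegge)
    (hNt : Lt.NonRegge) (hh : L.h₁ = Lt.h₁) (hx : 0 ≤ x) :
    Tendsto (fun ρ => spectral₁₁ L Lt x ρ) (far L Lt Side.plus) (𝓝 (Omega L Lt x)) ∧
    Tendsto (fun ρ => (Complex.I * ρ) • spectral₁₂ L Lt x ρ) (far L Lt Side.plus)
      (𝓝 (Xi L Lt x)) ∧
    Tendsto (fun ρ => (Complex.I * ρ)⁻¹ • spectral₂₁ L Lt x ρ) (far L Lt Side.plus)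
      (𝓝 (Xi L Lt x)) ∧
    Tendsto (fun ρ => spectral₂₂ L Lt x ρ) (far L Lt Side.plus) (𝓝 (Omega L Lt x)) := by
  obtain ⟨s₁, D₁, -, -, H₁⟩ := hL.exists_phi_asymptotics
  obtain ⟨s₂, D₂, -, -, H₂⟩ := hL.exists_weyl_asymptotics hN
  obtain ⟨s₃, D₃, -, -, H₃⟩ := hLt.exists_phiStar_asymptotics
  obtain ⟨s₄, D₄, -, -, H₄⟩ := hLt.exists_weylStar_asymptotics hNt
  have hlead : Lt.lead = L.lead := by rw [lead, lead, hh]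
  rw [hlead] at H₄
  rw [← hh] at H₃
  have him : ∀ ρ ∈ weylSet L Lt Side.plus, 0 < ρ.im := fun ρ hρ => by
    simpa [halfPlane, Side.sign] using hρ.1
  -- `A`, `B`, `At`, `Bt` and their primed versions: the remainders of `φ`, `Φ`, `φ̃*`, `Φ̃*` and of
  -- their derivatives tend to zero.
  have A := tendsto_zero_of_norm_le_inv (S := weylSet L Lt Side.plus) (s₀ := s₁) (D := D₁)
    fun ρ hρ hn => (H₁ ρ (him ρ hρ).le hn x hx).1
  have A' := tendsto_zero_of_norm_le_inv (S := weylSet L Lt Side.plus) (s₀ := s₁) (D := D₁)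
    fun ρ hρ hn => (H₁ ρ (him ρ hρ).le hn x hx).2
  have B := tendsto_zero_of_norm_le_inv (S := weylSet L Lt Side.plus) (s₀ := s₂) (D := D₂)
    fun ρ hρ hn => ((H₂ ρ hρ.1 hn hρ.2.1).2 x hx).1
  have B' := tendsto_zero_of_norm_le_inv (S := weylSet L Lt Side.plus) (s₀ := s₂) (D := D₂)
    fun ρ hρ hn => ((H₂ ρ hρ.1 hn hρ.2.1).2 x hx).2
  have At := tendsto_zero_of_norm_le_inv (S := weylSet L Lt Side.plus) (s₀ := s₃) (D := D₃)
    fun ρ hρ hn => (H₃ ρ (him ρ hρ).le hn x hx).1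
  have At' := tendsto_zero_of_norm_le_inv (S := weylSet L Lt Side.plus) (s₀ := s₃) (D := D₃)
    fun ρ hρ hn => (H₃ ρ (him ρ hρ).le hn x hx).2
  have Bt := tendsto_zero_of_norm_le_inv (S := weylSet L Lt Side.plus) (s₀ := s₄) (D := D₄)
    fun ρ hρ hn => (H₄ ρ hρ.1 hn hρ.2.2 x hx).1
  have Bt' := tendsto_zero_of_norm_le_inv (S := weylSet L Lt Side.plus) (s₀ := s₄) (D := D₄)
    fun ρ hρ hn => (H₄ ρ hρ.1 hn hρ.2.2 x hx).2
  set l := Bornology.cobounded ℂ ⊓ 𝓟 (weylSet L Lt Side.plus)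
  have hl : far L Lt Side.plus = l := rfl
  rw [hl]
  -- All limiting factors are bounded, since the oscillating exponential is at most one.
  have hosc : ∀ a b : CMat m, (∀ᶠ ρ : ℂ in l,
      ‖(1 / 2 : ℂ) • (Complex.exp (2 * (Complex.I * ρ) * x) • a + b)‖ ≤ ‖a‖ + ‖b‖) ∧
      ∀ᶠ ρ : ℂ in l, ‖(1 / 2 : ℂ) • (Complex.exp (2 * (Complex.I * ρ) * x) • a - b)‖ ≤
        ‖a‖ + ‖b‖ := fun a b => by
    have key : ∀ b : CMat m, ∀ᶠ ρ : ℂ in l, ‖(1 / 2 : ℂ) • (Complex.exp (2 * (Complex.I * ρ) * x) •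
        a + b)‖ ≤ ‖a‖ + ‖b‖ := fun b => by
      filter_upwards [mem_inf_of_right (mem_principal_self _)] with ρ hρ
      have hhalf : ‖(1 / 2 : ℂ)‖ = 1 / 2 := by norm_num
      have he : ‖Complex.exp (2 * (Complex.I * ρ) * x)‖ ≤ 1 := by
        rw [norm_cexp_mul_ofReal]
        refine Real.exp_le_one_iff.2 ?_
        have := him ρ hρ
        simp
        positivity
      have h1 : ‖Complex.exp (2 * (Complex.I * ρ) * x) • a‖ ≤ ‖a‖ := by
        rw [norm_smul]
        exact mul_le_of_le_one_left (norm_nonneg _) he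
      rw [norm_smul, hhalf]
      linarith [norm_add_le (Complex.exp (2 * (Complex.I * ρ) * x) • a) b, norm_nonneg a,
        norm_nonneg b]
    refine ⟨key b, ?_⟩
    have := key (-b)
    simpa only [norm_neg, ← sub_eq_add_neg] using this
  set p := L.P Side.minus x * L.lead
  set q := L.lead * Lt.PStar Side.minus x
  set c₁ := ‖L.P Side.minus x * (1 - L.h₁)‖ + ‖L.P Side.plus x * (1 + L.h₁)‖
  set c₂ := ‖(1 - L.h₁) * Lt.PStar Side.minus x‖ + ‖(1 + L.h₁) * Lt.PStar Side.plus x‖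
  have hc₁ : 0 ≤ c₁ := by positivity
  have hc₂ : 0 ≤ c₂ := by positivity
  obtain ⟨o₁, o₂⟩ := hosc (L.P Side.minus x * (1 - L.h₁)) (L.P Side.plus x * (1 + L.h₁))
  obtain ⟨o₃, o₄⟩ := hosc ((1 - L.h₁) * Lt.PStar Side.minus x) ((1 + L.h₁) * Lt.PStar Side.plus x)
  have hp : ∀ᶠ _ρ : ℂ in l, ‖p‖ ≤ c₂ + ‖p‖ := .of_forall fun _ => by linarith
  have hq : ∀ᶠ _ρ : ℂ in l, ‖q‖ ≤ c₁ + ‖q‖ := .of_forall fun _ => by linarith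
  replace o₁ := o₁.mono fun ρ h => h.trans (show c₁ ≤ c₁ + ‖q‖ by linarith [norm_nonneg q])
  replace o₂ := o₂.mono fun ρ h => h.trans (show c₁ ≤ c₁ + ‖q‖ by linarith [norm_nonneg q])
  replace o₃ := o₃.mono fun ρ h => h.trans (show c₂ ≤ c₂ + ‖p‖ by linarith [norm_nonneg p])
  replace o₄ := o₄.mono fun ρ h => h.trans (show c₂ ≤ c₂ + ‖p‖ by linarith [norm_nonneg p])
  have T₁ := (A.mul_sub_mul Bt' o₁ hq).sub (B.mul_sub_mul At' hp o₄)
  have T₂ := (B.mul_sub_mul At hp o₃).sub (A.mul_sub_mul Bt o₁ hq)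
  have T₃ := (A'.mul_sub_mul Bt' o₂ hq).sub (B'.mul_sub_mul At' hp o₄)
  have T₄ := (B'.mul_sub_mul At hp o₃).sub (A'.mul_sub_mul Bt o₂ hq)
  simp only [sub_zero] at T₁ T₂ T₃ T₄
  have hexp : ∀ ρ : ℂ, Complex.exp (Complex.I * ρ * x) * Complex.exp (-(Complex.I * ρ) * x) = 1 :=
    fun ρ => by
      rw [← Complex.exp_add]
      simp
  have hne : ∀ ρ ∈ weylSet L Lt Side.plus, Complex.I * ρ ≠ 0 := fun ρ hρ h0 => by
    have h1 : ρ = 0 := by simpa using h0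
    have := him ρ hρ
    simp [h1] at this
  have mem : weylSet L Lt Side.plus ∈ l := mem_inf_of_right (mem_principal_self _)
  have fin : ∀ {f : ℂ → CMat m} {J : CMat m}, Tendsto (fun ρ => f ρ - J) l (𝓝 0) →
      Tendsto f l (𝓝 J) := fun {f J} h => by
    simpa using h.add_const J
  refine ⟨fin (T₁.congr' ?_), fin (T₂.congr' ?_), fin (T₃.congr' ?_), fin (T₄.congr' ?_)⟩
  all_goals
    -- The scalar exponentials and powers of `iρ` in the products cancel.
    filter_upwards [mem] with ρ hρ
    obtain ⟨i₁, i₂, i₃, i₄⟩ := limit_identities (a := L.P Side.minus x) (b := L.P Side.plus x)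
      (c := Lt.PStar Side.minus x) (d := Lt.PStar Side.plus x)
      (Complex.exp (2 * (Complex.I * ρ) * x)) hN.mul_lead hN.lead_mul
    obtain ⟨j₁, j₂, j₃, j₄⟩ := spectral_eq L Lt x ρ
    have hρ0 := hne ρ hρ
    have hex := hexp ρ
    rw [sub_sub_sub_comm]
    simp only [p, q, Omega, Xi]
  · rw [i₁, j₁]
    congr 2
    · rw [smul_mul_smul_comm, hex, one_smul]
    · rw [smul_smul, smul_smul, smul_mul_smul_comm, show Complex.exp (-(Complex.I * ρ) * x) *
        (Complex.I * ρ) * (Complex.exp (Complex.I * ρ * x) * (Complex.I * ρ)⁻¹) = 1 by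
        rw [mul_mul_mul_comm, mul_inv_cancel₀ hρ0, mul_comm (Complex.exp _), hex, one_mul],
        one_smul]
  · rw [i₂, j₂, smul_sub (Complex.I * ρ)]
    congr 2
    · rw [smul_smul, smul_mul_smul_comm, mul_right_comm, mul_comm (Complex.exp _), hex, one_mul]
    · rw [smul_mul_smul_comm, hex, one_smul, mul_smul_comm]
  · rw [i₃, j₃, smul_sub (Complex.I * ρ)⁻¹]
    congr 2
    · rw [smul_mul_smul_comm, hex, one_smul, smul_mul_assoc]
    · rw [smul_mul_smul_comm, mul_comm (Complex.exp _), hex, one_smul, mul_smul_comm]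
  · rw [i₄, j₄]
    congr 2
    · rw [smul_mul_smul_comm, mul_comm (Complex.exp _), hex, one_smul]
    · rw [smul_smul, smul_smul, smul_mul_smul_comm, show Complex.exp (Complex.I * ρ * x) *
        (Complex.I * ρ)⁻¹ * (Complex.exp (-(Complex.I * ρ) * x) * (Complex.I * ρ)) = 1 by
        rw [mul_mul_mul_comm, inv_mul_cancel₀ hρ0, hex, one_mul], one_smul]

/-! ### The lower half-plane -/

theorem reflect_sine (L : Pencil m) (ρ : ℂ) : L.reflect.sine (-ρ) = L.sine ρ := by
  simp only [sine, reflect_isSolution]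

theorem transpose_reflect (L : Pencil m) : L.reflect.transpose = L.transpose.reflect := by
  simp [reflect, transpose]

theorem reflect_sineStar (L : Pencil m) (ρ : ℂ) : L.reflect.sineStar (-ρ) = L.sineStar ρ := by
  funext x
  rw [sineStar, transpose_reflect, reflect_sine, sineStar]

theorem reflect_spectral (L Lt : Pencil m) (x : ℝ) (ρ : ℂ) :
    spectral₁₁ L.reflect Lt.reflect x (-ρ) = spectral₁₁ L Lt x ρ ∧
    spectral₁₂ L.reflect Lt.reflect x (-ρ) = spectral₁₂ L Lt x ρ ∧
    spectral₂₁ L.reflect Lt.reflect x (-ρ) = spectral₂₁ L Lt x ρ ∧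
    spectral₂₂ L.reflect Lt.reflect x (-ρ) = spectral₂₂ L Lt x ρ := by
  simp only [spectral₁₁, spectral₁₂, spectral₂₁, spectral₂₂, regular₁₁, regular₁₂, regular₂₁,
    regular₂₂, weylDiff, reflect_sine, reflect_sineStar, reflect_phi, reflect_phiStar,
    reflect_weylMatrix, and_self]

theorem reflect_Xi (L Lt : Pencil m) (x : ℝ) : Xi L.reflect Lt.reflect x = -Xi L Lt x := by
  simp only [Xi, reflect_P, reflect_PStar, Side.opp]
  module

theorem tendsto_neg_far (L Lt : Pencil m) :
    Tendsto Neg.neg (far L Lt Side.minus) (far L.reflect Lt.reflect Side.plus) := by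
  refine tendsto_inf.2 ⟨tendsto_neg_cobounded.mono_left inf_le_left, ?_⟩
  refine tendsto_principal.2 ?_
  filter_upwards [mem_inf_of_right (mem_principal_self _)] with ρ hρ
  refine ⟨neg_mem_halfPlane.2 hρ.1, ?_, ?_⟩
  · rw [reflect_isWeylSolution]; exact hρ.2.1
  · rw [reflect_isWeylSolution]; exact hρ.2.2

/-- The limits of the entries of the spectral matrix as `|ρ| → ∞` in a half-plane. -/
theorem tendsto_spectral (hL : L.ClassV) (hLt : Lt.ClassV) (hN : L.NonRegge)
    (hNt : Lt.NonRegge) (hh : L.h₁ = Lt.h₁) (hx : 0 ≤ x) (s : Side) :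
    Tendsto (fun ρ => spectral₁₁ L Lt x ρ) (far L Lt s) (𝓝 (Omega L Lt x)) ∧
    Tendsto (fun ρ => (Complex.I * ρ) • spectral₁₂ L Lt x ρ) (far L Lt s) (𝓝 (Xi L Lt x)) ∧
    Tendsto (fun ρ => (Complex.I * ρ)⁻¹ • spectral₂₁ L Lt x ρ) (far L Lt s) (𝓝 (Xi L Lt x)) ∧
    Tendsto (fun ρ => spectral₂₂ L Lt x ρ) (far L Lt s) (𝓝 (Omega L Lt x)) := by
  cases s with
  | plus => exact tendsto_spectral_plus hL hLt hN hNt hh hx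
  | minus =>
    obtain ⟨h1, h2, h3, h4⟩ := tendsto_spectral_plus hL.reflect hLt.reflect hN.reflect hNt.reflect
      (by simp [reflect, hh]) hx
    have hn := tendsto_neg_far L Lt
    have hs := fun ρ => reflect_spectral L Lt x ρ
    rw [reflect_Omega] at h1 h4
    rw [reflect_Xi] at h2 h3
    refine ⟨(h1.comp hn).congr fun ρ => (hs ρ).1, ?_, ?_,
      (h4.comp hn).congr fun ρ => (hs ρ).2.2.2⟩
    · have := (h2.comp hn).neg
      rw [neg_neg] at this
      refine this.congr fun ρ => ?_
      simp only [Function.comp, (hs ρ).2.1]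
      module
    · have := (h3.comp hn).neg
      rw [neg_neg] at this
      refine this.congr fun ρ => ?_
      simp only [Function.comp, (hs ρ).2.2.1, mul_neg, inv_neg]
      module

/-! ### Agreement of the leading coefficients -/

theorem neBot_nhdsWithin_ofReal (t : ℝ) : (𝓝[halfPlane Side.plus] (t : ℂ)).NeBot := by
  rw [← mem_closure_iff_nhdsWithin_neBot, Metric.mem_closure_iff]
  intro ε hε
  refine ⟨t + (ε / 2 : ℝ) * Complex.I, by simp [halfPlane, Side.sign, hε], ?_⟩
  rw [dist_eq_norm]
  simp [abs_of_pos hε]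
  linarith

/-- If `M - M̃` is as small at infinity as the model pencil demands, then `h₁ = h̃₁`. -/
theorem h₁_eq_of_isModelPencil (hL : L.ClassV) (hLt : Lt.ClassV) (hN : L.NonRegge)
    (hNt : Lt.NonRegge) (hM : IsModelPencil L Lt) {R : ℝ}
    (hR : ∀ ρ : ℂ, R < ‖ρ‖ → ∀ s, ρ ∉ L.singularSet s ∧ ρ ∉ Lt.singularSet s) : L.h₁ = Lt.h₁ := by
  by_contra hne
  have hlead : L.lead ≠ Lt.lead := fun heq => hne <| by
    have h1 := hN.mul_lead
    rw [heq] at h1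
    have h2 : 1 + L.h₁ = 1 + Lt.h₁ := by
      calc 1 + L.h₁ = (1 + L.h₁) * (Lt.lead * (1 + Lt.h₁)) := by rw [hNt.lead_mul, mul_one]
        _ = _ := by rw [← mul_assoc, h1, one_mul]
    exact add_left_cancel h2
  set δ := ‖L.lead - Lt.lead‖
  have hδ : 0 < δ := norm_pos_iff.2 (sub_ne_zero.2 hlead)
  obtain ⟨s₁, D₁, hs₁, hD₁, H₁⟩ := hL.exists_weyl_asymptotics hN
  obtain ⟨s₂, D₂, hs₂, hD₂, H₂⟩ := hLt.exists_weyl_asymptotics hNt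
  obtain ⟨R₁, hR₁, hint⟩ := hM
  set T := max (max s₁ s₂ + 1) (max (max R R₁) (2 * (D₁ + D₂) / δ) + 1) with hT
  have hT1 : s₁ < T ∧ s₂ < T ∧ 1 < T ∧ R < T ∧ R₁ < T ∧ 2 * (D₁ + D₂) / δ < T := by
    have g1 := le_max_left (max s₁ s₂ + 1) (max (max R R₁) (2 * (D₁ + D₂) / δ) + 1)
    have g2 := le_max_right (max s₁ s₂ + 1) (max (max R R₁) (2 * (D₁ + D₂) / δ) + 1)
    have g3 := le_max_left s₁ s₂
    have g4 := le_max_right s₁ s₂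
    have g5 := le_max_left (max R R₁) (2 * (D₁ + D₂) / δ)
    have g6 := le_max_right (max R R₁) (2 * (D₁ + D₂) / δ)
    have g7 := le_max_left R R₁
    have g8 := le_max_right R R₁
    refine ⟨?_, ?_, ?_, ?_, ?_, ?_⟩ <;> linarith
  obtain ⟨t1, t2, t3, t4, t5, t6⟩ := hT1
  -- Both `iρM` and `iρM̃` are close to their different limits, so that `|t| ‖M - M̃‖ ≥ δ / 2`.
  have hlow : ∀ t : ℝ, T < |t| →
      δ / 2 ≤ |t| * ‖L.weylSide Side.plus t - Lt.weylSide Side.plus t‖ := by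
    intro t ht
    have hnb := neBot_nhdsWithin_ofReal t
    have hcl : (t : ℂ) ∈ closure (halfPlane Side.plus) := mem_closure_iff_nhdsWithin_neBot.2 hnb
    have htn : ‖(t : ℂ)‖ = |t| := by simp
    obtain ⟨n1, n2⟩ := hR t (by rw [htn]; linarith) Side.plus
    have hlim := (hL.tendsto_weylMatrix hcl n1).sub (hLt.tendsto_weylMatrix hcl n2)
    have hnorm : Tendsto (fun ρ : ℂ => ‖ρ‖) (𝓝[halfPlane Side.plus] (t : ℂ)) (𝓝 |t|) := by
      rw [← htn]
      exact (continuous_norm.tendsto _).mono_left nhdsWithin_le_nhds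
    refine ge_of_tendsto (hnorm.mul hlim.norm) ?_
    have w1 : ∀ᶠ ρ in 𝓝[halfPlane Side.plus] (t : ℂ), ∃ Φ, L.IsWeylSolution ρ Φ :=
      (by_contra fun hcon => n1 ⟨hcl, hcon⟩ :).1
    have w2 : ∀ᶠ ρ in 𝓝[halfPlane Side.plus] (t : ℂ), ∃ Φ, Lt.IsWeylSolution ρ Φ :=
      (by_contra fun hcon => n2 ⟨hcl, hcon⟩ :).1
    filter_upwards [w1, w2, self_mem_nhdsWithin, hnorm.eventually_const_lt ht] with ρ v1 v2 v3 v4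
    have g1 := (H₁ ρ v3 (by linarith) v1).1
    have g2 := (H₂ ρ v3 (by linarith) v2).1
    have hρ0 : 0 < ‖ρ‖ := by linarith
    have e1 : L.lead - Lt.lead = (Complex.I * ρ) • (L.weylMatrix ρ - Lt.weylMatrix ρ) -
        ((Complex.I * ρ) • L.weylMatrix ρ - L.lead) +
        ((Complex.I * ρ) • Lt.weylMatrix ρ - Lt.lead) := by
      rw [smul_sub]; abel
    have e2 : δ ≤ ‖ρ‖ * ‖L.weylMatrix ρ - Lt.weylMatrix ρ‖ + D₁ * ‖ρ‖⁻¹ + D₂ * ‖ρ‖⁻¹ := by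
      simp only [δ]
      rw [e1]
      refine (norm_add_le _ _).trans (add_le_add ((norm_sub_le _ _).trans (add_le_add ?_ g1)) g2)
      rw [norm_smul]
      simp
    have e3 : D₁ * ‖ρ‖⁻¹ + D₂ * ‖ρ‖⁻¹ ≤ δ / 2 := by
      rw [← add_mul, ← div_eq_mul_inv, div_le_div_iff₀ hρ0 two_pos]
      have := (div_lt_iff₀ hδ).1 (t6.trans v4)
      linarith
    linarith
  -- The integrand is bounded below by a positive constant on a set of infinite measure.
  have hinf : ∫⁻ t in {t : ℝ | R₁ < |t|}, ENNReal.ofReal (‖L.weylSide Side.plus (t : ℂ) -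
      Lt.weylSide Side.plus (t : ℂ)‖ ^ 2 * t ^ 4) = ⊤ := by
    refine eq_top_iff.2 ?_
    calc (⊤ : ENNReal) = ∫⁻ _ in Ioi T, ENNReal.ofReal ((δ / 2) ^ 2) := by
          rw [lintegral_const, Measure.restrict_apply_univ, Real.volume_Ioi, ENNReal.mul_top]
          exact (ENNReal.ofReal_pos.2 (by positivity)).ne'
      _ ≤ ∫⁻ t in Ioi T, ENNReal.ofReal (‖L.weylSide Side.plus (t : ℂ) -
            Lt.weylSide Side.plus (t : ℂ)‖ ^ 2 * t ^ 4) := by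
          refine setLIntegral_mono_ae' measurableSet_Ioi (.of_forall fun t ht => ?_)
          refine ENNReal.ofReal_le_ofReal ?_
          have ht1 : T < t := ht
          have habs : |t| = t := abs_of_pos (by linarith)
          have h1 := hlow t (by rw [habs]; exact ht1)
          rw [habs] at h1
          set n := ‖L.weylSide Side.plus (t : ℂ) - Lt.weylSide Side.plus (t : ℂ)‖
          have hn : 0 ≤ n := norm_nonneg _
          have h2 : (δ / 2) ^ 2 ≤ (t * n) ^ 2 := by gcongr
          have h3 : (1 : ℝ) ≤ t ^ 2 := by nlinarith
          nlinarith [mul_le_mul_of_nonneg_left h3 (sq_nonneg (t * n))]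
      _ ≤ _ := by
          refine lintegral_mono_set fun t ht => ?_
          have ht1 : T < t := ht
          show R₁ < |t|
          rw [abs_of_pos (by linarith)]
          linarith
  exact absurd (hint Side.plus) (by rw [hinf]; simp)

end Pencil

/-! ### Cycles and Cauchy's theorem -/

/-- A formal sum of finitely many paths `path i : [a i, b i] → ℂ` with integrable velocities whose
total boundary vanishes. The parameter of a path may run backwards, from `a i` down to `b i`. -/
structure PathCycle (ι : Type*) [Fintype ι] where
  path : ι → ℝ → ℂ
  vel : ι → ℝ → ℂ
  a : ι → ℝ
  b : ι → ℝ
  cont : ∀ i, ContinuousOn (path i) (uIcc (a i) (b i))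
  hasDeriv : ∀ i, ∃ s : Set ℝ, s.Countable ∧
    ∀ t ∈ Ioo (min (a i) (b i)) (max (a i) (b i)) \ s, HasDerivAt (path i) (vel i t) t
  integrable : ∀ i, IntervalIntegrable (vel i) volume (a i) (b i)
  closed : ∀ g : ℂ → ℂ, ∑ i, (g (path i (b i)) - g (path i (a i))) = 0

namespace PathCycle

variable {ι : Type*} [Fintype ι] (Γ : PathCycle ι)
variable {E : Type*} [NormedAddCommGroup E] [NormedSpace ℂ E] [CompleteSpace E]

/-- The points of the paths of a cycle. -/
def trace : Set ℂ := ⋃ i, Γ.path i '' uIcc (Γ.a i) (Γ.b i)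

/-- The integral of a function along a cycle. -/
def integral (f : ℂ → E) : E := ∑ i, ∫ t in Γ.a i..Γ.b i, Γ.vel i t • f (Γ.path i t)

/-- `2πi` times the winding number. -/
def index (w : ℂ) : ℂ := Γ.integral fun z => (z - w)⁻¹

theorem isCompact_trace : IsCompact Γ.trace :=
  isCompact_iUnion fun i => isCompact_uIcc.image_of_continuousOn (Γ.cont i)

theorem path_mem_trace {i : ι} {t : ℝ} (ht : t ∈ uIcc (Γ.a i) (Γ.b i)) : Γ.path i t ∈ Γ.trace :=
  mem_iUnion.2 ⟨i, mem_image_of_mem _ ht⟩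

theorem continuousOn_comp {X : Type*} [TopologicalSpace X] {f : ℂ → X}
    (hf : ContinuousOn f Γ.trace) (i : ι) :
    ContinuousOn (fun t => f (Γ.path i t)) (uIcc (Γ.a i) (Γ.b i)) :=
  hf.comp (Γ.cont i) fun _ ht => Γ.path_mem_trace ht

theorem intervalIntegrable {f : ℂ → E} (hf : ContinuousOn f Γ.trace) (i : ι) :
    IntervalIntegrable (fun t => Γ.vel i t • f (Γ.path i t)) volume (Γ.a i) (Γ.b i) :=
  (Γ.integrable i).smul_continuousOn (Γ.continuousOn_comp hf i)

theorem integral_sub {f g : ℂ → E} (hf : ContinuousOn f Γ.trace) (hg : ContinuousOn g Γ.trace) :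
    Γ.integral (fun z => f z - g z) = Γ.integral f - Γ.integral g := by
  simp only [integral, ← Finset.sum_sub_distrib]
  refine Finset.sum_congr rfl fun i _ => ?_
  rw [← intervalIntegral.integral_sub (Γ.intervalIntegrable hf i) (Γ.intervalIntegrable hg i)]
  simp only [smul_sub]

theorem integral_congr {f g : ℂ → E} (h : ∀ z ∈ Γ.trace, f z = g z) :
    Γ.integral f = Γ.integral g := by
  refine Finset.sum_congr rfl fun i _ => intervalIntegral.integral_congr fun t ht => ?_
  simp only [h _ (Γ.path_mem_trace ht)]

/-- The length of a cycle. -/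
def length : ℝ := ∑ i, |∫ t in Γ.a i..Γ.b i, ‖Γ.vel i t‖|

theorem length_nonneg : 0 ≤ Γ.length := Finset.sum_nonneg fun _ _ => abs_nonneg _

theorem norm_integral_le {f : ℂ → E} {C : ℝ} (hf : ∀ z ∈ Γ.trace, ‖f z‖ ≤ C) :
    ‖Γ.integral f‖ ≤ Γ.length * C := by
  rw [integral, length, Finset.sum_mul]
  refine (norm_sum_le _ _).trans (Finset.sum_le_sum fun i _ => ?_)
  by_cases hC : 0 ≤ C
  · have h := intervalIntegral.norm_integral_le_abs_of_norm_le (μ := volume) (a := Γ.a i)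
      (b := Γ.b i) (f := fun t => Γ.vel i t • f (Γ.path i t)) (g := fun t => ‖Γ.vel i t‖ * C)
      ((ae_restrict_mem measurableSet_uIoc).mono fun t ht => by
        rw [norm_smul]
        exact mul_le_mul_of_nonneg_left (hf _ (Γ.path_mem_trace (uIoc_subset_uIcc ht)))
          (norm_nonneg _)) ((Γ.integrable i).norm.mul_const C)
    rwa [intervalIntegral.integral_mul_const, abs_mul, abs_of_nonneg hC] at h
  · exact absurd ((norm_nonneg _).trans (hf _ (Γ.path_mem_trace (i := i) left_mem_uIcc))) hC

theorem integral_eq_zero_of_hasDerivAt {G G' : ℂ → ℂ} (hG : ∀ z ∈ Γ.trace, HasDerivAt G (G' z) z)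
    (hG' : ContinuousOn G' Γ.trace) : Γ.integral G' = 0 := by
  rw [← Γ.closed G]
  refine Finset.sum_congr rfl fun i _ => ?_
  obtain ⟨s, hs, hd⟩ := Γ.hasDeriv i
  refine integral_eq_of_hasDerivAt_off_countable (fun t => G (Γ.path i t)) _ hs
    (Γ.continuousOn_comp (fun z hz => (hG z hz).continuousAt.continuousWithinAt) i)
    (fun t ht => ?_) (Γ.intervalIntegrable hG' i)
  have h1 : Γ.path i t ∈ Γ.trace := Γ.path_mem_trace (Ioo_subset_Icc_self ht.1)
  have := (hG _ h1).comp t (hd t ht)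
  simpa [mul_comm, Function.comp_def] using this

theorem continuousOn_inv_sub {w : ℂ} (hw : w ∉ Γ.trace) :
    ContinuousOn (fun z : ℂ => (z - w)⁻¹) Γ.trace :=
  (continuousOn_id.sub continuousOn_const).inv₀ fun z hz =>
    sub_ne_zero.2 fun h : z = w => hw (h ▸ hz)

/-- The winding number vanishes at a point that a line separates from the cycle. -/
theorem index_eq_zero_of_re_pos {w : ℂ} (u : ℂ) (h : ∀ z ∈ Γ.trace, 0 < ((z - w) * u).re) :
    Γ.index w = 0 := by
  have hu : ∀ z ∈ Γ.trace, z - w ≠ 0 ∧ u ≠ 0 := fun z hz => by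
    have := h z hz
    constructor <;> rintro h0 <;> simp [h0] at this
  refine Γ.integral_eq_zero_of_hasDerivAt (G := fun z => Complex.log ((z - w) * u)) (fun z hz => ?_)
    (Γ.continuousOn_inv_sub fun hw => (hu w hw).1 (sub_self w))
  obtain ⟨h2, h3⟩ := hu z hz
  refine ((((hasDerivAt_id' z).sub_const w).mul_const u).clog (.inl (h z hz))).congr_deriv ?_
  rw [mul_div_mul_right _ _ h3, one_div]

/-- The winding number is constant along a segment that does not meet the cycle. -/
theorem index_eq_of_segment {w v : ℂ} (h : ∀ s ∈ Icc (0 : ℝ) 1, w + s * (v - w) ∉ Γ.trace) :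
    Γ.index w = Γ.index v := by
  have hw : w ∉ Γ.trace := by simpa using h 0 (by simp)
  have hv : v ∉ Γ.trace := by simpa using h 1 (by simp)
  rw [← sub_eq_zero, index, index,
    ← Γ.integral_sub (Γ.continuousOn_inv_sub hw) (Γ.continuousOn_inv_sub hv)]
  refine Γ.integral_eq_zero_of_hasDerivAt (G := fun z => Complex.log ((z - w) / (z - v)))
    (fun z hz => ?_) ((Γ.continuousOn_inv_sub hw).sub (Γ.continuousOn_inv_sub hv))
  have h1 : z - w ≠ 0 := sub_ne_zero.2 fun h0 => hw (h0 ▸ hz)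
  have h2 : z - v ≠ 0 := sub_ne_zero.2 fun h0 => hv (h0 ▸ hz)
  have hs : (z - w) / (z - v) ∈ Complex.slitPlane := by
    -- A quotient `-r ≤ 0` would put `z` on the segment from `w` to `v`.
    rw [Complex.mem_slitPlane_iff_not_le_zero]
    intro hle
    obtain ⟨hre, him⟩ := Complex.le_def.1 hle
    set r := -((z - w) / (z - v)).re with hr
    have hr0 : 0 ≤ r := by simpa [hr] using hre
    have hq : (z - w) / (z - v) = -(r : ℂ) := by
      apply Complex.ext <;> simp [hr]
      simpa using him
    rw [div_eq_iff h2] at hq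
    refine h (r / (1 + r)) ⟨by positivity, (div_le_one (by positivity)).2 (by linarith)⟩ ?_
    have h3 : (1 + r : ℂ) ≠ 0 := by exact_mod_cast (by positivity : (1 + r : ℝ) ≠ 0)
    have h4 : w + ((r / (1 + r) : ℝ) : ℂ) * (v - w) = z := by
      push_cast
      field_simp
      linear_combination -hq
    rwa [h4]
  refine ((((hasDerivAt_id' z).sub_const w).fun_div ((hasDerivAt_id' z).sub_const v) h2).clog
    hs).congr_deriv ?_
  field_simp

theorem index_eq_of_ball {w v : ℂ} {r : ℝ} (h : Disjoint (Metric.ball w r) Γ.trace)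
    (hv : v ∈ Metric.ball w r) : Γ.index w = Γ.index v := by
  refine Γ.index_eq_of_segment fun s hs hmem => h.notMem_of_mem_left ?_ hmem
  rw [mem_ball_iff_norm] at hv ⊢
  rw [add_sub_cancel_left, norm_mul, Complex.norm_real, Real.norm_of_nonneg hs.1]
  exact (mul_le_of_le_one_left (norm_nonneg _) hs.2).trans_lt hv

theorem isOpen_index_eq_zero : IsOpen {w | w ∉ Γ.trace ∧ Γ.index w = 0} := by
  refine Metric.isOpen_iff.2 fun w ⟨hw, h0⟩ => ?_
  obtain ⟨r, hr, hsub⟩ := Metric.isOpen_iff.1 Γ.isCompact_trace.isClosed.isOpen_compl w hw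
  refine ⟨r, hr, fun v hv => ⟨hsub hv, ?_⟩⟩
  rw [← Γ.index_eq_of_ball (disjoint_compl_left.mono_left hsub) hv, h0]

theorem exists_trace_bound : ∃ B : ℝ, 0 < B ∧ ∀ z ∈ Γ.trace, ‖z‖ ≤ B := by
  obtain ⟨B, hB⟩ := Γ.isCompact_trace.isBounded.exists_norm_le
  exact ⟨max B 1, by positivity, fun z hz => (hB z hz).trans (le_max_left _ _)⟩

theorem index_eq_zero_of_far {B : ℝ} (hB : ∀ z ∈ Γ.trace, ‖z‖ ≤ B) {w : ℂ} (hw : B < ‖w‖) :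
    Γ.index w = 0 := by
  refine Γ.index_eq_zero_of_re_pos (-(starRingEnd ℂ) w) fun z hz => ?_
  have h0 : 0 ≤ B := (norm_nonneg z).trans (hB z hz)
  have h1 : (z * (starRingEnd ℂ) w).re ≤ B * ‖w‖ := by
    refine (Complex.re_le_norm _).trans ?_
    rw [norm_mul, RCLike.norm_conj]
    exact mul_le_mul_of_nonneg_right (hB z hz) (norm_nonneg _)
  have h2 : ((z - w) * -(starRingEnd ℂ) w).re = ‖w‖ ^ 2 - (z * (starRingEnd ℂ) w).re := by
    have : w * (starRingEnd ℂ) w = (‖w‖ ^ 2 : ℝ) := by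
      rw [Complex.mul_conj, Complex.normSq_eq_norm_sq]
    rw [mul_neg, sub_mul, this, neg_sub, Complex.sub_re, Complex.ofReal_re]
  rw [h2]
  nlinarith

/-- Holomorphic dependence of an integral along a cycle on a parameter. -/
theorem differentiableAt_integral {F : ℂ → ℂ → E} {U : Set ℂ} (hU : IsOpen U) {C : ℝ}
    (hc : ∀ w ∈ U, ContinuousOn (F w) Γ.trace)
    (hd : ∀ z ∈ Γ.trace, DifferentiableOn ℂ (fun w => F w z) U)
    (hb : ∀ w ∈ U, ∀ z ∈ Γ.trace, ‖F w z‖ ≤ C) :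
    DifferentiableOn ℂ (fun w => Γ.integral (F w)) U := by
  simp only [integral, intervalIntegral.intervalIntegral_eq_integral_uIoc]
  refine DifferentiableOn.fun_sum fun i _ => DifferentiableOn.fun_const_smul ?_ _
  refine differentiableOn_integral_of_dominated hU (bound := fun t => ‖Γ.vel i t‖ * C)
    (fun w hw => ((Γ.intervalIntegrable (hc w hw) i).def'.aestronglyMeasurable)) ?_ ?_ ?_
  · filter_upwards [ae_restrict_mem measurableSet_uIoc] with t ht
    exact (hd _ (Γ.path_mem_trace (uIoc_subset_uIcc ht))).fun_const_smul _
  · filter_upwards [ae_restrict_mem measurableSet_uIoc] with t ht w hw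
    rw [norm_smul]
    exact mul_le_mul_of_nonneg_left (hb w hw _ (Γ.path_mem_trace (uIoc_subset_uIcc ht)))
      (norm_nonneg _)
  · exact ((Γ.integrable i).norm.mul_const C).def'

/-- The difference quotient of a holomorphic function is bounded on compact sets, up to the
diagonal. -/
theorem exists_bound_dslope {f : ℂ → E} {U K B : Set ℂ} (hU : IsOpen U)
    (hf : DifferentiableOn ℂ f U) (hK : IsCompact K) (hKU : K ⊆ U) (hB : IsCompact B)
    (hBU : B ⊆ U) :
    ∃ C, ∀ z ∈ K, ∀ w ∈ B, ‖dslope f z w‖ ≤ C := by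
  obtain ⟨δ, hδ, hδU⟩ := hK.exists_cthickening_subset_open hU hKU
  obtain ⟨C₁, hC₁⟩ := (hK.cthickening (r := δ)).exists_bound_of_continuousOn
    ((hf.deriv hU).continuousOn.mono hδU)
  obtain ⟨C₂, hC₂⟩ := hK.exists_bound_of_continuousOn (hf.continuousOn.mono hKU)
  obtain ⟨C₃, hC₃⟩ := hB.exists_bound_of_continuousOn (hf.continuousOn.mono hBU)
  refine ⟨max C₁ (δ⁻¹ * (C₃ + C₂)), fun z hz w hw => ?_⟩
  have hball : ∀ v, ‖v - z‖ ≤ δ → v ∈ Metric.cthickening δ K := fun v hv =>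
    Metric.mem_cthickening_of_dist_le v z δ K hz (by rwa [dist_eq_norm])
  rcases eq_or_ne w z with rfl | hne
  · rw [dslope_same]
    exact (hC₁ _ (hball w (by simp [hδ.le]))).trans (le_max_left _ _)
  have hn : 0 < ‖w - z‖ := norm_pos_iff.2 (sub_ne_zero.2 hne)
  rw [dslope_of_ne _ hne, slope_def_module, norm_smul, norm_inv]
  -- Close to the diagonal the mean value inequality applies, away from it the bounds for `f`.
  rcases le_or_gt ‖w - z‖ δ with hle | hlt
  · refine le_trans ?_ (le_max_left _ _)
    rw [inv_mul_le_iff₀ hn, mul_comm]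
    refine (convex_closedBall z δ).norm_image_sub_le_of_norm_deriv_le (f := f) (C := C₁)
      (fun v hv => ?_) (fun v hv => hC₁ v ?_) (by simp [hδ.le]) (mem_closedBall_iff_norm.2 hle)
    · exact (hf v (hδU (hball v (mem_closedBall_iff_norm.1 hv)))).differentiableAt
        (hU.mem_nhds (hδU (hball v (mem_closedBall_iff_norm.1 hv))))
    · exact hball v (mem_closedBall_iff_norm.1 hv)
  · refine le_trans ?_ (le_max_right _ _)
    have h1 : ‖f w - f z‖ ≤ C₃ + C₂ := (norm_sub_le _ _).trans (add_le_add (hC₃ w hw) (hC₂ z hz))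
    have h2 : ‖w - z‖⁻¹ ≤ δ⁻¹ := inv_anti₀ hδ hlt.le
    exact mul_le_mul h2 h1 (norm_nonneg _) (by positivity)

theorem norm_inv_sub_le {B : ℝ} {z w : ℂ} (hz : ‖z‖ ≤ B) (hw : B < ‖w‖) :
    ‖(z - w)⁻¹‖ ≤ (‖w‖ - B)⁻¹ := by
  rw [norm_inv]
  have := norm_sub_norm_le w z
  rw [norm_sub_rev w z] at this
  exact inv_anti₀ (by linarith) (by linarith)

theorem tendsto_norm_sub_inv (B : ℝ) :
    Tendsto (fun w : ℂ => (‖w‖ - B)⁻¹) (cocompact ℂ) (𝓝 0) :=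
  ((tendsto_norm_cocompact_atTop (E := ℂ)).atTop_add tendsto_const_nhds).inv_tendsto_atTop

/-- A Cauchy integral tends to zero at infinity. -/
theorem tendsto_cauchy {f : ℂ → E} (hf : ContinuousOn f Γ.trace) :
    Tendsto (fun w => Γ.integral fun z => (z - w)⁻¹ • f z) (cocompact ℂ) (𝓝 0) := by
  obtain ⟨C, hC⟩ := Γ.isCompact_trace.exists_bound_of_continuousOn hf
  obtain ⟨B, hB, hbd⟩ := Γ.exists_trace_bound
  have h1 : Tendsto (fun w : ℂ => Γ.length * ((‖w‖ - B)⁻¹ * C)) (cocompact ℂ) (𝓝 0) := by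
    simpa using ((tendsto_norm_sub_inv B).mul_const C).const_mul Γ.length
  refine squeeze_zero_norm' ?_ h1
  filter_upwards [(tendsto_norm_cocompact_atTop (E := ℂ)).eventually_gt_atTop B] with w hw
  refine Γ.norm_integral_le fun z hz => ?_
  rw [norm_smul]
  exact mul_le_mul (norm_inv_sub_le (hbd z hz) hw) (hC z hz) (norm_nonneg _)
    (inv_nonneg.2 (by linarith))

/-- **Cauchy's theorem** for a cycle that does not wind around the points outside of the domain of
holomorphy, by Dixon's argument: the integral of the difference quotient and the Cauchy integral
paste to an entire function that vanishes at infinity. -/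
theorem integral_eq_zero {U : Set ℂ} (hU : IsOpen U) (hΓ : Γ.trace ⊆ U)
    (hind : ∀ w ∉ U, Γ.index w = 0) {f : ℂ → E} (hf : DifferentiableOn ℂ f U) :
    Γ.integral f = 0 := by
  classical
  have hfc : ContinuousOn f Γ.trace := hf.continuousOn.mono hΓ
  set V := {w | w ∉ Γ.trace ∧ Γ.index w = 0}
  have hV : IsOpen V := Γ.isOpen_index_eq_zero
  set h : ℂ → E := fun w => Γ.integral fun z => dslope f z w
  set g : ℂ → E := fun w => Γ.integral fun z => (z - w)⁻¹ • f z
  have hsymm : ∀ z w, dslope f z w = dslope f w z := fun z w => by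
    rcases eq_or_ne z w with rfl | hne
    · rfl
    · rw [dslope_of_ne _ hne, dslope_of_ne _ hne.symm, slope_comm]
  have hcs : ∀ w ∈ U, ContinuousOn (fun z => dslope f z w) Γ.trace := fun w hw => by
    have : ContinuousOn (dslope f w) U :=
      (continuousOn_dslope (hU.mem_nhds hw)).2 ⟨hf.continuousOn,
        (hf w hw).differentiableAt (hU.mem_nhds hw)⟩
    exact (this.mono hΓ).congr fun z _ => hsymm z w
  have hdh : DifferentiableOn ℂ h U := fun w hw => by
    obtain ⟨r, hr, hrU⟩ := Metric.nhds_basis_closedBall.mem_iff.1 (hU.mem_nhds hw)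
    obtain ⟨C, hC⟩ := exists_bound_dslope hU hf Γ.isCompact_trace hΓ
      (isCompact_closedBall w r) hrU
    have hsub : Metric.ball w r ⊆ U := Metric.ball_subset_closedBall.trans hrU
    refine ((Γ.differentiableAt_integral (F := fun w z => dslope f z w) Metric.isOpen_ball (C := C)
      (fun v hv => hcs v (hsub hv)) (fun z hz => ?_) (fun v hv z hz =>
        hC z hz v (Metric.ball_subset_closedBall hv))).differentiableAt
      (Metric.ball_mem_nhds w hr)).differentiableWithinAt
    exact ((Complex.differentiableOn_dslope (hU.mem_nhds (hΓ hz))).2 hf).mono hsub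
  have hdg : DifferentiableOn ℂ g V := fun w hw => by
    obtain ⟨r, hr, hrV⟩ := Metric.nhds_basis_closedBall.mem_iff.1
      (Γ.isCompact_trace.isClosed.isOpen_compl.mem_nhds hw.1)
    obtain ⟨C, hC⟩ := Γ.isCompact_trace.exists_bound_of_continuousOn hfc
    have hne : ∀ v ∈ Metric.ball w (r / 2), ∀ z ∈ Γ.trace, r / 2 ≤ ‖z - v‖ := fun v hv z hz => by
      by_contra! hlt
      refine hrV ?_ hz
      rw [mem_ball_iff_norm] at hv
      rw [mem_closedBall_iff_norm, ← sub_add_sub_cancel z v w]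
      linarith [norm_add_le (z - v) (v - w)]
    refine ((Γ.differentiableAt_integral (F := fun w z => (z - w)⁻¹ • f z)
      Metric.isOpen_ball (C := (r / 2)⁻¹ * C)
      (fun v hv => (Γ.continuousOn_inv_sub fun hmem => ?_).smul hfc) (fun z hz v hv => ?_)
      (fun v hv z hz => ?_)).differentiableAt
      (Metric.ball_mem_nhds w (half_pos hr))).differentiableWithinAt
    · have := hne v hv v hmem
      simp at this
      linarith
    · have h0 : z - v ≠ 0 := norm_pos_iff.1 ((half_pos hr).trans_le (hne v hv z hz))
      exact (((differentiableAt_id.const_sub z).fun_inv h0).smul_const _).differentiableWithinAt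
    · rw [norm_smul, norm_inv]
      exact mul_le_mul (inv_anti₀ (half_pos hr) (hne v hv z hz)) (hC z hz) (norm_nonneg _)
        (by positivity)
  have heq : ∀ w ∈ U, w ∈ V → h w = g w := fun w hw hwV => by
    have h1 : h w = Γ.integral fun z => (z - w)⁻¹ • f z - (z - w)⁻¹ • f w := by
      refine Γ.integral_congr fun z hz => ?_
      have hne : w ≠ z := fun h0 => hwV.1 (h0 ▸ hz)
      rw [dslope_of_ne _ hne, slope_comm, slope_def_module, smul_sub]
    have h2 : (Γ.integral fun z => (z - w)⁻¹ • f w) = Γ.index w • f w := by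
      simp only [integral, index, Finset.sum_smul]
      refine Finset.sum_congr rfl fun i _ => ?_
      rw [← intervalIntegral.integral_smul_const]
      simp only [smul_eq_mul, mul_smul]
    rw [h1, Γ.integral_sub ((Γ.continuousOn_inv_sub hwV.1).fun_smul hfc)
      ((Γ.continuousOn_inv_sub hwV.1).fun_smul continuousOn_const), h2, hwV.2, zero_smul, sub_zero]
  set H : ℂ → E := fun w => if w ∈ U then h w else g w
  have hHg : ∀ w ∈ V, H w = g w := fun w hw => by
    by_cases hwU : w ∈ U
    · simp only [H, if_pos hwU, heq w hwU hw]
    · simp only [H, if_neg hwU]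
  have hH : Differentiable ℂ H := fun w => by
    by_cases hw : w ∈ U
    · refine ((hdh w hw).differentiableAt (hU.mem_nhds hw)).congr_of_eventuallyEq ?_
      filter_upwards [hU.mem_nhds hw] with v hv
      simp only [H, if_pos hv]
    · have hwV : w ∈ V := ⟨fun hmem => hw (hΓ hmem), hind w hw⟩
      refine ((hdg w hwV).differentiableAt (hV.mem_nhds hwV)).congr_of_eventuallyEq ?_
      filter_upwards [hV.mem_nhds hwV] with v hv using hHg v hv
  obtain ⟨B, hB, hbd⟩ := Γ.exists_trace_bound
  have hfar : ∀ᶠ w in cocompact ℂ, w ∈ V ∧ B < ‖w‖ := by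
    filter_upwards [(tendsto_norm_cocompact_atTop (E := ℂ)).eventually_gt_atTop B] with w hw
    exact ⟨⟨fun hmem => (hbd w hmem).not_gt hw, Γ.index_eq_zero_of_far hbd hw⟩, hw⟩
  have hHlim : Tendsto H (cocompact ℂ) (𝓝 0) :=
    (Γ.tendsto_cauchy hfc).congr' (hfar.mono fun w hw => (hHg w hw.1).symm)
  have hzero : ∀ w, H w = 0 := fun w => hH.apply_eq_of_tendsto_cocompact w hHlim
  -- The leading coefficient of the vanishing Cauchy integral at infinity is the integral of `f`.
  have hlim : Tendsto (fun w => Γ.integral fun z => (z - w)⁻¹ • (z • f z)) (cocompact ℂ) (𝓝 0) :=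
    Γ.tendsto_cauchy ((continuousOn_id' _).fun_smul hfc)
  refine tendsto_nhds_unique (tendsto_const_nhds.congr' ?_) hlim
  filter_upwards [hfar] with w hw
  have h1 : (Γ.integral fun z => w • (z - w)⁻¹ • f z) = 0 := by
    have h2 : (Γ.integral fun z => w • (z - w)⁻¹ • f z) = w • g w := by
      simp only [integral, g, Finset.smul_sum, ← intervalIntegral.integral_smul]
      refine Finset.sum_congr rfl fun i _ => ?_
      congr 1
      funext t
      rw [smul_comm]
    rw [h2, ← hHg w hw.1, hzero, smul_zero]
  have hi := (Γ.continuousOn_inv_sub hw.1.1)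
  rw [← sub_zero (Γ.integral fun z => (z - w)⁻¹ • (z • f z)), ← h1,
    ← Γ.integral_sub (hi.fun_smul ((continuousOn_id' _).fun_smul hfc))
      (continuousOn_const.fun_smul (hi.fun_smul hfc))]
  refine Γ.integral_congr fun z hz => ?_
  have hne : z - w ≠ 0 := sub_ne_zero.2 fun h0 => hw.1.1 (h0 ▸ hz)
  rw [smul_smul, smul_smul, ← sub_smul]
  rw [show (z - w)⁻¹ * z - w * (z - w)⁻¹ = 1 by field_simp, one_smul]

end PathCycle

/-! ### Cauchy's theorem up to the boundary of a half-plane -/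

namespace PathCycle

variable {ι : Type*} [Fintype ι] (Γ : PathCycle ι)
variable {E : Type*} [NormedAddCommGroup E] [NormedSpace ℂ E] [CompleteSpace E]

/-- Cauchy's theorem for a cycle in the closed upper half-plane and a function that is holomorphic
in the open half-plane and continuous up to its boundary, off an exceptional set `Λ`. The cycle is
lifted into the open half-plane by a small vertical shift. -/
theorem integral_eq_zero_of_im_nonneg {Λ : Set ℂ} {f : ℂ → E} (him : ∀ z ∈ Γ.trace, 0 ≤ z.im)
    (hdisj : ∀ z ∈ Γ.trace, z ∉ Λ)
    (hΛ : ∀ z, 0 ≤ z.im → z ∉ Λ → ∀ᶠ w in 𝓝[{w | 0 < w.im}] z, w ∉ Λ)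
    (hc : ContinuousOn f ({z | 0 ≤ z.im} \ Λ)) (hd : DifferentiableOn ℂ f ({z | 0 < z.im} \ Λ))
    (hind : ∀ w ∈ Λ, 0 < w.im → Γ.index w = 0) : Γ.integral f = 0 := by
  have hfc : ContinuousOn f Γ.trace := hc.mono fun z hz => ⟨him z hz, hdisj z hz⟩
  have hopen : IsOpen ({z : ℂ | 0 < z.im} \ Λ) := by
    refine isOpen_iff_mem_nhds.2 fun z hz => ?_
    have h1 : {w : ℂ | 0 < w.im} ∈ 𝓝 z :=
      (isOpen_lt continuous_const Complex.continuous_im).mem_nhds hz.1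
    have h2 := hΛ z (le_of_lt hz.1) hz.2
    rw [nhdsWithin_eq_nhds.2 h1] at h2
    exact inter_mem h1 h2
  -- The vertical shifts are uniformly close to the cycle and avoid the exceptional set.
  have key : ∀ η > 0, ∀ᶠ ε : ℝ in 𝓝 (0 : ℝ), ∀ z ∈ Γ.trace, 0 < ε → z ∈ Γ.trace →
      z + ε * Complex.I ∉ Λ ∧ ‖f z - f (z + ε * Complex.I)‖ ≤ η := fun η hη => by
    refine Γ.isCompact_trace.eventually_forall_of_forall_eventually
      (P := fun (ε : ℝ) z => 0 < ε → z ∈ Γ.trace →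
        z + ε * Complex.I ∉ Λ ∧ ‖f z - f (z + ε * Complex.I)‖ ≤ η) fun k hk => ?_
    have hshift : Tendsto (fun q : ℝ × ℂ => q.2 + q.1 * Complex.I) (𝓝 (0, k)) (𝓝 k) := by
      have : ContinuousAt (fun q : ℝ × ℂ => q.2 + q.1 * Complex.I) (0, k) := by fun_prop
      simpa [ContinuousAt] using this
    have hsnd : Tendsto (fun q : ℝ × ℂ => q.2) (𝓝 (0, k)) (𝓝 k) := by
      have : ContinuousAt (fun q : ℝ × ℂ => q.2) (0, k) := by fun_prop
      simpa [ContinuousAt] using this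
    have h1 := eventually_nhdsWithin_iff.1 (hΛ k (him k hk) (hdisj k hk))
    have h2 := eventually_nhdsWithin_iff.1
      ((hc k ⟨him k hk, hdisj k hk⟩).eventually (Metric.ball_mem_nhds _ (half_pos hη)))
    filter_upwards [hshift.eventually h1, hshift.eventually h2, hsnd.eventually h2] with q g1 g2 g3
      hε hq
    have hpos : 0 < (q.2 + q.1 * Complex.I).im := by
      have := him _ hq
      simp
      linarith
    have g4 := g1 hpos
    have g5 := g2 ⟨hpos.le, g4⟩
    have g6 := g3 ⟨him _ hq, hdisj _ hq⟩
    refine ⟨g4, ?_⟩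
    rw [dist_eq_norm] at g5 g6
    rw [← sub_sub_sub_cancel_right _ _ (f k)]
    exact (norm_sub_le _ _).trans (by linarith)
  refine norm_le_zero_iff.1 (le_of_forall_pos_le_add fun η hη => ?_)
  rw [zero_add]
  have hlen : 0 < Γ.length + 1 := by linarith [Γ.length_nonneg]
  obtain ⟨δ, hδ, hball⟩ := Metric.eventually_nhds_iff.1 (key (η / (Γ.length + 1)) (by positivity))
  have hK : ∀ ε : ℝ, 0 < ε → ε < δ → ∀ z ∈ Γ.trace, z + ε * Complex.I ∉ Λ ∧
      ‖f z - f (z + ε * Complex.I)‖ ≤ η / (Γ.length + 1) := fun ε h0 h1 z hz =>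
    hball (by simpa [abs_of_pos h0] using h1) z hz h0 hz
  set ε := δ / 2 with hε
  have hε0 : 0 < ε := by positivity
  have hcont : Continuous fun z : ℂ => z + ε * Complex.I := by fun_prop
  have hzero : Γ.integral (fun z => f (z + ε * Complex.I)) = 0 := by
    refine Γ.integral_eq_zero (hopen.preimage hcont) (fun z hz => ⟨?_, ?_⟩) (fun w hw => ?_)
      (hd.comp (by fun_prop) fun z hz => hz)
    · have := him z hz
      simp
      linarith
    · exact (hK ε hε0 (by linarith) z hz).1
    · by_cases hw0 : 0 < (w + ε * Complex.I).im
      · have hwΛ : w + ε * Complex.I ∈ Λ := by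
          by_contra hcon
          exact hw ⟨hw0, hcon⟩
        rw [← hind _ hwΛ hw0]
        refine Γ.index_eq_of_segment fun s hs hmem => ?_
        rw [add_sub_cancel_left] at hmem
        rcases hs.2.eq_or_lt with h1 | h1
        · refine hdisj _ hmem ?_
          rwa [h1, Complex.ofReal_one, one_mul]
        · refine (hK ((1 - s) * ε) (mul_pos (by linarith) hε0) ?_ _ hmem).1 ?_
          · nlinarith [hs.1]
          · convert hwΛ using 1
            push_cast
            ring
      · refine Γ.index_eq_zero_of_re_pos (-Complex.I) fun z hz => ?_
        have := him z hz
        simp at hw0 ⊢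
        linarith
  have h1 : ContinuousOn (fun z => f (z + ε * Complex.I)) Γ.trace := by
    refine hc.comp hcont.continuousOn fun z hz => ⟨?_, (hK ε hε0 (by linarith) z hz).1⟩
    have := him z hz
    simp
    linarith
  calc ‖Γ.integral f‖ = ‖Γ.integral fun z => f z - f (z + ε * Complex.I)‖ := by
        rw [Γ.integral_sub hfc h1, hzero, sub_zero]
    _ ≤ Γ.length * (η / (Γ.length + 1)) :=
        Γ.norm_integral_le fun z hz => (hK ε hε0 (by linarith) z hz).2
    _ ≤ η := by
        rw [mul_div_assoc', div_le_iff₀ hlen]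
        nlinarith

end PathCycle

/-! ### The contour -/

/-- `c` is an arc in the closed upper half-plane, with velocity `c'`, that leads from the real point
`p` to the real point `q < p`. -/
structure IsUpperArc (c c' : ℝ → ℂ) (a b p q : ℝ) : Prop where
  le : a ≤ b
  cont : ContinuousOn c (Icc a b)
  hasDeriv : ∃ s : Set ℝ, s.Countable ∧ ∀ t ∈ Ioo a b \ s, HasDerivAt c (c' t) t
  integrable : IntervalIntegrable c' volume a b
  start : c a = p
  finish : c b = q
  im_nonneg : ∀ t ∈ Icc a b, 0 ≤ (c t).im

namespace IsUpperArc

variable {c c' : ℝ → ℂ} {a b p q : ℝ}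

/-- The closed curve that runs through the arc from `p` to `q`, along the real axis from `q` to
`-R`, back along the upper half-circle to `R`, and along the real axis from `R` to `p`. -/
def cycle (h : IsUpperArc c c' a b p q) (R : ℝ) : PathCycle (Fin 4) where
  path := ![c, fun t => t, fun t => circleMap 0 R t, fun t => t]
  vel := ![c', fun _ => 1, fun t => circleMap 0 R t * Complex.I, fun _ => 1]
  a := ![a, q, Real.pi, R]
  b := ![b, -R, 0, p]
  cont i := by
    fin_cases i
    · simpa [uIcc_of_le h.le] using h.cont
    · exact Complex.continuous_ofReal.continuousOn
    · exact (continuous_circleMap 0 R).continuousOn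
    · exact Complex.continuous_ofReal.continuousOn
  hasDeriv i := by
    fin_cases i
    · simpa [h.le] using h.hasDeriv
    · exact ⟨∅, countable_empty, fun t _ => Complex.ofRealCLM.hasDerivAt⟩
    · exact ⟨∅, countable_empty, fun t _ => hasDerivAt_circleMap 0 R t⟩
    · exact ⟨∅, countable_empty, fun t _ => Complex.ofRealCLM.hasDerivAt⟩
  integrable i := by
    fin_cases i
    · exact h.integrable
    · exact continuous_const.intervalIntegrable _ _
    · exact ((continuous_circleMap 0 R).mul continuous_const).intervalIntegrable _ _
    · exact continuous_const.intervalIntegrable _ _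
  closed g := by
    simp [Fin.sum_univ_four, h.start, h.finish, circleMap]
    ring

theorem cycle_integral {E : Type*} [NormedAddCommGroup E] [NormedSpace ℂ E]
    (h : IsUpperArc c c' a b p q) (R : ℝ) (f : ℂ → E) :
    (h.cycle R).integral f = (∫ t in a..b, c' t • f (c t)) - (∫ t in (-R)..q, f t) -
      (∫ t in (0 : ℝ)..Real.pi, (circleMap 0 R t * Complex.I) • f (circleMap 0 R t)) -
      ∫ t in p..R, f t := by
  simp only [PathCycle.integral, cycle, Fin.sum_univ_four]
  simp [intervalIntegral.integral_symm q (-R), intervalIntegral.integral_symm R p,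
    intervalIntegral.integral_symm Real.pi 0, sub_eq_add_neg]

theorem mem_trace_cycle (h : IsUpperArc c c' a b p q) {R : ℝ} (hR : 0 ≤ R) (hp : p ≤ R)
    (hq : -R ≤ q) {z : ℂ} (hz : z ∈ (h.cycle R).trace) : (∃ t ∈ Icc a b, z = c t) ∨
      (∃ t : ℝ, (t ≤ q ∨ p ≤ t) ∧ z = t) ∨ (‖z‖ = |R| ∧ 0 ≤ z.im) := by
  obtain ⟨i, t, ht, rfl⟩ := mem_iUnion.1 hz
  fin_cases i
  · exact .inl ⟨t, by simpa [cycle, uIcc_of_le h.le] using ht, rfl⟩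
  · refine .inr (.inl ⟨t, .inl ?_, rfl⟩)
    have : t ∈ uIcc q (-R) := ht
    rw [uIcc_of_ge hq] at this
    exact this.2
  · refine .inr (.inr ⟨?_, ?_⟩)
    · simp [cycle]
    · have : t ∈ uIcc Real.pi 0 := ht
      rw [uIcc_of_ge Real.pi_pos.le] at this
      have h1 : (circleMap 0 R t).im = R * Real.sin t := by
        simp [circleMap, Complex.exp_ofReal_mul_I_im]
      show 0 ≤ (circleMap 0 R t).im
      rw [h1]
      exact mul_nonneg hR (Real.sin_nonneg_of_nonneg_of_le_pi this.1 this.2)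
  · refine .inr (.inl ⟨t, .inr ?_, rfl⟩)
    have : t ∈ uIcc R p := ht
    rw [uIcc_of_ge hp] at this
    exact this.1

theorem im_nonneg_of_mem_trace (h : IsUpperArc c c' a b p q) {R : ℝ} (hR : 0 ≤ R) (hp : p ≤ R)
    (hq : -R ≤ q) {z : ℂ} (hz : z ∈ (h.cycle R).trace) : 0 ≤ z.im := by
  rcases h.mem_trace_cycle hR hp hq hz with ⟨t, ht, rfl⟩ | ⟨t, -, rfl⟩ | h1
  · exact h.im_nonneg t ht
  · simp
  · exact h1.2

/-- Cauchy's theorem moves the integral over the arc and the two adjacent rays to a large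
half-circle. -/
theorem integral_eq_halfCircle {E : Type*} [NormedAddCommGroup E] [NormedSpace ℂ E]
    [CompleteSpace E] (h : IsUpperArc c c' a b p q) {R : ℝ} (hR : 0 ≤ R) (hp : p ≤ R)
    (hq : -R ≤ q) {Λ : Set ℂ} {f : ℂ → E} (harc : ∀ t ∈ Icc a b, c t ∉ Λ)
    (hray : ∀ t : ℝ, (t ≤ q ∨ p ≤ t) → (t : ℂ) ∉ Λ) (hfar : ∀ z ∈ Λ, ‖z‖ < R)
    (hΛ : ∀ z, 0 ≤ z.im → z ∉ Λ → ∀ᶠ w in 𝓝[{w | 0 < w.im}] z, w ∉ Λ)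
    (hc : ContinuousOn f ({z | 0 ≤ z.im} \ Λ)) (hd : DifferentiableOn ℂ f ({z | 0 < z.im} \ Λ))
    (hind : ∀ w ∈ Λ, 0 < w.im → (h.cycle R).index w = 0) :
    (∫ t in a..b, c' t • f (c t)) - (∫ t in (-R)..q, f t) - (∫ t in p..R, f t) =
      ∫ t in (0 : ℝ)..Real.pi, (circleMap 0 R t * Complex.I) • f (circleMap 0 R t) := by
  have h1 := (h.cycle R).integral_eq_zero_of_im_nonneg
    (fun z hz => h.im_nonneg_of_mem_trace hR hp hq hz) (fun z hz hzΛ => ?_) hΛ hc hd hind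
  · rw [h.cycle_integral] at h1
    rw [← sub_eq_zero, ← h1]
    abel
  · rcases h.mem_trace_cycle hR hp hq hz with ⟨t, ht, rfl⟩ | ⟨t, ht, rfl⟩ | ht
    · exact harc t ht hzΛ
    · exact hray t ht hzΛ
    · have := hfar z hzΛ
      rw [ht.1, abs_of_nonneg hR] at this
      exact lt_irrefl _ this

end IsUpperArc

theorem mem_closure_halfPlane {s : Side} {z : ℂ} :
    z ∈ closure (halfPlane s) ↔ 0 ≤ s.sign * z.im := by
  cases s with
  | plus =>
    have : halfPlane Side.plus = {z : ℂ | 0 < z.im} := by simp [halfPlane, Side.sign]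
    rw [this, Complex.closure_setOfPred_lt_im]
    simp [Side.sign]
  | minus =>
    have : halfPlane Side.minus = {z : ℂ | z.im < 0} := by simp [halfPlane, Side.sign]
    rw [this, Complex.closure_setOfPred_im_lt]
    simp [Side.sign]

namespace Contour

variable (γ : Contour)

theorem continuousOn_curve : ContinuousOn γ.curve (Icc 0 1) := by
  obtain ⟨n, p, hp, h0, h1, hC⟩ := γ.piecewise_C1
  have key : ∀ k ≤ n, ContinuousOn γ.curve (Icc (p 0) (p k)) := fun k hk => by
    induction k with
    | zero => simp
    | succ k ih =>
      rw [← Icc_union_Icc_eq_Icc (hp (Nat.zero_le k)) (hp k.le_succ)]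
      exact (ih (by lia)).union_of_isClosed (hC k (by lia)).continuousOn isClosed_Icc isClosed_Icc
  simpa [h0, h1] using key n le_rfl

theorem hasDerivAt_curve : ∃ s : Set ℝ, s.Countable ∧
    ∀ t ∈ Ioo (0 : ℝ) 1 \ s, HasDerivAt γ.curve (deriv γ.curve t) t := by
  obtain ⟨n, p, hp, h0, h1, hC⟩ := γ.piecewise_C1
  refine ⟨range p, countable_range p, fun t ht => ?_⟩
  have key : ∀ k ≤ n, t < p k → ∃ i < n, t ∈ Ioo (p i) (p (i + 1)) := fun k hk htk => by
    induction k with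
    | zero => exact absurd htk (by rw [h0]; exact ht.1.1.le.not_gt)
    | succ k ih =>
      rcases lt_trichotomy t (p k) with h | h | h
      · exact ih (by lia) h
      · exact absurd ⟨k, h.symm⟩ ht.2
      · exact ⟨k, by lia, h, htk⟩
  obtain ⟨i, hi, hti⟩ := key n le_rfl (by rw [h1]; exact ht.1.2)
  exact (((hC i hi).differentiableOn one_ne_zero).differentiableAt
    (Icc_mem_nhds hti.1 hti.2)).hasDerivAt

theorem intervalIntegrable_deriv_curve : IntervalIntegrable (deriv γ.curve) volume 0 1 := by
  obtain ⟨n, p, hp, h0, h1, hC⟩ := γ.piecewise_C1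
  rw [← h0, ← h1]
  refine IntervalIntegrable.trans_iterate fun i hi => ?_
  rcases (hp i.le_succ).eq_or_lt with heq | hlt
  · rw [Nat.succ_eq_add_one] at heq
    rw [heq]
  · have h2 : ContinuousOn (derivWithin γ.curve (Icc (p i) (p (i + 1)))) (Icc (p i) (p (i + 1))) :=
      (hC i hi).continuousOn_derivWithin (uniqueDiffOn_Icc hlt) le_rfl
    refine (h2.intervalIntegrable_of_Icc hlt.le).congr_ae ?_
    rw [uIoc_of_le hlt.le, ← restrict_Ioo_eq_restrict_Ioc]
    filter_upwards [ae_restrict_mem measurableSet_Ioo] with t ht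
    exact derivWithin_of_mem_nhds (Icc_mem_nhds ht.1 ht.2)

theorem isUpperArc_plus :
    IsUpperArc γ.curve (deriv γ.curve) 0 γ.mid γ.right γ.left where
  le := γ.mid_mem.1.le
  cont := γ.continuousOn_curve.mono (Icc_subset_Icc_right γ.mid_mem.2.le)
  hasDeriv := by
    obtain ⟨s, hs, h⟩ := γ.hasDerivAt_curve
    exact ⟨s, hs, fun t ht => h t ⟨Ioo_subset_Ioo_right γ.mid_mem.2.le ht.1, ht.2⟩⟩
  integrable := γ.intervalIntegrable_deriv_curve.mono_set (by
    rw [uIcc_of_le γ.mid_mem.1.le, uIcc_of_le zero_le_one]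
    exact Icc_subset_Icc_right γ.mid_mem.2.le)
  start := γ.curve_zero
  finish := γ.curve_mid
  im_nonneg t ht := by
    rcases ht.1.eq_or_lt with rfl | h1
    · simp [γ.curve_zero]
    rcases ht.2.eq_or_lt with rfl | h2
    · simp [γ.curve_mid]
    · exact (γ.upper t ⟨h1, h2⟩).le

/-- The lower arc of `γ₀`, rotated by a half-turn. -/
theorem isUpperArc_minus : IsUpperArc (fun t => -γ.curve t) (fun t => -deriv γ.curve t) γ.mid 1
    (-γ.left) (-γ.right) where
  le := γ.mid_mem.2.le
  cont := (γ.continuousOn_curve.mono (Icc_subset_Icc_left γ.mid_mem.1.le)).fun_neg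
  hasDeriv := by
    obtain ⟨s, hs, h⟩ := γ.hasDerivAt_curve
    exact ⟨s, hs, fun t ht => (h t ⟨Ioo_subset_Ioo_left γ.mid_mem.1.le ht.1, ht.2⟩).fun_neg⟩
  integrable := (γ.intervalIntegrable_deriv_curve.mono_set (by
    rw [uIcc_of_le γ.mid_mem.2.le, uIcc_of_le zero_le_one]
    exact Icc_subset_Icc_left γ.mid_mem.1.le)).neg
  start := by simp [γ.curve_mid]
  finish := by simp [γ.curve_one]
  im_nonneg t ht := by
    rcases ht.1.eq_or_lt with rfl | h1
    · simp [γ.curve_mid]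
    rcases ht.2.eq_or_lt with rfl | h2
    · simp [γ.curve_one]
    · simpa using (γ.lower t ⟨h1, h2⟩).le

/-- The closed curve `γ₀` as a cycle. -/
def innerCycle : PathCycle Unit where
  path _ := γ.curve
  vel _ := deriv γ.curve
  a _ := 0
  b _ := 1
  cont _ := by simpa using γ.continuousOn_curve
  hasDeriv _ := by simpa using γ.hasDerivAt_curve
  integrable _ := γ.intervalIntegrable_deriv_curve
  closed g := by simp [γ.curve_zero, γ.curve_one]

theorem trace_innerCycle : γ.innerCycle.trace = γ.inner := by
  simp [PathCycle.trace, innerCycle, inner, iUnion_const]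

theorem Encloses.index_eq {γ : Contour} {w : ℂ} (h : γ.Encloses w) :
    γ.innerCycle.index w = 2 * Real.pi * Complex.I := by
  have h1 := h.2
  rw [inv_mul_eq_iff_eq_mul₀ (by simp [Real.pi_ne_zero]), mul_one] at h1
  rw [← h1]
  simp [PathCycle.index, PathCycle.integral, innerCycle, div_eq_mul_inv]

theorem Encloses.index_ne_zero {γ : Contour} {w : ℂ} (h : γ.Encloses w) :
    γ.innerCycle.index w ≠ 0 := by
  rw [h.index_eq]
  simp [Real.pi_ne_zero]

theorem exists_inner_bound : ∃ B : ℝ, 0 < B ∧ ∀ z ∈ γ.inner, ‖z‖ ≤ B := by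
  rw [← trace_innerCycle]
  exact γ.innerCycle.exists_trace_bound

theorem Encloses.norm_le {γ : Contour} {B : ℝ} (hB : ∀ z ∈ γ.inner, ‖z‖ ≤ B) {w : ℂ}
    (h : γ.Encloses w) : ‖w‖ ≤ B := by
  by_contra! hlt
  exact h.index_ne_zero (γ.innerCycle.index_eq_zero_of_far (by rwa [trace_innerCycle]) hlt)

theorem right_mem_inner : (γ.right : ℂ) ∈ γ.inner := ⟨0, by simp, γ.curve_zero⟩

theorem left_mem_inner : (γ.left : ℂ) ∈ γ.inner :=
  ⟨γ.mid, Ioo_subset_Icc_self γ.mid_mem, γ.curve_mid⟩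

theorem eq_of_ofReal_mem_inner {t : ℝ} (ht : (t : ℂ) ∈ γ.inner) : t = γ.right ∨ t = γ.left := by
  obtain ⟨u, hu, hut⟩ := ht
  have him : (γ.curve u).im = 0 := by simp [hut]
  rcases lt_trichotomy u γ.mid with h | h | h
  · rcases hu.1.eq_or_lt with h0 | h0
    · left
      rw [← h0, γ.curve_zero] at hut
      exact_mod_cast hut.symm
    · exact absurd (γ.upper u ⟨h0, h⟩) (by simp [him])
  · right
    rw [h, γ.curve_mid] at hut
    exact_mod_cast hut.symm
  · rcases hu.2.eq_or_lt with h0 | h0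
    · left
      rw [h0, γ.curve_one] at hut
      exact_mod_cast hut.symm
    · exact absurd (γ.lower u ⟨h, h0⟩) (by simp [him])

/-- The contour `γ₀` encloses no points of the cuts. -/
theorem not_encloses_ray {t : ℝ} (ht : t ≤ γ.left ∨ γ.right ≤ t) : ¬ γ.Encloses t := fun h => by
  obtain ⟨B, hB, hbd⟩ := γ.exists_inner_bound
  have hl := γ.left_neg
  have hr := γ.right_pos
  -- A real segment from a point of a cut to a far point misses `γ₀`.
  have key : ∀ v : ℝ, B < |v| → (∀ s ∈ Icc (0 : ℝ) 1, t + s * (v - t) ≠ γ.left ∧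
      t + s * (v - t) ≠ γ.right) → False := fun v hv hs => by
    refine h.index_ne_zero ?_
    rw [γ.innerCycle.index_eq_of_segment (v := (v : ℂ)), γ.innerCycle.index_eq_zero_of_far
      (by rwa [trace_innerCycle]) (by simpa using hv)]
    intro s hs' hmem
    rw [trace_innerCycle, ← Complex.ofReal_sub, ← Complex.ofReal_mul, ← Complex.ofReal_add] at hmem
    rcases γ.eq_of_ofReal_mem_inner hmem with h1 | h1
    · exact (hs s hs').2 h1
    · exact (hs s hs').1 h1
  rcases ht with ht | ht
  · have hlt : t < γ.left := ht.lt_of_ne fun h0 => h.1 (h0 ▸ γ.left_mem_inner)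
    refine key (min t (-B) - 1) ?_ fun s hs => ?_
    · have := min_le_right t (-B)
      rw [abs_of_neg (by linarith)]
      linarith
    · have h1 : s * (min t (-B) - 1 - t) ≤ 0 :=
        mul_nonpos_of_nonneg_of_nonpos hs.1 (by linarith [min_le_left t (-B)])
      exact ⟨by linarith, by linarith⟩
  · have hlt : γ.right < t := ht.lt_of_ne fun h0 => h.1 (h0 ▸ γ.right_mem_inner)
    refine key (max t B + 1) ?_ fun s hs => ?_
    · have := le_max_right t B
      rw [abs_of_pos (by linarith)]
      linarith
    · have h1 : 0 ≤ s * (max t B + 1 - t) :=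
        mul_nonneg hs.1 (by linarith [le_max_left t B])
      exact ⟨by linarith, by linarith⟩

theorem integral_cycle_minus {E : Type*} [NormedAddCommGroup E] [NormedSpace ℂ E] (R : ℝ)
    (f : ℂ → E) : (γ.isUpperArc_minus.cycle R).integral (fun z => f (-z)) =
      (∫ t in Real.pi..2 * Real.pi, (circleMap 0 R t * Complex.I) • f (circleMap 0 R t)) -
      (∫ t in γ.mid..1, deriv γ.curve t • f (γ.curve t)) - (∫ t in γ.right..R, f t) -
      ∫ t in (-R)..γ.left, f t := by
  have h1 : ∫ t in (-R)..(-γ.right), f (-(t : ℂ)) = ∫ t in γ.right..R, f t := by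
    have := intervalIntegral.integral_comp_neg (a := -R) (b := -γ.right) fun t : ℝ => f t
    simpa using this
  have h2 : ∫ t in (-γ.left)..R, f (-(t : ℂ)) = ∫ t in (-R)..γ.left, f t := by
    have := intervalIntegral.integral_comp_neg (a := -γ.left) (b := R) fun t : ℝ => f t
    simpa using this
  have h3 : ∫ t in (0 : ℝ)..Real.pi, (circleMap 0 R t * Complex.I) • f (-circleMap 0 R t) =
      -∫ t in Real.pi..2 * Real.pi, (circleMap 0 R t * Complex.I) • f (circleMap 0 R t) := by
    have := intervalIntegral.integral_comp_add_right (a := 0) (b := Real.pi)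
      (fun t => (circleMap 0 R t * Complex.I) • f (circleMap 0 R t)) Real.pi
    rw [zero_add, ← two_mul] at this
    rw [← this, ← intervalIntegral.integral_neg]
    refine intervalIntegral.integral_congr fun t _ => ?_
    have hc : circleMap 0 R (t + Real.pi) = -circleMap 0 R t := by
      simp [circleMap, add_mul, Complex.exp_add]
    simp only [hc, neg_mul, neg_smul, neg_neg]
  have h4 : ∫ t in γ.mid..1, (-deriv γ.curve t) • f (-(-γ.curve t)) =
      -∫ t in γ.mid..1, deriv γ.curve t • f (γ.curve t) := by
    simp only [neg_neg, neg_smul, intervalIntegral.integral_neg]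
  rw [IsUpperArc.cycle_integral, h1, h2, h3, h4]
  abel

/-- A point enclosed by `γ₀` lies outside of the region between `γ₀` and a large half-circle. -/
theorem Encloses.index_cycle_eq_zero {γ : Contour} {R : ℝ} (hR : ∀ z ∈ γ.inner, ‖z‖ < R) {w : ℂ}
    (h : γ.Encloses w) (hwR : ‖w‖ < R) :
    (0 < w.im → (γ.isUpperArc_plus.cycle R).index w = 0) ∧
    (0 < (-w).im → (γ.isUpperArc_minus.cycle R).index (-w) = 0) := by
  have hR0 : 0 ≤ R := (norm_nonneg w).trans hwR.le
  have hr : γ.right ≤ R := by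
    have := hR _ γ.right_mem_inner
    rw [Complex.norm_real] at this
    exact (Real.le_norm_self _).trans this.le
  have hl : -R ≤ γ.left := by
    have := hR _ γ.left_mem_inner
    rw [Complex.norm_real] at this
    linarith [neg_abs_le γ.left, Real.norm_eq_abs γ.left]
  -- The two winding numbers add up to that of the circle minus that of `γ₀`.
  have hsum : w.im ≠ 0 → (γ.isUpperArc_plus.cycle R).index w +
      (γ.isUpperArc_minus.cycle R).index (-w) = 0 := fun him => by
    have e1 : (γ.isUpperArc_minus.cycle R).index (-w) =
        -(γ.isUpperArc_minus.cycle R).integral (fun z => (-z - w)⁻¹) := by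
      rw [PathCycle.index, PathCycle.integral, PathCycle.integral, ← Finset.sum_neg_distrib]
      refine Finset.sum_congr rfl fun i _ => ?_
      rw [← intervalIntegral.integral_neg]
      refine intervalIntegral.integral_congr fun t _ => ?_
      simp only [smul_eq_mul]
      rw [← mul_neg, ← inv_neg]
      ring_nf
    have hcont : ContinuousOn (fun z : ℂ => (z - w)⁻¹) {w}ᶜ := fun z hz =>
      ((continuousAt_id.sub continuousAt_const).inv₀ (sub_ne_zero.2 hz)).continuousWithinAt
    have hcirc : Continuous fun t : ℝ => (circleMap 0 R t * Complex.I) • (circleMap 0 R t - w)⁻¹ :=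
      ((continuous_circleMap 0 R).mul continuous_const).smul
        (((continuous_circleMap 0 R).sub continuous_const).inv₀ fun t h0 => by
          have h1 : circleMap 0 R t = w := sub_eq_zero.1 h0
          rw [← h1] at hwR
          simp [abs_of_nonneg hR0] at hwR)
    have hcurve : IntervalIntegrable (fun t => deriv γ.curve t • (γ.curve t - w)⁻¹) volume 0 1 :=
      γ.innerCycle.intervalIntegrable (f := fun z => (z - w)⁻¹) (hcont.mono fun z hz h0 =>
        h.1 (by rw [← trace_innerCycle]; exact h0 ▸ hz)) ()
    have hmid := γ.mid_mem
    have e2 := intervalIntegral.integral_add_adjacent_intervals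
      (hcurve.mono_set (c := 0) (d := γ.mid) (by
        rw [uIcc_of_le hmid.1.le, uIcc_of_le zero_le_one]
        exact Icc_subset_Icc_right hmid.2.le))
      (hcurve.mono_set (c := γ.mid) (d := 1) (by
        rw [uIcc_of_le hmid.2.le, uIcc_of_le zero_le_one]
        exact Icc_subset_Icc_left hmid.1.le))
    have e3 := intervalIntegral.integral_add_adjacent_intervals
      (hcirc.intervalIntegrable (μ := volume) 0 Real.pi)
      (hcirc.intervalIntegrable (μ := volume) Real.pi (2 * Real.pi))
    have e4 : ∫ t in (0 : ℝ)..2 * Real.pi,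
        (circleMap 0 R t * Complex.I) • (circleMap 0 R t - w)⁻¹ = 2 * Real.pi * Complex.I := by
      have := circleIntegral.integral_sub_inv_of_mem_ball (c := 0) (w := w) (R := R)
        (by simpa using hwR)
      rw [circleIntegral] at this
      simpa using this
    have e5 : ∫ t in (0 : ℝ)..1, deriv γ.curve t • (γ.curve t - w)⁻¹ =
        2 * Real.pi * Complex.I := by
      have := h.index_eq
      simpa [PathCycle.index, PathCycle.integral, innerCycle] using this
    rw [e1, γ.integral_cycle_minus R fun z => (z - w)⁻¹, PathCycle.index, IsUpperArc.cycle_integral]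
    linear_combination e2 - e3 - e4 + e5
  -- The cycle in the other half-plane does not wind around the point.
  constructor <;> intro him
  · have h1 := hsum him.ne'
    rwa [(γ.isUpperArc_minus.cycle R).index_eq_zero_of_re_pos (-Complex.I) fun z hz => ?_,
      add_zero] at h1
    have := γ.isUpperArc_minus.im_nonneg_of_mem_trace hR0 (p := -γ.left) (by linarith)
      (by linarith) hz
    simp
    linarith
  · rw [Complex.neg_im] at him
    have h1 := hsum (by linarith)
    rwa [(γ.isUpperArc_plus.cycle R).index_eq_zero_of_re_pos (-Complex.I) fun z hz => ?_,
      zero_add] at h1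
    have := γ.isUpperArc_plus.im_nonneg_of_mem_trace hR0 hr hl hz
    simp
    linarith

/-- Exceptional sets in the closed half-planes that `γ₀` encloses. -/
structure Admissible (γ : Contour) (Λ : Side → Set ℂ) : Prop where
  encloses : ∀ s, ∀ w ∈ Λ s, γ.Encloses w
  eventually : ∀ s, ∀ z ∈ closure (halfPlane s) \ Λ s, ∀ᶠ w in 𝓝[halfPlane s] z, w ∉ Λ s

theorem Admissible.side_subset {γ : Contour} {Λ : Side → Set ℂ} (h : γ.Admissible Λ) (s : Side) :
    γ.side s ⊆ closure (halfPlane s) \ Λ s := by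
  rintro z (⟨hz, him⟩ | ⟨t, ht, rfl⟩)
  · exact ⟨mem_closure_halfPlane.2 him, fun hΛ => (h.encloses s z hΛ).1 hz⟩
  · exact ⟨mem_closure_halfPlane.2 (by simp), fun hΛ => γ.not_encloses_ray ht (h.encloses s t hΛ)⟩

theorem curve_mem_side_plus {t : ℝ} (ht : t ∈ Icc 0 γ.mid) : γ.curve t ∈ γ.side Side.plus :=
  .inl ⟨⟨t, ⟨ht.1, ht.2.trans γ.mid_mem.2.le⟩, rfl⟩, by
    simpa [Side.sign] using γ.isUpperArc_plus.im_nonneg t ht⟩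

theorem curve_mem_side_minus {t : ℝ} (ht : t ∈ Icc γ.mid 1) : γ.curve t ∈ γ.side Side.minus :=
  .inl ⟨⟨t, ⟨γ.mid_mem.1.le.trans ht.1, ht.2⟩, rfl⟩, by
    simpa [Side.sign] using γ.isUpperArc_minus.im_nonneg t ht⟩

theorem ray_mem_side {t : ℝ} (ht : t ≤ γ.left ∨ γ.right ≤ t) (s : Side) : (t : ℂ) ∈ γ.side s :=
  .inr ⟨t, ht, rfl⟩

theorem integral_ray_sub {m : ℕ} {F : Side → ℂ → CMat m} (hF : ∀ s, ContinuousOn (F s) (γ.side s))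
    {a b : ℝ} (hab : ∀ t ∈ uIcc a b, t ≤ γ.left ∨ γ.right ≤ t) :
    ∫ t in a..b, (F Side.minus (t : ℂ) - F Side.plus (t : ℂ)) =
      (∫ t in a..b, F Side.minus (t : ℂ)) - ∫ t in a..b, F Side.plus (t : ℂ) := by
  have h : ∀ s, IntervalIntegrable (fun t : ℝ => F s t) volume a b := fun s =>
    ContinuousOn.intervalIntegrable ((hF s).comp Complex.continuous_ofReal.continuousOn
      fun t ht => γ.ray_mem_side (hab t ht) s)
  exact intervalIntegral.integral_sub (h _) (h _)

/-- The integral of a pair of holomorphic functions over `γ` is an integral over a large circle. -/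
theorem truncIntegral_eq_circle {m : ℕ} {Λ : Side → Set ℂ} (hΛ : γ.Admissible Λ) {R : ℝ}
    (hR : ∀ z ∈ γ.inner, ‖z‖ < R) {F : Side → ℂ → CMat m}
    (hc : ∀ s, ContinuousOn (F s) (closure (halfPlane s) \ Λ s))
    (hd : ∀ s, DifferentiableOn ℂ (F s) (halfPlane s \ Λ s)) :
    γ.truncIntegral F R =
      (∫ t in (0 : ℝ)..Real.pi,
        (circleMap 0 R t * Complex.I) • F Side.plus (circleMap 0 R t)) +
      ∫ t in Real.pi..2 * Real.pi,
        (circleMap 0 R t * Complex.I) • F Side.minus (circleMap 0 R t) := by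
  obtain ⟨B, hB, hBR, hBi⟩ : ∃ B, 0 < B ∧ B < R ∧ ∀ z ∈ γ.inner, ‖z‖ ≤ B := by
    have hcomp : IsCompact γ.inner := by
      rw [← trace_innerCycle]
      exact γ.innerCycle.isCompact_trace
    obtain ⟨z, hz, hmax⟩ := hcomp.exists_isMaxOn ⟨_, γ.right_mem_inner⟩ continuous_norm.continuousOn
    refine ⟨‖z‖, ?_, hR z hz, fun w hw => hmax hw⟩
    have : ‖(γ.right : ℂ)‖ ≤ ‖z‖ := hmax γ.right_mem_inner
    rw [Complex.norm_real] at this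
    exact (γ.right_pos.trans_le (Real.le_norm_self _)).trans_le this
  have hfar : ∀ s, ∀ z ∈ Λ s, ‖z‖ < R := fun s z hz =>
    ((hΛ.encloses s z hz).norm_le hBi).trans_lt hBR
  have hr : γ.right ≤ R := by
    have := hR _ γ.right_mem_inner
    rw [Complex.norm_real] at this
    exact (Real.le_norm_self _).trans this.le
  have hl : -R ≤ γ.left := by
    have := hR _ γ.left_mem_inner
    rw [Complex.norm_real] at this
    linarith [neg_abs_le γ.left, Real.norm_eq_abs γ.left]
  have hFs : ∀ s, ContinuousOn (F s) (γ.side s) := fun s => (hc s).mono (hΛ.side_subset s)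
  have hp : halfPlane Side.plus = {w : ℂ | 0 < w.im} := by simp [halfPlane, Side.sign]
  have hpc : closure (halfPlane Side.plus) = {w : ℂ | 0 ≤ w.im} :=
    ext fun w => by simp [mem_closure_halfPlane, Side.sign]
  -- The lower half of the contour is rotated into the upper half-plane by `ξ ↦ -ξ`.
  have P := γ.isUpperArc_plus.integral_eq_halfCircle (hB.trans hBR).le hr hl
    (Λ := Λ Side.plus) (f := F Side.plus)
    (fun t ht => (hΛ.side_subset _ (γ.curve_mem_side_plus ht)).2)
    (fun t ht => (hΛ.side_subset _ (γ.ray_mem_side ht _)).2) (hfar _)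
    (fun z hz hzΛ => by
      have := hΛ.eventually Side.plus z ⟨by rw [hpc]; exact hz, hzΛ⟩
      rwa [hp] at this)
    (by have := hc Side.plus; rwa [hpc] at this) (by have := hd Side.plus; rwa [hp] at this)
    (fun w hw him => ((hΛ.encloses _ w hw).index_cycle_eq_zero hR (hfar _ w hw)).1 him)
  have hnc : ∀ z : ℂ, 0 ≤ z.im → -z ∈ closure (halfPlane Side.minus) := fun z hz => by
    simpa [mem_closure_halfPlane, Side.sign] using hz
  have hno : ∀ z : ℂ, 0 < z.im → -z ∈ halfPlane Side.minus := fun z hz => by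
    simpa [halfPlane, Side.sign] using hz
  have Q := γ.isUpperArc_minus.integral_eq_halfCircle (hB.trans hBR).le (by linarith) (by linarith)
    (Λ := {z | -z ∈ Λ Side.minus}) (f := fun z => F Side.minus (-z))
    (fun t ht => by
      simpa using (hΛ.side_subset _ (γ.curve_mem_side_minus ht)).2)
    (fun t ht => by
      have h1 : -t ≤ γ.left ∨ γ.right ≤ -t := ht.symm.imp (by intro; linarith) (by intro; linarith)
      simpa using (hΛ.side_subset _ (γ.ray_mem_side h1 Side.minus)).2)
    (fun z hz => by simpa using hfar _ _ hz)
    (fun z hz hzΛ => by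
      have h1 := hΛ.eventually Side.minus (-z) ⟨hnc z hz, hzΛ⟩
      refine Tendsto.eventually (f := fun w : ℂ => -w) ?_ h1
      exact tendsto_nhdsWithin_iff.2 ⟨(continuous_neg.tendsto z).mono_left nhdsWithin_le_nhds,
        eventually_mem_nhdsWithin.mono fun w hw => hno w hw⟩)
    ((hc Side.minus).comp continuous_neg.continuousOn fun z hz => ⟨hnc z hz.1, hz.2⟩)
    ((hd Side.minus).comp differentiable_neg.differentiableOn fun z hz => ⟨hno z hz.1, hz.2⟩)
    (fun w hw him => by
      have := ((hΛ.encloses _ _ hw).index_cycle_eq_zero hR (hfar _ _ hw)).2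
      rw [neg_neg] at this
      exact this him)
  have h0 := γ.integral_cycle_minus R (F Side.minus)
  rw [IsUpperArc.cycle_integral, ← Q] at h0
  rw [truncIntegral, γ.integral_ray_sub hFs fun t ht => ?_, γ.integral_ray_sub hFs fun t ht => ?_,
    ← P]
  · rw [← sub_eq_zero] at h0 ⊢
    rw [← h0]
    abel
  · rw [uIcc_of_le hl] at ht
    exact .inl ht.2
  · rw [uIcc_of_le hr] at ht
    exact .inr ht.1

end Contour

/-! ### Contour integrals from the behaviour at infinity -/

theorem circleMap_mem_halfPlane_plus {R t : ℝ} (hR : 0 < R) (ht : t ∈ Ioo 0 Real.pi) :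
    circleMap 0 R t ∈ halfPlane Side.plus := by
  have h1 : (circleMap 0 R t).im = R * Real.sin t := by
    simp [circleMap, Complex.exp_ofReal_mul_I_im]
  simp only [halfPlane, Side.sign, one_mul, mem_ofPred_eq, h1]
  exact mul_pos hR (Real.sin_pos_of_mem_Ioo ht)

theorem circleMap_mem_halfPlane_minus {R t : ℝ} (hR : 0 < R)
    (ht : t ∈ Ioo Real.pi (2 * Real.pi)) : circleMap 0 R t ∈ halfPlane Side.minus := by
  have h1 : (circleMap 0 R t).im = R * Real.sin t := by
    simp [circleMap, Complex.exp_ofReal_mul_I_im]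
  have h2 : 0 < Real.sin (t - Real.pi) :=
    Real.sin_pos_of_mem_Ioo ⟨by linarith [ht.1], by linarith [ht.2]⟩
  rw [Real.sin_sub_pi] at h2
  simp only [halfPlane, Side.sign, mem_ofPred_eq, h1]
  nlinarith

/-- If `ξ (f ξ) → J` uniformly on a large arc, then the integral of `f` over the arc is close to
the length of the arc times `i J`. -/
theorem norm_arc_sub_le {f : ℂ → CMat m} {J : CMat m} {R η a b : ℝ} (hab : a ≤ b)
    (hf : ContinuousOn (fun t : ℝ => f (circleMap 0 R t)) (Icc a b))
    (h : ∀ t ∈ Ioo a b, ‖circleMap 0 R t • f (circleMap 0 R t) - J‖ ≤ η) :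
    ‖(∫ t in a..b, (circleMap 0 R t * Complex.I) • f (circleMap 0 R t)) -
      ((b - a : ℝ) * Complex.I) • J‖ ≤ η * (b - a) := by
  have hi : IntervalIntegrable (fun t => (circleMap 0 R t * Complex.I) • f (circleMap 0 R t))
      volume a b := by
    refine ContinuousOn.intervalIntegrable ?_
    rw [uIcc_of_le hab]
    exact ((continuous_circleMap 0 R).mul continuous_const).continuousOn.fun_smul hf
  have h1 : ((b - a : ℝ) * Complex.I) • J = ∫ _ in a..b, Complex.I • J := by
    rw [intervalIntegral.integral_const, mul_smul]
    exact Complex.coe_smul _ _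
  rw [h1, ← intervalIntegral.integral_sub hi intervalIntegrable_const]
  refine (intervalIntegral.norm_integral_le_of_norm_le_const_ae (C := η) ?_).trans
    (by rw [abs_of_nonneg (by linarith)])
  have hb : ∀ᵐ t : ℝ, t ≠ b := by simp [ae_iff, measure_singleton]
  filter_upwards [hb] with t htb ht
  rw [uIoc_of_le hab] at ht
  rw [mul_comm, mul_smul, ← smul_sub, norm_smul, Complex.norm_I, one_mul]
  exact h t ⟨ht.1, ht.2.lt_of_ne htb⟩

namespace Contour

variable (γ : Contour)

/-- If a pair of holomorphic functions differs from an entire function by `J / ξ + o(1 / ξ)`, then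
its integral over `γ` is `2πi J`. -/
theorem hasIntegral_of_tendsto {Λ : Side → Set ℂ} (hΛ : γ.Admissible Λ) {F : Side → ℂ → CMat m}
    (hc : ∀ s, ContinuousOn (F s) (closure (halfPlane s) \ Λ s))
    (hd : ∀ s, DifferentiableOn ℂ (F s) (halfPlane s \ Λ s)) {E : ℂ → CMat m}
    (hE : Differentiable ℂ E) {J : CMat m}
    (hlim : ∀ s, Tendsto (fun ξ => ξ • (F s ξ - E ξ))
      (Bornology.cobounded ℂ ⊓ 𝓟 (halfPlane s \ Λ s)) (𝓝 J)) :
    γ.HasIntegral F ((2 * Real.pi * Complex.I : ℂ) • J) := by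
  obtain ⟨B, hB, hBi⟩ := γ.exists_inner_bound
  refine Metric.tendsto_atTop.2 fun ε hε => ?_
  set η := ε / (4 * Real.pi)
  have hη : 0 < η := by positivity
  have h1 : ∀ s, ∃ r, ∀ ξ ∈ halfPlane s \ Λ s, r ≤ ‖ξ‖ → ‖ξ • (F s ξ - E ξ) - J‖ ≤ η := fun s => by
    have h2 := (hlim s).eventually (Metric.closedBall_mem_nhds J hη)
    rw [eventually_inf_principal, ← comap_norm_atTop, eventually_comap] at h2
    obtain ⟨r, hr⟩ := eventually_atTop.1 h2
    exact ⟨r, fun ξ hξ hn => mem_closedBall_iff_norm.1 (hr ‖ξ‖ hn ξ rfl hξ)⟩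
  choose r hr using h1
  refine ⟨max (max (r Side.plus) (r Side.minus)) B + 1, fun R hR => ?_⟩
  have g1 := le_max_left (max (r Side.plus) (r Side.minus)) B
  have g2 := le_max_right (max (r Side.plus) (r Side.minus)) B
  have g3 := le_max_left (r Side.plus) (r Side.minus)
  have g4 := le_max_right (r Side.plus) (r Side.minus)
  have hR0 : 0 < R := by linarith
  have hnorm : ∀ t, ‖circleMap 0 R t‖ = R := fun t => by simp [abs_of_pos hR0]
  have hnΛ : ∀ s t, circleMap 0 R t ∉ Λ s := fun s t ht => by
    have := (hΛ.encloses s _ ht).norm_le hBi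
    rw [hnorm] at this
    linarith
  have hcm := continuous_circleMap (0 : ℂ) R
  have hmem : ∀ s (a b : ℝ), a < b → (∀ t ∈ Ioo a b, circleMap 0 R t ∈ halfPlane s) →
      ContinuousOn (fun t : ℝ => F s (circleMap 0 R t)) (Icc a b) := fun s a b hab h => by
    refine (hc s).comp hcm.continuousOn fun t ht => ⟨?_, hnΛ s t⟩
    have h2 : MapsTo (circleMap 0 R) (closure (Ioo a b)) (closure (halfPlane s)) :=
      MapsTo.closure h hcm
    rw [closure_Ioo hab.ne] at h2
    exact h2 ht
  have hpi := Real.pi_pos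
  have main : ∀ s (a b : ℝ), a < b → (∀ t ∈ Ioo a b, circleMap 0 R t ∈ halfPlane s) →
      ‖(∫ t in a..b, (circleMap 0 R t * Complex.I) • F s (circleMap 0 R t)) -
        (∫ t in a..b, (circleMap 0 R t * Complex.I) • E (circleMap 0 R t)) -
        ((b - a : ℝ) * Complex.I) • J‖ ≤ η * (b - a) := fun s a b hab h => by
    have hF := hmem s a b hab h
    have hEc : Continuous fun t : ℝ => E (circleMap 0 R t) := hE.continuous.comp hcm
    have hs : ContinuousOn (fun t => circleMap 0 R t * Complex.I) (Icc a b) :=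
      (hcm.mul continuous_const).continuousOn
    have h3 := norm_arc_sub_le (f := fun ξ => F s ξ - E ξ) (J := J) (η := η) hab.le
      (hF.fun_sub hEc.continuousOn) fun t ht => hr s _ ⟨h t ht, hnΛ s t⟩ (by
        rw [hnorm]; cases s <;> linarith)
    rw [← intervalIntegral.integral_sub]
    · simpa only [smul_sub] using h3
    · refine ContinuousOn.intervalIntegrable ?_
      rw [uIcc_of_le hab.le]
      exact hs.fun_smul hF
    · refine ContinuousOn.intervalIntegrable ?_
      rw [uIcc_of_le hab.le]
      exact hs.fun_smul hEc.continuousOn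
  have m1 := main Side.plus 0 Real.pi hpi fun t ht => circleMap_mem_halfPlane_plus hR0 ht
  have m2 := main Side.minus Real.pi (2 * Real.pi) (by linarith)
    fun t ht => circleMap_mem_halfPlane_minus hR0 ht
  have hEi : ∀ a b, IntervalIntegrable (fun t => (circleMap 0 R t * Complex.I) •
      E (circleMap 0 R t)) volume a b := fun a b =>
    ((hcm.mul continuous_const).smul (hE.continuous.comp hcm)).intervalIntegrable a b
  -- The entire function contributes nothing over the whole circle.
  have hE0 : (∫ t in (0 : ℝ)..Real.pi, (circleMap 0 R t * Complex.I) • E (circleMap 0 R t)) +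
      ∫ t in Real.pi..2 * Real.pi, (circleMap 0 R t * Complex.I) • E (circleMap 0 R t) = 0 := by
    rw [intervalIntegral.integral_add_adjacent_intervals (hEi _ _) (hEi _ _)]
    have := Complex.circleIntegral_eq_zero_of_differentiable_on_off_countable (c := 0) (f := E)
      hR0.le countable_empty hE.continuous.continuousOn fun z _ => hE z
    rw [circleIntegral] at this
    simpa using this
  rw [γ.truncIntegral_eq_circle hΛ (fun z hz => (hBi z hz).trans_lt (by linarith)) hc hd,
    dist_eq_norm]
  have h4 : (2 * Real.pi * Complex.I : ℂ) • J = ((Real.pi - 0 : ℝ) * Complex.I) • J +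
      ((2 * Real.pi - Real.pi : ℝ) * Complex.I) • J := by
    rw [← add_smul]
    congr 1
    push_cast
    ring
  have h5 : ∀ a b c d e f : CMat m, c + d = 0 → a + b - (e + f) = (a - c - e) + (b - d - f) :=
    fun a b c d e f h => by
      rw [eq_neg_of_add_eq_zero_right h]
      abel
  rw [h4, h5 _ _ _ _ _ _ hE0]
  refine (norm_add_le _ _).trans_lt ?_
  have h6 : η * (2 * Real.pi) = ε / 2 := by
    simp only [η]
    field_simp
    norm_num
  linarith

end Contour

/-! ### The integrals of the main equation -/

namespace Pencil

variable {L Lt : Pencil m} {ρ θ : ℂ} {x : ℝ}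

theorem ClassV.eventually_notMem_singularSet_plus (h : L.ClassV) {z : ℂ}
    (hz : z ∈ closure (halfPlane Side.plus) \ L.singularSet Side.plus) :
    ∀ᶠ w in 𝓝[halfPlane Side.plus] z, w ∉ L.singularSet Side.plus := by
  obtain ⟨h1, A, h2⟩ := by_contra fun hcon => hz.2 ⟨hz.1, hcon⟩
  have h3 : ∀ᶠ w in 𝓝[halfPlane Side.plus] z, ‖L.weylMatrix w‖ < ‖A‖ + 1 :=
    h2.norm.eventually_lt_const (by linarith)
  filter_upwards [eventually_eventually_nhdsWithin.2 (h1.and h3), self_mem_nhdsWithin]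
    with w hw hw'
  rw [(isOpen_halfPlane _).nhdsWithin_eq hw'] at hw
  refine fun hmem => hmem.2 ?_
  rw [(isOpen_halfPlane _).nhdsWithin_eq hw']
  exact ⟨hw.mono fun _ h => h.1, _,
    (h.differentiableAt_weylMatrix hw' (hw.mono fun _ h => ⟨h.1, h.2.le⟩)).continuousAt⟩

theorem ClassV.eventually_notMem_singularSet (h : L.ClassV) {s : Side} {z : ℂ}
    (hz : z ∈ closure (halfPlane s) \ L.singularSet s) :
    ∀ᶠ w in 𝓝[halfPlane s] z, w ∉ L.singularSet s := by
  cases s with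
  | plus => exact h.eventually_notMem_singularSet_plus hz
  | minus =>
    have h1 : -z ∈ closure (halfPlane Side.plus) \ L.reflect.singularSet Side.plus := by
      refine ⟨?_, fun hm => hz.2 ((reflect_singularSet L Side.plus z).1 hm)⟩
      have := hz.1
      rw [mem_closure_halfPlane] at this ⊢
      simpa [Side.sign] using this
    have h2 : Tendsto Neg.neg (𝓝[halfPlane Side.minus] z) (𝓝[halfPlane Side.plus] (-z)) :=
      tendsto_nhdsWithin_iff.2 ⟨(continuous_neg.tendsto z).mono_left nhdsWithin_le_nhds,
        eventually_mem_nhdsWithin.mono fun w hw => neg_mem_halfPlane.2 hw⟩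
    filter_upwards [h2.eventually (h.reflect.eventually_notMem_singularSet_plus h1)] with w hw hm
    exact hw ((reflect_singularSet L Side.plus w).2 hm)

theorem admissible_singularSet (hL : L.ClassV) (hLt : Lt.ClassV) {γ : Contour}
    (h : ∀ s, ∀ w ∈ L.singularSet s, γ.Encloses w)
    (ht : ∀ s, ∀ w ∈ Lt.singularSet s, γ.Encloses w) :
    γ.Admissible fun s => L.singularSet s ∪ Lt.singularSet s where
  encloses s w hw := hw.elim (h s w) (ht s w)
  eventually s z hz := by
    filter_upwards [hL.eventually_notMem_singularSet ⟨hz.1, fun h0 => hz.2 (.inl h0)⟩,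
      hLt.eventually_notMem_singularSet ⟨hz.1, fun h0 => hz.2 (.inr h0)⟩] with w h1 h2 h3
    exact h3.elim h1 h2

theorem mem_weylSet (hL : L.ClassV) (hLt : Lt.ClassV) {s : Side} :
    halfPlane s \ (L.singularSet s ∪ Lt.singularSet s) ⊆ weylSet L Lt s := fun _ hz =>
  ⟨hz.1, (hL.regular hz.1 fun h => hz.2 (.inl h)).1, (hLt.regular hz.1 fun h => hz.2 (.inr h)).1⟩

/-- `M_± - M̃_±` on the closed half-planes. -/
def sideDiff (L Lt : Pencil m) (s : Side) (ρ : ℂ) : CMat m := L.weylSide s ρ - Lt.weylSide s ρ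

theorem sideDiff_eq {s : Side} (hρ : ρ ∈ halfPlane s) : sideDiff L Lt s ρ = weylDiff L Lt ρ := by
  simp only [sideDiff, weylDiff, weylSide, if_pos hρ]

theorem continuousOn_sideDiff (hL : L.ClassV) (hLt : Lt.ClassV) (s : Side) :
    ContinuousOn (sideDiff L Lt s)
      (closure (halfPlane s) \ (L.singularSet s ∪ Lt.singularSet s)) :=
  ((hL.continuousOn_weylSide s).mono fun _ h => ⟨h.1, fun h0 => h.2 (.inl h0)⟩).sub
    ((hLt.continuousOn_weylSide s).mono fun _ h => ⟨h.1, fun h0 => h.2 (.inr h0)⟩)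

theorem differentiableOn_sideDiff (hL : L.ClassV) (hLt : Lt.ClassV) (s : Side) :
    DifferentiableOn ℂ (sideDiff L Lt s)
      (halfPlane s \ (L.singularSet s ∪ Lt.singularSet s)) := fun z hz => by
  have h1 := (hL.regular hz.1 fun h => hz.2 (.inl h)).2.self_of_nhds.1
  have h2 := (hLt.regular hz.1 fun h => hz.2 (.inr h)).2.self_of_nhds.1
  refine ((h1.sub h2).congr_of_eventuallyEq ?_).differentiableWithinAt
  filter_upwards [(isOpen_halfPlane s).mem_nhds hz.1] with w hw
  exact sideDiff_eq hw

/-- `⟨φ*(θ), φ(ρ)⟩ = φ*'(θ) φ(ρ) - φ*(θ) φ'(ρ)`. -/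
def bracket (L : Pencil m) (x : ℝ) (ρ θ : ℂ) : CMat m :=
  dHalf (L.phiStar θ) x * L.phi ρ x - L.phiStar θ x * dHalf (L.phi ρ) x

theorem ClassV.bracket_self (h : L.ClassV) (hx : 0 ≤ x) (ρ : ℂ) : L.bracket x ρ ρ = 0 :=
  (h.fundamental_inverse ρ hx).1.2

theorem ClassV.differentiable_bracket_left (h : L.ClassV) (hx : 0 ≤ x) (θ : ℂ) :
    Differentiable ℂ fun ρ => L.bracket x ρ θ :=
  ((h.differentiable_phi hx).1.const_mul _).sub ((h.differentiable_phi hx).2.const_mul _)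

theorem ClassV.differentiable_bracket_right (h : L.ClassV) (hx : 0 ≤ x) (ρ : ℂ) :
    Differentiable ℂ fun θ => L.bracket x ρ θ :=
  ((h.differentiable_phiStar hx).2.mul_const _).sub ((h.differentiable_phiStar hx).1.mul_const _)

theorem _root_.Differentiable.dslope {f : ℂ → CMat m} (hf : Differentiable ℂ f) (a : ℂ) :
    Differentiable ℂ (_root_.dslope f a) :=
  differentiableOn_univ.1 ((Complex.differentiableOn_dslope univ_mem).2 hf.differentiableOn)

/-- `D(x, ξ, θ)` as a function of `ξ`, with the removable singularity at `ξ = θ` removed. -/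
def quotLeft (L : Pencil m) (x : ℝ) (θ : ℂ) : ℂ → CMat m := dslope (fun ξ => L.bracket x ξ θ) θ

/-- `D(x, ρ, ξ)` as a function of `ξ`, with the removable singularity at `ξ = ρ` removed. -/
def quotRight (L : Pencil m) (x : ℝ) (ρ : ℂ) (ξ : ℂ) : CMat m :=
  -dslope (fun ξ => L.bracket x ρ ξ) ρ ξ

theorem ClassV.quotLeft_eq (h : L.ClassV) (hx : 0 ≤ x) {ξ : ℂ} (hξ : ξ ≠ θ) :
    L.quotLeft x θ ξ = L.D x ξ θ := by
  rw [quotLeft, dslope_of_ne _ hξ, slope_def_module, h.bracket_self hx, sub_zero]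
  rfl

theorem ClassV.quotRight_eq (h : L.ClassV) (hx : 0 ≤ x) {ξ : ℂ} (hξ : ξ ≠ ρ) :
    L.quotRight x ρ ξ = L.D x ρ ξ := by
  rw [quotRight, dslope_of_ne _ hξ, slope_def_module, h.bracket_self hx, sub_zero, ← neg_smul,
    ← inv_neg, neg_sub]
  rfl

theorem ClassV.differentiable_quotLeft (h : L.ClassV) (hx : 0 ≤ x) (θ : ℂ) :
    Differentiable ℂ (L.quotLeft x θ) := (h.differentiable_bracket_left hx θ).dslope θ

theorem ClassV.differentiable_quotRight (h : L.ClassV) (hx : 0 ≤ x) (ρ : ℂ) :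
    Differentiable ℂ (L.quotRight x ρ) := ((h.differentiable_bracket_right hx ρ).dslope ρ).neg

theorem differentiable_regular (hL : L.ClassV) (hLt : Lt.ClassV) (hx : 0 ≤ x) :
    Differentiable ℂ (regular₁₁ L Lt x) ∧ Differentiable ℂ (regular₁₂ L Lt x) ∧
    Differentiable ℂ (regular₂₁ L Lt x) ∧ Differentiable ℂ (regular₂₂ L Lt x) := by
  obtain ⟨a1, a2⟩ := hL.differentiable_phi hx
  obtain ⟨b1, b2⟩ := hL.differentiable_sine hx
  obtain ⟨c1, c2⟩ := hLt.differentiable_phiStar hx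
  obtain ⟨d1, d2⟩ := hLt.differentiable_sineStar hx
  exact ⟨(a1.mul d2).sub (b1.mul c2), (b1.mul c1).sub (a1.mul d1), (a2.mul d2).sub (b2.mul c2),
    (b2.mul c1).sub (a2.mul d1)⟩

theorem tendsto_inv_cobounded_zero : Tendsto (fun ξ : ℂ => ξ⁻¹) (Bornology.cobounded ℂ) (𝓝 0) :=
  tendsto_inv₀_cobounded

theorem tendsto_div_sub (a : ℂ) :
    Tendsto (fun ξ : ℂ => ξ * (ξ - a)⁻¹) (Bornology.cobounded ℂ) (𝓝 1) := by
  have h1 : Tendsto (fun ξ : ℂ => (1 - a * ξ⁻¹)⁻¹) (Bornology.cobounded ℂ) (𝓝 1) := by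
    have h2 : Tendsto (fun ξ : ℂ => 1 - a * ξ⁻¹) (Bornology.cobounded ℂ) (𝓝 1) := by
      simpa using (tendsto_inv_cobounded_zero.const_mul a).const_sub 1
    simpa using h2.inv₀ one_ne_zero
  refine h1.congr' ?_
  filter_upwards [Bornology.eventually_ne_cobounded (0 : ℂ)] with ξ hξ
  have h2 : 1 - a * ξ⁻¹ = (ξ - a) * ξ⁻¹ := by
    rw [sub_mul, mul_inv_cancel₀ hξ]
  rw [h2, mul_inv, inv_inv, mul_comm]

theorem tendsto_div_sub' (a : ℂ) :
    Tendsto (fun ξ : ℂ => ξ * (a - ξ)⁻¹) (Bornology.cobounded ℂ) (𝓝 (-1)) := by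
  refine (tendsto_div_sub a).neg.congr fun ξ => ?_
  rw [← mul_neg, ← inv_neg, neg_sub]

theorem far_le (hL : L.ClassV) (hLt : Lt.ClassV) (s : Side) : Bornology.cobounded ℂ ⊓
    𝓟 (halfPlane s \ (L.singularSet s ∪ Lt.singularSet s)) ≤ far L Lt s :=
  inf_le_inf_left _ (principal_mono.2 (mem_weylSet hL hLt))

theorem ClassV.phiStar_mul_sine (h : L.ClassV) (ρ : ℂ) (hx : 0 ≤ x) :
    dHalf (L.phiStar ρ) x * L.sine ρ x - L.phiStar ρ x * dHalf (L.sine ρ) x = -1 := by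
  obtain ⟨s1, s2, s3⟩ := h.sine_spec ρ
  obtain ⟨g1, g2, g3⟩ := h.phiStar_spec ρ
  rw [g1.wronskian_eq s1 hx, s2, s3, g2, g3]
  simp

/-- The regular matrix maps the column `φ̃, φ̃'` to the column `φ, φ'`. -/
theorem regular_mul_phi (hLt : Lt.ClassV) (hx : 0 ≤ x) (ρ : ℂ) :
    regular₁₁ L Lt x ρ * Lt.phi ρ x + regular₁₂ L Lt x ρ * dHalf (Lt.phi ρ) x = L.phi ρ x ∧
    regular₂₁ L Lt x ρ * Lt.phi ρ x + regular₂₂ L Lt x ρ * dHalf (Lt.phi ρ) x =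
      dHalf (L.phi ρ) x := by
  obtain ⟨⟨h1, h2⟩, -⟩ := hLt.fundamental_inverse ρ hx
  have key : ∀ a b : CMat m, (a * dHalf (Lt.sineStar ρ) x - b * dHalf (Lt.phiStar ρ) x) *
      Lt.phi ρ x + (b * Lt.phiStar ρ x - a * Lt.sineStar ρ x) * dHalf (Lt.phi ρ) x = a := by
    intro a b
    calc _ = a * (dHalf (Lt.sineStar ρ) x * Lt.phi ρ x - Lt.sineStar ρ x * dHalf (Lt.phi ρ) x) -
        b * (dHalf (Lt.phiStar ρ) x * Lt.phi ρ x - Lt.phiStar ρ x * dHalf (Lt.phi ρ) x) := by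
          noncomm_ring
      _ = a := by rw [h1, h2]; simp
  exact ⟨key _ _, key _ _⟩

/-- The regular matrix maps the row `φ*', -φ*` to the row `φ̃*', -φ̃*`. -/
theorem row_mul_regular (hL : L.ClassV) (hx : 0 ≤ x) (θ : ℂ) (c d : CMat m) :
    dHalf (L.phiStar θ) x * (regular₁₁ L Lt x θ * c + regular₁₂ L Lt x θ * d) -
      L.phiStar θ x * (regular₂₁ L Lt x θ * c + regular₂₂ L Lt x θ * d) =
    dHalf (Lt.phiStar θ) x * c - Lt.phiStar θ x * d := by
  have h1 := (hL.fundamental_inverse θ hx).1.2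
  have h2 := hL.phiStar_mul_sine θ hx
  have key : ∀ a b f f' g g' u u' v v' : CMat m, b * f - a * f' = 0 → b * g - a * g' = -1 →
      b * ((f * u' - g * v') * c + (g * v - f * u) * d) -
        a * ((f' * u' - g' * v') * c + (g' * v - f' * u) * d) = v' * c - v * d := by
    intro a b f f' g g' u u' v v' e1 e2
    calc _ = (b * f - a * f') * (u' * c - u * d) - (b * g - a * g') * (v' * c - v * d) := by
          noncomm_ring
      _ = _ := by rw [e1, e2]; noncomm_ring
  exact key _ _ _ _ _ _ _ _ _ _ h1 h2

variable {γ : Contour}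

/-- The integral that makes `φ` a solution of the main equation: multiplying the spectral matrix by
the column `φ̃(ρ), φ̃'(ρ)` gives `(ρ - θ)` times the integrand, up to an entire function. -/
theorem hasIntegral_phi (hL : L.ClassV) (hLt : Lt.ClassV) (hN : L.NonRegge) (hNt : Lt.NonRegge)
    (hh : L.h₁ = Lt.h₁) (hΛ : γ.Admissible fun s => L.singularSet s ∪ Lt.singularSet s)
    (hx : 0 ≤ x) (K : CMat m) (ρ : ℂ) :
    γ.HasIntegral (fun s ξ => K * L.phi ξ x * sideDiff L Lt s ξ * Lt.quotRight x ρ ξ)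
      ((2 * Real.pi * Complex.I : ℂ) • (K * (Omega L Lt x * Lt.phi ρ x - L.phi ρ x))) := by
  obtain ⟨r1, r2, r3, r4⟩ := differentiable_regular hL hLt hx
  have hA : Differentiable ℂ fun ξ => K * L.phi ξ x := (hL.differentiable_phi hx).1.const_mul K
  have hB := hLt.differentiable_quotRight hx ρ
  set c := Lt.phi ρ x
  set d := dHalf (Lt.phi ρ) x
  set e : ℂ → CMat m := fun ξ => K * (regular₁₁ L Lt x ξ * c + regular₁₂ L Lt x ξ * d) with he
  have hed : Differentiable ℂ e := ((r1.mul_const _).add (r2.mul_const _)).const_mul K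
  have heρ : e ρ = K * L.phi ρ x := by
    simp only [he, c, d, (regular_mul_phi hLt hx ρ).1]
  refine γ.hasIntegral_of_tendsto hΛ
    (F := fun s ξ => K * L.phi ξ x * sideDiff L Lt s ξ * Lt.quotRight x ρ ξ)
    (fun s => (hA.continuous.continuousOn.mul (continuousOn_sideDiff hL hLt s)).mul
      hB.continuous.continuousOn)
    (fun s => (hA.differentiableOn.mul (differentiableOn_sideDiff hL hLt s)).mul
      hB.differentiableOn) (E := fun ξ => -dslope e ρ ξ) (hed.dslope ρ).neg fun s => ?_
  obtain ⟨t1, t2, -, -⟩ := tendsto_spectral hL hLt hN hNt hh hx s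
  replace t1 := t1.mono_left (far_le hL hLt s)
  replace t2 := t2.mono_left (far_le hL hLt s)
  set l := Bornology.cobounded ℂ ⊓ 𝓟 (halfPlane s \ (L.singularSet s ∪ Lt.singularSet s))
  have hlc : l ≤ Bornology.cobounded ℂ := inf_le_left
  have hinv : Tendsto (fun ξ : ℂ => ξ⁻¹) l (𝓝 0) := tendsto_inv_cobounded_zero.mono_left hlc
  have t3 : Tendsto (fun ξ => spectral₁₂ L Lt x ξ) l (𝓝 0) := by
    have h1 := (hinv.const_mul (Complex.I)⁻¹).smul t2
    rw [mul_zero, zero_smul] at h1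
    refine h1.congr' ?_
    filter_upwards [hlc (Bornology.eventually_ne_cobounded (0 : ℂ))] with ξ hξ
    rw [smul_smul, ← mul_inv, inv_mul_cancel₀ (mul_ne_zero Complex.I_ne_zero hξ), one_smul]
  have hlim := ((tendsto_div_sub' ρ).mono_left hlc).smul
    ((((t1.mul_const c).add (t3.mul_const d)).const_mul K).const_sub (e ρ))
  rw [zero_mul, add_zero, neg_one_smul, neg_sub, heρ, ← mul_sub] at hlim
  -- Off the pole the integrand minus its entire part is `(ρ - ξ)⁻¹` times the difference of `e ρ`
  -- and the spectral counterpart of `e ξ`.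
  refine hlim.congr' ?_
  filter_upwards [hlc (Bornology.eventually_ne_cobounded ρ),
    mem_inf_of_right (mem_principal_self _)] with ξ hξ hmem
  rw [← heρ, hLt.quotRight_eq hx hξ, D, dslope_of_ne _ hξ, slope_def_module, sideDiff_eq hmem.1,
    mul_smul_comm, ← neg_smul, ← inv_neg, neg_sub, ← smul_sub, smul_smul]
  congr 1
  simp only [he, spectral₁₁, spectral₁₂]
  noncomm_ring

/-- The integral of a product of two kernels. The row `φ*'(θ), -φ*(θ)` and the column
`φ̃(ρ), φ̃'(ρ)` around the spectral matrix give a function of the integration variable `ξ` whose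
entire part takes the values `⟨φ̃*(θ), φ̃(ρ)⟩` at `ξ = θ` and `⟨φ*(θ), φ(ρ)⟩` at `ξ = ρ`. These
produce the two kernels on the right, and the growth of the lower left entry of the spectral matrix
produces the term with `Ξ`. -/
theorem hasIntegral_kernel (hL : L.ClassV) (hLt : Lt.ClassV) (hN : L.NonRegge) (hNt : Lt.NonRegge)
    (hh : L.h₁ = Lt.h₁) (hΛ : γ.Admissible fun s => L.singularSet s ∪ Lt.singularSet s)
    (hx : 0 ≤ x) (hρθ : ρ ≠ θ) :
    γ.HasIntegral (fun s ξ => L.quotLeft x θ ξ * sideDiff L Lt s ξ * Lt.quotRight x ρ ξ)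
      ((2 * Real.pi * Complex.I : ℂ) • (Lt.D x ρ θ - L.D x ρ θ -
        Complex.I • (L.phiStar θ x * Xi L Lt x * Lt.phi ρ x))) := by
  obtain ⟨r1, r2, r3, r4⟩ := differentiable_regular hL hLt hx
  have hA := hL.differentiable_quotLeft hx θ
  have hB := hLt.differentiable_quotRight hx ρ
  set a := L.phiStar θ x
  set b := dHalf (L.phiStar θ) x
  set c := Lt.phi ρ x
  set d := dHalf (Lt.phi ρ) x
  set e : ℂ → CMat m := fun ξ => b * (regular₁₁ L Lt x ξ * c + regular₁₂ L Lt x ξ * d) -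
    a * (regular₂₁ L Lt x ξ * c + regular₂₂ L Lt x ξ * d) with he
  have hed : Differentiable ℂ e :=
    (((r1.mul_const _).add (r2.mul_const _)).const_mul b).sub
      (((r3.mul_const _).add (r4.mul_const _)).const_mul a)
  have heθ : e θ = Lt.bracket x ρ θ := row_mul_regular hL hx θ c d
  have heρ : e ρ = L.bracket x ρ θ := by
    simp only [he, c, d, (regular_mul_phi hLt hx ρ).1, (regular_mul_phi hLt hx ρ).2]
    rfl
  refine γ.hasIntegral_of_tendsto hΛ
    (F := fun s ξ => L.quotLeft x θ ξ * sideDiff L Lt s ξ * Lt.quotRight x ρ ξ)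
    (fun s => (hA.continuous.continuousOn.mul (continuousOn_sideDiff hL hLt s)).mul
      hB.continuous.continuousOn)
    (fun s => (hA.differentiableOn.mul (differentiableOn_sideDiff hL hLt s)).mul
      hB.differentiableOn) (E := fun ξ => (ρ - θ)⁻¹ • (dslope e θ ξ - dslope e ρ ξ))
    (((hed.dslope θ).fun_sub (hed.dslope ρ)).fun_const_smul _) fun s => ?_
  obtain ⟨t1, t2, t3, t4⟩ := tendsto_spectral hL hLt hN hNt hh hx s
  replace t1 := t1.mono_left (far_le hL hLt s)
  replace t2 := t2.mono_left (far_le hL hLt s)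
  replace t3 := t3.mono_left (far_le hL hLt s)
  replace t4 := t4.mono_left (far_le hL hLt s)
  set l := Bornology.cobounded ℂ ⊓ 𝓟 (halfPlane s \ (L.singularSet s ∪ Lt.singularSet s))
  have hlc : l ≤ Bornology.cobounded ℂ := inf_le_left
  have hinv : Tendsto (fun ξ : ℂ => ξ⁻¹) l (𝓝 0) := tendsto_inv_cobounded_zero.mono_left hlc
  set p : ℂ → CMat m := fun ξ => b * (spectral₁₁ L Lt x ξ * c + spectral₁₂ L Lt x ξ * d) -
    a * (spectral₂₁ L Lt x ξ * c + spectral₂₂ L Lt x ξ * d) with hp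
  have hne : ∀ᶠ ξ in l, ξ ≠ 0 := hlc (Bornology.eventually_ne_cobounded (0 : ℂ))
  have u1 : Tendsto (fun ξ => ξ⁻¹ • spectral₁₁ L Lt x ξ) l (𝓝 0) := by simpa using hinv.smul t1
  have u4 : Tendsto (fun ξ => ξ⁻¹ • spectral₂₂ L Lt x ξ) l (𝓝 0) := by simpa using hinv.smul t4
  have u2 : Tendsto (fun ξ => ξ⁻¹ • spectral₁₂ L Lt x ξ) l (𝓝 0) := by
    have h1 := (hinv.mul (hinv.const_mul (Complex.I)⁻¹)).smul t2
    rw [mul_zero, mul_zero, zero_smul] at h1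
    refine h1.congr' ?_
    filter_upwards [hne] with ξ hξ
    rw [smul_smul, mul_assoc, ← mul_inv, inv_mul_cancel₀ (mul_ne_zero Complex.I_ne_zero hξ),
      mul_one]
  have u3 : Tendsto (fun ξ => ξ⁻¹ • spectral₂₁ L Lt x ξ) l (𝓝 (Complex.I • Xi L Lt x)) := by
    refine (t3.const_smul Complex.I).congr fun ξ => ?_
    rw [smul_smul, mul_inv, mul_inv_cancel_left₀ Complex.I_ne_zero]
  have hpl : Tendsto (fun ξ => ξ⁻¹ • p ξ) l (𝓝 (-(Complex.I • (a * Xi L Lt x * c)))) := by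
    have h1 := (((u1.mul_const c).add (u2.mul_const d)).const_mul b).sub
      (((u3.mul_const c).add (u4.mul_const d)).const_mul a)
    simp only [zero_mul, mul_zero, add_zero, zero_sub, smul_mul_assoc, mul_smul_comm,
      ← mul_assoc] at h1
    refine h1.congr fun ξ => ?_
    simp only [hp, smul_sub, smul_add, mul_add, mul_smul_comm]
  have v1 := (tendsto_div_sub θ).mono_left hlc
  have v2 := (tendsto_div_sub' ρ).mono_left hlc
  have hlim := ((v1.mul v2).smul hpl).neg.add
    (((v1.smul_const (e θ)).add (v2.smul_const (e ρ))).const_smul (ρ - θ)⁻¹)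
  have hJ : -((1 * -1 : ℂ) • -(Complex.I • (a * Xi L Lt x * c))) +
      (ρ - θ)⁻¹ • ((1 : ℂ) • e θ + (-1 : ℂ) • e ρ) =
      Lt.D x ρ θ - L.D x ρ θ - Complex.I • (a * Xi L Lt x * c) := by
    rw [heθ, heρ]
    simp only [D, bracket]
    module
  rw [hJ] at hlim
  refine hlim.congr' ?_
  filter_upwards [hlc (Bornology.eventually_ne_cobounded ρ), hne,
    hlc (Bornology.eventually_ne_cobounded θ),
    mem_inf_of_right (mem_principal_self _)] with ξ hξρ hξ0 hξθ hmem
  have hprod : L.bracket x ξ θ * weylDiff L Lt ξ * Lt.bracket x ρ ξ = e ξ - p ξ := by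
    simp only [he, hp, spectral₁₁, spectral₁₂, spectral₂₁, spectral₂₂, bracket]
    noncomm_ring
  rw [hLt.quotRight_eq hx hξρ, hL.quotLeft_eq hx hξθ, sideDiff_eq hmem.1, dslope_of_ne _ hξρ,
    dslope_of_ne _ hξθ, slope_def_module, slope_def_module]
  have hD1 : L.D x ξ θ = (ξ - θ)⁻¹ • L.bracket x ξ θ := rfl
  have hD2 : Lt.D x ρ ξ = (ρ - ξ)⁻¹ • Lt.bracket x ρ ξ := rfl
  rw [hD1, hD2, smul_mul_assoc, smul_mul_assoc, mul_smul_comm, hprod]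
  have k1 : ρ - ξ ≠ 0 := sub_ne_zero.2 hξρ.symm
  have k2 : ξ - θ ≠ 0 := sub_ne_zero.2 hξθ
  have k3 : ρ - θ ≠ 0 := sub_ne_zero.2 hρθ
  have k4 : ξ - ρ ≠ 0 := sub_ne_zero.2 hξρ
  have k5 : (ξ - ρ)⁻¹ = -(ρ - ξ)⁻¹ := by rw [← inv_neg, neg_sub]
  rw [k5]
  match_scalars <;> field_simp <;> ring

end Pencil

/-! ### Integrals over the contour as integrals over the line -/

theorem intervalIntegral_congr_Ioo {E : Type*} [NormedAddCommGroup E] [NormedSpace ℝ E]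
    {f g : ℝ → E} {a b : ℝ} (hab : a ≤ b) (h : ∀ t ∈ Ioo a b, f t = g t) :
    ∫ t in a..b, f t = ∫ t in a..b, g t := by
  rw [intervalIntegral.integral_of_le hab, intervalIntegral.integral_of_le hab,
    integral_Ioc_eq_integral_Ioo, integral_Ioc_eq_integral_Ioo]
  exact setIntegral_congr_fun measurableSet_Ioo h

namespace Contour

variable (γ : Contour)

open Classical in
/-- A parametrization of `γ` by the real line: the left cut for `t < 0`, the curve `γ₀` for
`0 ≤ t ≤ 1`, the right cut for `1 < t`. -/
def param (t : ℝ) : ℂ :=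
  if t < 0 then γ.left + t else if t ≤ 1 then γ.curve (max 0 (min t 1)) else γ.right + (t - 1)

open Classical in
/-- The velocity of `γ` on the side `s` in the parametrization `param`; it vanishes on the arc that
belongs to the other side. -/
def weight : Side → ℝ → ℂ
  | Side.plus, t => if t < 0 ∨ 1 < t then -1 else if t < γ.mid then deriv γ.curve t else 0
  | Side.minus, t => if t < 0 ∨ 1 < t then 1 else if t < γ.mid then 0 else deriv γ.curve t

/-- The density on the line that represents an integral over `γ`. -/
def density (F : Side → ℂ → CMat m) (t : ℝ) : CMat m :=
  γ.weight Side.plus t • F Side.plus (γ.param t) + γ.weight Side.minus t • F Side.minus (γ.param t)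

theorem param_of_neg {t : ℝ} (ht : t < 0) : γ.param t = ((γ.left + t : ℝ) : ℂ) := by
  simp [param, ht]

theorem param_of_mem {t : ℝ} (ht : t ∈ Icc (0 : ℝ) 1) : γ.param t = γ.curve t := by
  simp [param, ht.1.not_gt, ht.2, ht.1]

theorem param_of_gt {t : ℝ} (ht : 1 < t) : γ.param t = ((γ.right + (t - 1) : ℝ) : ℂ) := by
  simp [param, ht.not_ge, (zero_lt_one.trans ht).not_gt]

theorem measurable_param : Measurable γ.param := by
  refine Measurable.ite measurableSet_Iio (by fun_prop)
    (Measurable.ite measurableSet_Iic (Continuous.measurable ?_) (by fun_prop))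
  refine γ.continuousOn_curve.comp_continuous (by fun_prop) fun t => ⟨le_max_left _ _, ?_⟩
  exact max_le zero_le_one (min_le_right _ _)

theorem param_mem_side {s : Side} {t : ℝ} (h : γ.weight s t ≠ 0) : γ.param t ∈ γ.side s := by
  rcases lt_or_ge t 0 with h0 | h0
  · rw [γ.param_of_neg h0]
    exact γ.ray_mem_side (.inl (by linarith)) s
  rcases lt_or_ge 1 t with h1 | h1
  · rw [γ.param_of_gt h1]
    exact γ.ray_mem_side (.inr (by linarith)) s
  · rw [γ.param_of_mem ⟨h0, h1⟩]
    cases s with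
    | plus =>
      refine γ.curve_mem_side_plus ⟨h0, ?_⟩
      by_contra hlt
      exact h (by simp [weight, h0.not_gt, h1.not_gt, (not_le.1 hlt).le.not_gt])
    | minus =>
      refine γ.curve_mem_side_minus ⟨?_, h1⟩
      by_contra hlt
      exact h (by simp [weight, h0.not_gt, h1.not_gt, not_le.1 hlt])

theorem exists_param_mem_side (t : ℝ) : ∃ s, γ.param t ∈ γ.side s := by
  rcases lt_or_ge t 0 with h0 | h0
  · rw [γ.param_of_neg h0]
    exact ⟨_, γ.ray_mem_side (.inl (by linarith)) Side.plus⟩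
  rcases lt_or_ge 1 t with h1 | h1
  · rw [γ.param_of_gt h1]
    exact ⟨_, γ.ray_mem_side (.inr (by linarith)) Side.plus⟩
  · rw [γ.param_of_mem ⟨h0, h1⟩]
    rcases le_total t γ.mid with h2 | h2
    · exact ⟨_, γ.curve_mem_side_plus ⟨h0, h2⟩⟩
    · exact ⟨_, γ.curve_mem_side_minus ⟨h2, h1⟩⟩

theorem density_congr {F G : Side → ℂ → CMat m} {t : ℝ}
    (h : ∀ s, γ.param t ∈ γ.side s → F s (γ.param t) = G s (γ.param t)) :
    γ.density F t = γ.density G t := by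
  have key : ∀ s, γ.weight s t • F s (γ.param t) = γ.weight s t • G s (γ.param t) := fun s => by
    by_cases hw : γ.weight s t = 0
    · rw [hw, zero_smul, zero_smul]
    · rw [h s (γ.param_mem_side hw)]
  rw [density, density, key, key]

theorem density_of_neg (F : Side → ℂ → CMat m) {t : ℝ} (ht : t < 0) :
    γ.density F t = F Side.minus ((γ.left + t : ℝ) : ℂ) - F Side.plus ((γ.left + t : ℝ) : ℂ) := by
  simp only [density, weight, γ.param_of_neg ht, ht, true_or, if_true]
  module

theorem density_of_gt (F : Side → ℂ → CMat m) {t : ℝ} (ht : 1 < t) :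
    γ.density F t = F Side.minus ((γ.right + (t - 1) : ℝ) : ℂ) -
      F Side.plus ((γ.right + (t - 1) : ℝ) : ℂ) := by
  simp only [density, weight, γ.param_of_gt ht, ht, or_true, if_true]
  module

theorem density_of_upper (F : Side → ℂ → CMat m) {t : ℝ} (ht : t ∈ Ioo 0 γ.mid) :
    γ.density F t = deriv γ.curve t • F Side.plus (γ.curve t) := by
  have h1 : t ≤ 1 := ht.2.le.trans γ.mid_mem.2.le
  simp [density, weight, γ.param_of_mem ⟨ht.1.le, h1⟩, ht.1.le.not_gt, h1.not_gt, ht.2]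

theorem density_of_lower (F : Side → ℂ → CMat m) {t : ℝ} (ht : t ∈ Ioo γ.mid 1) :
    γ.density F t = deriv γ.curve t • F Side.minus (γ.curve t) := by
  have h1 : 0 ≤ t := γ.mid_mem.1.le.trans ht.1.le
  simp [density, weight, γ.param_of_mem ⟨h1, ht.2.le⟩, ht.2.le.not_gt, h1.not_gt, ht.1.le.not_gt]

/-- If the density is integrable, the truncated contour integrals are its integrals over the
corresponding bounded intervals of the line. -/
theorem truncIntegral_eq_density {F : Side → ℂ → CMat m} (hF : Integrable (γ.density F)) {R : ℝ}
    (hr : γ.right ≤ R) (hl : -R ≤ γ.left) :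
    γ.truncIntegral F R = ∫ t in (-R - γ.left)..(R - γ.right + 1), γ.density F t := by
  have hi : ∀ a b, IntervalIntegrable (γ.density F) volume a b := fun a b =>
    hF.intervalIntegrable
  have h1 : ∫ t in (-R - γ.left)..0, γ.density F t =
      ∫ t in (-R)..γ.left, (F Side.minus (t : ℂ) - F Side.plus (t : ℂ)) := by
    rw [intervalIntegral_congr_Ioo (by linarith) fun t ht => γ.density_of_neg F ht.2,
      intervalIntegral.integral_comp_add_left
        (fun t : ℝ => F Side.minus (t : ℂ) - F Side.plus (t : ℂ)) γ.left]
    congr 1 <;> ring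
  have h2 : ∫ t in (1 : ℝ)..(R - γ.right + 1), γ.density F t =
      ∫ t in γ.right..R, (F Side.minus (t : ℂ) - F Side.plus (t : ℂ)) := by
    rw [intervalIntegral_congr_Ioo (by linarith) fun t ht => γ.density_of_gt F ht.1]
    have := intervalIntegral.integral_comp_add_left (a := 1) (b := R - γ.right + 1)
      (fun t : ℝ => F Side.minus (t : ℂ) - F Side.plus (t : ℂ)) (γ.right - 1)
    rw [show γ.right - 1 + 1 = γ.right by ring, show γ.right - 1 + (R - γ.right + 1) = R by ring]
      at this
    rw [← this]
    congr 1
    funext t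
    rw [show γ.right + (t - 1) = γ.right - 1 + t by ring]
  have h3 : ∫ t in (0 : ℝ)..γ.mid, γ.density F t =
      ∫ t in (0 : ℝ)..γ.mid, deriv γ.curve t • F Side.plus (γ.curve t) :=
    intervalIntegral_congr_Ioo γ.mid_mem.1.le fun t ht => γ.density_of_upper F ht
  have h4 : ∫ t in γ.mid..1, γ.density F t =
      ∫ t in γ.mid..1, deriv γ.curve t • F Side.minus (γ.curve t) :=
    intervalIntegral_congr_Ioo γ.mid_mem.2.le fun t ht => γ.density_of_lower F ht
  have q1 := intervalIntegral.integral_add_adjacent_intervals (hi (-R - γ.left) 0)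
    (hi 0 (R - γ.right + 1))
  have q2 := intervalIntegral.integral_add_adjacent_intervals (hi 0 γ.mid)
    (hi γ.mid (R - γ.right + 1))
  have q3 := intervalIntegral.integral_add_adjacent_intervals (hi γ.mid 1)
    (hi 1 (R - γ.right + 1))
  rw [truncIntegral, ← h1, ← h2, ← h3, ← h4, ← q1, ← q2, ← q3]
  abel

theorem HasIntegral.eq_integral {γ : Contour} {F : Side → ℂ → CMat m} {J : CMat m}
    (h : γ.HasIntegral F J) (hF : Integrable (γ.density F)) : J = ∫ t, γ.density F t := by
  refine tendsto_nhds_unique h ((intervalIntegral_tendsto_integral hF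
    (tendsto_atBot_add_const_right _ (-γ.left) tendsto_neg_atTop_atBot)
    (tendsto_atTop_add_const_right _ (1 - γ.right) tendsto_id)).congr' ?_)
  filter_upwards [eventually_ge_atTop γ.right, eventually_ge_atTop (-γ.left)] with R h1 h2
  rw [γ.truncIntegral_eq_density hF h1 (by linarith)]
  congr 1
  simp only [id]
  ring

theorem ae_curve_notMem {S : Set ℂ} (hS : S.Countable) :
    ∀ᵐ t : ℝ, t ∈ Ico (0 : ℝ) 1 → γ.curve t ∉ S := by
  have h1 : ({t | t ∈ Ico (0 : ℝ) 1 ∧ γ.curve t ∈ S} : Set ℝ).Countable :=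
    MapsTo.countable_of_injOn (f := γ.curve) (t := S) (fun t ht => ht.2)
      (γ.simple.mono fun t ht => ht.1) hS
  filter_upwards [h1.ae_notMem volume] with t ht h2 h3 using ht ⟨h2, h3⟩

theorem ae_ofReal_notMem {S : Set ℂ} (hS : S.Countable) : ∀ᵐ t : ℝ, (t : ℂ) ∉ S :=
  (hS.preimage_of_injOn Complex.ofReal_injective.injOn).ae_notMem volume

/-- The values of the integrand at countably many points and off the contour play no role. -/
theorem truncIntegral_congr {F G : Side → ℂ → CMat m} {S : Set ℂ} (hS : S.Countable)
    (h : ∀ s, ∀ θ ∈ γ.side s, θ ∉ S → F s θ = G s θ) {R : ℝ} (hr : γ.right ≤ R)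
    (hl : -R ≤ γ.left) : γ.truncIntegral F R = γ.truncIntegral G R := by
  have hmid := γ.mid_mem
  rw [truncIntegral, truncIntegral]
  congr 1
  · congr 1
    · congr 1
      · refine intervalIntegral.integral_congr_ae ?_
        filter_upwards [γ.ae_curve_notMem hS] with t ht ht'
        rw [uIoc_of_le hmid.1.le] at ht'
        rw [h _ _ (γ.curve_mem_side_plus ⟨ht'.1.le, ht'.2⟩)
          (ht ⟨ht'.1.le, ht'.2.trans_lt hmid.2⟩)]
      · refine intervalIntegral.integral_congr_ae ?_
        have hb : ∀ᵐ t : ℝ, t ≠ 1 := by simp [ae_iff, measure_singleton]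
        filter_upwards [γ.ae_curve_notMem hS, hb] with t ht h1 ht'
        rw [uIoc_of_le hmid.2.le] at ht'
        rw [h _ _ (γ.curve_mem_side_minus ⟨ht'.1.le, ht'.2⟩)
          (ht ⟨hmid.1.le.trans ht'.1.le, ht'.2.lt_of_ne h1⟩)]
    · refine intervalIntegral.integral_congr_ae ?_
      filter_upwards [ae_ofReal_notMem hS] with t ht ht'
      rw [uIoc_of_le hr] at ht'
      have h1 := fun s => h s _ (γ.ray_mem_side (.inr ht'.1.le) s) ht
      rw [h1, h1]
  · refine intervalIntegral.integral_congr_ae ?_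
    filter_upwards [ae_ofReal_notMem hS] with t ht ht'
    rw [uIoc_of_le hl] at ht'
    have h1 := fun s => h s _ (γ.ray_mem_side (.inl ht'.2) s) ht
    rw [h1, h1]

theorem HasIntegral.congr {γ : Contour} {F G : Side → ℂ → CMat m} {J : CMat m} {S : Set ℂ}
    (hF : γ.HasIntegral F J) (hS : S.Countable)
    (h : ∀ s, ∀ θ ∈ γ.side s, θ ∉ S → F s θ = G s θ) : γ.HasIntegral G J := by
  refine Tendsto.congr' ?_ hF
  filter_upwards [eventually_ge_atTop γ.right, eventually_ge_atTop (-γ.left)] with R h1 h2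
  exact γ.truncIntegral_congr hS h h1 (by linarith)

theorem ae_param_notMem {S : Set ℂ} (hS : S.Countable) : ∀ᵐ t : ℝ, γ.param t ∉ S := by
  have hc : ∀ a : ℝ, ∀ᵐ t : ℝ, ((a + t : ℝ) : ℂ) ∉ S := fun a =>
    (hS.preimage_of_injOn (f := fun t : ℝ => ((a + t : ℝ) : ℂ)) (fun t _ u _ h => by
      have := Complex.ofReal_injective h
      linarith)).ae_notMem volume
  have hb : ∀ᵐ t : ℝ, t ≠ 1 := by simp [ae_iff, measure_singleton]
  filter_upwards [γ.ae_curve_notMem hS, hc γ.left, hc (γ.right - 1), hb] with t h1 h2 h3 h4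
  rcases lt_or_ge t 0 with h0 | h0
  · rwa [γ.param_of_neg h0]
  rcases lt_or_ge 1 t with h5 | h5
  · rw [γ.param_of_gt h5]
    rwa [show γ.right + (t - 1) = γ.right - 1 + t by ring]
  · rw [γ.param_of_mem ⟨h0, h5⟩]
    exact h1 ⟨h0, h5.lt_of_ne h4⟩

/-- On the bounded part of the contour continuity suffices; on the far parts of the cuts
integrability has to be assumed. -/
theorem integrable_density {F : Side → ℂ → CMat m} (hF : ∀ s, ContinuousOn (F s) (γ.side s))
    {R : ℝ} (hray : ∀ s, IntegrableOn (fun t : ℝ => F s t) {t | R < |t|}) :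
    Integrable (γ.density F) := by
  have hmid := γ.mid_mem
  have hright : ∀ s, IntegrableOn (fun t : ℝ => F s t) (Ici γ.right) := fun s => by
    have h1 : IntegrableOn (fun t : ℝ => F s t) (Icc γ.right |R|) :=
      ((hF s).comp Complex.continuous_ofReal.continuousOn fun t ht =>
        γ.ray_mem_side (.inr ht.1) s).integrableOn_compact isCompact_Icc
    refine (h1.union (hray s)).mono_set fun t ht => ?_
    rcases le_or_gt t |R| with h | h
    · exact .inl ⟨ht, h⟩
    · exact .inr ((le_abs_self R).trans_lt (h.trans_le (le_abs_self t)))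
  have hleft : ∀ s, IntegrableOn (fun t : ℝ => F s t) (Iic γ.left) := fun s => by
    have h1 : IntegrableOn (fun t : ℝ => F s t) (Icc (-|R|) γ.left) :=
      ((hF s).comp Complex.continuous_ofReal.continuousOn fun t ht =>
        γ.ray_mem_side (.inl ht.2) s).integrableOn_compact isCompact_Icc
    refine (h1.union (hray s)).mono_set fun t ht => ?_
    rcases le_or_gt (-|R|) t with h | h
    · exact .inl ⟨h, ht⟩
    · exact .inr ((le_abs_self R).trans_lt ((by linarith : |R| < -t).trans_le (neg_le_abs t)))
  have hcomp : ∀ {f : ℝ → CMat m} {A : Set ℝ} (a : ℝ), MeasurableSet A → IntegrableOn f A →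
      IntegrableOn (fun t => f (a + t)) {t | a + t ∈ A} := fun {f A} a hA hf => by
    have h1 := (integrable_indicator_iff hA).2 hf
    have h2 := h1.comp_add_left a
    refine (integrable_indicator_iff ((measurable_const_add a) hA)).1 (h2.congr ?_)
    exact .of_forall fun t => by by_cases h : a + t ∈ A <;> simp [indicator, h]
  have p1 : IntegrableOn (γ.density F) (Iio 0) := by
    have h1 := (hcomp γ.left measurableSet_Iic (hleft Side.minus)).sub
      (hcomp γ.left measurableSet_Iic (hleft Side.plus))
    refine (h1.mono_set (s := Iio 0) fun t ht => ?_).congr_fun (fun t ht => ?_) measurableSet_Iio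
    · have : t < 0 := ht
      show γ.left + t ≤ γ.left
      linarith
    · exact (γ.density_of_neg F ht).symm
  have p2 : IntegrableOn (γ.density F) (Ioi 1) := by
    have h1 := (hcomp (γ.right - 1) measurableSet_Ici (hright Side.minus)).sub
      (hcomp (γ.right - 1) measurableSet_Ici (hright Side.plus))
    refine (h1.mono_set (s := Ioi 1) fun t ht => ?_).congr_fun (fun t ht => ?_) measurableSet_Ioi
    · have : 1 < t := ht
      show γ.right ≤ γ.right - 1 + t
      linarith
    · rw [γ.density_of_gt F ht, show γ.right + (t - 1) = γ.right - 1 + t by ring]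
      rfl
  have p3 : IntegrableOn (γ.density F) (Ioo 0 γ.mid) := by
    have h1 : IntervalIntegrable (fun t => deriv γ.curve t • F Side.plus (γ.curve t)) volume
        0 γ.mid := by
      refine γ.isUpperArc_plus.integrable.smul_continuousOn ?_
      rw [uIcc_of_le hmid.1.le]
      exact (hF _).comp γ.isUpperArc_plus.cont fun t ht => γ.curve_mem_side_plus ht
    rw [intervalIntegrable_iff_integrableOn_Ioo_of_le hmid.1.le] at h1
    exact h1.congr_fun (fun t ht => (γ.density_of_upper F ht).symm) measurableSet_Ioo
  have p4 : IntegrableOn (γ.density F) (Ioo γ.mid 1) := by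
    have h1 : IntervalIntegrable (fun t => deriv γ.curve t • F Side.minus (γ.curve t)) volume
        γ.mid 1 := by
      refine IntervalIntegrable.smul_continuousOn (γ.intervalIntegrable_deriv_curve.mono_set ?_) ?_
      · rw [uIcc_of_le hmid.2.le, uIcc_of_le zero_le_one]
        exact Icc_subset_Icc_left hmid.1.le
      · rw [uIcc_of_le hmid.2.le]
        exact (hF _).comp (γ.continuousOn_curve.mono (Icc_subset_Icc_left hmid.1.le))
          fun t ht => γ.curve_mem_side_minus ht
    rw [intervalIntegrable_iff_integrableOn_Ioo_of_le hmid.2.le] at h1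
    exact h1.congr_fun (fun t ht => (γ.density_of_lower F ht).symm) measurableSet_Ioo
  have hfin : IntegrableOn (γ.density F) ({0, γ.mid, 1} : Set ℝ) :=
    IntegrableOn.of_measure_zero ((toFinite _).measure_zero _)
  rw [← integrableOn_univ]
  refine ((((p1.union p3).union p4).union p2).union hfin).mono_set fun t _ => ?_
  simp only [mem_union, mem_Iio, mem_Ioo, mem_Ioi, mem_insert_iff, mem_singleton_iff]
  grind

end Contour

/-! ### Integrability of the difference of the Weyl matrices -/

namespace Pencil

variable {L Lt : Pencil m} {γ : Contour}

/-- The first moment of `M - M̃` on the cuts is finite, by `2 |t| n ≤ n² t⁴ + t⁻²` for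
`n = ‖M - M̃‖`. -/
theorem integrableOn_sideDiff (hM : IsModelPencil L Lt)
    (hc : ∀ s, ContinuousOn (sideDiff L Lt s) (γ.side s)) : ∃ R, ∀ s,
      IntegrableOn (fun t : ℝ => (1 + |t|) * ‖sideDiff L Lt s t‖) {t | R < |t|} := by
  obtain ⟨R, hR, hfin⟩ := hM
  set R' := max (max R 1) (max γ.right (-γ.left))
  have e1 : R ≤ R' := (le_max_left R 1).trans (le_max_left _ _)
  have e2 : 1 ≤ R' := (le_max_right R 1).trans (le_max_left _ _)
  have e3 : γ.right ≤ R' := (le_max_left _ _).trans (le_max_right _ _)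
  have e4 : -γ.left ≤ R' := (le_max_right _ _).trans (le_max_right _ _)
  refine ⟨R', fun s => ?_⟩
  have hmeas : MeasurableSet {t : ℝ | R' < |t|} := measurableSet_lt measurable_const (by fun_prop)
  have hcont : ContinuousOn (fun t : ℝ => ‖sideDiff L Lt s t‖) {t : ℝ | R' < |t|} :=
    ((hc s).comp Complex.continuous_ofReal.continuousOn fun t ht => γ.ray_mem_side (by
      rcases lt_abs.1 (show R' < |t| from ht) with h | h
      · right; linarith
      · left; linarith) s).norm
  have h1 : IntegrableOn (fun t : ℝ => ‖sideDiff L Lt s t‖ ^ 2 * t ^ 4) {t : ℝ | R' < |t|} := by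
    refine ⟨((hcont.pow 2).mul (by fun_prop)).aestronglyMeasurable hmeas, ?_⟩
    rw [hasFiniteIntegral_iff_ofReal (.of_forall fun t => by positivity)]
    exact (lintegral_mono_set fun t (ht : R' < |t|) => e1.trans_lt ht).trans_lt (hfin s)
  have h2 : IntegrableOn (fun t : ℝ => 2 * (1 + t ^ 2)⁻¹) {t : ℝ | R' < |t|} :=
    (integrable_inv_one_add_sq.const_mul 2).integrableOn
  refine (h1.add h2).mono' ((ContinuousOn.mul (by fun_prop) hcont).aestronglyMeasurable hmeas) ?_
  filter_upwards [ae_restrict_mem hmeas] with t ht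
  have ht' : R' < |t| := ht
  set n := ‖sideDiff L Lt s t‖
  have hn : 0 ≤ n := norm_nonneg _
  rw [Real.norm_of_nonneg (by positivity)]
  have ht1 : 1 < |t| := by linarith
  have hsq : t ^ 2 = |t| ^ 2 := (sq_abs t).symm
  have hsq4 : t ^ 4 = |t| ^ 4 := by rw [show (4 : ℕ) = 2 * 2 by norm_num, pow_mul, pow_mul, hsq]
  simp only [Pi.add_apply]
  rw [hsq, hsq4]
  set u := |t|
  have hu : 0 < u := by linarith
  have h3 : (u ^ 2)⁻¹ ≤ 2 * (1 + u ^ 2)⁻¹ := by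
    rw [← div_eq_mul_inv, inv_le_comm₀ (by positivity) (by positivity), inv_div]
    nlinarith
  have h4 : 2 * (u * n) ≤ n ^ 2 * u ^ 4 + (u ^ 2)⁻¹ := by
    have : (n * u ^ 2 - u⁻¹) ^ 2 = n ^ 2 * u ^ 4 + (u ^ 2)⁻¹ - 2 * (u * n) := by
      field_simp
      ring
    nlinarith [sq_nonneg (n * u ^ 2 - u⁻¹)]
  nlinarith

end Pencil

/-! ### Bounds for the kernel on the contour -/

namespace Contour

variable (γ : Contour)

theorem exists_abs_im_le : ∃ T : ℝ, ∀ s, ∀ ρ ∈ γ.side s, |ρ.im| ≤ T := by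
  obtain ⟨B, hB0, hB⟩ := γ.exists_inner_bound
  refine ⟨B, fun s ρ hρ => ?_⟩
  rcases hρ with h | ⟨t, -, rfl⟩
  · exact (Complex.abs_im_le_norm ρ).trans (hB ρ h.1)
  · simpa using hB0.le

theorem density_mul (A B : ℂ → CMat m) (G : Side → ℂ → CMat m) (t : ℝ) :
    γ.density (fun s ξ => A ξ * G s ξ * B ξ) t =
      A (γ.param t) * γ.density G t * B (γ.param t) := by
  simp only [density, mul_add, add_mul, mul_smul_comm, smul_mul_assoc]

theorem density_mul_right (B : ℂ → CMat m) (G : Side → ℂ → CMat m) (t : ℝ) :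
    γ.density (fun s ξ => G s ξ * B ξ) t = γ.density G t * B (γ.param t) := by
  simp only [density, add_mul, smul_mul_assoc]

theorem density_mul_left (A : ℂ → CMat m) (G : Side → ℂ → CMat m) (t : ℝ) :
    γ.density (fun s ξ => A ξ * G s ξ) t = A (γ.param t) * γ.density G t := by
  simp only [density, mul_add, mul_smul_comm]

end Contour

namespace Pencil

variable {L Lt : Pencil m} {γ : Contour} {x : ℝ}

/-- Off the diagonal the numerator of the kernel grows linearly; near the diagonal the maximum
principle applies. -/
theorem ClassV.exists_bound_D (h : L.ClassV) (hx : 0 ≤ x) (T : ℝ) :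
    ∃ C, 0 ≤ C ∧ ∀ ρ θ : ℂ, |ρ.im| ≤ T → |θ.im| ≤ T → ‖L.D x ρ θ‖ ≤ C * (1 + ‖ρ‖) := by
  obtain ⟨C₁, h₁, H₁⟩ := h.exists_bound_strip hx (T + 1)
  obtain ⟨C₂, h₂, H₂⟩ := h.exists_bound_strip_star hx (T + 1)
  have hC : 0 ≤ C₂ * C₁ := mul_nonneg h₂ h₁
  have hfar : ∀ ρ θ : ℂ, |ρ.im| ≤ T → |θ.im| ≤ T + 1 → 1 ≤ ‖ρ - θ‖ →
      ‖L.D x ρ θ‖ ≤ 3 * (C₂ * C₁) * (1 + ‖ρ‖) := fun ρ θ hρ hθ hd => by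
    obtain ⟨a1, a2⟩ := H₁ ρ (by linarith)
    obtain ⟨b1, b2⟩ := H₂ θ hθ
    have hb : ‖L.bracket x ρ θ‖ ≤ C₂ * C₁ * (2 + ‖θ‖ + ‖ρ‖) := by
      refine (norm_sub_le _ _).trans ?_
      calc _ ≤ C₂ * (1 + ‖θ‖) * C₁ + C₂ * (C₁ * (1 + ‖ρ‖)) := by
            gcongr
            · exact (norm_mul_le _ _).trans (mul_le_mul b2 a1 (norm_nonneg _) (by positivity))
            · exact (norm_mul_le _ _).trans (mul_le_mul b1 a2 (norm_nonneg _) h₂)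
        _ = _ := by ring
    have hθ' : ‖θ‖ ≤ ‖ρ‖ + ‖ρ - θ‖ := by
      rw [norm_sub_rev]
      exact norm_le_norm_add_norm_sub' θ ρ |>.trans (by linarith)
    have hd0 : 0 < ‖ρ - θ‖ := by linarith
    have hD : L.D x ρ θ = (ρ - θ)⁻¹ • L.bracket x ρ θ := rfl
    rw [hD, norm_smul, norm_inv, inv_mul_le_iff₀ hd0]
    refine hb.trans ?_
    have : 2 + ‖θ‖ + ‖ρ‖ ≤ ‖ρ - θ‖ * (3 * (1 + ‖ρ‖)) := by nlinarith [norm_nonneg ρ]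
    calc _ ≤ C₂ * C₁ * (‖ρ - θ‖ * (3 * (1 + ‖ρ‖))) := mul_le_mul_of_nonneg_left this hC
      _ = _ := by ring
  refine ⟨3 * (C₂ * C₁), by positivity, fun ρ θ hρ hθ => ?_⟩
  rcases le_or_gt 1 ‖ρ - θ‖ with hd | hd
  · exact hfar ρ θ hρ (by linarith) hd
  rcases eq_or_ne θ ρ with rfl | hne
  · simp only [D, sub_self, inv_zero, zero_smul, norm_zero]
    positivity
  rw [← h.quotRight_eq hx hne]
  refine Complex.norm_le_of_forall_mem_frontier_norm_le (U := Metric.ball ρ 1)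
    Metric.isBounded_ball (h.differentiable_quotRight hx ρ).diffContOnCl (fun ξ hξ => ?_)
    (subset_closure (by rwa [Metric.mem_ball, dist_eq_norm, norm_sub_rev]))
  rw [frontier_ball _ one_ne_zero, mem_sphere_iff_norm] at hξ
  have hξρ : ξ ≠ ρ := fun h0 => by simp [h0] at hξ
  rw [h.quotRight_eq hx hξρ]
  refine hfar ρ ξ hρ ?_ (by rw [norm_sub_rev, hξ])
  have h1 := Complex.abs_im_le_norm (ξ - ρ)
  rw [hξ, Complex.sub_im] at h1
  have h2 := abs_sub_abs_le_abs_sub ξ.im ρ.im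
  linarith

theorem ClassV.stronglyMeasurable_D (h : L.ClassV) (hx : 0 ≤ x) {α : Type*} [MeasurableSpace α]
    {f g : α → ℂ} (hf : Measurable f) (hg : Measurable g) :
    StronglyMeasurable fun a => L.D x (f a) (g a) := by
  obtain ⟨a1, a2⟩ := h.differentiable_phi hx
  obtain ⟨b1, b2⟩ := h.differentiable_phiStar hx
  exact (hf.sub hg).inv.stronglyMeasurable.smul
    (((b2.continuous.stronglyMeasurable.comp_measurable hg).mul
      (a1.continuous.stronglyMeasurable.comp_measurable hf)).sub
    ((b1.continuous.stronglyMeasurable.comp_measurable hg).mul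
      (a2.continuous.stronglyMeasurable.comp_measurable hf)))

theorem integrable_density_of_le (hM : IsModelPencil L Lt)
    (hc : ∀ s, ContinuousOn (sideDiff L Lt s) (γ.side s)) {F : Side → ℂ → CMat m} {C : ℝ}
    (hF : ∀ s, ContinuousOn (F s) (γ.side s))
    (hC : ∀ s, ∀ θ ∈ γ.side s, ‖F s θ‖ ≤ C * ((1 + ‖θ‖) * ‖sideDiff L Lt s θ‖)) :
    Integrable (γ.density F) := by
  obtain ⟨R, hR⟩ := integrableOn_sideDiff hM hc
  set R' := max R (max γ.right (-γ.left))
  have e3 : γ.right ≤ R' := (le_max_left _ _).trans (le_max_right _ _)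
  have e4 : -γ.left ≤ R' := (le_max_right _ _).trans (le_max_right _ _)
  have hmeas : MeasurableSet {t : ℝ | R' < |t|} := measurableSet_lt measurable_const (by fun_prop)
  have hmem : ∀ s, ∀ t ∈ {t : ℝ | R' < |t|}, (t : ℂ) ∈ γ.side s := fun s t ht =>
    γ.ray_mem_side (by
      rcases lt_abs.1 (show R' < |t| from ht) with h | h
      · right; linarith
      · left; linarith) s
  refine γ.integrable_density hF (R := R') fun s => ?_
  refine (((hR s).mono_set fun t (ht : R' < |t|) => (le_max_left _ _).trans_lt ht).const_mul
    C).mono' (((hF s).comp Complex.continuous_ofReal.continuousOn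
      (hmem s)).aestronglyMeasurable hmeas) ?_
  filter_upwards [ae_restrict_mem hmeas] with t ht
  simpa using hC s t (hmem s t ht)

/-- The rows of `φ(x, ρ)` are linearly independent as functions of `ρ`. -/
theorem ClassV.eq_zero_of_mul_phi (h : L.ClassV) (hN : L.NonRegge) (hx : 0 ≤ x) {K : CMat m}
    {a : ℝ} (hK : ∀ t : ℝ, a ≤ t → K * L.phi t x = 0) : K = 0 := by
  have hd : Differentiable ℂ fun ρ => K * L.phi ρ x := (h.differentiable_phi hx).1.const_mul K
  have hall : (fun ρ => K * L.phi ρ x) = fun _ => 0 := by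
    refine AnalyticOnNhd.eq_of_frequently_eq (z₀ := (a : ℂ))
      (fun z _ => hd.analyticAt z) (fun z _ => analyticAt_const) ?_
    have ht : Tendsto (fun t : ℝ => (t : ℂ)) (𝓝[>] a) (𝓝[≠] (a : ℂ)) := by
      refine tendsto_nhdsWithin_iff.2 ⟨Complex.continuous_ofReal.continuousAt.mono_left
        nhdsWithin_le_nhds, ?_⟩
      filter_upwards [self_mem_nhdsWithin] with t (ht : a < t)
      simpa using ht.ne'
    refine ht.frequently (Eventually.frequently ?_)
    filter_upwards [self_mem_nhdsWithin] with t (ht : a < t) using hK t ht.le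
  rcases hx.eq_or_lt with rfl | hx0
  · have := congrFun hall 0
    simpa only [(h.phi_spec 0).2.1, mul_one] using this
  obtain ⟨s₀, D, hs₀, hD, H⟩ := h.exists_phi_asymptotics
  -- along the positive imaginary axis `exp (iρx) φ(x, ρ)` tends to `P₊ (1 + h₁) / 2`
  have hlim : Tendsto (fun τ : ℝ => Complex.exp (Complex.I * (τ * Complex.I) * x) •
      L.phi (τ * Complex.I) x - (1 / 2 : ℂ) • (Complex.exp (2 * (Complex.I * (τ * Complex.I)) * x) •
        (L.P Side.minus x * (1 - L.h₁)) + L.P Side.plus x * (1 + L.h₁))) atTop (𝓝 0) := by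
    refine squeeze_zero_norm' (a := fun τ : ℝ => D * τ⁻¹) ?_
      (by simpa using tendsto_inv_atTop_zero.const_mul D)
    filter_upwards [eventually_ge_atTop s₀, eventually_ge_atTop 0] with τ h1 h2
    have hn : ‖(τ * Complex.I : ℂ)‖ = τ := by simp [abs_of_nonneg h2]
    have := (H (τ * Complex.I) (by simpa using h2) (by rwa [hn]) x hx).1
    rwa [hn] at this
  have hexp : Tendsto (fun τ : ℝ => Complex.exp (2 * (Complex.I * (τ * Complex.I)) * x)) atTop
      (𝓝 0) := by
    refine squeeze_zero_norm' (a := fun τ : ℝ => Real.exp (-(τ * (2 * x)))) ?_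
      (Real.tendsto_exp_neg_atTop_nhds_zero.comp
        (tendsto_id.atTop_mul_const (by linarith : 0 < 2 * x)))
    refine .of_forall fun τ => ?_
    rw [Complex.norm_exp]
    simp
    linarith
  have h2 : Tendsto (fun τ : ℝ => K * (Complex.exp (Complex.I * (τ * Complex.I) * x) •
      L.phi (τ * Complex.I) x - (1 / 2 : ℂ) • (Complex.exp (2 * (Complex.I * (τ * Complex.I)) * x) •
        (L.P Side.minus x * (1 - L.h₁)) + L.P Side.plus x * (1 + L.h₁)))) atTop
      (𝓝 (-((1 / 2 : ℂ) • (K * (L.P Side.plus x * (1 + L.h₁)))))) := by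
    have h3 := ((((hexp.smul_const (L.P Side.minus x * (1 - L.h₁))).add_const
      (L.P Side.plus x * (1 + L.h₁))).const_smul (1 / 2 : ℂ)).const_mul K).neg
    rw [zero_smul, zero_add, mul_smul_comm] at h3
    refine h3.congr fun τ => ?_
    have : K * L.phi (τ * Complex.I) x = 0 := congrFun hall (τ * Complex.I)
    rw [mul_sub K, mul_smul_comm, mul_smul_comm, this, smul_zero, zero_sub]
  have h4 := tendsto_nhds_unique h2 (by simpa using hlim.const_mul K)
  have h5 : K * L.P Side.plus x * (1 + L.h₁) = 0 := by
    rw [mul_assoc]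
    exact (smul_eq_zero.1 (neg_eq_zero.1 h4)).resolve_left (by norm_num)
  have h6 : K * L.P Side.plus x = 0 := by
    have := congrArg (· * (1 + L.h₁)⁻¹) h5
    simpa only [mul_assoc, Matrix.mul_nonsing_inv _ (isUnit_iff_ne_zero.2 hN.1), mul_one,
      zero_mul] using this
  have := congrArg (· * L.PStar Side.plus.opp x) h6
  simpa only [mul_assoc, h.P_mul_PStar _ hx, mul_one, zero_mul] using this

theorem sideDiff_swap (L Lt : Pencil m) (s : Side) (ρ : ℂ) :
    sideDiff Lt L s ρ = -sideDiff L Lt s ρ := (neg_sub _ _).symm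

theorem density_sideDiff_swap (L Lt : Pencil m) (t : ℝ) :
    γ.density (sideDiff Lt L) t = -γ.density (sideDiff L Lt) t := by
  simp only [Contour.density, sideDiff_swap L Lt, smul_neg, neg_add]

/-! ### Solutions of the homogeneous main equation -/

/-- The difference of the Weyl matrices has a first moment on the contour. -/
theorem integrable_density_sideDiff (hM : IsModelPencil L Lt)
    (hc : ∀ s, ContinuousOn (sideDiff L Lt s) (γ.side s)) :
    Integrable (γ.density (sideDiff L Lt)) ∧
    Integrable fun t => (1 + ‖γ.param t‖) * ‖γ.density (sideDiff L Lt) t‖ := by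
  constructor
  · refine integrable_density_of_le hM hc (C := 1) hc fun s θ _ => ?_
    rw [one_mul]
    exact le_mul_of_one_le_left (norm_nonneg _) (by linarith [norm_nonneg θ])
  · have hcn : Continuous fun θ : ℂ => ((1 + ‖θ‖ : ℝ) : ℂ) := by fun_prop
    have h1 := integrable_density_of_le hM hc (C := 1)
      (F := fun s θ => ((1 + ‖θ‖ : ℝ) : ℂ) • sideDiff L Lt s θ)
      (fun s => hcn.continuousOn.smul (hc s)) fun s θ _ => by
        rw [norm_smul, Complex.norm_of_nonneg (by positivity), one_mul]
    refine h1.norm.congr (.of_forall fun t => ?_)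
    simp only [Contour.density, smul_comm _ ((1 + ‖γ.param t‖ : ℝ) : ℂ)]
    rw [← smul_add, norm_smul, Complex.norm_of_nonneg (by positivity)]

/-- The integral of a product of two kernels as an integral over the line. -/
theorem integral_kernel (hL : L.ClassV) (hLt : Lt.ClassV) (hN : L.NonRegge) (hNt : Lt.NonRegge)
    (hh : L.h₁ = Lt.h₁) (hΛ : γ.Admissible fun s => Lt.singularSet s ∪ L.singularSet s)
    (hM : IsModelPencil L Lt) (hc : ∀ s, ContinuousOn (sideDiff L Lt s) (γ.side s))
    (hx : 0 ≤ x) {T : ℝ} (hT : ∀ t, |(γ.param t).im| ≤ T) {θ σ : ℂ} (hθ : |θ.im| ≤ T)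
    (hσ : |σ.im| ≤ T) (hne : θ ≠ σ) :
    Integrable (fun u => Lt.D x (γ.param u) θ * γ.density (sideDiff L Lt) u *
      L.D x σ (γ.param u)) ∧
    ∫ u, Lt.D x (γ.param u) θ * γ.density (sideDiff L Lt) u * L.D x σ (γ.param u) =
      -((2 * Real.pi * Complex.I : ℂ) • (L.D x σ θ - Lt.D x σ θ -
        Complex.I • (Lt.phiStar θ x * Xi Lt L x * L.phi σ x))) := by
  obtain ⟨C₁, hC₁, H₁⟩ := hL.exists_bound_D hx T
  obtain ⟨C₂, hC₂, H₂⟩ := hLt.exists_bound_D hx T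
  obtain ⟨hn, hn'⟩ := integrable_density_sideDiff hM hc
  set n : ℝ → CMat m := γ.density (sideDiff L Lt)
  have hp := γ.measurable_param
  have h1 := ((hasIntegral_kernel hLt hL hNt hN hh.symm hΛ hx hne.symm).congr
    (G := fun s ξ => Lt.D x ξ θ * sideDiff Lt L s ξ * L.D x σ ξ)
    (S := {θ, σ}) (toFinite _).countable fun s ξ _ hξ => by
      simp only [mem_insert_iff, mem_singleton_iff, not_or] at hξ
      rw [hLt.quotLeft_eq hx hξ.1, hL.quotRight_eq hx hξ.2])
  have h2 : ∀ u, γ.density (fun s ξ => Lt.D x ξ θ * sideDiff Lt L s ξ * L.D x σ ξ) u =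
      -(Lt.D x (γ.param u) θ * n u * L.D x σ (γ.param u)) := fun u => by
    rw [γ.density_mul (fun ξ => Lt.D x ξ θ) (fun ξ => L.D x σ ξ),
      density_sideDiff_swap L Lt, mul_neg, neg_mul]
  have h3 : Integrable fun u => Lt.D x (γ.param u) θ * n u * L.D x σ (γ.param u) := by
    refine (hn'.const_mul (C₂ * (C₁ * (1 + ‖σ‖)))).mono'
      (((hLt.stronglyMeasurable_D hx hp measurable_const).aestronglyMeasurable.mul hn.1).mul
        (hL.stronglyMeasurable_D hx measurable_const hp).aestronglyMeasurable)
      (.of_forall fun u => ?_)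
    calc _ ≤ C₂ * (1 + ‖γ.param u‖) * ‖n u‖ * (C₁ * (1 + ‖σ‖)) := by
          refine (norm_mul_le _ _).trans (mul_le_mul ((norm_mul_le _ _).trans ?_)
            (H₁ σ _ hσ (hT u)) (norm_nonneg _) (by positivity))
          exact mul_le_mul_of_nonneg_right (H₂ _ _ (hT u) hθ) (norm_nonneg _)
      _ = _ := by ring
  refine ⟨h3, ?_⟩
  rw [h1.eq_integral (h3.neg.congr (.of_forall fun u => (h2 u).symm)),
    integral_congr_ae (.of_forall h2), integral_neg, neg_neg]

/-- A bounded continuous solution of the homogeneous main equation is a constant multiple of `φ`: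
insert the equation into `∫ y M̂ D`, exchange the integrals, and evaluate the inner one by
`hasIntegral_kernel` with the two pencils exchanged. -/
theorem exists_eq_mul_phi (hL : L.ClassV) (hLt : Lt.ClassV) (hN : L.NonRegge) (hNt : Lt.NonRegge)
    (hh : L.h₁ = Lt.h₁) (hΛ : γ.Admissible fun s => Lt.singularSet s ∪ L.singularSet s)
    (hM : IsModelPencil L Lt) (hc : ∀ s, ContinuousOn (sideDiff L Lt s) (γ.side s))
    (hx : 0 ≤ x) {y : Side → ℂ → CMat m} (hy : ∀ s, ContinuousOn (y s) (γ.side s)) {C : ℝ}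
    (hC : ∀ s, ∀ ρ ∈ γ.side s, ‖y s ρ‖ ≤ C)
    (heq : ∀ s, ∀ ρ ∈ γ.side s, y s ρ = -((2 * Real.pi * Complex.I : ℂ)⁻¹ •
      ∫ t, γ.density (fun s' θ => y s' θ * rTilde L Lt x ρ s' θ) t)) :
    ∃ B : CMat m, ∀ s, ∀ ρ ∈ γ.side s, y s ρ = B * L.phi ρ x := by
  obtain ⟨T, hT⟩ := γ.exists_abs_im_le
  have hTp : ∀ t, |(γ.param t).im| ≤ T := fun t =>
    let ⟨s, hs⟩ := γ.exists_param_mem_side t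
    hT s _ hs
  obtain ⟨C₁, hC₁, H₁⟩ := hL.exists_bound_D hx T
  obtain ⟨C₂, hC₂, H₂⟩ := hLt.exists_bound_D hx T
  obtain ⟨C₃, hC₃, H₃⟩ := hLt.exists_bound_strip_star hx T
  have hC0 : 0 ≤ C := (norm_nonneg _).trans
    (hC Side.plus _ (γ.ray_mem_side (.inr le_rfl) Side.plus))
  set κ : ℂ := (2 * Real.pi * Complex.I : ℂ)⁻¹ with hκ
  have hκ0 : (2 * Real.pi * Complex.I : ℂ) ≠ 0 := Complex.two_pi_I_ne_zero
  set a : ℝ → CMat m := γ.density fun s θ => y s θ * sideDiff L Lt s θ with ha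
  have ha_int : Integrable a := integrable_density_of_le hM hc (C := C)
    (fun s => (hy s).mul (hc s)) fun s θ hθ => by
      refine (norm_mul_le _ _).trans (mul_le_mul (hC s θ hθ) ?_ (norm_nonneg _) hC0)
      exact le_mul_of_one_le_left (norm_nonneg _) (by linarith [norm_nonneg θ])
  obtain ⟨hn_int, hn'⟩ := integrable_density_sideDiff hM hc
  have hp := γ.measurable_param
  have hD₁ : ∀ σ : ℂ, StronglyMeasurable fun t => L.D x σ (γ.param t) := fun σ =>
    hL.stronglyMeasurable_D hx measurable_const hp
  have hD₂ : ∀ σ : ℂ, StronglyMeasurable fun t => Lt.D x σ (γ.param t) := fun σ =>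
    hLt.stronglyMeasurable_D hx measurable_const hp
  have hD : StronglyMeasurable fun p : ℝ × ℝ => Lt.D x (γ.param p.1) (γ.param p.2) :=
    hLt.stronglyMeasurable_D hx (hp.comp measurable_fst) (hp.comp measurable_snd)
  have hS : StronglyMeasurable fun t => Lt.phiStar (γ.param t) x :=
    (hLt.differentiable_phiStar hx).1.continuous.stronglyMeasurable.comp_measurable hp
  -- the equation in terms of the density `a`, on both sides of the cuts at once
  have heq' : ∀ s, ∀ ρ ∈ γ.side s, y s ρ = -(κ • ∫ t, a t * Lt.D x ρ (γ.param t)) :=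
    fun s ρ hρ => by
      rw [heq s ρ hρ]
      congr 2
      refine integral_congr_ae (.of_forall fun t => ?_)
      exact (γ.density_congr fun s' _ => (mul_assoc _ _ _).symm).trans
        (γ.density_mul_right (fun θ => Lt.D x ρ θ) _ t)
  set n : ℝ → CMat m := γ.density (sideDiff L Lt) with hn
  have haZ : ∀ u, a u = -(κ • ∫ t, a t * Lt.D x (γ.param u) (γ.param t)) * n u := fun u => by
    rw [hn, ← γ.density_mul_left fun ξ => -(κ • ∫ t, a t * Lt.D x ξ (γ.param t))]
    exact γ.density_congr fun s hs => by rw [heq' s _ hs]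
  have hint₂ : ∀ σ, |σ.im| ≤ T → Integrable fun t => a t * Lt.D x σ (γ.param t) := fun σ hσ => by
    refine (ha_int.norm.mul_const (C₂ * (1 + ‖σ‖))).mono'
      (ha_int.1.mul (hD₂ σ).aestronglyMeasurable) (.of_forall fun t => ?_)
    exact (norm_mul_le _ _).trans
      (mul_le_mul_of_nonneg_left (H₂ σ _ hσ (hTp t)) (norm_nonneg _))
  have hint₁ : ∀ σ, |σ.im| ≤ T → Integrable fun t => a t * L.D x σ (γ.param t) := fun σ hσ => by
    refine (ha_int.norm.mul_const (C₁ * (1 + ‖σ‖))).mono'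
      (ha_int.1.mul (hD₁ σ).aestronglyMeasurable) (.of_forall fun t => ?_)
    exact (norm_mul_le _ _).trans
      (mul_le_mul_of_nonneg_left (H₁ σ _ hσ (hTp t)) (norm_nonneg _))
  have hint₃ : Integrable fun t => a t * Lt.phiStar (γ.param t) x := by
    refine (ha_int.norm.mul_const C₃).mono' (ha_int.1.mul hS.aestronglyMeasurable)
      (.of_forall fun t => ?_)
    exact (norm_mul_le _ _).trans
      (mul_le_mul_of_nonneg_left (H₃ _ (hTp t)).1 (norm_nonneg _))
  set b : CMat m := ∫ t, a t * Lt.phiStar (γ.param t) x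
  refine ⟨(κ * Complex.I) • (b * Xi Lt L x), fun s σ hσ => ?_⟩
  have hσT := hT s σ hσ
  have hF : Integrable (Function.uncurry fun u t : ℝ =>
      a t * Lt.D x (γ.param u) (γ.param t) * n u * L.D x σ (γ.param u))
      ((volume : Measure ℝ).prod volume) := by
    refine ((hn'.mul_prod (ha_int.norm.const_mul (C₂ * (C₁ * (1 + ‖σ‖)))))).mono'
      (((ha_int.1.comp_snd.mul hD.aestronglyMeasurable).mul hn_int.1.comp_fst).mul
        ((hD₁ σ).comp_measurable measurable_fst).aestronglyMeasurable) (.of_forall fun p => ?_)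
    calc _ ≤ ‖a p.2‖ * (C₂ * (1 + ‖γ.param p.1‖)) * ‖n p.1‖ * (C₁ * (1 + ‖σ‖)) := by
          refine (norm_mul_le _ _).trans (mul_le_mul ((norm_mul_le _ _).trans ?_)
            (H₁ σ _ hσT (hTp p.1)) (norm_nonneg _) (by positivity))
          refine mul_le_mul_of_nonneg_right ((norm_mul_le _ _).trans ?_) (norm_nonneg _)
          exact mul_le_mul_of_nonneg_left (H₂ _ _ (hTp _) (hTp _)) (norm_nonneg _)
      _ = _ := by ring
  have hswap := integral_integral_swap hF
  -- In one order the inner integral is the homogeneous equation, in the other the kernel relation.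
  have hleft : ∀ u, ∫ t, a t * Lt.D x (γ.param u) (γ.param t) * n u * L.D x σ (γ.param u) =
      -((2 * Real.pi * Complex.I : ℂ) • (a u * L.D x σ (γ.param u))) := fun u => by
    have hi := hint₂ (γ.param u) (hTp u)
    rw [integral_mul_const_of_integrable (hi.mul_const _), integral_mul_const_of_integrable hi,
      ← smul_mul_assoc, ← neg_mul]
    congr 1
    rw [haZ u, neg_mul, smul_neg, neg_neg, smul_mul_assoc, smul_smul, hκ, mul_inv_cancel₀ hκ0,
      one_smul]
  have hright : ∀ᵐ t, ∫ u, a t * Lt.D x (γ.param u) (γ.param t) * n u * L.D x σ (γ.param u) =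
      -((2 * Real.pi * Complex.I : ℂ) • (a t * L.D x σ (γ.param t) - a t * Lt.D x σ (γ.param t) -
        Complex.I • (a t * Lt.phiStar (γ.param t) x * (Xi Lt L x * L.phi σ x)))) := by
    filter_upwards [γ.ae_param_notMem (countable_singleton σ)] with t ht
    obtain ⟨h1, h2⟩ := integral_kernel hL hLt hN hNt hh hΛ hM hc hx hTp (hTp t) hσT ht
    simp only [mul_assoc (a t)] at h1 ⊢
    rw [integral_const_mul_of_integrable h1, h2, mul_neg, mul_smul_comm, mul_sub, mul_sub,
      mul_smul_comm]
    simp only [mul_assoc]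
  have h1 : (2 * Real.pi * Complex.I : ℂ) • ∫ t, a t * L.D x σ (γ.param t) =
      (2 * Real.pi * Complex.I : ℂ) • ((∫ t, a t * L.D x σ (γ.param t)) -
        (∫ t, a t * Lt.D x σ (γ.param t)) - Complex.I • (b * (Xi Lt L x * L.phi σ x))) := by
    rw [integral_congr_ae (.of_forall hleft), integral_congr_ae hright, integral_neg,
      integral_neg, integral_smul, integral_smul, neg_inj] at hswap
    have hi : Integrable fun t => a t * L.D x σ (γ.param t) - a t * Lt.D x σ (γ.param t) :=
      (hint₁ σ hσT).sub (hint₂ σ hσT)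
    have hi' : Integrable fun t =>
        Complex.I • (a t * Lt.phiStar (γ.param t) x * (Xi Lt L x * L.phi σ x)) :=
      (hint₃.mul_const _).smul Complex.I
    rw [hswap, integral_sub hi hi', integral_sub (hint₁ σ hσT) (hint₂ σ hσT),
      integral_smul, integral_mul_const_of_integrable hint₃]
  have h2 := smul_right_injective _ hκ0 h1
  have h3 : ∫ t, a t * Lt.D x σ (γ.param t) = -(Complex.I • (b * (Xi Lt L x * L.phi σ x))) := by
    rw [eq_neg_iff_add_eq_zero]
    have h4 : ∀ u v w : CMat m, u = u - v - w → v + w = 0 := fun u v w h => by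
      have := sub_eq_zero.2 h
      rwa [sub_sub, sub_sub_cancel] at this
    exact h4 _ _ _ h2
  rw [heq' s σ hσ, h3, smul_neg, neg_neg, smul_smul, smul_mul_assoc, mul_assoc]

/-! ### Existence and uniqueness for the main equation -/

/-- The integral in the main equation converges absolutely. -/
theorem integrable_mainEquation (hLt : Lt.ClassV) (hM : IsModelPencil L Lt)
    (hc : ∀ s, ContinuousOn (sideDiff L Lt s) (γ.side s)) (hx : 0 ≤ x) {y : Side → ℂ → CMat m}
    (hy : ∀ s, ContinuousOn (y s) (γ.side s)) {C : ℝ} (hC : ∀ s, ∀ ρ ∈ γ.side s, ‖y s ρ‖ ≤ C)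
    (ρ : ℂ) : Integrable (γ.density fun s θ => y s θ * rTilde L Lt x ρ s θ) := by
  obtain ⟨T, hT⟩ := γ.exists_abs_im_le
  obtain ⟨D, hD, H⟩ := hLt.exists_bound_D hx (max T |ρ.im|)
  have hp := γ.measurable_param
  have ha := (integrable_density_of_le hM hc (F := fun s θ => y s θ * sideDiff L Lt s θ) (C := C)
    (fun s => (hy s).mul (hc s)) fun s θ hθ => by
      refine (norm_mul_le _ _).trans (mul_le_mul (hC s θ hθ) ?_ (norm_nonneg _)
        ((norm_nonneg _).trans (hC s θ hθ)))
      exact le_mul_of_one_le_left (norm_nonneg _) (by linarith [norm_nonneg θ]))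
  have h1 : ∀ t, γ.density (fun s θ => y s θ * rTilde L Lt x ρ s θ) t =
      γ.density (fun s θ => y s θ * sideDiff L Lt s θ) t * Lt.D x ρ (γ.param t) := fun t =>
    (γ.density_congr fun s _ => (mul_assoc _ _ _).symm).trans
      (γ.density_mul_right (fun θ => Lt.D x ρ θ) _ t)
  refine Integrable.congr ((ha.norm.mul_const (D * (1 + ‖ρ‖))).mono'
    (ha.1.mul (hLt.stronglyMeasurable_D hx measurable_const hp).aestronglyMeasurable)
    (.of_forall fun t => ?_)) (.of_forall fun t => (h1 t).symm)
  obtain ⟨s, hs⟩ := γ.exists_param_mem_side t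
  exact (norm_mul_le _ _).trans (mul_le_mul_of_nonneg_left
    (H ρ _ (le_max_right _ _) ((hT s _ hs).trans (le_max_left _ _))) (norm_nonneg _))

theorem isContinuousFun_mul_phi (hL : L.ClassV) (hx : 0 ≤ x) (K : CMat m) :
    γ.IsContinuousFun fun _ ρ => K * L.phi ρ x := by
  obtain ⟨T, hT⟩ := γ.exists_abs_im_le
  obtain ⟨C, -, hC⟩ := hL.exists_bound_strip hx T
  exact ⟨fun _ => ((hL.differentiable_phi hx).1.const_mul K).continuous.continuousOn, rfl, rfl,
    ‖K‖ * C, fun s ρ hρ => (norm_mul_le _ _).trans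
      (mul_le_mul_of_nonneg_left (hC ρ (hT s ρ hρ)).1 (norm_nonneg _))⟩

theorem hasIntegral_mul_phi (hL : L.ClassV) (hLt : Lt.ClassV) (hN : L.NonRegge)
    (hNt : Lt.NonRegge) (hh : L.h₁ = Lt.h₁)
    (hΛ : γ.Admissible fun s => L.singularSet s ∪ Lt.singularSet s) (hx : 0 ≤ x) (K : CMat m)
    (ρ : ℂ) : γ.HasIntegral (fun s θ => K * L.phi θ x * rTilde L Lt x ρ s θ)
      ((2 * Real.pi * Complex.I : ℂ) • (K * (Omega L Lt x * Lt.phi ρ x - L.phi ρ x))) := by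
  refine (hasIntegral_phi hL hLt hN hNt hh hΛ hx K ρ).congr (countable_singleton ρ)
    fun s θ _ hθ => ?_
  rw [hLt.quotRight_eq hx hθ, mul_assoc]
  rfl

theorem solvesMainEquation (hL : L.ClassV) (hLt : Lt.ClassV) (hN : L.NonRegge)
    (hNt : Lt.NonRegge) (hh : L.h₁ = Lt.h₁)
    (hΛ : γ.Admissible fun s => L.singularSet s ∪ Lt.singularSet s) (hx : 0 ≤ x)
    (hΩ : (Omega L Lt x).det ≠ 0) :
    SolvesMainEquation L Lt γ x fun _ ρ => (Omega L Lt x)⁻¹ * L.phi ρ x := fun s ρ _ => by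
  refine ⟨_, hasIntegral_mul_phi hL hLt hN hNt hh hΛ hx _ ρ, ?_⟩
  rw [smul_smul, inv_mul_cancel₀ Complex.two_pi_I_ne_zero, one_smul, mul_sub, ← mul_assoc,
    Matrix.nonsing_inv_mul _ (isUnit_iff_ne_zero.2 hΩ), one_mul, add_sub_cancel]

/-- The homogeneous main equation has only the trivial bounded continuous solution: for `y = B φ`
its left side is `B Ω φ̃`. -/
theorem eq_zero_of_homogeneous (hL : L.ClassV) (hLt : Lt.ClassV) (hN : L.NonRegge)
    (hNt : Lt.NonRegge) (hh : L.h₁ = Lt.h₁)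
    (hΛ : γ.Admissible fun s => L.singularSet s ∪ Lt.singularSet s)
    (hΛ' : γ.Admissible fun s => Lt.singularSet s ∪ L.singularSet s)
    (hM : IsModelPencil L Lt) (hc : ∀ s, ContinuousOn (sideDiff L Lt s) (γ.side s))
    (hx : 0 ≤ x) (hΩ : (Omega L Lt x).det ≠ 0) {y : Side → ℂ → CMat m}
    (hy : ∀ s, ContinuousOn (y s) (γ.side s)) {C : ℝ} (hC : ∀ s, ∀ ρ ∈ γ.side s, ‖y s ρ‖ ≤ C)
    (heq : ∀ s, ∀ ρ ∈ γ.side s, y s ρ = -((2 * Real.pi * Complex.I : ℂ)⁻¹ •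
      ∫ t, γ.density (fun s' θ => y s' θ * rTilde L Lt x ρ s' θ) t)) :
    ∀ s, ∀ ρ ∈ γ.side s, y s ρ = 0 := by
  obtain ⟨B, hB⟩ := exists_eq_mul_phi hL hLt hN hNt hh hΛ' hM hc hx hy hC heq
  have hBΩ : B * Omega L Lt x = 0 := by
    refine hLt.eq_zero_of_mul_phi hNt hx (a := γ.right) fun t ht => ?_
    have hmem := γ.ray_mem_side (.inr ht) Side.plus
    have h1 := (hasIntegral_mul_phi hL hLt hN hNt hh hΛ hx B t).congr
      (G := fun s θ => y s θ * rTilde L Lt x t s θ) countable_empty fun s θ hθ _ => by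
        rw [hB s θ hθ]
    have h2 := heq _ _ hmem
    rw [← h1.eq_integral (integrable_mainEquation hLt hM hc hx hy hC t), smul_smul,
      inv_mul_cancel₀ Complex.two_pi_I_ne_zero, one_smul, hB _ _ hmem, mul_sub, neg_sub,
      eq_comm, sub_eq_self] at h2
    rwa [mul_assoc]
  have hB0 : B = 0 := by
    have := congrArg (· * (Omega L Lt x)⁻¹) hBΩ
    simpa only [mul_assoc, Matrix.mul_nonsing_inv _ (isUnit_iff_ne_zero.2 hΩ), mul_one,
      zero_mul] using this
  intro s ρ hρ
  rw [hB s ρ hρ, hB0, zero_mul]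

/-- The main equation has at most one bounded continuous solution. -/
theorem eq_of_solvesMainEquation (hL : L.ClassV) (hLt : Lt.ClassV) (hN : L.NonRegge)
    (hNt : Lt.NonRegge) (hh : L.h₁ = Lt.h₁) (hM : IsModelPencil L Lt)
    (hγ_L : ∀ s, ∀ w ∈ L.singularSet s, γ.Encloses w)
    (hγ_Lt : ∀ s, ∀ w ∈ Lt.singularSet s, γ.Encloses w) (hx : 0 ≤ x)
    (hΩ : (Omega L Lt x).det ≠ 0) {z w : Side → ℂ → CMat m} (hz : γ.IsContinuousFun z)
    (hw : γ.IsContinuousFun w) (hzs : SolvesMainEquation L Lt γ x z)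
    (hws : SolvesMainEquation L Lt γ x w) : ∀ s, ∀ ρ ∈ γ.side s, z s ρ = w s ρ := by
  intro s ρ hρ
  have hΛ' := admissible_singularSet hLt hL hγ_Lt hγ_L
  have hΛ := admissible_singularSet hL hLt hγ_L hγ_Lt
  have hc : ∀ s, ContinuousOn (sideDiff L Lt s) (γ.side s) := fun s =>
    (continuousOn_sideDiff hL hLt s).mono (hΛ.side_subset s)
  obtain ⟨C₁, hC₁⟩ := hz.bdd
  obtain ⟨C₂, hC₂⟩ := hw.bdd
  refine sub_eq_zero.1 (eq_zero_of_homogeneous hL hLt hN hNt hh hΛ hΛ' hM hc hx hΩ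
    (y := fun s ρ => z s ρ - w s ρ) (C := C₁ + C₂)
    (fun s => (hz.cont s).sub (hw.cont s))
    (fun s ρ hρ => (norm_sub_le _ _).trans (add_le_add (hC₁ s ρ hρ) (hC₂ s ρ hρ)))
    (fun s ρ hρ => ?_) s ρ hρ)
  obtain ⟨J₁, hJ₁, e₁⟩ := hzs s ρ hρ
  obtain ⟨J₂, hJ₂, e₂⟩ := hws s ρ hρ
  have i₁ := integrable_mainEquation hLt hM hc hx hz.cont hC₁ ρ
  have i₂ := integrable_mainEquation hLt hM hc hx hw.cont hC₂ ρ
  have hJ : ∫ t, γ.density (fun s' θ => (z s' θ - w s' θ) *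
      rTilde L Lt x ρ s' θ) t = J₁ - J₂ := by
    rw [hJ₁.eq_integral i₁, hJ₂.eq_integral i₂, ← integral_sub i₁ i₂]
    refine integral_congr_ae (.of_forall fun t => ?_)
    simp only [Contour.density, sub_mul, smul_sub]
    abel
  rw [hJ, smul_sub, neg_sub, sub_eq_sub_iff_add_eq_add, ← e₁, add_comm, ← e₂]

end Pencil

end

theorem mainTheorem4 {m : ℕ} (L Lt : Pencil m)
    (hL : L.ClassV) (hLt : Lt.ClassV) (hh : L.NonRegge) (hht : Lt.NonRegge)
    (hM : IsModelPencil L Lt)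
    (γ : Contour) (hγ_zero : γ.Encloses 0)
    (hγ_L : ∀ s, ∀ w ∈ L.singularSet s, γ.Encloses w)
    (hγ_Lt : ∀ s, ∀ w ∈ Lt.singularSet s, γ.Encloses w)
    (x : ℝ) (hx : 0 ≤ x) (hΩ : (Omega L Lt x).det ≠ 0) :
    γ.IsContinuousFun (fun _ ρ => (Omega L Lt x)⁻¹ * L.phi ρ x) ∧
    SolvesMainEquation L Lt γ x (fun _ ρ => (Omega L Lt x)⁻¹ * L.phi ρ x) ∧
    ∀ z : Side → ℂ → CMat m, γ.IsContinuousFun z → SolvesMainEquation L Lt γ x z →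
      ∀ s, ∀ ρ ∈ γ.side s, z s ρ = (Omega L Lt x)⁻¹ * L.phi ρ x := by
  obtain ⟨B, -, hB⟩ := γ.exists_inner_bound
  have hh₁ : L.h₁ = Lt.h₁ := Pencil.h₁_eq_of_isModelPencil hL hLt hh hht hM (R := B)
    fun ρ hρ s => ⟨fun h => ((hγ_L s ρ h).norm_le hB).not_gt hρ,
      fun h => ((hγ_Lt s ρ h).norm_le hB).not_gt hρ⟩
  have hΛ := Pencil.admissible_singularSet hL hLt hγ_L hγ_Lt
  have hcont := Pencil.isContinuousFun_mul_phi (γ := γ) hL hx (Omega L Lt x)⁻¹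
  have hsol := Pencil.solvesMainEquation hL hLt hh hht hh₁ hΛ hx hΩ
  exact ⟨hcont, hsol, fun z hz hzs =>
    Pencil.eq_of_solvesMainEquation hL hLt hh hht hh₁ hM hγ_L hγ_Lt hx hΩ hz hcont hzs hsol⟩
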